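/- The machine is the deterministic unit-cost word RAM with $w$-bit words: registers and memory cells hold integers in $[0, 2^w)$, memory is addressed by words, and the instructions (constants, copying, arithmetic including multiplication and division, bitwise operations and shifts, comparisons, loads, stores, branches and loops) take one step each. Arrays are indexed from $1$, $(b..e]=\{b+1,\dots,e\}$, and $\operatorname{argmin}$ denotes the smallest index at which the minimum is attained. For every constant $K$ there are a preprocessing program, a query program and a constant $c$, none of them depending on the input or on $w$, such that the following holds. Let $m\ge 0$ and $m'\in[0..m]$, let $A[1..m']$ and $B[1..m']$ be arrays of nonnegative integers with $$\max_{1\le i\le m'} A[i]\le K\,(m\log m+1)\quad\text{and}\quad \sum_{i=1}^{m'} B[i]\le K\,(m\log m+1),$$ and let the word size satisfy $2^w\ge c\,(m\log m+1)$ (with $0\log 0=0$). Given $m$, $m'$, $A$ and $B$, the preprocessing program halts after at most $c\,(m+1)$ steps. Afterwards, for all $b,e\in[0..m']$ and all $v\ge 0$ such that some $i\in(b..e]$ has $B[i]\ge v$, the query program, given $b$, $e$, $v$ and what the preprocessing has left in memory and in one register, computes the three-sided range minimum query $$\operatorname{argmin}\{A[i] : i\in(b..e],\ B[i]\ge v\}$$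 in at most $c\cdot\max(1,\log\log m)$ steps (where $\max(1,\log\log m)$ is read as $1$ for $m\le 1$), and leaves the memory as it found it, so that any number of queries can be answered one after another. -/

import Mathlib

/-! ### Three-sided range minimum queries

Arrays `A[1 .. n]` of nonnegative integers are functions `ℕ → ℕ` of which only the values at the
indices `1, …, n` matter; all indices below are 1-based. -/

/-- The positions `i ∈ (b .. e]` with `B[i] ≥ v`. -/
def threeSidedRange (B : ℕ → ℕ) (b e v : ℕ) : Finset ℕ :=
  (Finset.Ioc b e).filter (fun i => v ≤ B i)

/-- The number of positions `i ∈ (b .. e]` with `B[i] ≥ v`. -/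
def threeSidedRangeCount (B : ℕ → ℕ) (b e v : ℕ) : ℕ :=
  (threeSidedRange B b e v).card

/-- The argmin of `A[i]` over the `i ∈ (b .. e]` with `B[i] ≥ v`: the smallest one among the
positions of that set at which `A` is minimal. Meaningful if the set is not empty. -/
noncomputable def threeSidedRMQ (A B : ℕ → ℕ) (b e v : ℕ) : ℕ :=
  sInf {i : ℕ | i ∈ threeSidedRange B b e v ∧ ∀ j ∈ threeSidedRange B b e v, A i ≤ A j}

/-! ### The word RAM

A deterministic unit-cost random access machine whose registers and memory cells hold `w`-bit
words, that is, natural numbers below `2 ^ w`; the memory is addressed by words. A program is a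
finite command, so it uses finitely many registers and constants, and it does not depend on `w`
nor on the input. -/

namespace WordRAM

/-- Binary word operations. -/
inductive BinOp : Type
  | add | sub | mul | div | mod | land | lor | xor | shl | shr | lt | eq

/-- The result of a binary operation on `w`-bit words: arithmetic is modulo `2 ^ w`, a quotient by
zero is zero, comparisons return `0` or `1`. -/
def BinOp.eval (w : ℕ) : BinOp → ℕ → ℕ → ℕ
  | .add, x, y => (x + y) % 2 ^ w
  | .sub, x, y => (x + (2 ^ w - y)) % 2 ^ w
  | .mul, x, y => (x * y) % 2 ^ w
  | .div, x, y => x / y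
  | .mod, x, y => x % y
  | .land, x, y => x &&& y
  | .lor, x, y => x ||| y
  | .xor, x, y => x ^^^ y
  | .shl, x, y => (x <<< y) % 2 ^ w
  | .shr, x, y => x >>> y
  | .lt, x, y => if x < y then 1 else 0
  | .eq, x, y => if x = y then 1 else 0

/-- Programs. Registers are named by natural numbers. -/
inductive Cmd : Type
  /-- do nothing -/
  | nop : Cmd
  /-- `r_d := n` -/
  | const (d n : ℕ) : Cmd
  /-- `r_d := r_a` -/
  | copy (d a : ℕ) : Cmd
  /-- `r_d := r_a ∘ r_b` -/
  | op (o : BinOp) (d a b : ℕ) : Cmd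
  /-- `r_d := mem[r_a]` -/
  | load (d a : ℕ) : Cmd
  /-- `mem[r_a] := r_s` -/
  | store (a s : ℕ) : Cmd
  /-- first `p`, then `q` -/
  | seq (p q : Cmd) : Cmd
  /-- if `r_a ≠ 0` then `p` else `q` -/
  | cond (a : ℕ) (p q : Cmd) : Cmd
  /-- while `r_a ≠ 0` do `p` -/
  | loop (a : ℕ) (p : Cmd) : Cmd

/-- The contents of the registers and of the memory. -/
structure State : Type where
  reg : ℕ → ℕ
  mem : ℕ → ℕ

/-- All registers and memory cells hold `w`-bit words. -/
def State.IsWord (w : ℕ) (s : State) : Prop :=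
  (∀ r, s.reg r < 2 ^ w) ∧ ∀ a, s.mem a < 2 ^ w

/-- Write `x` to the register `r_d`. -/
def State.setReg (s : State) (d x : ℕ) : State :=
  { s with reg := Function.update s.reg d x }

/-- Write `x` to the memory cell with address `a`. -/
def State.setMem (s : State) (a x : ℕ) : State :=
  { s with mem := Function.update s.mem a x }

/-- `Exec w p s s' t`: with word size `w`, the program `p` started in the state `s` halts in the
state `s'` after exactly `t` steps. Every instruction and every test of a register by `cond` or
`loop` is one step. -/
inductive Exec (w : ℕ) : Cmd → State → State → ℕ → Prop
  | nop (s : State) : Exec w .nop s s 1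
  | const (d n : ℕ) (s : State) : Exec w (.const d n) s (s.setReg d (n % 2 ^ w)) 1
  | copy (d a : ℕ) (s : State) : Exec w (.copy d a) s (s.setReg d (s.reg a)) 1
  | op (o : BinOp) (d a b : ℕ) (s : State) :
      Exec w (.op o d a b) s (s.setReg d (o.eval w (s.reg a) (s.reg b))) 1
  | load (d a : ℕ) (s : State) : Exec w (.load d a) s (s.setReg d (s.mem (s.reg a))) 1
  | store (a r : ℕ) (s : State) : Exec w (.store a r) s (s.setMem (s.reg a) (s.reg r)) 1
  | seq {p q : Cmd} {s s' s'' : State} {t t' : ℕ} :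
      Exec w p s s' t → Exec w q s' s'' t' → Exec w (.seq p q) s s'' (t + t')
  | cond_true {a : ℕ} {p q : Cmd} {s s' : State} {t : ℕ} :
      s.reg a ≠ 0 → Exec w p s s' t → Exec w (.cond a p q) s s' (t + 1)
  | cond_false {a : ℕ} {p q : Cmd} {s s' : State} {t : ℕ} :
      s.reg a = 0 → Exec w q s s' t → Exec w (.cond a p q) s s' (t + 1)
  | loop_true {a : ℕ} {p : Cmd} {s s' s'' : State} {t t' : ℕ} :
      s.reg a ≠ 0 → Exec w p s s' t → Exec w (.loop a p) s' s'' t' →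
        Exec w (.loop a p) s s'' (t + t' + 1)
  | loop_false {a : ℕ} {p : Cmd} {s : State} :
      s.reg a = 0 → Exec w (.loop a p) s s 1

end WordRAM

/-- A state in which the preprocessing starts: `r_0 = m`, `r_1 = n`, the array `A[1 .. n]` is
stored in the memory cells `0, …, n - 1` and the array `B[1 .. n]` in the cells `n, …, 2 n - 1`.
All other registers and cells hold arbitrary words. -/
def IsPreprocessingInput (w m n : ℕ) (A B : ℕ → ℕ) (s : WordRAM.State) : Prop :=
  s.IsWord w ∧ s.reg 0 = m ∧ s.reg 1 = n ∧
    (∀ i < n, s.mem i = A (i + 1)) ∧ ∀ i < n, s.mem (n + i) = B (i + 1)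

/-- A state in which a query `(b, e, v)` starts, where `s₀` is the state left by the preprocessing:
the memory is that of `s₀`, the register `r_0` holds the value which it has in `s₀` (a pointer to
the data structure, say), and `r_1 = b`, `r_2 = e`, `r_3 = v`. All other registers hold arbitrary
words. -/
def IsQueryInput (w : ℕ) (s₀ : WordRAM.State) (b e v : ℕ) (s : WordRAM.State) : Prop :=
  s.IsWord w ∧ s.mem = s₀.mem ∧ s.reg 0 = s₀.reg 0 ∧ s.reg 1 = b ∧ s.reg 2 = e ∧ s.reg 3 = v

/-! ### A structured language on top of the word RAM

Programs with named variables, named arrays and counting loops. Their semantics is a total function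
on states whose variables and arrays hold natural numbers; `Stmt.safe` says that no value
overflows and no index is out of bounds, and `Stmt.time` is the number of steps of the
compiled program. -/

namespace RangeMin

open WordRAM

set_option linter.constructorNameAsVariable false
set_option linter.unusedSimpArgs false

/-! Let `f = branching m`, roughly the square root of `log m`, and `g = f * f`. A binary search
among polynomially many (in `f`) items costs `O(log f) = O(log log m)` steps, and `2 ^ g ≤ 2 * (m +
1)`, so a set of `g` bits fits in a word. Replacing `A[i]` by its rank `RK` in the order by value
and then by index makes the keys distinct, and the argmin becomes the position of the least key.

Classes. The thresholds `thr` are `0, g, 2g, 4g, …`, capped at `max B + 1`; `O(g)` of them suffice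
because `B` is bounded polynomially in `m`. A query with bound `v` uses the class with `θ ≤ v < θ'`,
which stores the set `E` of all elements with `B ≥ θ`. The sum of `B` is `g * O(m)`, so by Markov's
inequality the sizes of the classes decrease geometrically and their total is `O(m)`
(`sum_classCard_le`).

Levels. Inside a class the ends of the range are turned into ranks with respect to `E`
(`rankOf_spec`). The ranks are cut into nodes of `f ^ 2, …, f ^ 6` elements. Going up the levels, a
query strips the incomplete nodes from both ends (`levelQuery_spec`). Every stripped piece lies in
one node and, except on the lowest level, is a union of children of that node.

Nodes (`nodeQuery_spec`). The elements of a node are listed by descending `B`, so those with `B ≥ v`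
form a prefix, whose length is found by binary search. The list is cut into chunks of `g`. The
complete chunks of the prefix are answered by a table with one row per chunk, holding prefix minima
over the chunks of the node and a sparse table over the `f` children; a row has at most `(log f + 1)
* f ≤ g` cells, so the tables have linear size. In the last chunk, bit `p` of a mask stands for the
element with the `p`-th smallest key. The admissible elements are the AND of a mask for the prefix
by `B` with the XOR of two masks for prefixes by position, and the lowest set bit, again found by
binary search, is the minimum (`microQuery_spec`).

Top. What remains is a range of complete nodes of `f ^ 6` ranks. It is answered by a sparse table
over these nodes with one row for each `v` of the class (`topQuery_spec`). Since `θ' ≤ 2 * θ`, or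
`θ' ≤ g` for the first class, `(θ' - θ) * |E|` is `g * O(m)`; with the factor `O(g)` for the
logarithm and the divisor `f ^ 6 = g ^ 3` the table has `O(m / g)` cells, which is `O(m)` over all
classes (`sum_classTopCells_le`).

The preprocessing (`prep_spec`) uses only stable counting sorts, filters and scans that are linear
in these sizes. Both programs are written in a small structured language with a total semantics;
`Stmt.exec_compile` carries their correctness and their exact running time over to the word RAM. The
compiled query contains no store, so it leaves the memory unchanged. -/

/-- The variables. -/
inductive Reg : Type
  | b | e | v | n | m | lg | f | g | mx | NC | ns | H | N | J | th | th' | cb | jb | tb | ch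
  | S | k | l | t | q | h | x | acc | cnt | base | rows | C | stride | G | Hn | res | step | p | len
  | i | best | r | c0 | j0 | x0 | x1 | mask | pb | pe | row | y
  deriving DecidableEq

/-- The arrays. -/
inductive Arr : Type
  | A0 | B0 | LG | KEY | L1 | L2 | L3 | CNT | AO | RK | BN | WP | WA | WB | CTH | CB | CN | PL
  | LOC | RS | SL | AR | NB | AK | PP | MB | MP | ROW | COL | M | T1 | T2 | JT | META
  deriving DecidableEq

/-- The machine register of a variable. -/
def Reg.idx (x : Reg) : ℕ := x.ctorIdx + 1

/-- The registers from 100 on are thereby free for the temporaries of compiled code. -/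
theorem Reg.idx_lt (x : Reg) : x.idx < 100 := by cases x <;> decide

/-- Register 0 belongs to no variable: it holds the address at which the arrays begin, and this is
the pointer handed to the queries. -/
theorem Reg.idx_pos (x : Reg) : 0 < x.idx := Nat.succ_pos _

theorem Reg.idx_injective : Function.Injective Reg.idx := fun x y h => by
  have h : x.ctorIdx = y.ctorIdx := Nat.succ_injective h
  rw [← Reg.ofNat_ctorIdx x, ← Reg.ofNat_ctorIdx y, h]

/-- The arrays are interleaved with stride 64, so that all of them share one bound on the indices
and none needs a length of its own. -/
theorem Arr.ctorIdx_lt (a : Arr) : a.ctorIdx < 64 := by cases a <;> decide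

theorem Arr.ctorIdx_injective : Function.Injective Arr.ctorIdx := fun x y h => by
  rw [← Arr.ofNat_ctorIdx x, ← Arr.ofNat_ctorIdx y, h]

/-- The states: variables, arrays, and a read-only input array. -/
@[ext] structure St : Type where
  var : Reg → ℕ
  arr : Arr → ℕ → ℕ
  inp : ℕ → ℕ

/-- Assign a value to a variable. -/
def St.setVar (s : St) (x : Reg) (a : ℕ) : St := { s with var := Function.update s.var x a }

/-- Assign a value to an entry of an array. -/
def St.setArr (s : St) (a : Arr) (i z : ℕ) : St :=
  { s with arr := Function.update s.arr a (Function.update (s.arr a) i z) }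

theorem St.setVar_var (s : St) (x y : Reg) (a : ℕ) :
    (s.setVar x a).var y = if y = x then a else s.var y := by
  simp [St.setVar, Function.update_apply]

@[simp] theorem St.setVar_arr (s : St) (x : Reg) (a : ℕ) : (s.setVar x a).arr = s.arr := rfl

@[simp] theorem St.setVar_inp (s : St) (x : Reg) (a : ℕ) : (s.setVar x a).inp = s.inp := rfl

@[simp] theorem St.setArr_var (s : St) (a : Arr) (i z : ℕ) : (s.setArr a i z).var = s.var := rfl

@[simp] theorem St.setArr_inp (s : St) (a : Arr) (i z : ℕ) : (s.setArr a i z).inp = s.inp := rfl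

theorem St.setArr_arr (s : St) (a a' : Arr) (i j z : ℕ) :
    (s.setArr a i z).arr a' j = if a' = a ∧ j = i then z else s.arr a' j := by
  by_cases h : a' = a
  · subst h; simp [St.setArr, Function.update_apply]
  · simp [St.setArr, h]

@[simp] theorem St.setVar_var_same (s : St) (x : Reg) (a : ℕ) : (s.setVar x a).var x = a := by
  simp [St.setVar_var]

@[simp] theorem St.setVar_var_ne (s : St) {x y : Reg} (a : ℕ) (h : y ≠ x) :
    (s.setVar x a).var y = s.var y := by
  simp [St.setVar_var, h]

@[simp] theorem St.setArr_arr_same (s : St) (a : Arr) (i z : ℕ) :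
    (s.setArr a i z).arr a = Function.update (s.arr a) i z := by
  simp [St.setArr]

@[simp] theorem St.setArr_arr_ne (s : St) {a a' : Arr} (i z : ℕ) (h : a' ≠ a) :
    (s.setArr a i z).arr a' = s.arr a' := by
  simp [St.setArr, h]

/-- The exact result of an operation. -/
@[simp] def opVal : BinOp → ℕ → ℕ → ℕ
  | .add, x, y => x + y
  | .sub, x, y => x - y
  | .mul, x, y => x * y
  | .div, x, y => x / y
  | .mod, x, y => x % y
  | .land, x, y => x &&& y
  | .lor, x, y => x ||| y
  | .xor, x, y => x ^^^ y
  | .shl, x, y => x * 2 ^ y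
  | .shr, x, y => x / 2 ^ y
  | .lt, x, y => if x < y then 1 else 0
  | .eq, x, y => if x = y then 1 else 0

/-- An operation does not overflow in words less than `W`. -/
@[simp] def opFits (W : ℕ) : BinOp → ℕ → ℕ → Prop
  | .add, x, y => x + y < W
  | .sub, x, y => y ≤ x
  | .mul, x, y => x * y < W
  | .shl, x, y => x * 2 ^ y < W
  | _, _, _ => True

/-- Expressions. -/
inductive Expr : Type
  | var (x : Reg)
  | lit (n : ℕ)
  | bin (o : BinOp) (a b : Expr)
  | get (a : Arr) (i : Expr)
  | inp (i : Expr)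

/-- The limits on the values, on the indices of arrays and on the indices of the input. -/
structure Lim : Type where
  W : ℕ
  D : ℕ
  I : ℕ

namespace Expr

instance : Add Expr := ⟨bin .add⟩
instance : Sub Expr := ⟨bin .sub⟩
instance : Mul Expr := ⟨bin .mul⟩
instance : Div Expr := ⟨bin .div⟩
instance : Mod Expr := ⟨bin .mod⟩
instance (n : ℕ) : OfNat Expr n := ⟨lit n⟩
instance : Coe Reg Expr := ⟨var⟩

/-- `a < b`. -/
def lt (a b : Expr) : Expr := bin .lt a b

/-- `a ≤ b`. -/
def le (a b : Expr) : Expr := bin .eq (bin .lt b a) 0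

/-- `a = b`. -/
def eq (a b : Expr) : Expr := bin .eq a b

/-- `2 ^ a`. -/
def pow2 (a : Expr) : Expr := bin .shl 1 a

/-- The value of an expression. -/
def eval (s : St) : Expr → ℕ
  | var x => s.var x
  | lit n => n
  | bin o a b => opVal o (a.eval s) (b.eval s)
  | get a i => s.arr a (i.eval s)
  | inp i => s.inp (i.eval s)

/-- The evaluation stays within the limits. -/
def safe (c : Lim) (s : St) : Expr → Prop
  | var _ => True
  | lit n => n < c.W
  | bin o a b => a.safe c s ∧ b.safe c s ∧ opFits c.W o (a.eval s) (b.eval s)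
  | get _ i => i.safe c s ∧ i.eval s < c.D
  | inp i => i.safe c s ∧ i.eval s < c.I

/-- The number of steps of the evaluation. -/
def cost : Expr → ℕ
  | var _ => 1
  | lit _ => 1
  | bin _ a b => a.cost + b.cost + 1
  | get _ i => i.cost + 6
  | inp i => i.cost + 1

section
variable (s : St) (c : Lim) (x : Reg) (n : ℕ) (a b : Expr) (A : Arr)
@[simp] theorem eval_var : (var x).eval s = s.var x := rfl
@[simp] theorem eval_lit : (no_index (OfNat.ofNat n) : Expr).eval s = n := rfl
@[simp] theorem eval_lit' : (lit n : Expr).eval s = n := rfl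
@[simp] theorem eval_add : (a + b).eval s = a.eval s + b.eval s := rfl
@[simp] theorem eval_sub : (a - b).eval s = a.eval s - b.eval s := rfl
@[simp] theorem eval_mul : (a * b).eval s = a.eval s * b.eval s := rfl
@[simp] theorem eval_div : (a / b).eval s = a.eval s / b.eval s := rfl
@[simp] theorem eval_mod : (a % b).eval s = a.eval s % b.eval s := rfl
@[simp] theorem eval_bin (o : BinOp) : (bin o a b).eval s = opVal o (a.eval s) (b.eval s) := rfl
@[simp] theorem eval_get : (get A a).eval s = s.arr A (a.eval s) := rfl
@[simp] theorem eval_inp : (inp a).eval s = s.inp (a.eval s) := rfl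
@[simp] theorem eval_pow2 : (pow2 a).eval s = 2 ^ a.eval s := by simp [pow2]
@[simp] theorem eval_lt : (lt a b).eval s = if a.eval s < b.eval s then 1 else 0 := rfl
@[simp] theorem eval_le : (le a b).eval s = if a.eval s ≤ b.eval s then 1 else 0 := by
  rcases le_or_gt (a.eval s) (b.eval s) with h | h
  · simp [le, h, not_lt.2 h]
  · simp [le, h, not_le.2 h]
@[simp] theorem eval_eq : (eq a b).eval s = if a.eval s = b.eval s then 1 else 0 := rfl
@[simp] theorem cost_var : (var x).cost = 1 := rfl
@[simp] theorem cost_lit : (no_index (OfNat.ofNat n) : Expr).cost = 1 := rfl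
@[simp] theorem cost_lit' : (lit n).cost = 1 := rfl
@[simp] theorem cost_add : (a + b).cost = a.cost + b.cost + 1 := rfl
@[simp] theorem cost_sub : (a - b).cost = a.cost + b.cost + 1 := rfl
@[simp] theorem cost_mul : (a * b).cost = a.cost + b.cost + 1 := rfl
@[simp] theorem cost_div : (a / b).cost = a.cost + b.cost + 1 := rfl
@[simp] theorem cost_mod : (a % b).cost = a.cost + b.cost + 1 := rfl
@[simp] theorem cost_bin (o : BinOp) : (bin o a b).cost = a.cost + b.cost + 1 := rfl
@[simp] theorem cost_get : (get A a).cost = a.cost + 6 := rfl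
@[simp] theorem cost_inp : (inp a).cost = a.cost + 1 := rfl
@[simp] theorem cost_lt : (lt a b).cost = a.cost + b.cost + 1 := rfl
@[simp] theorem cost_eq : (eq a b).cost = a.cost + b.cost + 1 := rfl
@[simp] theorem cost_le : (le a b).cost = a.cost + b.cost + 3 := by
  change b.cost + a.cost + 1 + 1 + 1 = _
  omega
@[simp] theorem cost_pow2 : (pow2 a).cost = a.cost + 2 := by
  change 1 + a.cost + 1 = _
  omega
@[simp] theorem safe_var : (var x).safe c s := trivial
@[simp] theorem safe_lit : (no_index (OfNat.ofNat n) : Expr).safe c s ↔ n < c.W := Iff.rfl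
@[simp] theorem safe_lit' : (lit n : Expr).safe c s ↔ n < c.W := Iff.rfl
@[simp] theorem safe_add : (a + b).safe c s ↔
  a.safe c s ∧ b.safe c s ∧ a.eval s + b.eval s < c.W := Iff.rfl
@[simp] theorem safe_sub : (a - b).safe c s ↔
  a.safe c s ∧ b.safe c s ∧ b.eval s ≤ a.eval s := Iff.rfl
@[simp] theorem safe_mul : (a * b).safe c s ↔
  a.safe c s ∧ b.safe c s ∧ a.eval s * b.eval s < c.W := Iff.rfl
@[simp] theorem safe_div : (a / b).safe c s ↔ a.safe c s ∧ b.safe c s :=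
  and_congr_right' (iff_of_eq (and_true _))
@[simp] theorem safe_mod : (a % b).safe c s ↔ a.safe c s ∧ b.safe c s :=
  and_congr_right' (iff_of_eq (and_true _))
@[simp] theorem safe_bin (o : BinOp) : (bin o a b).safe c s ↔
  a.safe c s ∧ b.safe c s ∧ opFits c.W o (a.eval s) (b.eval s) := Iff.rfl
@[simp] theorem safe_get : (get A a).safe c s ↔ a.safe c s ∧ a.eval s < c.D := Iff.rfl
@[simp] theorem safe_inp : (inp a).safe c s ↔ a.safe c s ∧ a.eval s < c.I := Iff.rfl
@[simp] theorem safe_pow2 : (pow2 a).safe c s ↔ 1 < c.W ∧ a.safe c s ∧ 2 ^ a.eval s < c.W := by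
  simp [pow2]
@[simp] theorem safe_lt : (lt a b).safe c s ↔ a.safe c s ∧ b.safe c s := by simp [lt]
@[simp] theorem safe_le : (le a b).safe c s ↔ (b.safe c s ∧ a.safe c s) ∧ 0 < c.W := by simp [le]
@[simp] theorem safe_eq : (eq a b).safe c s ↔ a.safe c s ∧ b.safe c s := by simp [eq]
end

/-- The compiled expression leaves its value in the register `d`. -/
def compile (d : ℕ) : Expr → Cmd
  | var x => .copy d x.idx
  | lit n => .const d n
  | bin o a b => .seq (.seq (a.compile d) (b.compile (d + 1))) (.op o d d (d + 1))
  | get a i => .seq (i.compile d) (.seq (.const (d + 1) 64) (.seq (.op .mul d d (d + 1))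
      (.seq (.const (d + 1) a.ctorIdx) (.seq (.op .add d d (d + 1)) (.seq (.op .add d d 0)
        (.load d d))))))
  | inp i => .seq (i.compile d) (.load d d)

end Expr

/-- Statements. -/
inductive Stmt : Type
  | skip
  | assign (x : Reg) (e : Expr)
  | put (a : Arr) (i e : Expr)
  | seq (p q : Stmt)
  | ite (e : Expr) (p q : Stmt)
  /-- `for x < e do p` -/
  | loop (x : Reg) (e : Expr) (p : Stmt)

infix:60 " ::= " => Stmt.assign
infixr:50 " ;; " => Stmt.seq

namespace Stmt

/-- The state after `k` rounds of a loop. -/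
def iter (f : St → St) (x : Reg) (s : St) : ℕ → St
  | 0 => s
  | k + 1 => f ((iter f x s k).setVar x k)

/-- The state after the execution. -/
def run : Stmt → St → St
  | skip, s => s
  | assign x e, s => s.setVar x (e.eval s)
  | put a i e, s => s.setArr a (i.eval s) (e.eval s)
  | seq p q, s => q.run (p.run s)
  | ite e p q, s => if e.eval s ≠ 0 then p.run s else q.run s
  | loop x e p, s => iter p.run x s (e.eval s)

/-- The execution stays within the limits. -/
def safe (c : Lim) : Stmt → St → Prop
  | skip, _ => True
  | assign _ e, s => e.safe c s
  | put _ i e, s => i.safe c s ∧ e.safe c s ∧ i.eval s < c.D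
  | seq p q, s => p.safe c s ∧ q.safe c (p.run s)
  | ite e p q, s => e.safe c s ∧ if e.eval s ≠ 0 then p.safe c s else q.safe c s
  | loop x e p, s => e.safe c s ∧ ∀ k < e.eval s, p.safe c ((iter p.run x s k).setVar x k)

/-- The number of steps of the execution. -/
def time : Stmt → St → ℕ
  | skip, _ => 1
  | assign _ e, _ => e.cost + 1
  | put _ i e, _ => i.cost + e.cost + 6
  | seq p q, s => p.time s + q.time (p.run s)
  | ite e p q, s => e.cost + 1 + if e.eval s ≠ 0 then p.time s else q.time s
  | loop x e p, s => e.cost + 3 +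
      ∑ k ∈ Finset.range (e.eval s), (p.time ((iter p.run x s k).setVar x k) + 5)

/-- The compiled program, which uses the registers from `d` on for temporary values. -/
def compile (d : ℕ) : Stmt → Cmd
  | skip => .nop
  | assign x e => .seq (e.compile d) (.copy x.idx d)
  | put a i e => .seq (i.compile d) (.seq (.const (d + 1) 64) (.seq (.op .mul d d (d + 1))
      (.seq (.const (d + 1) a.ctorIdx) (.seq (.op .add d d (d + 1)) (.seq (.op .add d d 0)
        (.seq (e.compile (d + 1)) (.store d (d + 1))))))))
  | seq p q => .seq (p.compile d) (q.compile d)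
  | ite e p q => .seq (e.compile d) (.cond d (p.compile d) (q.compile d))
  | loop x e p => .seq (.seq (e.compile d) (.seq (.const (d + 1) 0) (.op .lt (d + 2) (d + 1) d)))
      (.loop (d + 2) (.seq (.seq (.copy x.idx (d + 1)) (p.compile (d + 3)))
        (.seq (.const (d + 2) 1) (.seq (.op .add (d + 1) (d + 1) (d + 2))
          (.op .lt (d + 2) (d + 1) d)))))

end Stmt

/-! ### Correctness of the compilation -/

theorem Exec.cast {w : ℕ} {p : Cmd} {s s' : State} {t t' : ℕ} (h : Exec w p s s' t) (e : t = t') :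
    Exec w p s s' t' := e ▸ h

/-- A comparison may return `1`, which is a word only if `w` is positive. -/
theorem BinOp.eval_lt {w : ℕ} (hw1 : 0 < w) (o : BinOp) {x y : ℕ} (hx : x < 2 ^ w) (hy : y < 2 ^ w) :
    o.eval w x y < 2 ^ w := by
  have hw : 0 < 2 ^ w := Nat.two_pow_pos w
  cases o <;> simp only [BinOp.eval]
  case add => exact Nat.mod_lt _ hw
  case sub => exact Nat.mod_lt _ hw
  case mul => exact Nat.mod_lt _ hw
  case div => exact (Nat.div_le_self _ _).trans_lt hx
  case mod => exact (Nat.mod_le _ _).trans_lt hx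
  case land => exact Nat.and_lt_two_pow _ hy
  case lor => exact Nat.or_lt_two_pow hx hy
  case xor => exact Nat.xor_lt_two_pow hx hy
  case shl => exact Nat.mod_lt _ hw
  case shr => exact (Nat.shiftRight_le _ _).trans_lt hx
  all_goals
    split
    · exact Nat.one_lt_two_pow hw1.ne'
    · exact hw

theorem BinOp.eval_eq {w : ℕ} (o : BinOp) {x y : ℕ} (hx : x < 2 ^ w) (hy : y < 2 ^ w)
    (h : opFits (2 ^ w) o x y) : o.eval w x y = opVal o x y := by
  cases o <;> simp_all only [BinOp.eval, opVal, opFits]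
  case add => exact Nat.mod_eq_of_lt h
  case sub =>
    -- There is no borrow because `opFits` demands `y ≤ x`.
    have : x + (2 ^ w - y) = x - y + 2 ^ w := by omega
    rw [this, Nat.add_mod_right]; exact Nat.mod_eq_of_lt (by omega)
  case mul => exact Nat.mod_eq_of_lt h
  case shl => rw [Nat.shiftLeft_eq]; exact Nat.mod_eq_of_lt h
  case shr => exact Nat.shiftRight_eq_div_pow _ _

theorem _root_.WordRAM.State.IsWord.setReg {w : ℕ} {s : State} (h : s.IsWord w) {d x : ℕ} (hx : x < 2 ^ w) :
    (s.setReg d x).IsWord w :=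
  ⟨fun r => by
    by_cases e : r = d
    · subst e; simpa [State.setReg] using hx
    · simpa [State.setReg, e] using h.1 r, h.2⟩

theorem _root_.WordRAM.State.IsWord.setMem {w : ℕ} {s : State} (h : s.IsWord w) {d x : ℕ} (hx : x < 2 ^ w) :
    (s.setMem d x).IsWord w :=
  ⟨h.1, fun r => by
    by_cases e : r = d
    · subst e; simpa [State.setMem] using hx
    · simpa [State.setMem, e] using h.2 r⟩

theorem Exec.isWord {w : ℕ} (hw : 0 < w) {p : Cmd} {s s' : State} {t : ℕ} (h : Exec w p s s' t)
    (hs : s.IsWord w) : s'.IsWord w := by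
  induction h with
  | nop => exact hs
  | const d n s => exact hs.setReg (Nat.mod_lt _ (Nat.two_pow_pos w))
  | copy d a s => exact hs.setReg (hs.1 _)
  | op o d a b s => exact hs.setReg (BinOp.eval_lt hw o (hs.1 _) (hs.1 _))
  | load d a s => exact hs.setReg (hs.2 _)
  | store a r s => exact hs.setMem (hs.1 _)
  | seq _ _ h1 h2 => exact h2 (h1 hs)
  | cond_true _ _ h => exact h hs
  | cond_false _ _ h => exact h hs
  | loop_true _ _ _ h1 h2 => exact h2 (h1 hs)
  | loop_false _ => exact hs

/-- The program has no store instructions. -/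
def storeFree : Cmd → Bool
  | .store _ _ => false
  | .seq p q => storeFree p && storeFree q
  | .cond _ p q => storeFree p && storeFree q
  | .loop _ p => storeFree p
  | _ => true

/-- This is how queries are shown to leave the memory as they found it. -/
theorem Exec.mem_eq {w : ℕ} {p : Cmd} {s s' : State} {t : ℕ} (h : Exec w p s s' t)
    (hp : storeFree p = true) : s'.mem = s.mem := by
  induction h with
  | store => simp [storeFree] at hp
  | seq _ _ h1 h2 =>
    simp only [storeFree, Bool.and_eq_true] at hp
    rw [h2 hp.2, h1 hp.1]
  | cond_true _ _ h => simp only [storeFree, Bool.and_eq_true] at hp; exact h hp.1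
  | cond_false _ _ h => simp only [storeFree, Bool.and_eq_true] at hp; exact h hp.2
  | loop_true _ _ _ h1 h2 =>
    rw [h2 hp, h1 (by simpa [storeFree] using hp)]
  | _ => rfl

/-- The machine state `s` represents the state `h`. -/
structure Rep (w D off : ℕ) (s : State) (h : St) : Prop where
  word : s.IsWord w
  reg_zero : s.reg 0 = off
  var : ∀ x : Reg, s.reg x.idx = h.var x
  arr : ∀ a : Arr, ∀ i < D, s.mem (i * 64 + a.ctorIdx + off) = h.arr a i
  inp : ∀ i < off, s.mem i = h.inp i

/-- A representation looks only at register 0, at the registers of the variables and at the memory,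
so temporaries may change freely. -/
theorem Rep.congr {w D off : ℕ} {s s' : State} {h : St} (hr : Rep w D off s h)
    (hw : s'.IsWord w) (hm : s'.mem = s.mem) (hreg : ∀ r < 100, s'.reg r = s.reg r) :
    Rep w D off s' h where
  word := hw
  reg_zero := by rw [hreg 0 (by norm_num), hr.reg_zero]
  var x := by rw [hreg _ x.idx_lt, hr.var]
  arr a i hi := by rw [hm, hr.arr a i hi]
  inp i hi := by rw [hm, hr.inp i hi]

@[simp] theorem setReg_reg (s : State) (d x r : ℕ) :
    (s.setReg d x).reg r = if r = d then x else s.reg r := by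
  simp [State.setReg, Function.update_apply]

@[simp] theorem setReg_mem (s : State) (d x : ℕ) : (s.setReg d x).mem = s.mem := rfl

@[simp] theorem setMem_reg (s : State) (d x : ℕ) : (s.setMem d x).reg = s.reg := rfl

theorem setMem_mem (s : State) (d x r : ℕ) :
    (s.setMem d x).mem r = if r = d then x else s.mem r := by
  simp [State.setMem, Function.update_apply]

/-- The state after the address computation of an array access. -/
def addressState (w d i off : ℕ) (a : Arr) (s : State) : State :=
  ((((s.setReg (d + 1) (64 % 2 ^ w)).setReg d (i * 64)).setReg (d + 1)
    (a.ctorIdx % 2 ^ w)).setReg d (i * 64 + a.ctorIdx)).setReg d (i * 64 + a.ctorIdx + off)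

/-- The bound on `D * 64 + off` keeps every address below `2 ^ w`, so the modular arithmetic of the
machine is exact. The rest `q` of the access is a parameter because loads and stores share this
prefix and the compiled code nests to the right. -/
theorem exec_address {w D off d i : ℕ} {s : State} (a : Arr) (hd : 100 ≤ d) (hi : i < D)
    (hD : D * 64 + off < 2 ^ w) (h0 : s.reg 0 = off) (hs : s.reg d = i) {q : Cmd} {s' : State}
    {t : ℕ} (hq : Exec w q (addressState w d i off a s) s' t) :
    Exec w (.seq (.const (d + 1) 64) (.seq (.op .mul d d (d + 1))
      (.seq (.const (d + 1) a.ctorIdx) (.seq (.op .add d d (d + 1)) (.seq (.op .add d d 0)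
        q))))) s s' (t + 5) := by
  have ha := a.ctorIdx_lt
  have h64 : 64 % 2 ^ w = 64 := Nat.mod_eq_of_lt (by omega)
  have hc : a.ctorIdx % 2 ^ w = a.ctorIdx := Nat.mod_eq_of_lt (by omega)
  have e1 : BinOp.eval w .mul i 64 = i * 64 := Nat.mod_eq_of_lt (by omega)
  have e2 : BinOp.eval w .add (i * 64) a.ctorIdx = i * 64 + a.ctorIdx :=
    Nat.mod_eq_of_lt (by omega)
  have e3 : BinOp.eval w .add (i * 64 + a.ctorIdx) off = i * 64 + a.ctorIdx + off :=
    Nat.mod_eq_of_lt (by omega)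
  have hd0 : 0 ≠ d := by omega
  refine Exec.cast (.seq (.const _ _ _) (.seq (.op _ _ _ _ _) (.seq (.const _ _ _)
    (.seq (.op _ _ _ _ _) (.seq (.op _ _ _ _ _) (?_ : Exec w q _ s' t)))))) (by omega)
  convert hq using 1
  simp [addressState, h64, hc, hs, h0, e1, e2, e3, hd0]

/-- The registers from `d` on act as a stack: the second operand is evaluated from `d + 1` on and so
preserves the first one, which waits in `d`. -/
theorem Expr.exec_compile {w D off : ℕ} (hw : 0 < w) (hD : D * 64 + off < 2 ^ w) (h : St) (e : Expr) :
    ∀ (d : ℕ) (s : State), 100 ≤ d → Rep w D off s h → e.safe ⟨2 ^ w, D, off⟩ h →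
      ∃ s', Exec w (e.compile d) s s' e.cost ∧ s'.mem = s.mem ∧ s'.reg d = e.eval h ∧
        (∀ r < d, s'.reg r = s.reg r) ∧ Rep w D off s' h := by
  -- The representation of the final state is automatic: evaluation writes neither to memory nor to
  -- any register below `d`.
  have key : ∀ (d : ℕ) (s s' : State) (p : Cmd) (t a : ℕ), 100 ≤ d → Rep w D off s h →
      Exec w p s s' t → s'.mem = s.mem → s'.reg d = a → (∀ r < d, s'.reg r = s.reg r) →
      ∃ s', Exec w p s s' t ∧ s'.mem = s.mem ∧ s'.reg d = a ∧
        (∀ r < d, s'.reg r = s.reg r) ∧ Rep w D off s' h :=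
    fun d s s' p t a hd hr hx hm ha hreg => ⟨s', hx, hm, ha, hreg,
      hr.congr (Exec.isWord hw hx hr.word) hm fun r h => hreg r (by omega)⟩
  induction e with
  | var x =>
    intro d s hd hr _
    refine key d s _ _ _ _ hd hr (.copy _ _ _) rfl (by simp [hr.var]) fun r h => ?_
    simp [h.ne]
  | lit n =>
    intro d s hd hr hs
    refine key d s _ _ _ _ hd hr (.const _ _ _) rfl ?_ fun r h => ?_
    · simpa using Nat.mod_eq_of_lt hs
    · simp [h.ne]
  | bin o a b iha ihb =>
    intro d s hd hr ⟨h1, h2, h3⟩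
    obtain ⟨s1, x1, m1, v1, r1, hr1⟩ := iha d s hd hr h1
    obtain ⟨s2, x2, m2, v2, r2, hr2⟩ := ihb (d + 1) s1 (by omega) hr1 h2
    refine key d s _ _ _ _ hd hr (.seq (.seq x1 x2) (.op _ _ _ _ _)) (by simp [m1, m2]) ?_
      fun r h => ?_
    · have hv : s2.reg d = a.eval h := by rw [r2 d (by omega), v1]
      rw [← hv, ← v2] at h3
      simp only [setReg_reg, if_pos, Expr.eval_bin, ← v2, ← hv]
      exact BinOp.eval_eq o (hr2.word.1 _) (hr2.word.1 _) h3
    · simp [h.ne, r2 r (by omega), r1 r h]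
  | get a i ih =>
    intro d s hd hr ⟨h1, h2⟩
    obtain ⟨s1, x1, m1, v1, r1, hr1⟩ := ih d s hd hr h1
    refine key d s _ _ _ _ hd hr (Exec.cast (.seq x1 (exec_address a hd h2 hD hr1.reg_zero v1
      (.load _ _ _))) (by simp only [cost])) (by simp [addressState, m1]) ?_ fun r h => ?_
    · simp [addressState, hr1.arr a _ h2]
    · have h' : r ≠ d + 1 := by omega
      simp [addressState, h.ne, h', r1 r h]
  | inp i ih =>
    intro d s hd hr ⟨h1, h2⟩
    obtain ⟨s1, x1, m1, v1, r1, hr1⟩ := ih d s hd hr h1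
    refine key d s _ _ _ _ hd hr (.seq x1 (.load _ _ _)) (by simp [m1]) ?_ fun r h => ?_
    · simp [v1, hr1.inp _ h2]
    · simp [h.ne, r1 r h]

theorem Rep.setVar {w D off : ℕ} {s : State} {h : St} (hr : Rep w D off s h) (x : Reg) {a : ℕ}
    (ha : a < 2 ^ w) : Rep w D off (s.setReg x.idx a) (h.setVar x a) where
  word := hr.word.setReg ha
  reg_zero := by simp [x.idx_pos.ne, hr.reg_zero]
  var y := by
    by_cases e : y = x
    · simp [e]
    · simp [e, Reg.idx_injective.eq_iff, hr.var]
  arr := hr.arr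
  inp := hr.inp

theorem Rep.setArr {w D off : ℕ} {s : State} {h : St} (hr : Rep w D off s h)
    (a : Arr) {i z : ℕ} (hz : z < 2 ^ w) :
    Rep w D off (s.setMem (i * 64 + a.ctorIdx + off) z) (h.setArr a i z) where
  word := hr.word.setMem hz
  reg_zero := hr.reg_zero
  var := hr.var
  arr a' j hj := by
    have h1 := a.ctorIdx_lt
    have h2 := a'.ctorIdx_lt
    rw [setMem_mem, St.setArr_arr, hr.arr _ _ hj]
    refine if_congr ⟨fun e => ?_, fun ⟨e1, e2⟩ => by rw [e1, e2]⟩ rfl rfl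
    -- The address determines array and index, since the numbers of arrays are less than 64.
    exact ⟨Arr.ctorIdx_injective (by omega), by omega⟩
  inp j hj := by
    -- The input occupies the cells below `off`, where no array reaches.
    rw [setMem_mem, if_neg (by omega), hr.inp _ hj]; rfl

/-- A loop keeps its bound, counter and test in the registers `d`, `d + 1`, `d + 2` and compiles its
body from `d + 3` on. The counter is copied into the loop variable in every round, so the body may
overwrite the latter. Only temporaries below `d` are claimed to be preserved, since the program may
change its variables. -/
theorem Stmt.exec_compile {w D off : ℕ} (hw : 0 < w) (hD : D * 64 + off < 2 ^ w) (p : Stmt) :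
    ∀ (d : ℕ) (s : State) (h : St), 100 ≤ d → Rep w D off s h → p.safe ⟨2 ^ w, D, off⟩ h →
      ∃ s', Exec w (p.compile d) s s' (p.time h) ∧ Rep w D off s' (p.run h) ∧
        ∀ r < d, 100 ≤ r → s'.reg r = s.reg r := by
  induction p with
  | skip => exact fun d s h hd hr hs => ⟨s, .nop _, hr, fun _ _ _ => rfl⟩
  | assign x e =>
    intro d s h hd hr hs
    obtain ⟨s1, x1, m1, v1, r1, hr1⟩ := e.exec_compile hw hD h d s hd hr hs
    refine ⟨_, .seq x1 (.copy _ _ _), ?_, fun r h1 h2 => ?_⟩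
    · have := hr1.setVar x (hr1.word.1 d)
      rwa [v1] at this ⊢
    · have := x.idx_lt
      have : r ≠ x.idx := by omega
      simp [this, r1 r h1]
  | put a i e =>
    intro d s h hd hr ⟨h1, h2, h3⟩
    obtain ⟨s1, x1, m1, v1, r1, hr1⟩ := i.exec_compile hw hD h d s hd hr h1
    set s2 := addressState w d (i.eval h) off a s1 with hs2
    have ha := a.ctorIdx_lt
    have h3' : i.eval h < D := h3
    have hr2 : Rep w D off s2 h := by
      refine hr1.congr ?_ rfl fun r hr => ?_
      · exact ((((hr1.word.setReg (Nat.mod_lt _ (Nat.two_pow_pos w))).setReg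
          (by omega)).setReg (Nat.mod_lt _ (Nat.two_pow_pos w))).setReg (by omega)).setReg
            (by omega)
      · have h' : r ≠ d + 1 := by omega
        have h'' : r ≠ d := by omega
        simp [hs2, addressState, h', h'']
    obtain ⟨s3, x3, m3, v3, r3, hr3⟩ := e.exec_compile hw hD h (d + 1) s2 (by omega) hr2 h2
    have hd3 : s3.reg d = i.eval h * 64 + a.ctorIdx + off := by
      rw [r3 d (by omega), hs2]; simp [addressState]
    refine ⟨_, Exec.cast (.seq x1 (exec_address a hd h3 hD hr1.reg_zero v1
      (.seq x3 (.store _ _ _))))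
      (by simp only [time]; omega), ?_, fun r h1 h2 => ?_⟩
    · have := hr3.setArr a (i := i.eval h) (hr3.word.1 (d + 1))
      rw [hd3, v3]
      rwa [v3] at this
    · have h' : r ≠ d + 1 := by omega
      have h'' : r ≠ d := by omega
      rw [setMem_reg, r3 r (by omega), hs2]
      simp [addressState, h', h'', r1 r h1]
  | seq p q ihp ihq =>
    intro d s h hd hr ⟨h1, h2⟩
    obtain ⟨s1, x1, hr1, r1⟩ := ihp d s h hd hr h1
    obtain ⟨s2, x2, hr2, r2⟩ := ihq d s1 _ hd hr1 h2
    exact ⟨s2, .seq x1 x2, hr2, fun r h h' => by rw [r2 r h h', r1 r h h']⟩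
  | ite e p q ihp ihq =>
    intro d s h hd hr ⟨h1, h2⟩
    obtain ⟨s1, x1, m1, v1, r1, hr1⟩ := e.exec_compile hw hD h d s hd hr h1
    by_cases hc : e.eval h = 0
    · rw [if_neg (by simpa using hc)] at h2
      obtain ⟨s2, x2, hr2, r2⟩ := ihq d s1 h hd hr1 h2
      refine ⟨s2, Exec.cast (.seq x1 (.cond_false (by rw [v1, hc]) x2)) ?_, ?_, fun r h h' => ?_⟩
      · simp [time, hc]; omega
      · simpa [run, hc] using hr2
      · rw [r2 r h h', r1 r h]
    · rw [if_pos hc] at h2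
      obtain ⟨s2, x2, hr2, r2⟩ := ihp d s1 h hd hr1 h2
      refine ⟨s2, Exec.cast (.seq x1 (.cond_true (by rw [v1]; exact hc) x2)) ?_, ?_,
        fun r h h' => ?_⟩
      · simp [time, hc]; omega
      · simpa [run, hc] using hr2
      · rw [r2 r h h', r1 r h]
  | loop x e p ih =>
    intro d s h hd hr ⟨h1, h2⟩
    obtain ⟨s1, x1, m1, v1, r1, hr1⟩ := e.exec_compile hw hD h d s hd hr h1
    have hw0 : 0 < 2 ^ w := Nat.two_pow_pos w
    set n := e.eval h with hn
    have hnw : n < 2 ^ w := v1 ▸ hr1.word.1 d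
    set body : Cmd := .seq (.seq (.copy x.idx (d + 1)) (p.compile (d + 3)))
        (.seq (.const (d + 2) 1) (.seq (.op .add (d + 1) (d + 1) (d + 2))
          (.op .lt (d + 2) (d + 1) d))) with hb
    -- Induction on the number `j` of remaining rounds, for every machine state that can occur at
    -- the test of round `k`.
    have main : ∀ j k : ℕ, k + j = n → ∀ s2 : State, Rep w D off s2 (iter p.run x h k) →
        s2.reg d = n → s2.reg (d + 1) = k → s2.reg (d + 2) = (if k < n then 1 else 0) →
        ∃ s3, Exec w (.loop (d + 2) body) s2 s3
          (1 + ∑ i ∈ Finset.range j, (p.time ((iter p.run x h (k + i)).setVar x (k + i)) + 5)) ∧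
          Rep w D off s3 (iter p.run x h n) ∧ ∀ r < d, 100 ≤ r → s3.reg r = s2.reg r := by
      intro j
      induction j with
      | zero =>
        intro k hk s2 hr2 e1 e2 e3
        obtain rfl : k = n := by omega
        exact ⟨s2, Exec.cast (.loop_false (by simpa using e3)) (by simp), hr2, fun _ _ _ => rfl⟩
      | succ j ihj =>
        intro k hk s2 hr2 e1 e2 e3
        have hkn : k < n := by omega
        have hrv := hr2.setVar x (a := k) (by omega)
        obtain ⟨s3, x3, hr3, r3⟩ := ih (d + 3) _ _ (by omega) hrv (h2 k hkn)
        have hxl := x.idx_lt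
        have hx0 : d ≠ x.idx := by omega
        have hx1 : d + 1 ≠ x.idx := by omega
        have f0 : s3.reg d = n := by rw [r3 d (by omega) (by omega)]; simpa [hx0] using e1
        have f1 : s3.reg (d + 1) = k := by
          rw [r3 _ (by omega) (by omega)]; simpa [hx1] using e2
        have h1w : 1 % 2 ^ w = 1 := Nat.mod_eq_of_lt (by omega)
        have hadd : BinOp.eval w .add k 1 = k + 1 := Nat.mod_eq_of_lt (by omega)
        set s4 := (s3.setReg (d + 2) (1 % 2 ^ w)) with hs4
        set s5 := s4.setReg (d + 1) (BinOp.eval w .add (s4.reg (d + 1)) (s4.reg (d + 2))) with hs5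
        set s6 := s5.setReg (d + 2) (BinOp.eval w .lt (s5.reg (d + 1)) (s5.reg d)) with hs6
        have hx4 : Exec w body s2 s6 (1 + p.time ((iter p.run x h k).setVar x k) + 3) := by
          refine Exec.cast (.seq (.seq (.copy _ _ _) (?_ : Exec w (p.compile (d + 3)) _ s3 _))
            (.seq (.const _ _ _) (.seq (.op _ _ _ _ _) (.op _ _ _ _ _)))) rfl
          rw [e2]; exact x3
        have hw6 := Exec.isWord hw hx4 hr2.word
        have hr6 : Rep w D off s6 (iter p.run x h (k + 1)) := by
          refine Rep.congr hr3 hw6 rfl fun r hr => ?_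
          have : r ≠ d + 1 := by omega
          have : r ≠ d + 2 := by omega
          simp [hs6, hs5, hs4, *]
        obtain ⟨s7, x7, hr7, r7⟩ := ihj (k + 1) (by omega) s6 hr6
          (by simp [hs6, hs5, hs4, f0])
          (by simp [hs6, hs5, hs4, f1, h1w, hadd])
          (by simp [hs6, hs5, hs4, f1, f0, h1w, hadd]; rfl)
        refine ⟨s7, Exec.cast (.loop_true (by simp [e3, hkn]) hx4 x7) ?_, hr7, fun r h h' => ?_⟩
        · rw [Finset.sum_range_succ']
          have e : ∀ i, k + 1 + i = k + (i + 1) := fun i => by omega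
          simp only [e, Nat.add_zero]
          omega
        · have hA : r ≠ d + 1 := by omega
          have hB : r ≠ d + 2 := by omega
          have hC : r ≠ x.idx := by omega
          rw [r7 r h h', hs6]
          simp [hs5, hs4, hA, hB, r3 r (by omega) h', hC]
    set s2 := (s1.setReg (d + 1) (0 % 2 ^ w)) with hs2
    set s3 := s2.setReg (d + 2) (BinOp.eval w .lt (s2.reg (d + 1)) (s2.reg d)) with hs3
    have hx3 : Exec w (.seq (e.compile d) (.seq (.const (d + 1) 0) (.op .lt (d + 2) (d + 1) d)))
        s s3 (e.cost + (1 + 1)) := .seq x1 (.seq (.const _ _ _) (.op _ _ _ _ _))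
    have hr3 : Rep w D off s3 h := by
      refine Rep.congr hr1 (Exec.isWord hw hx3 hr.word) rfl fun r hr => ?_
      have : r ≠ d + 1 := by omega
      have : r ≠ d + 2 := by omega
      simp [hs3, hs2, *]
    obtain ⟨s4, x4, hr4, r4⟩ := main n 0 (by omega) s3 hr3 (by simp [hs3, hs2, v1])
      (by simp [hs3, hs2]) (by simp [hs3, hs2, v1]; rfl)
    refine ⟨s4, Exec.cast (.seq hx3 x4) ?_, hr4, fun r h h' => ?_⟩
    · simp only [time, Nat.zero_add, ← hn]; omega
    · have hA : r ≠ d + 1 := by omega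
      have hB : r ≠ d + 2 := by omega
      rw [r4 r h h', hs3]
      simp [hs2, hA, hB, r1 r h]

/-! ### Program logic -/

namespace Stmt

/-- The program may assign the variable `y`. -/
def wr : Stmt → Reg → Bool
  | skip, _ => false
  | assign x _, y => decide (y = x)
  | put _ _ _, _ => false
  | seq p q, y => p.wr y || q.wr y
  | ite _ p q, y => p.wr y || q.wr y
  | loop x _ p, y => decide (y = x) || p.wr y

/-- The program may write to the array `b`. -/
def wa : Stmt → Arr → Bool
  | skip, _ => false
  | assign _ _, _ => false
  | put a _ _, b => decide (b = a)
  | seq p q, b => p.wa b || q.wa b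
  | ite _ p q, b => p.wa b || q.wa b
  | loop _ _ p, b => p.wa b

/-- The program has no loops. -/
def flat : Stmt → Bool
  | seq p q => p.flat && q.flat
  | ite _ p q => p.flat && q.flat
  | loop _ _ _ => false
  | _ => true

/-- A bound on the number of steps of a program without loops. -/
def cost : Stmt → ℕ
  | skip => 1
  | assign _ e => e.cost + 1
  | put _ i e => i.cost + e.cost + 6
  | seq p q => p.cost + q.cost
  | ite e p q => e.cost + 1 + max p.cost q.cost
  | loop _ _ _ => 0

theorem time_le_cost : ∀ {p : Stmt} (_ : p.flat = true) (s : St), p.time s ≤ p.cost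
  | skip, _, _ => le_rfl
  | assign _ _, _, _ => le_rfl
  | put _ _ _, _, _ => le_rfl
  | seq p q, h, s => by
    simp only [flat, Bool.and_eq_true] at h
    exact Nat.add_le_add (time_le_cost h.1 s) (time_le_cost h.2 _)
  | ite e p q, h, s => by
    simp only [flat, Bool.and_eq_true] at h
    have h1 := time_le_cost h.1 s
    have h2 := time_le_cost h.2 s
    simp only [time, cost]
    split <;> omega

/-- `s'` agrees with `s` except for what `p` may write. -/
structure Same (p : Stmt) (s s' : St) : Prop where
  var : ∀ y, p.wr y = false → s'.var y = s.var y
  arr : ∀ a, p.wa a = false → s'.arr a = s.arr a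
  inp : s'.inp = s.inp

theorem Same.refl (p : Stmt) (s : St) : Same p s s := ⟨fun _ _ => rfl, fun _ _ => rfl, rfl⟩

theorem iter_same {p : Stmt} (hp : ∀ s, Same p s (p.run s)) (x : Reg) (e : Expr) (s : St) (k : ℕ) :
    Same (loop x e p) s (iter p.run x s k) := by
  induction k with
  | zero => exact .refl _ _
  | succ k ih =>
    have h := hp ((iter p.run x s k).setVar x k)
    refine ⟨fun y hy => ?_, fun a ha => ?_, ?_⟩
    · have hy' : y ≠ x ∧ p.wr y = false := by simpa [wr] using hy
      rw [iter, h.var y hy'.2, St.setVar_var_ne _ _ hy'.1, ih.var y hy]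
    · rw [iter, h.arr a ha, St.setVar_arr, ih.arr a ha]
    · rw [iter, h.inp, St.setVar_inp, ih.inp]

/-- The frame rule. As `wr` and `wa` are computed from the syntax, each later claim that a variable
or an array is untouched is closed by evaluation. -/
theorem run_same (p : Stmt) : ∀ s, Same p s (p.run s) := by
  induction p with
  | skip => exact fun s => .refl _ _
  | assign x e =>
    exact fun s => ⟨fun y hy => by simp only [wr, decide_eq_false_iff_not] at hy; simp [run, hy],
      fun _ _ => rfl, rfl⟩
  | put a i e =>
    exact fun s => ⟨fun _ _ => rfl, fun y hy => by
      simp only [wa, decide_eq_false_iff_not] at hy; simp [run, hy], rfl⟩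
  | seq p q hp hq =>
    refine fun s => ⟨fun y hy => ?_, fun a ha => ?_, ?_⟩
    · simp only [wr, Bool.or_eq_false_iff] at hy
      rw [run, (hq _).var y hy.2, (hp _).var y hy.1]
    · simp only [wa, Bool.or_eq_false_iff] at ha
      rw [run, (hq _).arr a ha.2, (hp _).arr a ha.1]
    · rw [run, (hq _).inp, (hp _).inp]
  | ite e p q hp hq =>
    refine fun s => ⟨fun y hy => ?_, fun a ha => ?_, ?_⟩
    · simp only [wr, Bool.or_eq_false_iff] at hy
      rw [run]; split
      exacts [(hp _).var y hy.1, (hq _).var y hy.2]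
    · simp only [wa, Bool.or_eq_false_iff] at ha
      rw [run]; split
      exacts [(hp _).arr a ha.1, (hq _).arr a ha.2]
    · rw [run]; split
      exacts [(hp _).inp, (hq _).inp]
  | loop x e p hp => exact fun s => iter_same hp x e s _

end Stmt

/-! ### Hoare triples with time bounds -/

open Stmt

/-- Started in `s`, the program `p` stays within the limits `c`, takes at most `T` steps and ends
in a state with the property `Q`. -/
def Triple (c : Lim) (p : Stmt) (s : St) (T : ℕ) (Q : St → Prop) : Prop :=
  p.safe c s ∧ p.time s ≤ T ∧ Q (p.run s)

namespace Triple

variable {c : Lim} {p q : Stmt} {s : St} {T T₁ T₂ : ℕ} {Q Q₁ Q₂ : St → Prop}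

theorem mono (h : Triple c p s T₁ Q₁) (hT : T₁ ≤ T₂) (hQ : ∀ s', Same p s s' → Q₁ s' → Q₂ s') :
    Triple c p s T₂ Q₂ :=
  ⟨h.1, h.2.1.trans hT, hQ _ (run_same p s) h.2.2⟩

/-- The second part receives `Same p s s'` for free, so postconditions only need to mention what
changes. -/
theorem seq (h : Triple c p s T₁ Q₁)
    (h' : ∀ s', Same p s s' → Q₁ s' → Triple c q s' T₂ Q₂) : Triple c (p ;; q) s (T₁ + T₂) Q₂ :=
  have h2 := h' _ (run_same p s) h.2.2
  ⟨⟨h.1, h2.1⟩, Nat.add_le_add h.2.1 h2.2.1, h2.2.2⟩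

theorem seq_le (h : Triple c p s T₁ Q₁)
    (h' : ∀ s', Same p s s' → Q₁ s' → Triple c q s' T₂ Q₂) (hT : T₁ + T₂ ≤ T) :
    Triple c (p ;; q) s T Q₂ :=
  (h.seq h').mono hT fun _ _ => id

theorem flat (hp : p.flat = true) (hc : p.cost ≤ T) (hs : p.safe c s) (hQ : Q (p.run s)) :
    Triple c p s T Q :=
  ⟨hs, (time_le_cost hp s).trans hc, hQ⟩

theorem assign_seq {x : Reg} {e : Expr} (he : e.safe c s)
    (h : Triple c q (s.setVar x (e.eval s)) T Q) (hT : e.cost + 1 + T ≤ T₁) :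
    Triple c (x ::= e ;; q) s T₁ Q :=
  ⟨⟨he, h.1⟩, (Nat.add_le_add_left h.2.1 _).trans hT, h.2.2⟩

theorem put_seq {a : Arr} {i e : Expr} (hi : i.safe c s) (he : e.safe c s) (hD : i.eval s < c.D)
    (h : Triple c q (s.setArr a (i.eval s) (e.eval s)) T Q) (hT : i.cost + e.cost + 6 + T ≤ T₁) :
    Triple c (.put a i e ;; q) s T₁ Q :=
  ⟨⟨⟨hi, he, hD⟩, h.1⟩, (Nat.add_le_add_left h.2.1 _).trans hT, h.2.2⟩

theorem ite {e : Expr} (he : e.safe c s) (h1 : e.eval s ≠ 0 → Triple c p s T Q)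
    (h2 : e.eval s = 0 → Triple c q s T Q) : Triple c (.ite e p q) s (e.cost + 1 + T) Q := by
  by_cases h : e.eval s = 0
  · obtain ⟨a, b, d⟩ := h2 h
    exact ⟨⟨he, by simpa [h] using a⟩, by simpa [time, h] using b, by simpa [run, h] using d⟩
  · obtain ⟨a, b, d⟩ := h1 h
    exact ⟨⟨he, by simpa [h] using a⟩, by simpa [time, h] using b, by simpa [run, h] using d⟩

/-- `I k` is the invariant before round `k`, and the `5` is the overhead of a round. The time `t k`
may vary with the round, which the loop over the classes needs: the cost of a class depends on its
size. -/
theorem loop_sum {x : Reg} {e : Expr} (I : ℕ → St → Prop) (n : ℕ) (t : ℕ → ℕ) (he : e.safe c s)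
    (hn : e.eval s = n) (h0 : I 0 s)
    (step : ∀ k < n, ∀ s', Same (.loop x e p) s s' → I k s' →
      Triple c p (s'.setVar x k) (t k) (I (k + 1))) :
    Triple c (.loop x e p) s (e.cost + 3 + ∑ k ∈ Finset.range n, (t k + 5)) (I n) := by
  have hI : ∀ k ≤ n, I k (iter p.run x s k) := by
    intro k hk
    induction k with
    | zero => exact h0
    | succ k ih => exact (step k hk _ (iter_same (run_same p) x e s k) (ih (by omega))).2.2
  have hT := fun k (hk : k < n) => step k hk _ (iter_same (run_same p) x e s k) (hI k hk.le)
  subst hn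
  refine ⟨⟨he, fun k hk => (hT k hk).1⟩, ?_, hI _ le_rfl⟩
  refine Nat.add_le_add_left (Finset.sum_le_sum fun k hk => ?_) _
  exact Nat.add_le_add_right (hT k (Finset.mem_range.1 hk)).2.1 _

theorem loop {x : Reg} {e : Expr} (I : ℕ → St → Prop) (n t : ℕ) (he : e.safe c s)
    (hn : e.eval s = n) (h0 : I 0 s)
    (step : ∀ k < n, ∀ s', Same (.loop x e p) s s' → I k s' →
      Triple c p (s'.setVar x k) t (I (k + 1))) :
    Triple c (.loop x e p) s (e.cost + 3 + n * (t + 5)) (I n) :=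
  (loop_sum I n (fun _ => t) he hn h0 step).mono (by simp) fun _ _ => id

/-- A loop that fills an array with values that do not depend on this array. -/
theorem loop_put {x : Reg} {e ie ve : Expr} {a : Arr} (n : ℕ) (idx val : ℕ → ℕ) (he : e.safe c s)
    (hn : e.eval s = n)
    (hb : ∀ k < n, ∀ u : ℕ → ℕ,
      (ie.eval ⟨Function.update s.var x k, Function.update s.arr a u, s.inp⟩ = idx k ∧
        ve.eval ⟨Function.update s.var x k, Function.update s.arr a u, s.inp⟩ = val k) ∧
      ie.safe c ⟨Function.update s.var x k, Function.update s.arr a u, s.inp⟩ ∧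
      ve.safe c ⟨Function.update s.var x k, Function.update s.arr a u, s.inp⟩)
    (hD : ∀ k < n, idx k < c.D) (inj : ∀ k < n, ∀ j < k, idx j ≠ idx k) :
    Triple c (.loop x e (.put a ie ve)) s (e.cost + 3 + n * (ie.cost + ve.cost + 6 + 5))
      (fun s' => (∀ k < n, s'.arr a (idx k) = val k) ∧
        ∀ i, (∀ k < n, i ≠ idx k) → s'.arr a i = s.arr a i) := by
  refine loop (fun k s' => (∀ j < k, s'.arr a (idx j) = val j) ∧
        ∀ i, (∀ j < k, i ≠ idx j) → s'.arr a i = s.arr a i) n _ he hn (by simp) ?_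
  intro k hk s' hs hI
  -- The loop writes only to `x` and `a`, so the contents of `a` are all that is unknown about the
  -- state. This is why `hb` quantifies over them.
  have e1 : s'.setVar x k =
      ⟨Function.update s.var x k, Function.update s.arr a (s'.arr a), s.inp⟩ := by
    ext y i
    · by_cases h : y = x
      · subst h; simp
      · simp [h, hs.var y (by simp [wr, h])]
    · by_cases h : y = a
      · subst h; simp
      · simp [h, hs.arr y (by simp [wa, h])]
    · simp [hs.inp]
  obtain ⟨⟨h1, h2⟩, h3, h4⟩ := hb k hk (s'.arr a)
  rw [← e1] at h1 h2 h3 h4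
  refine flat rfl le_rfl ⟨h3, h4, by rw [h1]; exact hD k hk⟩ ?_
  simp only [run, h1, h2, St.setArr_arr, St.setVar_arr]
  refine ⟨fun j hj => ?_, fun i hi => ?_⟩
  · rcases Nat.lt_succ_iff_lt_or_eq.1 hj with hj | rfl
    · rw [if_neg (fun h => inj k hk j hj h.2), hI.1 j hj]
    · simp
  · rw [if_neg (fun h => hi k (by omega) h.2), hI.2 i fun j hj => hi j (by omega)]

end Triple

open RangeMin.Expr

/-! ### Enumerations of finite sets in arrays -/

/-- The numbers `u 0, …, u (N - 1)` are the elements of `E`, increasing with respect to `r`. -/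
structure Enum (u : ℕ → ℕ) (N : ℕ) (E : Finset ℕ) (r : ℕ → ℕ → Prop) : Prop where
  card : E.card = N
  mem : ∀ i < N, u i ∈ E
  sorted : ∀ i j, i < j → j < N → r (u i) (u j)

/-- The order by the key `κ`, ties being resolved by `r`. -/
def KeyLex (κ : ℕ → ℕ) (r : ℕ → ℕ → Prop) (a b : ℕ) : Prop := κ a < κ b ∨ κ a = κ b ∧ r a b

namespace Enum

variable {u : ℕ → ℕ} {N : ℕ} {E : Finset ℕ} {r : ℕ → ℕ → Prop}

theorem congr (h : Enum u N E r) {u' : ℕ → ℕ} (hu : ∀ i < N, u' i = u i) : Enum u' N E r :=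
  ⟨h.card, fun i hi => by rw [hu i hi]; exact h.mem i hi,
    fun i j hij hj => by rw [hu i (hij.trans hj), hu j hj]; exact h.sorted i j hij hj⟩

theorem weaken (h : Enum u N E r) {r' : ℕ → ℕ → Prop} (hr : ∀ a ∈ E, ∀ b ∈ E, r a b → r' a b) :
    Enum u N E r' :=
  ⟨h.card, h.mem, fun i j hij hj => hr _ (h.mem i (hij.trans hj)) _ (h.mem j hj)
    (h.sorted i j hij hj)⟩

theorem inj (h : Enum u N E r) (hr : ∀ a, ¬ r a a) {i j : ℕ} (hi : i < N) (hj : j < N)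
    (e : u i = u j) : i = j := by
  rcases lt_trichotomy i j with hij | hij | hij
  · exact absurd (e ▸ h.sorted i j hij hj) (hr _)
  · exact hij
  · exact absurd (e ▸ h.sorted j i hij hi) (hr _)

/-- An injection into a finite set of the same size is onto; hence `Enum` can do with the
cardinality. -/
theorem surj (h : Enum u N E r) (hr : ∀ a, ¬ r a a) {a : ℕ} (ha : a ∈ E) : ∃ i < N, u i = a := by
  have := Finset.surj_on_of_inj_on_of_card_le (s := Finset.range N) (t := E) (fun i _ => u i)
    (fun i hi => h.mem i (Finset.mem_range.1 hi))
    (fun i j hi hj e => h.inj hr (Finset.mem_range.1 hi) (Finset.mem_range.1 hj) e)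
    (by rw [h.card, Finset.card_range]) a ha
  obtain ⟨i, hi, e⟩ := this
  exact ⟨i, Finset.mem_range.1 hi, e.symm⟩

/-- A downward closed property holds exactly for the first elements. -/
theorem lt_card_filter_iff (h : Enum u N E r) (hr : ∀ a, ¬ r a a) {P : ℕ → Prop}
    [DecidablePred P] (hP : ∀ a ∈ E, ∀ b ∈ E, r a b → P b → P a) {i : ℕ} (hi : i < N) :
    P (u i) ↔ i < (E.filter P).card := by
  have hE : E.filter P = ((Finset.range N).filter (fun i => P (u i))).image u := by
    ext a
    simp only [Finset.mem_filter, Finset.mem_image, Finset.mem_range]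
    constructor
    · rintro ⟨ha, hp⟩
      obtain ⟨i, hi, rfl⟩ := h.surj hr ha
      exact ⟨i, ⟨hi, hp⟩, rfl⟩
    · rintro ⟨i, ⟨hi, hp⟩, rfl⟩
      exact ⟨h.mem i hi, hp⟩
  have hcard : (E.filter P).card = ((Finset.range N).filter (fun i => P (u i))).card := by
    rw [hE, Finset.card_image_of_injOn]
    intro i hi j hj e
    exact h.inj hr (by simp at hi; exact hi.1) (by simp at hj; exact hj.1) e
  have down : ∀ j i, i < j → j < N → P (u j) → P (u i) := fun j i hij hj =>
    hP _ (h.mem i (hij.trans hj)) _ (h.mem j hj) (h.sorted i j hij hj)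
  rw [hcard]
  constructor
  · intro hp
    calc i < (Finset.range (i + 1)).card := by simp
      _ ≤ _ := Finset.card_le_card fun j hj => by
        simp only [Finset.mem_range, Finset.mem_filter] at hj ⊢
        refine ⟨by omega, ?_⟩
        rcases Nat.lt_succ_iff_lt_or_eq.1 hj with hj | rfl
        · exact down i j hj hi hp
        · exact hp
  · intro hlt
    by_contra hp
    refine absurd hlt (not_lt.2 ?_)
    calc _ ≤ (Finset.range i).card := Finset.card_le_card fun j hj => by
          simp only [Finset.mem_range, Finset.mem_filter] at hj ⊢
          by_contra hij
          rcases (not_lt.1 hij).lt_or_eq with hij | rfl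
          · exact hp (down j i hij hj.1 hj.2)
          · exact hp hj.2
      _ = i := by simp

end Enum

theorem KeyLex.irrefl {κ : ℕ → ℕ} {r : ℕ → ℕ → Prop} (hr : ∀ a, ¬ r a a) (a : ℕ) :
    ¬ KeyLex κ r a a := by
  simp [KeyLex, hr]

/-- If the elements of `E` have the numbers `0, …, N - 1` and are sorted by the quotient of this
number by `S`, then every position has the right quotient. -/
theorem Enum.div_eq {u : ℕ → ℕ} {N S : ℕ} {E : Finset ℕ} {r : ℕ → ℕ → Prop} {φ κ : ℕ → ℕ}
    (h : Enum u N E (KeyLex κ r)) (hκ : ∀ a ∈ E, κ a = φ a / S) (hr : ∀ a, ¬ r a a) (hS : 0 < S)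
    (hφ : ∀ a ∈ E, φ a < N) (hinj : ∀ a ∈ E, ∀ b ∈ E, φ a = φ b → a = b) {i : ℕ} (hi : i < N) :
    φ (u i) / S = i / S := by
  have himage : E.image φ = Finset.range N := by
    apply Finset.eq_of_subset_of_card_le
    · intro x hx
      obtain ⟨a, ha, rfl⟩ := Finset.mem_image.1 hx
      exact Finset.mem_range.2 (hφ a ha)
    · rw [Finset.card_range, Finset.card_image_of_injOn (fun a ha b hb => hinj a ha b hb), h.card]
  -- Two natural numbers agree if they lie below the same bounds `j`. The elements with quotient
  -- less than `j` come first in the enumeration, and there are `min (j * S) N` of them because `φ`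
  -- takes each value below `N` exactly once.
  have key : ∀ j, φ (u i) / S < j ↔ i / S < j := by
    intro j
    have h1 := h.lt_card_filter_iff (KeyLex.irrefl hr) (P := fun a => φ a / S < j) (by
      intro a ha b hb hab hb'
      rw [← hκ a ha]
      rw [← hκ b hb] at hb'
      rcases hab with hab | hab <;> omega) hi
    rw [h1]
    have h2 : ((E.filter fun a => φ a / S < j)).card = min (j * S) N := by
      have : ((E.filter fun a => φ a / S < j).image φ) = Finset.range (min (j * S) N) := by
        ext x
        simp only [Finset.mem_image, Finset.mem_filter, Finset.mem_range, lt_min_iff]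
        constructor
        · rintro ⟨a, ⟨ha, hlt⟩, rfl⟩
          exact ⟨(Nat.div_lt_iff_lt_mul hS).1 hlt, hφ a ha⟩
        · rintro ⟨hx, hxN⟩
          obtain ⟨a, ha, rfl⟩ := Finset.mem_image.1 (himage ▸ Finset.mem_range.2 hxN)
          exact ⟨a, ⟨ha, (Nat.div_lt_iff_lt_mul hS).2 hx⟩, rfl⟩
      rw [← Finset.card_image_of_injOn (f := φ), this, Finset.card_range]
      intro a ha b hb
      simp at ha hb
      exact hinj a ha.1 b hb.1
    rw [h2, Nat.div_lt_iff_lt_mul hS]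
    omega
  have a := (key (φ (u i) / S + 1)).1 (by omega)
  have b := (key (i / S + 1)).2 (by omega)
  omega

/-! ### Counting sort -/

/-- `CNT[j]` becomes the number of elements of the list `src` with a key less than `j`. -/
def countStarts (src key : Arr) : Stmt :=
  .loop .t (var .J + 1) (.put .CNT (var .t) 0) ;;
  .loop .t (var .N) (.put .CNT (get key (get src (var .t)) + 1)
    (get .CNT (get key (get src (var .t)) + 1) + 1)) ;;
  .loop .t (var .J) (.put .CNT (var .t + 1) (get .CNT (var .t + 1) + get .CNT (var .t)))

/-- Sort the list `src` stably by the keys. -/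
def csort (src key dst : Arr) : Stmt :=
  countStarts src key ;;
  .loop .t (var .N) (
    .put dst (get .CNT (get key (get src (var .t)))) (get src (var .t)) ;;
    .put .CNT (get key (get src (var .t))) (get .CNT (get key (get src (var .t))) + 1))

theorem count_lt_succ (f : ℕ → ℕ) (j N : ℕ) :
    Nat.count (fun t => f t < j + 1) N =
      Nat.count (fun t => f t < j) N + Nat.count (fun t => f t = j) N := by
  induction N with
  | zero => simp
  | succ N ih =>
    simp only [Nat.count_succ, ih]
    split_ifs <;> omega

theorem count_lt_mono (f : ℕ → ℕ) {j j' : ℕ} (h : j ≤ j') (N : ℕ) :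
    Nat.count (fun t => f t < j) N ≤ Nat.count (fun t => f t < j') N :=
  Nat.count_mono_left (fun _ h' => by omega)

/-- The position of the `t`-th element in the stably sorted list. -/
def csortPos (f : ℕ → ℕ) (N t : ℕ) : ℕ :=
  Nat.count (fun t' => f t' < f t) N + Nat.count (fun t' => f t' = f t) t

theorem csortPos_lt_count (f : ℕ → ℕ) {N t : ℕ} (h : t < N) :
    csortPos f N t < Nat.count (fun t' => f t' < f t + 1) N := by
  rw [count_lt_succ, csortPos]
  exact Nat.add_lt_add_left (Nat.count_strict_mono (p := fun t' => f t' = f t) rfl h) _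

theorem csortPos_lt (f : ℕ → ℕ) {N t : ℕ} (h : t < N) : csortPos f N t < N :=
  (csortPos_lt_count f h).trans_le (Nat.count_le _)

theorem csortPos_strictMono (f : ℕ → ℕ) {N t t' : ℕ} (h : t < N)
    (hl : f t < f t' ∨ f t = f t' ∧ t < t') : csortPos f N t < csortPos f N t' := by
  rcases hl with hl | ⟨hl, hlt⟩
  · exact (csortPos_lt_count f h).trans_le ((count_lt_mono f hl N).trans (Nat.le_add_right _ _))
  · simp only [csortPos, hl]
    exact Nat.add_lt_add_left (Nat.count_strict_mono (p := fun s => f s = f t') hl hlt) _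

theorem csortPos_ne (f : ℕ → ℕ) {N t t' : ℕ} (h : t < N) (h' : t' < N) (hn : t ≠ t') :
    csortPos f N t ≠ csortPos f N t' := by
  rcases lt_trichotomy (f t) (f t') with hl | hl | hl
  · exact (csortPos_strictMono f h (.inl hl)).ne
  · rcases lt_or_gt_of_ne hn with hlt | hlt
    · exact (csortPos_strictMono f h (.inr ⟨hl, hlt⟩)).ne
    · exact (csortPos_strictMono f h' (.inr ⟨hl.symm, hlt⟩)).ne'
  · exact (csortPos_strictMono f h' (.inl hl)).ne'

/-- The target positions are distinct and less than `N`, hence every position is hit. They increase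
with the key and, for equal keys, with the place in the old list; so the result is sorted by key,
and the old order survives as the tie-break. -/
theorem Enum.of_csortPos {u u' κ : ℕ → ℕ} {N : ℕ} {E : Finset ℕ} {r : ℕ → ℕ → Prop}
    (h : Enum u N E r)
    (hu : ∀ t < N, u' (csortPos (fun t => κ (u t)) N t) = u t) : Enum u' N E (KeyLex κ r) := by
  set f := fun t => κ (u t) with hf
  have hsurj : ∀ i < N, ∃ t < N, csortPos f N t = i := by
    intro i hi
    obtain ⟨t, ht, e⟩ := Finset.surj_on_of_inj_on_of_card_le (s := Finset.range N)
      (t := Finset.range N) (fun t _ => csortPos f N t)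
      (fun t ht => Finset.mem_range.2 (csortPos_lt f (Finset.mem_range.1 ht)))
      (fun t t' ht ht' e => by
        by_contra hn
        exact csortPos_ne f (Finset.mem_range.1 ht) (Finset.mem_range.1 ht') hn e) le_rfl i
        (Finset.mem_range.2 hi)
    exact ⟨t, Finset.mem_range.1 ht, e.symm⟩
  refine ⟨h.card, fun i hi => ?_, fun i j hij hj => ?_⟩
  · obtain ⟨t, ht, rfl⟩ := hsurj i hi
    rw [hu t ht]; exact h.mem t ht
  · obtain ⟨t, ht, rfl⟩ := hsurj i (hij.trans hj)
    obtain ⟨t', ht', rfl⟩ := hsurj j hj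
    rw [hu t ht, hu t' ht']
    rcases lt_trichotomy (f t) (f t') with hl | hl | hl
    · exact .inl hl
    · refine .inr ⟨hl, ?_⟩
      rcases lt_trichotomy t t' with hlt | rfl | hlt
      · exact h.sorted t t' hlt ht'
      · exact absurd hij (lt_irrefl _)
      · exact absurd (csortPos_strictMono f ht' (.inr ⟨hl.symm, hlt⟩)) (by omega)
    · exact absurd (csortPos_strictMono f ht' (.inl hl)) (by omega)

/-- Occurrences of the key `j` are counted in cell `j + 1`, so summing up in place leaves in cell
`j` the number of smaller keys. -/
theorem countStarts_spec {c : Lim} (hc : 64 * c.D < c.W) {src key : Arr} {s : St}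
    {N J : ℕ} (h1 : src ≠ .CNT) (h2 : key ≠ .CNT) (hN : s.var .N = N) (hJ : s.var .J = J)
    (hND : N < c.D) (hJD : J < c.D) (hu : ∀ t < N, s.arr src t < c.D)
    (hk : ∀ t < N, s.arr key (s.arr src t) < J) :
    Triple c (countStarts src key) s (100 * (N + J + 1)) fun s' =>
      ∀ j ≤ J, s'.arr .CNT j = Nat.count (fun t => s.arr key (s.arr src t) < j) N := by
  set f := fun t => s.arr key (s.arr src t) with hf
  refine Triple.seq_le (T₁ := 50 * (J + 1)) (T₂ := 60 * N + 50 * J + 50) (Q₁ := fun s' => ∀ j ≤ J, s'.arr .CNT j = 0)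
    ((Triple.loop_put (J + 1) id (fun _ => 0) ?_ (by simp [hJ]) ?_ ?_ ?_).mono ?_ ?_) ?_ (by omega)
  · simp [hJ]; omega
  · simp; omega
  · simp; omega
  · simp; omega
  · simp
    omega
  · intro s' _ h j hj
    exact h.1 j (by omega)
  intro s1 hs1 hz
  have e1 : s1.var .N = N := by simp [hs1.var, wr, hN]
  have e2 : s1.var .J = J := by simp [hs1.var, wr, hJ]
  have e3 : s1.arr src = s.arr src := by simp [hs1.arr, wa, h1]
  have e4 : s1.arr key = s.arr key := by simp [hs1.arr, wa, h2]
  refine Triple.seq_le (T₁ := 60 * N + 10) (T₂ := 50 * J + 10)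
    ((Triple.loop (fun k s' => s'.arr .CNT 0 = 0 ∧
      ∀ j < J, s'.arr .CNT (j + 1) = Nat.count (fun t => f t = j) k) N 50 ?_ ?_ ?_ ?_).mono ?_
      (fun _ _ => id)) ?_ (by omega)
  · simp
  · simp [e1]
  · simp [hz]; exact fun j hj => hz _ (by omega)
  · intro k hk' s' hs ⟨i0, i1⟩
    have a3 : s'.arr src = s.arr src := by simp [hs.arr, wa, h1, e3]
    have a4 : s'.arr key = s.arr key := by simp [hs.arr, wa, h2, e4]
    have b1 := hk k hk'
    have b2 := hu k hk'
    have b3 := i1 _ b1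
    have b4 : Nat.count (fun t => f t = f k) k ≤ k := Nat.count_le _
    have b5 : f k = s.arr key (s.arr src k) := rfl
    rw [← b5] at b1 b3
    refine Triple.flat rfl (by simp [Stmt.cost]) ?_ ?_
    · simp [Stmt.safe, a3, a4, ← b5, b3]
      omega
    · simp [run, a3, a4, i0, Function.update_apply, ← b5]
      intro j hj
      rw [Nat.count_succ, i1 j hj, i1 _ b1]
      split_ifs with h h' h'
      · rw [h]
      · exact absurd h.symm h'
      · exact absurd h'.symm h
      · rfl
  · simp
    omega
  intro s2 hs2 ⟨i0, i1⟩
  have e2 : s2.var .J = J := by simp [hs2.var, wr, e2]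
  -- Up to index `k` the cells hold prefix sums; above it they still hold the plain counts.
  refine (Triple.loop (fun k s' => (∀ j ≤ k, s'.arr .CNT j = Nat.count (fun t => f t < j) N) ∧
      ∀ j < J, k ≤ j → s'.arr .CNT (j + 1) = Nat.count (fun t => f t = j) N) J 40 ?_ ?_ ?_ ?_).mono ?_
      (fun _ _ h => h.1)
  · simp
  · simp [e2]
  · simp [i0]; exact i1
  · intro k hk' s' hs ⟨j0, j1⟩
    have b1 := j0 k le_rfl
    have b2 := j1 k hk' le_rfl
    have b3 := count_lt_succ f k N
    have b4 : Nat.count (fun t => f t < k + 1) N ≤ N := Nat.count_le _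
    refine Triple.flat rfl (by simp [Stmt.cost]) ?_ ?_
    · simp [Stmt.safe, b1, b2]
      omega
    · simp [run, Function.update_apply, b1, b2]
      refine ⟨fun j hj => ?_, fun j hj hkj => ?_⟩
      · split_ifs with h
        · rw [h, b3, add_comm]
        · exact j0 j (by omega)
      · rw [if_neg (by omega), j1 j hj (by omega)]
  · simp
    omega

/-- After `k` elements, cell `j` of `CNT` is the start of the block of key `j` plus the number of
its elements already placed. For the key of the next element this is by definition `csortPos`. -/
theorem csort_spec {c : Lim} (hc : 64 * c.D < c.W) {src key dst : Arr} {s : St}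
    {N J : ℕ} (h1 : src ≠ .CNT) (h2 : key ≠ .CNT) (h3 : dst ≠ .CNT) (h4 : src ≠ dst)
    (h5 : key ≠ dst) (hN : s.var .N = N) (hJ : s.var .J = J)
    (hND : N < c.D) (hJD : J < c.D) (hu : ∀ t < N, s.arr src t < c.D)
    (hk : ∀ t < N, s.arr key (s.arr src t) < J) {E : Finset ℕ} {r : ℕ → ℕ → Prop}
    (hE : Enum (s.arr src) N E r) :
    Triple c (csort src key dst) s (200 * (N + J + 1)) fun s' =>
      Enum (s'.arr dst) N E (KeyLex (s.arr key) r) := by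
  set f := fun t => s.arr key (s.arr src t) with hf
  refine Triple.seq_le (T₂ := 100 * N + 100) (countStarts_spec hc h1 h2 hN hJ hND hJD hu hk) ?_
    (by omega)
  intro s1 hs1 hz
  have e1 : s1.var .N = N := by simp [hs1.var, countStarts, wr, hN]
  have e3 : s1.arr src = s.arr src := by simp [hs1.arr, countStarts, wa, h1]
  have e4 : s1.arr key = s.arr key := by simp [hs1.arr, countStarts, wa, h2]
  refine (Triple.loop (fun k s' =>
      (∀ j < J, s'.arr .CNT j = Nat.count (fun t => f t < j) N + Nat.count (fun t => f t = j) k) ∧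
      ∀ t < k, s'.arr dst (csortPos f N t) = s.arr src t) N 80 ?_ ?_ ?_ ?_).mono ?_
      (fun _ _ h => hE.of_csortPos h.2)
  · simp
  · simp [e1]
  · simp; exact fun j hj => hz j hj.le
  · intro k hk' s' hs ⟨i0, i1⟩
    have a3 : s'.arr src = s.arr src := by simp [hs.arr, wa, h1, h4, e3]
    have a4 : s'.arr key = s.arr key := by simp [hs.arr, wa, h2, h5, e4]
    have b5 : f k = s.arr key (s.arr src k) := rfl
    have b1 := hk k hk'
    have b2 := hu k hk'
    rw [← b5] at b1
    have b3 : s'.arr .CNT (f k) = csortPos f N k := i0 _ b1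
    have b4 := csortPos_lt f hk'
    refine Triple.flat rfl (by simp [Stmt.cost]) ?_ ?_
    · simp [Stmt.safe, run, a3, a4, ← b5, b3, h1, h2, h3, h4, h5, h3.symm, Function.update_apply]
      omega
    · simp [run, a3, a4, ← b5, b3, h1, h2, h3, h4, h5, h3.symm, Function.update_apply]
      refine ⟨fun j hj => ?_, fun t ht => ?_⟩
      · split_ifs with h
        · rw [h, Nat.count_succ, if_pos rfl, ← add_assoc]; rfl
        · rw [Nat.count_succ, if_neg (Ne.symm h), i0 j hj, add_zero]
      · split_ifs with h
        · by_contra hne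
          have : t ≠ k := fun e => hne (by rw [e])
          exact csortPos_ne f (by omega) hk' this h
        · refine i1 t (lt_of_le_of_ne ht fun e => h (by rw [e]))
  · simp
    omega

/-! ### Filtering a list -/

/-- Keep those elements `a` of the list `A` in place for which `B0[a]` is at least `th`. -/
def filterList (A : Arr) : Stmt :=
  .cnt ::= 0 ;;
  .loop .t (var .N) (.ite (le (var .th) (get .B0 (get A (var .t))))
    (.put A (var .cnt) (get A (var .t)) ;; .cnt ::= var .cnt + 1) .skip)

theorem exists_count_eq (p : ℕ → Prop) [DecidablePred p] {i N : ℕ} (h : i < Nat.count p N) :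
    ∃ t < N, p t ∧ Nat.count p t = i := by
  induction N with
  | zero => simp at h
  | succ N ih =>
    rw [Nat.count_succ] at h
    by_cases hi : i < Nat.count p N
    · obtain ⟨t, ht, h'⟩ := ih hi
      exact ⟨t, by omega, h'⟩
    · split_ifs at h with hp
      · exact ⟨N, by omega, hp, by omega⟩
      · omega

theorem Enum.card_filter {u : ℕ → ℕ} {N : ℕ} {E : Finset ℕ} {r : ℕ → ℕ → Prop}
    (h : Enum u N E r) (hr : ∀ a, ¬ r a a) (P : ℕ → Prop) [DecidablePred P] :
    (E.filter P).card = Nat.count (fun t => P (u t)) N := by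
  have hE : E.filter P = ((Finset.range N).filter (fun i => P (u i))).image u := by
    ext a
    simp only [Finset.mem_filter, Finset.mem_image, Finset.mem_range]
    constructor
    · rintro ⟨ha, hp⟩
      obtain ⟨i, hi, rfl⟩ := h.surj hr ha
      exact ⟨i, ⟨hi, hp⟩, rfl⟩
    · rintro ⟨i, ⟨hi, hp⟩, rfl⟩
      exact ⟨h.mem i hi, hp⟩
  rw [hE, Finset.card_image_of_injOn, Nat.count_eq_card_filter_range]
  intro i hi j hj e
  exact h.inj hr (by simp at hi; exact hi.1) (by simp at hj; exact hj.1) e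

theorem filterList_spec {c : Lim} (hc : 64 * c.D < c.W) {A : Arr} {s : St} {N θ : ℕ}
    (hA : A ≠ .B0) (hN : s.var .N = N) (hθ : s.var .th = θ) (hND : N < c.D)
    (hu : ∀ t < N, s.arr A t < c.D) {E : Finset ℕ} {r : ℕ → ℕ → Prop}
    (hE : Enum (s.arr A) N E r) (hr : ∀ a, ¬ r a a) :
    Triple c (filterList A) s (100 * (N + 1)) fun s' =>
      s'.var .cnt = (E.filter fun a => θ ≤ s.arr .B0 a).card ∧
      Enum (s'.arr A) (E.filter fun a => θ ≤ s.arr .B0 a).card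
        (E.filter fun a => θ ≤ s.arr .B0 a) r := by
  set P : ℕ → Prop := fun t => θ ≤ s.arr .B0 (s.arr A t) with hP
  refine Triple.assign_seq (T := 50 * N + 50) (by simp; omega) ?_ (by simp; omega)
  set s1 := s.setVar .cnt (eval s 0) with hs1
  have h0 : s1.var .cnt = 0 := by simp [hs1]
  have e1 : s1.var .N = N := by simp [hs1, hN]
  have e2 : s1.var .th = θ := by simp [hs1, hθ]
  have e3 : s1.arr = s.arr := rfl
  have hcard := hE.card_filter hr (fun a => θ ≤ s.arr .B0 a)
  -- Filtering in place is sound because `cnt ≤ k`: the entries from `k` on have not been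
  -- overwritten when they are read.
  refine (Triple.loop (fun k s' => s'.var .cnt = Nat.count P k ∧
      (∀ t < k, P t → s'.arr A (Nat.count P t) = s.arr A t) ∧
      ∀ t, k ≤ t → s'.arr A t = s.arr A t) N 45 ?_ ?_ ?_ ?_).mono ?_ ?_
  · simp
  · simp [e1]
  · simp [h0, e3]
  · intro k hk s' hs ⟨i0, i1, i2⟩
    have a1 : s'.var .th = θ := by simp [hs.var, wr, e2]
    have a2 : s'.arr .B0 = s.arr .B0 := by simp [hs.arr, wa, hA.symm, e3]
    have a3 := i2 k le_rfl
    have a4 := hu k hk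
    have a5 : Nat.count P k ≤ k := Nat.count_le _
    have a6 : θ ≤ s.arr .B0 (s.arr A k) ↔ P k := Iff.rfl
    refine Triple.flat rfl (by simp [Stmt.cost]) ?_ ?_
    · simp [Stmt.safe, a1, a2, a3, i0]
      refine ⟨by omega, ?_⟩
      exact fun _ => ⟨by omega, by omega, by simp [run, i0]; omega⟩
    · by_cases hp : P k
      · simp [run, a1, a2, a3, i0, a6, hp, Nat.count_succ, Function.update_apply]
        refine ⟨fun t ht hpt => ?_, fun t ht => ?_⟩
        · split_ifs with h
          · by_contra hne
            have : t < k := lt_of_le_of_ne ht fun e => hne (by rw [e])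
            exact absurd h (Nat.count_strict_mono hpt this).ne
          · exact i1 t (lt_of_le_of_ne ht fun e => h (by rw [e])) hpt
        · rw [if_neg (by omega), i2 t (by omega)]
      · simp [run, a1, a2, a3, i0, a6, hp, Nat.count_succ]
        refine ⟨fun t ht hpt => ?_, fun t ht => i2 t (by omega)⟩
        exact i1 t (lt_of_le_of_ne ht fun e => hp (e ▸ hpt)) hpt
  · simp
    omega
  · rintro s' _ ⟨i0, i1, -⟩
    rw [hcard]
    refine ⟨i0, hcard, fun i hi => ?_, fun i j hij hj => ?_⟩
    · obtain ⟨t, ht, hp, rfl⟩ := exists_count_eq P hi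
      rw [i1 t ht hp]
      exact Finset.mem_filter.2 ⟨hE.mem t ht, hp⟩
    · obtain ⟨t, ht, hp, rfl⟩ := exists_count_eq P (hij.trans hj)
      obtain ⟨t', ht', hp', rfl⟩ := exists_count_eq P hj
      rw [i1 t ht hp, i1 t' ht' hp']
      refine hE.sorted t t' ?_ ht'
      by_contra hle
      exact absurd (Nat.count_monotone P (not_lt.1 hle)) (not_le.2 hij)

/-! ### Binary search -/

/-- The largest `p ≤ len` such that the test succeeds for `1, …, p`. -/
def bsearch (len test : Expr) : Stmt :=
  .len ::= len ;;
  .res ::= 0 ;;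
  .step ::= pow2 (var .H) ;;
  .loop .i (var .H + 1) (
    .p ::= var .res + var .step ;;
    .ite (le (var .p) (var .len)) (.ite test (.res ::= var .p) .skip) .skip ;;
    .step ::= var .step / 2)

/-- The step runs through `2 ^ H, …, 2, 1`. A result `0` means that already the first test fails.
The test is a program expression, tied to the predicate `ok` in every state that the search can
reach; so one lemma serves all searches. The factor `4` leaves room for `res + step` and for the
length, which is less than `2 ^ (H + 1)`. -/
theorem bsearch_spec {c : Lim} {len test : Expr} {s : St} {H L : ℕ} (ok : ℕ → Prop)
    (hH : s.var .H = H) (hc : 4 * 2 ^ H < c.W) (hcH : H + 1 < c.W) (hls : len.safe c s)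
    (hle : len.eval s = L) (hL : L < 2 ^ (H + 1))
    (ht : ∀ s', Same (bsearch len test) s s' → 1 ≤ s'.var .p → s'.var .p ≤ L →
      test.safe c s' ∧ (test.eval s' ≠ 0 ↔ ok (s'.var .p)))
    (down : ∀ p q, 1 ≤ p → p ≤ q → q ≤ L → ok q → ok p) :
    Triple c (bsearch len test) s (len.cost + 20 + (H + 1) * (test.cost + 30)) fun s' =>
      s'.var .res ≤ L ∧ ∀ p, 1 ≤ p → p ≤ L → (ok p ↔ p ≤ s'.var .res) := by
  have hpos : 0 < 2 ^ H := Nat.two_pow_pos H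
  have hL' : L < 2 * 2 ^ H := by rw [pow_succ] at hL; omega
  refine Triple.assign_seq hls (Triple.assign_seq (by simp; omega) (Triple.assign_seq
    (T := (H + 1) * (test.cost + 30) + 10) (by simp [hH]; omega) ?_ le_rfl) le_rfl)
    (by simp; omega)
  set s1 := ((s.setVar .len (len.eval s)).setVar .res _).setVar .step _ with hs1'
  have hs1 : Same (.len ::= len ;; .res ::= 0 ;; .step ::= pow2 (var .H)) s s1 := run_same _ s
  have a1 : s1.var .len = L := by simp [hs1', hle]
  have a2 : s1.var .res = 0 := by simp [hs1']
  have a3 : s1.var .step = 2 ^ H := by simp [hs1', hH]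
  have a4 : s1.var .H = H := by simp [hs1.var, wr, hH]
  -- All solutions lie below `res + 2 ^ (H + 1 - k)`; after `H + 1` rounds this is `res + 1`.
  refine (Triple.loop (fun k s' => s'.var .step = 2 ^ H / 2 ^ k ∧ s'.var .res ≤ L ∧
      (s'.var .res = 0 ∨ ok (s'.var .res)) ∧
      ∀ p, 1 ≤ p → p ≤ L → ok p → p < s'.var .res + 2 ^ (H + 1 - k)) (H + 1) (test.cost + 25)
      ?_ ?_ ?_ ?_).mono ?_ ?_
  · simp [a4]; omega
  · simp [a4]
  · simp [a2, a3]
    intro p _ hp _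
    omega
  · rintro k hk s' hs ⟨i0, i1, i2, i3⟩
    have b1 : s'.var .len = L := by simp [hs.var, wr, a1]
    have e1 : 2 ^ H / 2 ^ k = 2 ^ (H - k) := Nat.pow_div (by omega) (by norm_num)
    have e2 : 2 ^ (H + 1 - k) = 2 ^ (H - k) + 2 ^ (H - k) := by
      rw [show H + 1 - k = (H - k) + 1 by omega, pow_succ]; omega
    have e3 : 2 ^ (H - k) ≤ 2 ^ H := Nat.pow_le_pow_right (by norm_num) (by omega)
    have e4 : 0 < 2 ^ (H - k) := Nat.two_pow_pos _
    have e5 : 2 ^ H / 2 ^ (k + 1) = 2 ^ (H - k) / 2 := by rw [pow_succ, ← Nat.div_div_eq_div_mul, e1]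
    have e6 : H + 1 - (k + 1) = H - k := by omega
    rw [e1] at i0
    set s2 : St := (s'.setVar .i k).setVar .p (s'.var .res + 2 ^ (H - k)) with hs2
    have hsame : Same (bsearch len test) s s2 := by
      refine ⟨fun y hy => ?_, fun a ha => ?_, ?_⟩
      · have hy' : y ≠ .len ∧ y ≠ .res ∧ y ≠ .step ∧ y ≠ .i ∧ y ≠ .p := by
          simp [bsearch, wr] at hy; tauto
        obtain ⟨h1, h2, h3, h4, h5⟩ := hy'
        simp [hs2, hs.var, hs1.var, wr, h1, h2, h3, h4, h5]
      · simp [hs2, hs.arr, hs1.arr, wa]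
      · simp [hs2, hs.inp, hs1.inp]
    have hp2 : s2.var .p = s'.var .res + 2 ^ (H - k) := by simp [hs2]
    have hlen2 : s2.var .len = L := by simp [hs2, b1]
    have ht2 := ht s2 hsame (by omega)
    refine Triple.flat rfl ?_ ?_ ?_
    · simp [Stmt.cost]; omega
    · simp only [Stmt.safe, run, Expr.eval_add, Expr.eval_var, Expr.safe_add, Expr.safe_var,
        St.setVar_var, reduceCtorEq, if_false, i0, ← hs2]
      refine ⟨⟨trivial, trivial, by omega⟩, ⟨by simp; omega, ?_⟩, by simp; omega⟩
      simp only [Expr.eval_le, Expr.eval_var, hp2, hlen2]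
      by_cases h : s'.var .res + 2 ^ (H - k) ≤ L
      · simp only [h, if_true, ne_eq, one_ne_zero, not_false_eq_true]
        exact ⟨(ht2 (by omega)).1, by split <;> trivial⟩
      · simp only [h, if_false, ne_eq, not_true]
    · simp only [run, Expr.eval_add, Expr.eval_var, St.setVar_var, reduceCtorEq, if_false, i0,
        ← hs2, Expr.eval_le, hp2, hlen2, Expr.eval_div, Expr.eval_lit, e5, e6]
      have hst : s2.var .step = 2 ^ (H - k) := by simp [hs2, i0]
      have hr2 : s2.var .res = s'.var .res := by simp [hs2]
      by_cases h : s'.var .res + 2 ^ (H - k) ≤ L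
      · have ht3 := (ht2 (by omega)).2
        rw [hp2] at ht3
        by_cases h' : ok (s'.var .res + 2 ^ (H - k))
        · simp only [h, if_true, ne_eq, one_ne_zero, not_false_eq_true, ht3.2 h']
          simp [hst, h, h']
          intro p h1 h2 h3
          have := i3 p h1 h2 h3
          omega
        · have ht4 : eval s2 test = 0 := by by_contra h''; exact h' (ht3.1 h'')
          simp only [h, if_true, ne_eq, one_ne_zero, not_false_eq_true, ht4, not_true, if_false]
          simp only [St.setVar_var, hst, hr2, reduceCtorEq, if_true, if_false]
          refine ⟨trivial, i1, i2, fun p h1 h2 h3 => ?_⟩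
          by_contra hlt
          exact h' (down _ p (by omega) (by omega) h2 h3)
      · simp only [h, if_false, ne_eq, not_true]
        simp only [St.setVar_var, hst, hr2, reduceCtorEq, if_true, if_false]
        exact ⟨trivial, i1, i2, fun p h1 h2 h3 => by have := i3 p h1 h2 h3; omega⟩
  · simp
    nlinarith
  · rintro s' _ ⟨-, i1, i2, i3⟩
    refine ⟨i1, fun p h1 h2 => ⟨fun h => ?_, fun h => ?_⟩⟩
    · have := i3 p h1 h2 h
      simp at this; omega
    · rcases i2 with h0 | h0
      · omega
      · exact down p _ h1 h i1 h0

/-! ### Minima of keys -/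

/-- `z` is the minimum of `n` and of the keys of the elements with the property `P`. -/
structure MinOver (n : ℕ) (κ : ℕ → ℕ) (P : ℕ → Prop) (z : ℕ) : Prop where
  le : z ≤ n
  le_key : ∀ a, P a → z ≤ κ a
  attained : z < n → ∃ a, P a ∧ κ a = z

namespace MinOver

variable {n : ℕ} {κ : ℕ → ℕ} {P Q R : ℕ → Prop} {y z : ℕ}

theorem congr (h : MinOver n κ P z) (hP : ∀ a, P a ↔ Q a) : MinOver n κ Q z :=
  ⟨h.le, fun a ha => h.le_key a ((hP a).2 ha), fun hz => by simpa only [hP] using h.attained hz⟩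

theorem empty (hP : ∀ a, ¬ P a) : MinOver n κ P n :=
  ⟨le_rfl, fun a ha => absurd ha (hP a), fun h => absurd h (lt_irrefl n)⟩

theorem singleton {a : ℕ} (ha : κ a ≤ n) (hP : ∀ b, P b ↔ b = a) : MinOver n κ P (κ a) :=
  ⟨ha, fun b hb => by rw [(hP b).1 hb], fun _ => ⟨a, (hP a).2 rfl, rfl⟩⟩

theorem union (hy : MinOver n κ P y) (hz : MinOver n κ Q z) (hR : ∀ a, R a ↔ P a ∨ Q a) :
    MinOver n κ R (min y z) := by
  refine ⟨(min_le_left _ _).trans hy.le, fun a ha => ?_, fun h => ?_⟩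
  · rcases (hR a).1 ha with ha | ha
    · exact (min_le_left _ _).trans (hy.le_key a ha)
    · exact (min_le_right _ _).trans (hz.le_key a ha)
  · rcases min_choice y z with e | e
    · obtain ⟨a, ha, h'⟩ := hy.attained (e ▸ h)
      exact ⟨a, (hR a).2 (.inl ha), by rw [h', e]⟩
    · obtain ⟨a, ha, h'⟩ := hz.attained (e ▸ h)
      exact ⟨a, (hR a).2 (.inr ha), by rw [h', e]⟩

end MinOver

theorem same_group_of_mod_eq_zero {G t t' : ℕ} (h : t % G = 0) :
    t' ≤ t ∧ t' / G = t / G ↔ t' = t := by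
  constructor
  · rintro ⟨h1, h2⟩
    have e1 := Nat.div_add_mod t G
    have e2 := Nat.div_add_mod t' G
    rw [h2] at e2
    omega
  · rintro rfl; simp

theorem pred_div_eq {G t : ℕ} (hG : 0 < G) (h : t % G ≠ 0) : (t - 1) / G = t / G := by
  have e1 := Nat.div_add_mod t G
  have e2 := Nat.mod_lt t hG
  rw [Nat.div_eq_iff hG]
  constructor
  · rw [mul_comm]; omega
  · rw [mul_comm]; omega

/-- The recursion for prefixes of groups: unless `t` is the first of its group, its prefix is that
of `t - 1` together with `t`. Masks and table rows are both filled along it. -/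
theorem same_group_of_mod_ne_zero {G t t' : ℕ} (hG : 0 < G) (h : t % G ≠ 0) :
    t' ≤ t ∧ t' / G = t / G ↔ t' = t ∨ (t' ≤ t - 1 ∧ t' / G = (t - 1) / G) := by
  have ht : t ≠ 0 := by rintro rfl; simp at h
  rw [pred_div_eq hG h]
  constructor
  · rintro ⟨h1, h2⟩
    rcases h1.lt_or_eq with h1 | h1
    · exact .inr ⟨by omega, h2⟩
    · exact .inl h1
  · rintro (rfl | ⟨h1, h2⟩)
    · simp
    · exact ⟨by omega, h2⟩

theorem index_ne {C r r' x x' : ℕ} (hx : x < C) (hx' : x' < C) (h : r * C + x = r' * C + x') :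
    r = r' ∧ x = x' := by
  have hC : 0 < C := by omega
  have e1 : (r * C + x) / C = r := by
    rw [add_comm, Nat.add_mul_div_right _ _ hC, Nat.div_eq_of_lt hx, zero_add]
  have e2 : (r' * C + x') / C = r' := by
    rw [add_comm, Nat.add_mul_div_right _ _ hC, Nat.div_eq_of_lt hx', zero_add]
  have : r = r' := by rw [← e1, ← e2, h]
  subst this
  exact ⟨rfl, by omega⟩

theorem index_lt {C r r' x : ℕ} (hx : x < C) (hr : r < r') : r * C + x < r' * C := by
  calc r * C + x < r * C + C := by omega
    _ = (r + 1) * C := by ring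
    _ ≤ r' * C := Nat.mul_le_mul_right _ hr

/-! ### Masks of the prefixes of chunks -/

/-- The `t`-th mask is the set of the numbers `AR[a] % g` of the elements `a` of the list `L` that
belong to the same chunk of `g` elements as the `t`-th element and do not come after it. -/
def masks (L M : Arr) : Stmt :=
  .loop .t (var .N) (
    .acc ::= pow2 (get .AR (get L (var .t)) % var .g) ;;
    .ite (var .t % var .g)
      (.acc ::= .bin .lor (var .acc) (get M (var .jb + (var .t - 1)))) .skip ;;
    .put M (var .jb + var .t) (var .acc))

/-- Each mask arises from its predecessor by OR with one bit, except at the start of a chunk. All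
bit numbers are less than `g`, and `2 ^ g` is less than the word bound. -/
theorem masks_spec {c : Lim} (hc : 64 * c.D < c.W) {L M : Arr} {s : St} {N g jb : ℕ}
    (h1 : L ≠ M) (h2 : .AR ≠ M) (hN : s.var .N = N) (hg : s.var .g = g) (hjb : s.var .jb = jb)
    (hg0 : 0 < g) (hgW : 2 ^ g < c.W) (hND : jb + N < c.D) (hu : ∀ t < N, s.arr L t < c.D) :
    Triple c (masks L M) s (100 * (N + 1)) fun s' =>
      (∀ t < N, ∀ p, (s'.arr M (jb + t)).testBit p ↔
        ∃ t', (t' ≤ t ∧ t' / g = t / g) ∧ s.arr .AR (s.arr L t') % g = p) ∧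
      ∀ i < jb, s'.arr M i = s.arr M i := by
  refine (Triple.loop (fun k s' => (∀ t < k, ∀ p, (s'.arr M (jb + t)).testBit p ↔
        ∃ t', (t' ≤ t ∧ t' / g = t / g) ∧ s.arr .AR (s.arr L t') % g = p) ∧
      ∀ i < jb, s'.arr M i = s.arr M i) N 60 (by simp) (by simp [hN]) (by simp) ?_).mono
      (by simp; omega) (fun _ _ => id)
  intro k hk s' hs ⟨i0, i1⟩
  have a1 : s'.var .g = g := by simp [hs.var, wr, hg]
  have a2 : s'.var .jb = jb := by simp [hs.var, wr, hjb]
  have a3 : s'.arr L = s.arr L := by simp [hs.arr, wa, h1]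
  have a4 : s'.arr .AR = s.arr .AR := by simp [hs.arr, wa, h2]
  have a5 := hu k hk
  set z := s.arr .AR (s.arr L k) % g with hz
  have a6 : 2 ^ z < c.W :=
    (Nat.pow_le_pow_right (by norm_num) (Nat.mod_lt _ hg0).le).trans_lt hgW
  refine Triple.flat rfl (by simp [Stmt.cost]) ?_ ?_
  · by_cases h : k % g = 0
    · simp [Stmt.safe, run, a1, a2, a3, a4, ← hz, h]; omega
    · have : k ≠ 0 := by rintro rfl; simp at h
      simp [Stmt.safe, run, a1, a2, a3, a4, ← hz, h]; omega
  · have upd : ∀ y, (∀ p, y.testBit p ↔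
        ∃ t', (t' ≤ k ∧ t' / g = k / g) ∧ s.arr .AR (s.arr L t') % g = p) →
        (∀ t ≤ k, ∀ p, (Function.update (s'.arr M) (jb + k) y (jb + t)).testBit p ↔
          ∃ t', (t' ≤ t ∧ t' / g = t / g) ∧ s.arr .AR (s.arr L t') % g = p) ∧
        ∀ i < jb, Function.update (s'.arr M) (jb + k) y i = s.arr M i := by
      intro y hy
      refine ⟨fun t ht p => ?_, fun i hi => ?_⟩
      · rcases ht.lt_or_eq with ht | rfl
        · rw [Function.update_of_ne (by omega), i0 t ht]
        · rw [Function.update_self, hy]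
      · rw [Function.update_of_ne (by omega), i1 i hi]
    by_cases h : k % g = 0
    · simp [run, a1, a2, a3, a4, ← hz, h]
      refine upd _ fun p => ?_
      simp only [same_group_of_mod_eq_zero h, Nat.testBit_two_pow]
      simp [hz]
    · have hk0 : k ≠ 0 := by rintro rfl; simp at h
      simp [run, a1, a2, a3, a4, ← hz, h]
      refine upd _ fun p => ?_
      simp only [same_group_of_mod_ne_zero hg0 h, Nat.testBit_or, Nat.testBit_two_pow,
        Bool.or_eq_true, i0 (k - 1) (by omega) p]
      simp only [decide_eq_true_eq, or_and_right, exists_or, exists_eq_left, hz]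

/-! ### Tables of minima -/

/-- `M[r * C + x]` becomes the minimal key of an element with row `r` and column `x`. -/
def tableFill : Stmt :=
  .loop .t (var .rows * var .C) (.put .M (var .t) (var .n)) ;;
  .loop .t (var .N) (
    .i ::= get .ROW (get .WP (var .t)) * var .C + get .COL (get .WP (var .t)) ;;
    .ite (lt (get .RK (get .WP (var .t))) (get .M (var .i)))
      (.put .M (var .i) (get .RK (get .WP (var .t)))) .skip)

/-- Take the minima of the columns over the rows of a group up to the current row. -/
def tableRow (T : Arr) : Stmt :=
  .loop .x (var .C) (
    .acc ::= get .M (var .row * var .C + var .x) ;;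
    .ite (var .row % var .G)
      (.ite (lt (get .M ((var .row - 1) * var .C + var .x)) (var .acc))
        (.acc ::= get .M ((var .row - 1) * var .C + var .x)) .skip) .skip ;;
    .put .M (var .row * var .C + var .x) (var .acc) ;;
    .put T (var .c0 + var .x) (var .acc))

/-- The minima of the intervals of `2 ^ h` columns. -/
def tableSparse (T : Arr) : Stmt :=
  .loop .h (var .Hn - 1) (.loop .x (var .C) (
    .acc ::= get T (var .c0 + (var .h * var .C + var .x)) ;;
    .ite (lt (var .x + pow2 (var .h)) (var .C))
      (.ite (lt (get T (var .c0 + (var .h * var .C + (var .x + pow2 (var .h))))) (var .acc))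
        (.acc ::= get T (var .c0 + (var .h * var .C + (var .x + pow2 (var .h))))) .skip) .skip ;;
    .put T (var .c0 + ((var .h + 1) * var .C + var .x)) (var .acc)))

/-- The table of the minima over the rows of a group up to a row and over `2 ^ h` columns. -/
def table (T : Arr) : Stmt :=
  tableFill ;;
  .loop .row (var .rows) (
    .c0 ::= var .base + var .row * var .stride ;;
    tableRow T ;;
    tableSparse T)

/-- Doubling: an interval of `2 ^ (k + 1)` columns is the union of two intervals of `2 ^ k`. The
minima of single columns, which form the part for `h = 0`, are already in place. -/
theorem tableSparse_spec {c : Lim} (hc : 64 * c.D < c.W) {T : Arr} {s : St} {C Hn b0 n : ℕ}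
    {κ col : ℕ → ℕ} {R : ℕ → Prop} (hC : s.var .C = C) (hHn : s.var .Hn = Hn)
    (hb0 : s.var .c0 = b0) (hCD : C < c.D) (hH0 : 0 < Hn) (hHD : 2 ^ (Hn - 1) < c.D)
    (hD : b0 + Hn * C < c.D) (hcol : ∀ a, R a → col a < C)
    (h0 : ∀ x < C, MinOver n κ (fun a => R a ∧ col a = x) (s.arr T (b0 + x))) :
    Triple c (tableSparse T) s (150 * (Hn * (C + 1))) fun s' =>
      (∀ h < Hn, ∀ x < C, MinOver n κ (fun a => R a ∧ x ≤ col a ∧ col a < x + 2 ^ h)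
        (s'.arr T (b0 + (h * C + x)))) ∧
      ∀ i < b0, s'.arr T i = s.arr T i := by
  refine (Triple.loop (fun k s' => (∀ h ≤ k, ∀ x < C,
      MinOver n κ (fun a => R a ∧ x ≤ col a ∧ col a < x + 2 ^ h)
        (s'.arr T (b0 + (h * C + x)))) ∧
      ∀ i < b0, s'.arr T i = s.arr T i) (Hn - 1) (100 * C + 10) ?_ ?_ ?_ ?_).mono ?_ ?_
  · have : 1 < c.W := by omega
    simp [hHn, this]; omega
  · simp [hHn]
  · refine ⟨fun h hh x hx => ?_, fun _ _ => rfl⟩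
    obtain rfl : h = 0 := by omega
    simp only [zero_mul, zero_add, pow_zero]
    exact (h0 x hx).congr fun a => by rw [show (x ≤ col a ∧ col a < x + 1) ↔ col a = x by omega]
  · intro k hk s' hs ⟨i0, i1⟩
    have a1 : s'.var .C = C := by simp [hs.var, wr, hC]
    have a2 : s'.var .c0 = b0 := by simp [hs.var, wr, hb0]
    have hkH : (k + 1) * C ≤ (Hn - 1) * C := Nat.mul_le_mul_right _ (by omega)
    have hHC : (Hn - 1) * C + C = Hn * C := by
      obtain ⟨m, rfl⟩ := Nat.exists_eq_succ_of_ne_zero hH0.ne'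
      simp; ring
    have hk1 : (k + 1) * C = k * C + C := by ring
    have hkC : k < c.D := (Nat.lt_two_pow_self).trans_le
      ((Nat.pow_le_pow_right (by norm_num) (by omega : k ≤ Hn - 1)).trans hHD.le)
    have hpk : 2 ^ k < c.D :=
      (Nat.pow_le_pow_right (by norm_num) (by omega : k ≤ Hn - 1)).trans_lt hHD
    refine (Triple.loop (fun j s'' => (∀ x < j,
      MinOver n κ (fun a => R a ∧ x ≤ col a ∧ col a < x + 2 ^ (k + 1))
        (s''.arr T (b0 + ((k + 1) * C + x)))) ∧
      ∀ i < b0 + (k + 1) * C, s''.arr T i = s'.arr T i) C 95 (by simp) (by simp [a1]) (by simp)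
      ?_).mono (by simp; omega) ?_
    · intro x hx s2 hs2 ⟨j0, j1⟩
      have b1 : s2.var .C = C := by simp [hs2.var, wr, a1]
      have b2 : s2.var .c0 = b0 := by simp [hs2.var, wr, a2]
      have b3 : s2.var .h = k := by simp [hs2.var, wr]
      have b4 := j1 (b0 + (k * C + x)) (by omega)
      have b5 := i0 k le_rfl x hx
      have upd : ∀ y, MinOver n κ (fun a => R a ∧ x ≤ col a ∧ col a < x + 2 ^ (k + 1)) y →
          (∀ x' ≤ x, MinOver n κ (fun a => R a ∧ x' ≤ col a ∧ col a < x' + 2 ^ (k + 1))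
            (Function.update (s2.arr T) (b0 + ((k + 1) * C + x)) y (b0 + ((k + 1) * C + x')))) ∧
          ∀ i < b0 + (k + 1) * C, Function.update (s2.arr T) (b0 + ((k + 1) * C + x)) y i =
            s'.arr T i := by
        intro y hy
        refine ⟨fun x' hx' => ?_, fun i hi => ?_⟩
        · rcases hx'.lt_or_eq with hx' | rfl
          · rw [Function.update_of_ne (by omega)]; exact j0 x' hx'
          · rw [Function.update_self]; exact hy
        · rw [Function.update_of_ne (by omega), j1 i hi]
      by_cases hlt : x + 2 ^ k < C
      · have b6 := j1 (b0 + (k * C + (x + 2 ^ k))) (by omega)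
        have b7 := i0 k le_rfl _ hlt
        have b8 := b5.union b7 (R := fun a => R a ∧ x ≤ col a ∧ col a < x + 2 ^ (k + 1)) (by
          intro a
          have : 2 ^ (k + 1) = 2 ^ k + 2 ^ k := by rw [pow_succ]; omega
          constructor
          · rintro ⟨h1, h2, h3⟩
            by_cases h4 : col a < x + 2 ^ k
            · exact .inl ⟨h1, h2, h4⟩
            · exact .inr ⟨h1, by omega, by omega⟩
          · rintro (⟨h1, h2, h3⟩ | ⟨h1, h2, h3⟩)
            · exact ⟨h1, by omega, by omega⟩
            · exact ⟨h1, by omega, by omega⟩)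
        by_cases hm : s'.arr T (b0 + (k * C + (x + 2 ^ k))) < s'.arr T (b0 + (k * C + x))
        · rw [min_eq_right hm.le] at b8
          refine Triple.flat rfl (by simp [Stmt.cost]) ?_ ?_
          · simp [Stmt.safe, run, b1, b2, b3, b4, b6, hlt, hm]
            omega
          · simp [run, b1, b2, b3, b4, b6, hlt, hm]
            exact upd _ b8
        · rw [min_eq_left (not_lt.1 hm)] at b8
          refine Triple.flat rfl (by simp [Stmt.cost]) ?_ ?_
          · simp [Stmt.safe, run, b1, b2, b3, b4, b6, hlt, hm]
            omega
          · simp [run, b1, b2, b3, b4, b6, hlt, hm]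
            exact upd _ b8
      -- The second half lies beyond the last column and is empty, so the first half alone has the
      -- same minimum.
      · have b8 := b5.congr (Q := fun a => R a ∧ x ≤ col a ∧ col a < x + 2 ^ (k + 1)) (by
          intro a
          have : 2 ^ (k + 1) = 2 ^ k + 2 ^ k := by rw [pow_succ]; omega
          constructor
          · rintro ⟨h1, h2, h3⟩
            exact ⟨h1, h2, by omega⟩
          · rintro ⟨h1, h2, h3⟩
            have := hcol a h1
            exact ⟨h1, h2, by omega⟩)
        refine Triple.flat rfl (by simp [Stmt.cost]) ?_ ?_
        · simp [Stmt.safe, run, b1, b2, b3, b4, hlt]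
          omega
        · simp [run, b1, b2, b3, b4, hlt]
          exact upd _ b8
    · rintro s2 _ ⟨j0, j1⟩
      refine ⟨fun h hh x hx => ?_, fun i hi => ?_⟩
      · rcases hh.lt_or_eq with hh | rfl
        · have : h * C + x < (k + 1) * C := index_lt hx hh
          rw [j1 _ (by omega)]
          exact i0 h (by omega) x hx
        · exact j0 x hx
      · rw [j1 i (by omega), i1 i hi]
  · simp
    obtain ⟨m, rfl⟩ := Nat.exists_eq_succ_of_ne_zero hH0.ne'
    simp only [Nat.succ_eq_add_one, Nat.add_sub_cancel]
    nlinarith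
  · rintro s' _ ⟨i0, i1⟩
    exact ⟨fun h hh => i0 h (by omega), i1⟩

theorem tableFill_spec {c : Lim} (hc : 64 * c.D < c.W) {s : St} {N rows C n : ℕ}
    {E : Finset ℕ} {r : ℕ → ℕ → Prop} (hE : Enum (s.arr .WP) N E r) (hr : ∀ a, ¬ r a a)
    (hN : s.var .N = N) (hrows : s.var .rows = rows) (hC : s.var .C = C) (hn : s.var .n = n)
    (hND : N < c.D) (hRC : rows * C < c.D) (hED : ∀ a ∈ E, a < c.D)
    (hrow : ∀ a ∈ E, s.arr .ROW a < rows) (hcol : ∀ a ∈ E, s.arr .COL a < C)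
    (hκ : ∀ a ∈ E, s.arr .RK a ≤ n) :
    Triple c tableFill s (200 * (N + rows * C + 1)) fun s' => ∀ ρ < rows, ∀ x < C,
      MinOver n (s.arr .RK) (fun a => a ∈ E ∧ s.arr .ROW a = ρ ∧ s.arr .COL a = x)
        (s'.arr .M (ρ * C + x)) := by
  refine Triple.seq_le (T₂ := 150 * N + 20) (Triple.loop_put (rows * C) id (fun _ => n) ?_
    (by simp [hrows, hC]) ?_ ?_ ?_) ?_ (by simp; omega)
  · simp [hrows, hC]; omega
  · simp [hn]
  · simp; omega
  · simp; omega
  rintro s1 hs1 ⟨hz, -⟩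
  have e1 : s1.var .N = N := by simp [hs1.var, wr, hN]
  have e2 : s1.var .C = C := by simp [hs1.var, wr, hC]
  have e3 : ∀ a, a ≠ .M → s1.arr a = s.arr a := fun a ha => by simp [hs1.arr, wa, ha]
  refine (Triple.loop (fun k s' => ∀ ρ < rows, ∀ x < C,
      MinOver n (s.arr .RK) (fun a => (∃ t < k, s.arr .WP t = a) ∧ s.arr .ROW a = ρ ∧
        s.arr .COL a = x) (s'.arr .M (ρ * C + x))) N 100 (by simp) (by simp [e1]) ?_ ?_).mono
      (by simp; omega) ?_
  · intro ρ hρ x hx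
    have : s1.arr .M (ρ * C + x) = n := hz _ (index_lt hx hρ)
    rw [this]
    exact .empty (by simp)
  · intro k hk s' hs i0
    have a2 : s'.var .C = C := by simp [hs.var, wr, e2]
    have a3 : ∀ a, a ≠ .M → s'.arr a = s.arr a := fun a ha => by simp [hs.arr, wa, ha, e3]
    have hm := hE.mem k hk
    set z := s.arr .WP k with hz
    have b0 := hED z hm
    have b1 := hrow z hm
    have b2 := hcol z hm
    have b3 := index_lt b2 b1
    have b4 := hκ z hm
    have b5 := i0 _ b1 _ b2
    have hsing : MinOver n (s.arr .RK) (fun a => a = z) (s.arr .RK z) :=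
      .singleton b4 fun _ => Iff.rfl
    have new := b5.union hsing (R := fun a => (∃ t < k + 1, s.arr .WP t = a) ∧
        s.arr .ROW a = s.arr .ROW z ∧ s.arr .COL a = s.arr .COL z) (by
      intro a
      constructor
      · rintro ⟨⟨t, ht, rfl⟩, h⟩
        rcases Nat.lt_succ_iff_lt_or_eq.1 ht with ht | rfl
        · exact .inl ⟨⟨t, ht, rfl⟩, h⟩
        · exact .inr rfl
      · rintro (⟨⟨t, ht, rfl⟩, h⟩ | rfl)
        · exact ⟨⟨t, by omega, rfl⟩, h⟩
        · exact ⟨⟨k, by omega, rfl⟩, rfl, rfl⟩)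
    have old : ∀ ρ < rows, ∀ x < C, ρ * C + x ≠ s.arr .ROW z * C + s.arr .COL z →
        MinOver n (s.arr .RK) (fun a => (∃ t < k + 1, s.arr .WP t = a) ∧ s.arr .ROW a = ρ ∧
          s.arr .COL a = x) (s'.arr .M (ρ * C + x)) := by
      intro ρ hρ x hx hne
      refine (i0 ρ hρ x hx).congr fun a => ⟨?_, ?_⟩
      · rintro ⟨⟨t, ht, rfl⟩, h⟩
        exact ⟨⟨t, by omega, rfl⟩, h⟩
      · rintro ⟨⟨t, ht, rfl⟩, h1, h2⟩
        rcases Nat.lt_succ_iff_lt_or_eq.1 ht with ht | rfl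
        · exact ⟨⟨t, ht, rfl⟩, h1, h2⟩
        · exact absurd (by rw [hz, h1, h2]) hne
    by_cases hlt : s.arr .RK z < s'.arr .M (s.arr .ROW z * C + s.arr .COL z)
    · rw [min_eq_right hlt.le] at new
      refine Triple.flat rfl (by simp [Stmt.cost]) ?_ ?_
      · simp [Stmt.safe, run, a2, a3, ← hz, hlt]; omega
      · simp [run, a2, a3, ← hz, hlt]
        intro ρ hρ x hx
        by_cases he : ρ * C + x = s.arr .ROW z * C + s.arr .COL z
        · obtain ⟨rfl, rfl⟩ := index_ne hx b2 he
          rw [Function.update_self]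
          simpa using new
        · rw [Function.update_of_ne he]
          simpa using old ρ hρ x hx he
    · rw [min_eq_left (not_lt.1 hlt)] at new
      refine Triple.flat rfl (by simp [Stmt.cost]) ?_ ?_
      · simp [Stmt.safe, run, a2, a3, ← hz, hlt]; omega
      · simp [run, a2, a3, ← hz, hlt]
        intro ρ hρ x hx
        by_cases he : ρ * C + x = s.arr .ROW z * C + s.arr .COL z
        · obtain ⟨rfl, rfl⟩ := index_ne hx b2 he
          simpa using new
        · simpa using old ρ hρ x hx he
  · intro s' _ i0 ρ hρ x hx
    refine (i0 ρ hρ x hx).congr fun a => and_congr_left fun _ => ⟨?_, fun ha => ?_⟩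
    · rintro ⟨t, ht, rfl⟩; exact hE.mem t ht
    · exact hE.surj hr ha

/-- `M` is turned into prefix minima in place, row by row. When row `ρ` is treated, row `ρ - 1`
already stands for its whole group prefix, while row `ρ` still holds its own minima. -/
theorem tableRow_spec {c : Lim} (hc : 64 * c.D < c.W) {T : Arr} (hT : T ≠ .M) {s : St}
    {rows ρ C G b0 n : ℕ} {κ row col : ℕ → ℕ} {E : Finset ℕ} (hC : s.var .C = C)
    (hρ : s.var .row = ρ) (hG : s.var .G = G) (hb0 : s.var .c0 = b0) (hG0 : 0 < G)
    (hρr : ρ < rows) (hRC : rows * C < c.D) (hr : rows < c.D) (hD : b0 + C < c.D)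
    (hM : ∀ x < C, MinOver n κ (fun a => a ∈ E ∧ row a = ρ ∧ col a = x) (s.arr .M (ρ * C + x)))
    (hM' : ρ ≠ 0 → ∀ x < C, MinOver n κ (fun a => (a ∈ E ∧ row a ≤ ρ - 1 ∧
      row a / G = (ρ - 1) / G) ∧ col a = x) (s.arr .M ((ρ - 1) * C + x))) :
    Triple c (tableRow T) s (150 * (C + 1)) fun s' =>
      (∀ x < C, MinOver n κ (fun a => (a ∈ E ∧ row a ≤ ρ ∧ row a / G = ρ / G) ∧ col a = x)
        (s'.arr T (b0 + x))) ∧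
      (∀ x < C, MinOver n κ (fun a => (a ∈ E ∧ row a ≤ ρ ∧ row a / G = ρ / G) ∧ col a = x)
        (s'.arr .M (ρ * C + x))) ∧
      (∀ i, (ρ + 1) * C ≤ i → s'.arr .M i = s.arr .M i) ∧ ∀ i < b0, s'.arr T i = s.arr T i := by
  refine (Triple.loop (fun k s' =>
      (∀ x < k, MinOver n κ (fun a => (a ∈ E ∧ row a ≤ ρ ∧ row a / G = ρ / G) ∧ col a = x)
        (s'.arr T (b0 + x))) ∧
      (∀ x < k, MinOver n κ (fun a => (a ∈ E ∧ row a ≤ ρ ∧ row a / G = ρ / G) ∧ col a = x)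
        (s'.arr .M (ρ * C + x))) ∧
      (∀ i, (∀ x < k, i ≠ ρ * C + x) → s'.arr .M i = s.arr .M i) ∧
      ∀ i < b0, s'.arr T i = s.arr T i) C 120 (by simp) (by simp [hC]) (by simp) ?_).mono
      (by simp; omega) ?_
  · rintro k hk s' hs ⟨i0, i1, i2, i3⟩
    have a1 : s'.var .C = C := by simp [hs.var, wr, hC]
    have a2 : s'.var .row = ρ := by simp [hs.var, wr, hρ]
    have a3 : s'.var .G = G := by simp [hs.var, wr, hG]
    have a4 : s'.var .c0 = b0 := by simp [hs.var, wr, hb0]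
    have b1 := index_lt hk hρr
    have b2 : s'.arr .M (ρ * C + k) = s.arr .M (ρ * C + k) := i2 _ fun x hx => by omega
    have b3 := hM k hk
    have upd : ∀ y, MinOver n κ (fun a => (a ∈ E ∧ row a ≤ ρ ∧ row a / G = ρ / G) ∧ col a = k) y →
      (∀ x ≤ k, MinOver n κ (fun a => (a ∈ E ∧ row a ≤ ρ ∧ row a / G = ρ / G) ∧ col a = x)
        (Function.update (s'.arr T) (b0 + k) y (b0 + x))) ∧
      (∀ x ≤ k, MinOver n κ (fun a => (a ∈ E ∧ row a ≤ ρ ∧ row a / G = ρ / G) ∧ col a = x)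
        (Function.update (s'.arr .M) (ρ * C + k) y (ρ * C + x))) ∧
      (∀ i, (∀ x ≤ k, i ≠ ρ * C + x) → Function.update (s'.arr .M) (ρ * C + k) y i = s.arr .M i) ∧
      ∀ i < b0, Function.update (s'.arr T) (b0 + k) y i = s.arr T i := by
      intro y hy
      refine ⟨fun x hx => ?_, fun x hx => ?_, fun i hi => ?_, fun i hi => ?_⟩
      · rcases hx.lt_or_eq with hx | rfl
        · rw [Function.update_of_ne (by omega)]; exact i0 x hx
        · rw [Function.update_self]; exact hy
      · rcases hx.lt_or_eq with hx | rfl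
        · rw [Function.update_of_ne (by omega)]; exact i1 x hx
        · rw [Function.update_self]; exact hy
      · rw [Function.update_of_ne (hi k le_rfl), i2 i fun x hx => hi x hx.le]
      · rw [Function.update_of_ne (by omega), i3 i hi]
    by_cases h : ρ % G = 0
    · have b8 := b3.congr
        (Q := fun a => (a ∈ E ∧ row a ≤ ρ ∧ row a / G = ρ / G) ∧ col a = k) fun a => by
          rw [same_group_of_mod_eq_zero h, and_assoc]
      refine Triple.flat rfl (by simp [Stmt.cost]) ?_ ?_
      · simp [Stmt.safe, run, a1, a2, a3, a4, b2, h]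
        omega
      · simp [run, a1, a2, a3, a4, b2, h, hT, hT.symm]
        exact upd _ b8
    · have h0 : ρ ≠ 0 := by rintro rfl; simp at h
      have b4 := index_lt hk (show ρ - 1 < rows by omega)
      have b5 : s'.arr .M ((ρ - 1) * C + k) = s.arr .M ((ρ - 1) * C + k) := i2 _ fun x hx => by
        have := index_lt hk (show ρ - 1 < ρ by omega)
        omega
      have b6 := hM' h0 k hk
      have b8 := b3.union b6
        (R := fun a => (a ∈ E ∧ row a ≤ ρ ∧ row a / G = ρ / G) ∧ col a = k) fun a => by
          rw [same_group_of_mod_ne_zero hG0 h]; tauto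
      by_cases hm : s.arr .M ((ρ - 1) * C + k) < s.arr .M (ρ * C + k)
      · rw [min_eq_right hm.le] at b8
        refine Triple.flat rfl (by simp [Stmt.cost]) ?_ ?_
        · simp [Stmt.safe, run, a1, a2, a3, a4, b2, b5, h, hm]
          omega
        · simp [run, a1, a2, a3, a4, b2, b5, h, hm, hT, hT.symm]
          exact upd _ b8
      · rw [min_eq_left (not_lt.1 hm)] at b8
        refine Triple.flat rfl (by simp [Stmt.cost]) ?_ ?_
        · simp [Stmt.safe, run, a1, a2, a3, a4, b2, b5, h, hm]
          omega
        · simp [run, a1, a2, a3, a4, b2, b5, h, hm, hT, hT.symm]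
          exact upd _ b8
  · rintro s' _ ⟨i0, i1, i2, i3⟩
    refine ⟨i0, i1, fun i hi => i2 i fun x hx => ?_, i3⟩
    have := index_lt hx (Nat.lt_succ_self ρ)
    simp only [Nat.succ_eq_add_one] at this
    omega

/-- The array `T` contains at the address `base` the table of the minima of the keys of the
elements of `E` over the rows of a group up to a row and over intervals of `2 ^ h` columns. -/
def IsTable (T : ℕ → ℕ) (base rows C stride G Hn n : ℕ) (κ row col : ℕ → ℕ) (E : Finset ℕ) : Prop :=
  ∀ ρ < rows, ∀ h < Hn, ∀ x < C,
    MinOver n κ (fun a => (a ∈ E ∧ row a ≤ ρ ∧ row a / G = ρ / G) ∧ x ≤ col a ∧ col a < x + 2 ^ h)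
      (T (base + ρ * stride + (h * C + x)))

/-- The condition `Hn * C ≤ stride` keeps the sparse tables of different rows apart. Cells below
`base` are untouched, so tables can be stacked in one array. -/
theorem table_spec {c : Lim} (hc : 64 * c.D < c.W) {T : Arr} (hT : T ≠ .M)
    {s : St} {N rows C n stride G Hn base : ℕ}
    {E : Finset ℕ} {r : ℕ → ℕ → Prop} (hE : Enum (s.arr .WP) N E r) (hr : ∀ a, ¬ r a a)
    (hN : s.var .N = N) (hrows : s.var .rows = rows) (hC : s.var .C = C) (hn : s.var .n = n)
    (hstride : s.var .stride = stride) (hG : s.var .G = G) (hHn : s.var .Hn = Hn)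
    (hbase : s.var .base = base) (hG0 : 0 < G) (hH0 : 0 < Hn) (hHD : 2 ^ (Hn - 1) < c.D)
    (hst : Hn * C ≤ stride) (hD : base + rows * stride < c.D) (hrD : rows < c.D) (hCD : C < c.D)
    (hND : N < c.D) (hRC : rows * C < c.D) (hED : ∀ a ∈ E, a < c.D)
    (hrow : ∀ a ∈ E, s.arr .ROW a < rows) (hcol : ∀ a ∈ E, s.arr .COL a < C)
    (hκ : ∀ a ∈ E, s.arr .RK a ≤ n) :
    Triple c (table T) s (600 * (N + rows * (Hn * (C + 1)) + 1)) fun s' =>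
      IsTable (s'.arr T) base rows C stride G Hn n (s.arr .RK) (s.arr .ROW) (s.arr .COL) E ∧
      ∀ i < base, s'.arr T i = s.arr T i := by
  have hRH : rows * C + rows ≤ rows * (Hn * (C + 1)) := by
    calc rows * C + rows = rows * (1 * (C + 1)) := by ring
      _ ≤ _ := Nat.mul_le_mul_left _ (Nat.mul_le_mul_right _ hH0)
  refine Triple.seq_le (T₂ := 350 * (rows * (Hn * (C + 1))) + 20)
    (tableFill_spec hc hE hr hN hrows hC hn hND hRC hED hrow hcol hκ) ?_ (by omega)
  intro s1 hs1 hM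
  have e1 : s1.var .rows = rows := by simp [hs1.var, tableFill, wr, hrows]
  have e2 : s1.var .C = C := by simp [hs1.var, tableFill, wr, hC]
  have e3 : s1.var .stride = stride := by simp [hs1.var, tableFill, wr, hstride]
  have e4 : s1.var .base = base := by simp [hs1.var, tableFill, wr, hbase]
  have e5 : s1.var .G = G := by simp [hs1.var, tableFill, wr, hG]
  have e6 : s1.var .Hn = Hn := by simp [hs1.var, tableFill, wr, hHn]
  have e7 : s1.arr T = s.arr T := by simp [hs1.arr, tableFill, wa, hT]
  set R : ℕ → ℕ → Prop := fun ρ a => a ∈ E ∧ s.arr .ROW a ≤ ρ ∧ s.arr .ROW a / G = ρ / G with hR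
  -- Besides the finished rows of `T`, the invariant records that `M` is still unchanged from row
  -- `k` on and that row `k - 1` holds prefix minima.
  refine (Triple.loop (fun k s' => (∀ ρ < k, ∀ h < Hn, ∀ x < C,
      MinOver n (s.arr .RK) (fun a => R ρ a ∧ x ≤ s.arr .COL a ∧ s.arr .COL a < x + 2 ^ h)
        (s'.arr T (base + ρ * stride + (h * C + x)))) ∧
      (∀ i < base, s'.arr T i = s.arr T i) ∧ (∀ i, k * C ≤ i → s'.arr .M i = s1.arr .M i) ∧
      (k ≠ 0 → ∀ x < C, MinOver n (s.arr .RK) (fun a => R (k - 1) a ∧ s.arr .COL a = x)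
        (s'.arr .M ((k - 1) * C + x)))) rows (300 * (Hn * (C + 1)) + 30) (by simp) (by simp [e1])
      (by simp [e7]) ?_).mono ?_ ?_
  · rintro k hk s' hs ⟨i0, i1, i2, i3⟩
    have a2 : s'.var .C = C := by simp [hs.var, tableRow, tableSparse, wr, e2]
    have a3 : s'.var .stride = stride := by simp [hs.var, tableRow, tableSparse, wr, e3]
    have a4 : s'.var .base = base := by simp [hs.var, tableRow, tableSparse, wr, e4]
    have a5 : s'.var .G = G := by simp [hs.var, tableRow, tableSparse, wr, e5]
    have a6 : s'.var .Hn = Hn := by simp [hs.var, tableRow, tableSparse, wr, e6]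
    have hks : k * stride + stride ≤ rows * stride := by
      calc k * stride + stride = (k + 1) * stride := by ring
        _ ≤ _ := Nat.mul_le_mul_right _ hk
    have hCs : C ≤ stride := (Nat.le_mul_of_pos_left C hH0).trans hst
    have hHC : C + 1 ≤ Hn * (C + 1) := Nat.le_mul_of_pos_left (C + 1) hH0
    refine Triple.assign_seq (T := 300 * (Hn * (C + 1)) + 22)
      (by simp [a3, a4]; omega) ?_ (by simp; omega)
    set s2 := (s'.setVar .row k).setVar .c0 _ with hs2
    have b0 : s2.var .c0 = base + k * stride := by simp [hs2, a3, a4]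
    have b1 : s2.var .row = k := by simp [hs2]
    have b2 : s2.arr = s'.arr := rfl
    refine Triple.seq_le (T₁ := 150 * (C + 1)) (T₂ := 150 * (Hn * (C + 1)))
      (tableRow_spec hc hT (n := n) (κ := s.arr .RK) (row := s.arr .ROW) (col := s.arr .COL)
        (E := E) (by simp [hs2, a2] : s2.var .C = C) b1 (by simp [hs2, a5] : s2.var .G = G)
        b0 hG0 hk hRC hrD (by omega) ?_ ?_) ?_ (by omega)
    · intro x hx
      rw [b2, i2 _ (by omega)]
      exact hM k hk x hx
    · rw [b2]; exact i3
    rintro s3 hs3 ⟨j0, j1, j2, j3⟩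
    refine (tableSparse_spec hc (n := n) (κ := s.arr .RK) (col := s.arr .COL) (R := R k)
      (by simp [hs3.var, tableRow, wr, hs2, a2] : s3.var .C = C)
      (by simp [hs3.var, tableRow, wr, hs2, a6] : s3.var .Hn = Hn)
      (by simp [hs3.var, tableRow, wr, b0] : s3.var .c0 = base + k * stride)
      hCD hH0 hHD (by omega) (fun a ha => hcol a ha.1) j0).mono le_rfl ?_
    rintro s4 hs4 ⟨l0, l1⟩
    have d1 : s4.arr .M = s3.arr .M := by simp [hs4.arr, tableSparse, wa, hT.symm]
    refine ⟨fun ρ hρ h hh x hx => ?_, fun i hi => ?_, fun i hi => ?_, fun _ => ?_⟩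
    · rcases Nat.lt_succ_iff_lt_or_eq.1 hρ with hρ | rfl
      · have h1 : ρ * stride + stride ≤ k * stride := by
          calc ρ * stride + stride = (ρ + 1) * stride := by ring
            _ ≤ _ := Nat.mul_le_mul_right _ hρ
        have h2 : h * C + x < Hn * C := index_lt hx hh
        rw [l1 _ (by omega), j3 _ (by omega), b2]
        exact i0 ρ hρ h hh x hx
      · exact l0 h hh x hx
    · rw [l1 i (by omega), j3 i (by omega), b2, i1 i hi]
    · rw [d1, j2 i hi, b2, i2 i]
      calc k * C ≤ (k + 1) * C := Nat.mul_le_mul_right _ (by omega)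
        _ ≤ i := hi
    · rw [d1]; exact j1
  · simp
    nlinarith
  · rintro s' _ ⟨i0, i1, -⟩
    exact ⟨i0, i1⟩

/-! ### The structure for ranges of local positions and its queries -/

/-- The numbers `u 0, …, u (N - 1)` are the elements of `E`, and `φ` is the inverse map. -/
structure Bij (u φ : ℕ → ℕ) (N : ℕ) (E : Finset ℕ) : Prop where
  mem : ∀ i < N, u i ∈ E
  inv : ∀ i < N, φ (u i) = i
  lt : ∀ a ∈ E, φ a < N
  map : ∀ a ∈ E, u (φ a) = a

/-- The structure at the address `jb` for the elements of `E` with the local positions `loc`, which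
are divided into nodes of `S` positions. The list `u₁` is ordered by node and by descending `B`,
`slot` is its inverse, and its chunks are the blocks of `g` elements. The lists `u₂` and `u₃` are
ordered by chunk and by key, respectively position. -/
structure IsJob (NB AK PP MB MP T : ℕ → ℕ) (jb g f S ch N n : ℕ) (E : Finset ℕ)
    (loc κ B : ℕ → ℕ) (u₁ slot u₂ ar u₃ pr : ℕ → ℕ) : Prop where
  bij₁ : Bij u₁ slot N E
  bij₂ : Bij u₂ ar N E
  bij₃ : Bij u₃ pr N E
  node : ∀ a ∈ E, loc a / S = slot a / S
  desc : ∀ i j, i < j → j < N → i / S = j / S → B (u₁ j) ≤ B (u₁ i)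
  chunk₂ : ∀ a ∈ E, slot a / g = ar a / g
  asc₂ : ∀ i j, i < j → j < N → i / g = j / g → κ (u₂ i) < κ (u₂ j)
  chunk₃ : ∀ a ∈ E, slot a / g = pr a / g
  asc₃ : ∀ i j, i < j → j < N → i / g = j / g → loc (u₃ i) < loc (u₃ j)
  nb : ∀ i < N, NB (jb + i) = B (u₁ i)
  ak : ∀ i < N, AK (jb + i) = κ (u₂ i)
  pp : ∀ i < N, PP (jb + i) = loc (u₃ i)
  mb : ∀ t < N, ∀ p, (MB (jb + t)).testBit p ↔
    ∃ t', (t' ≤ t ∧ t' / g = t / g) ∧ ar (u₁ t') % g = p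
  mp : ∀ t < N, ∀ p, (MP (jb + t)).testBit p ↔
    ∃ t', (t' ≤ t ∧ t' / g = t / g) ∧ ar (u₃ t') % g = p
  tab : IsTable T jb (N / g + 1) f g (S / g) (Nat.log 2 f + 1) n κ (fun a => slot a / g)
    (fun a => loc a % S / ch) E

/-- Take a candidate into account. -/
def improve : Stmt := .ite (lt (var .acc) (var .best)) (.best ::= var .acc) .skip

@[simp] theorem improve_run (s : St) :
    improve.run s = s.setVar .best (min (s.var .best) (s.var .acc)) := by
  by_cases h : s.var .acc < s.var .best
  · simp [improve, run, h, min_eq_right h.le]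
  · simp only [improve, run, Expr.eval_lt, Expr.eval_var, h, if_false, ne_eq, not_true,
      min_eq_left (not_lt.1 h)]
    simp [St.setVar]

@[simp] theorem improve_safe (c : Lim) (s : St) : improve.safe c s := by
  simp [improve, Stmt.safe]

/-- Take the minimum of a table over the columns from `x` to `y - 1` into account. -/
def tableQuery (T : Arr) : Stmt :=
  .h ::= get .LG (var .y - var .x) ;;
  .base ::= var .base + var .row * var .stride ;;
  .acc ::= get T (var .base + (var .h * var .C + var .x)) ;;
  improve ;;
  .acc ::= get T (var .base + (var .h * var .C + (var .y - pow2 (var .h)))) ;;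
  improve

/-- With `h` the logarithm of the length, the intervals of `2 ^ h` columns at both ends of `[x, y)`
cover it. That they overlap does not matter for minima. -/
theorem tableQuery_spec {c : Lim} (hc : 64 * c.D < c.W) {T : Arr} {s : St}
    {base rows C stride G Hn n ρ x y : ℕ} {κ row col : ℕ → ℕ} {E : Finset ℕ} {P Q : ℕ → Prop}
    (hT : IsTable (s.arr T) base rows C stride G Hn n κ row col E)
    (hbase : s.var .base = base) (hρ : s.var .row = ρ) (hstride : s.var .stride = stride)
    (hC : s.var .C = C) (hx : s.var .x = x) (hy : s.var .y = y) (hxy : x < y) (hyC : y ≤ C)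
    (hρr : ρ < rows) (hLG : s.arr .LG (y - x) = Nat.log 2 (y - x)) (hHn : Nat.log 2 C < Hn)
    (hst : Hn * C ≤ stride) (hCD : C < c.D) (hD : base + rows * stride < c.D)
    (hbest : MinOver n κ P (s.var .best))
    (hQ : ∀ a, Q a ↔ P a ∨ ((a ∈ E ∧ row a ≤ ρ ∧ row a / G = ρ / G) ∧ x ≤ col a ∧ col a < y)) :
    Triple c (tableQuery T) s 100 fun s' => MinOver n κ Q (s'.var .best) := by
  set h := Nat.log 2 (y - x) with hh
  have b1 : 2 ^ h ≤ y - x := Nat.pow_log_le_self 2 (by omega)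
  have b2 : y - x < 2 ^ (h + 1) := Nat.lt_pow_succ_log_self (by norm_num) _
  have b3 : h < Hn := (Nat.log_mono_right (by omega)).trans_lt hHn
  have b4 : 2 ^ (h + 1) = 2 ^ h + 2 ^ h := by rw [pow_succ]; omega
  have b5 : ρ * stride + stride ≤ rows * stride := by
    calc ρ * stride + stride = (ρ + 1) * stride := by ring
      _ ≤ _ := Nat.mul_le_mul_right _ hρr
  have b6 := index_lt (show x < C by omega) b3
  have b7 := index_lt (show y - 2 ^ h < C by have := Nat.two_pow_pos h; omega) b3
  have t1 := hT ρ hρr h b3 x (by omega)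
  have t2 := hT ρ hρr h b3 (y - 2 ^ h) (by have := Nat.two_pow_pos h; omega)
  have fin := (hbest.union t1 fun _ => Iff.rfl).union t2 (R := Q) (by
    intro a
    rw [hQ]
    constructor
    · rintro (h1 | ⟨h1, h2, h3⟩)
      · exact .inl (.inl h1)
      · by_cases h4 : col a < x + 2 ^ h
        · exact .inl (.inr ⟨h1, h2, h4⟩)
        · exact .inr ⟨h1, by omega, by omega⟩
    · rintro ((h1 | ⟨h1, h2, h3⟩) | ⟨h1, h2, h3⟩)
      · exact .inl h1
      · exact .inr ⟨h1, h2, by omega⟩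
      · exact .inr ⟨h1, by omega, by omega⟩)
  refine Triple.flat rfl (by simp [tableQuery, Stmt.cost, improve]) ?_ ?_
  · simp [tableQuery, Stmt.safe, run, hbase, hρ, hstride, hC, hx, hy, hLG]
    omega
  · simpa [tableQuery, run, min_assoc, hbase, hρ, hstride, hC, hx, hy, hLG] using fin

/-! ### Queries in a chunk and in a node -/

/-- `q := min a b`. -/
def minInto (x : Reg) (a b : Expr) : Stmt := x ::= a ;; .ite (lt b (var x)) (x ::= b) .skip

/-- The mask of the elements of the chunk at `c0` with a position less than `x`. -/
def prefixMask (d x : Reg) : Stmt :=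
  bsearch (var .q) (lt (get .PP (var .jb + (var .c0 + (var .p - 1)))) (var x)) ;;
  d ::= 0 ;;
  .ite (var .res) (d ::= get .MP (var .jb + (var .c0 + (var .res - 1)))) .skip

/-- Take the elements of the chunk at `c0` into account. -/
def microQuery : Stmt :=
  minInto .q (var .g) (var .N - var .c0) ;;
  prefixMask .pb .x0 ;;
  prefixMask .pe .x1 ;;
  .mask ::= .bin .land (get .MB (var .jb + (var .j0 + (var .r - 1))))
    (.bin .xor (var .pe) (var .pb)) ;;
  .ite (var .mask) (
    bsearch (var .g) (eq (var .mask % pow2 (var .p)) 0) ;;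
    .acc ::= get .AK (var .jb + (var .c0 + var .res)) ;;
    improve) .skip

/-- Take the elements of the first `t` chunks of a node into account. -/
def nodeTable : Stmt :=
  .base ::= var .jb ;;
  .row ::= var .j0 / var .g + (var .t - 1) ;;
  .stride ::= var .g ;;
  .C ::= var .f ;;
  .x ::= (var .x0 - var .j0) / var .ch ;;
  .y ::= (var .x1 - var .j0) / var .ch ;;
  tableQuery .T1

/-- Take the elements of a node with a position from `x0` to `x1 - 1` into account. -/
def nodeQuery : Stmt :=
  .j0 ::= var .x0 / var .S * var .S ;;
  minInto .q (var .S) (var .N - var .j0) ;;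
  bsearch (var .q) (le (var .v) (get .NB (var .jb + (var .j0 + (var .p - 1))))) ;;
  .r ::= var .res ;;
  .ite (var .r) (
    .t ::= (var .r - 1) / var .g ;;
    .c0 ::= var .j0 + var .t * var .g ;;
    .ite (var .t) nodeTable .skip ;;
    microQuery) .skip

/-- The program evaluates `b` after `x` has been assigned; `hbe` excludes that this matters. -/
theorem minInto_triple {c : Lim} {s : St} {x : Reg} {a b : Expr} {q : Stmt} {T T' : ℕ}
    {Q : St → Prop}
    (ha : a.safe c s) (hb : b.safe c (s.setVar x (a.eval s)))
    (hbe : b.eval (s.setVar x (a.eval s)) = b.eval s)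
    (h : Triple c q (s.setVar x (min (a.eval s) (b.eval s))) T Q)
    (hT : a.cost + 2 * b.cost + 5 + T ≤ T') : Triple c (minInto x a b ;; q) s T' Q := by
  refine Triple.seq_le (T₁ := a.cost + 2 * b.cost + 5)
    (Q₁ := fun s' => s' = s.setVar x (min (a.eval s) (b.eval s)))
    (Triple.flat rfl (by simp [minInto, Stmt.cost]; omega) ?_ ?_)
    (fun s' _ e => by rw [e]; exact h) hT
  · simp [minInto, Stmt.safe, run, ha, hb]
  · have e : (s.setVar x (a.eval s)).var x = a.eval s := by simp
    by_cases hlt : b.eval s < a.eval s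
    · simp only [minInto, run, Expr.eval_lt, Expr.eval_var, e, hbe, hlt,
        min_eq_right hlt.le, if_true, ne_eq, one_ne_zero, not_false_eq_true]
      simp [St.setVar, Function.update_idem]
    · simp only [minInto, run, Expr.eval_lt, Expr.eval_var, e, hbe, hlt,
        min_eq_left (not_lt.1 hlt), if_false, ne_eq, not_true]

/-- Divisibility by `2 ^ p` is thus downward closed in `p`, so the lowest set bit can be found by
binary search. -/
theorem testBit_mod_eq_zero_iff (z p : ℕ) : z % 2 ^ p = 0 ↔ ∀ i < p, z.testBit i = false := by
  constructor
  · intro h i hi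
    have := Nat.testBit_mod_two_pow z p i
    rw [h] at this
    simpa [hi] using this.symm
  · intro h
    apply Nat.eq_of_testBit_eq
    intro i
    rw [Nat.testBit_mod_two_pow]
    by_cases hi : i < p
    · simp [h i hi]
    · simp [hi]

section
variable {NB AK PP MB MP T : ℕ → ℕ} {jb g f S ch N n : ℕ} {E : Finset ℕ}
    {loc κ B : ℕ → ℕ} {u₁ slot u₂ ar u₃ pr : ℕ → ℕ}

/-- The chunk is also listed by position, so the elements before `xx` form a prefix of that list,
and the mask of this prefix is stored. The minimum with `N - c0` accounts for an incomplete last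
chunk. -/
theorem prefixMask_spec {c : Lim} (hc : 64 * c.D < c.W) {s : St} {d x : Reg} {c0 xx H : ℕ}
    (hj : IsJob (s.arr .NB) (s.arr .AK) (s.arr .PP) (s.arr .MB) (s.arr .MP) (s.arr .T1) jb g f S ch
      N n E loc κ B u₁ slot u₂ ar u₃ pr)
    (hH : s.var .H = H) (hHW : 4 * 2 ^ H < c.W) (hHW' : H + 1 < c.W) (hgH : g < 2 ^ (H + 1))
    (hq : s.var .q = min g (N - c0)) (hjb : s.var .jb = jb) (hc0 : s.var .c0 = c0)
    (hx : s.var x = xx) (hg0 : 0 < g) (hc0g : c0 % g = 0) (hc0N : c0 < N) (hD : jb + N < c.D)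
    (hne : x ≠ .len ∧ x ≠ .res ∧ x ≠ .step ∧ x ≠ .i ∧ x ≠ .p)
    (hd : d ≠ .res) (hd' : d ≠ .jb ∧ d ≠ .c0) :
    Triple c (prefixMask d x) s (100 * (H + 2)) fun s' => ∀ p, (s'.var d).testBit p ↔
      ∃ a ∈ E, (slot a / g = c0 / g ∧ loc a < xx) ∧ ar a % g = p := by
  -- As `c0` is a multiple of `g`, the interval of `g` numbers from `c0` on is exactly one chunk.
  have hch : ∀ i, c0 ≤ i → i < c0 + g → i / g = c0 / g := by
    intro i h1 h2
    have e1 := Nat.div_add_mod c0 g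
    rw [Nat.div_eq_iff hg0]
    constructor
    · rw [mul_comm]; omega
    · rw [mul_comm]; omega
  refine Triple.seq_le (T₁ := 21 + (H + 1) * 51) (T₂ := 30)
    ((bsearch_spec (L := min g (N - c0)) (fun p => loc (u₃ (c0 + (p - 1))) < xx) hH hHW hHW' (by simp) (by simp [hq]) ?_
      ?_ ?_).mono ?_ fun _ _ => id) ?_ (by omega)
  · exact (min_le_left _ _).trans_lt hgH
  · intro s' hs h1 h2
    have a1 : s'.var .jb = jb := by simp [hs.var, bsearch, wr, hjb]
    have a2 : s'.var .c0 = c0 := by simp [hs.var, bsearch, wr, hc0]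
    have a3 : s'.arr = s.arr := by funext a; simp [hs.arr, bsearch, wa]
    have a4 : s'.var x = xx := by simp [hs.var, bsearch, wr, hne, hx]
    have a5 := hj.pp (c0 + (s'.var .p - 1)) (by omega)
    simp [a1, a2, a3, a4, a5]
    omega
  · intro p q h1 h2 h3 h4
    rcases h2.lt_or_eq with h2 | rfl
    · refine (hj.asc₃ (c0 + (p - 1)) (c0 + (q - 1)) (by omega) (by omega) ?_).trans h4
      rw [hch (c0 + (p - 1)) (by omega) (by omega), hch (c0 + (q - 1)) (by omega) (by omega)]
    · exact h4
  · simp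
  rintro s1 hs1 ⟨hr, hok⟩
  have a1 : s1.var .jb = jb := by simp [hs1.var, bsearch, wr, hjb]
  have a2 : s1.var .c0 = c0 := by simp [hs1.var, bsearch, wr, hc0]
  have a3 : s1.arr = s.arr := by funext a; simp [hs1.arr, bsearch, wa]
  set res := s1.var .res with hres
  have iff : ∀ a ∈ E, slot a / g = c0 / g → (loc a < xx ↔ pr a < c0 + res) := by
    intro a ha hs
    have h1 := hj.bij₃.lt a ha
    have h2 := hj.chunk₃ a ha
    have e1 := Nat.div_add_mod c0 g
    have e2 := Nat.div_add_mod (pr a) g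
    have e3 := Nat.mod_lt (pr a) hg0
    rw [← h2, hs] at e2
    have h3 := hok (pr a - c0 + 1) (by omega) (by omega)
    have e4 : c0 + (pr a - c0 + 1 - 1) = pr a := by omega
    rw [e4, hj.bij₃.map a ha] at h3
    rw [h3]
    omega
  -- An empty prefix has no stored mask; its mask is the initial value `0`.
  by_cases h0 : res = 0
  · refine Triple.flat rfl (by simp [Stmt.cost]) ?_ ?_
    · simp [Stmt.safe, run, hd.symm, ← hres, h0]; omega
    · simp [run, hd.symm, ← hres, h0]
      rintro p a ha h1 h2 -
      rw [iff a ha h1, h0] at h2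
      have h3 := hj.chunk₃ a ha
      have e1 := Nat.div_add_mod c0 g
      have e2 := Nat.div_add_mod (pr a) g
      rw [← h3, h1] at e2
      omega
  · have b1 := hj.mp (c0 + (res - 1)) (by omega)
    refine Triple.flat rfl (by simp [Stmt.cost]) ?_ ?_
    · simp [Stmt.safe, run, hd.symm, hd'.1.symm, hd'.2.symm, ← hres, h0, a1, a2]; omega
    · simp [run, hd.symm, hd'.1.symm, hd'.2.symm, ← hres, h0, a1, a2, a3]
      intro p
      rw [b1, hch _ (by omega) (by omega)]
      constructor
      · rintro ⟨t', ⟨h1, h2⟩, h3⟩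
        have h4 := hj.bij₃.mem t' (by omega)
        have h5 := hj.bij₃.inv t' (by omega)
        have h6 : slot (u₃ t') / g = c0 / g := by rw [hj.chunk₃ _ h4, h5, h2]
        refine ⟨u₃ t', h4, ⟨h6, ?_⟩, h3⟩
        rw [iff _ h4 h6, h5]; omega
      · rintro ⟨a, ha, ⟨h1, h2⟩, h3⟩
        refine ⟨pr a, ⟨?_, ?_⟩, ?_⟩
        · have := (iff a ha h1).1 h2; omega
        · rw [← hj.chunk₃ a ha, h1]
        · rw [hj.bij₃.map a ha, h3]

/-- Within a chunk the bit number `ar a % g` determines the element and increases with the key.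
Intersecting the prefix by `B` with the difference of two prefixes by position gives the mask of the
admissible elements, whose lowest bit belongs to the least key. -/
theorem microQuery_spec {c : Lim} (hc : 64 * c.D < c.W) {s : St} {c0 j0 r x0 x1 H : ℕ}
    {P Q : ℕ → Prop}
    (hj : IsJob (s.arr .NB) (s.arr .AK) (s.arr .PP) (s.arr .MB) (s.arr .MP) (s.arr .T1) jb g f S ch
      N n E loc κ B u₁ slot u₂ ar u₃ pr)
    (hH : s.var .H = H) (hHW : 4 * 2 ^ H < c.W) (hHW' : H + 1 < c.W) (hgH : g < 2 ^ (H + 1))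
    (hg : s.var .g = g) (hN : s.var .N = N) (hjb : s.var .jb = jb) (hc0 : s.var .c0 = c0)
    (hj0 : s.var .j0 = j0) (hr : s.var .r = r)
    (hx0 : s.var .x0 = x0) (hx1 : s.var .x1 = x1) (hg0 : 0 < g) (hgW : 2 ^ g < c.W)
    (hc0g : c0 % g = 0) (hc0N : c0 < N)
    (hD : jb + N < c.D) (hr0 : 0 < r) (hrc : c0 < j0 + r) (hrg : j0 + r ≤ c0 + g)
    (hrN : j0 + r ≤ N) (hx01 : x0 ≤ x1) (hbest : MinOver n κ P (s.var .best))
    (hQ : ∀ a, Q a ↔ P a ∨ (a ∈ E ∧ (slot a / g = c0 / g ∧ slot a < j0 + r) ∧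
      x0 ≤ loc a ∧ loc a < x1)) :
    Triple c microQuery s (500 * (H + 2)) fun s' => MinOver n κ Q (s'.var .best) := by
  have hch : ∀ i, c0 ≤ i → i < c0 + g → i / g = c0 / g := by
    intro i h1 h2
    have e1 := Nat.div_add_mod c0 g
    rw [Nat.div_eq_iff hg0]
    constructor
    · rw [mul_comm]; omega
    · rw [mul_comm]; omega
  refine minInto_triple (T := 400 * (H + 2)) (by simp) (by simp [hN, hc0]; omega) (by simp) ?_
    (by simp; omega)
  set s1 := s.setVar .q _ with hs1
  have hq1 : s1.var .q = min g (N - c0) := by simp [hs1, hg, hN, hc0]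
  have hv1 : ∀ y, y ≠ .q → s1.var y = s.var y := fun y hy => by simp [hs1, hy]
  refine Triple.seq_le (T₂ := 300 * (H + 2)) (prefixMask_spec hc (by exact hj)
    (by simp [hv1, hH] : s1.var .H = H) hHW hHW' hgH hq1 (by simp [hv1, hjb] : s1.var .jb = jb)
    (by simp [hv1, hc0] : s1.var .c0 = c0) (by simp [hv1, hx0] : s1.var .x0 = x0) hg0 hc0g hc0N hD
    (by simp) (by simp) (by simp)) ?_ (by omega)
  intro s2 hs2 m2
  have hv2 : ∀ y, y ≠ .q → y ≠ .pb → y ≠ .len → y ≠ .res → y ≠ .step → y ≠ .i → y ≠ .p →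
      s2.var y = s.var y := fun y h1 h2 h3 h4 h5 h6 h7 => by
    rw [hs2.var y (by simp [prefixMask, bsearch, wr, *]), hv1 y h1]
  have hq2 : s2.var .q = min g (N - c0) := by rw [hs2.var _ (by rfl), hq1]
  have ha2 : s2.arr = s.arr := by funext a; exact hs2.arr a rfl
  refine Triple.seq_le (T₂ := 200 * (H + 2)) (prefixMask_spec hc (s := s2) (by rw [ha2]; exact hj)
    (by simp [hv2, hH] : s2.var .H = H) hHW hHW' hgH hq2 (by simp [hv2, hjb] : s2.var .jb = jb)
    (by simp [hv2, hc0] : s2.var .c0 = c0) (by simp [hv2, hx1] : s2.var .x1 = x1) hg0 hc0g hc0N hD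
    (by simp) (by simp) (by simp)) ?_ (by omega)
  intro s3 hs3 m3
  have hv3 : ∀ y, y ≠ .q → y ≠ .pb → y ≠ .pe → y ≠ .len → y ≠ .res → y ≠ .step → y ≠ .i → y ≠ .p →
      s3.var y = s.var y := fun y h1 h2 h3 h4 h5 h6 h7 h8 => by
    rw [hs3.var y (by simp [prefixMask, bsearch, wr, *]), hv2 y h1 h2 h4 h5 h6 h7 h8]
  have hpb3 : s3.var .pb = s2.var .pb := hs3.var _ rfl
  have ha3 : s3.arr = s.arr := by funext a; rw [hs3.arr a rfl, ha2]
  rw [← hpb3] at m2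
  -- the elements that are identified by the bits
  have uniq : ∀ a ∈ E, ∀ b ∈ E, slot a / g = c0 / g → slot b / g = c0 / g →
      ar a % g = ar b % g → a = b := by
    intro a ha b hb h1 h2 h3
    have h4 := hj.chunk₂ a ha
    have h5 := hj.chunk₂ b hb
    have e1 := Nat.div_add_mod (ar a) g
    have e2 := Nat.div_add_mod (ar b) g
    rw [← h4, h1] at e1
    rw [← h5, h2] at e2
    rw [← hj.bij₂.map a ha, ← hj.bij₂.map b hb, show ar a = ar b by omega]
  set mask := s.arr .MB (jb + (j0 + (r - 1))) &&& (s3.var .pe ^^^ s3.var .pb) with hmask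
  have hbit : ∀ p, mask.testBit p ↔ ∃ a ∈ E, ((slot a / g = c0 / g ∧ slot a < j0 + r) ∧
      x0 ≤ loc a ∧ loc a < x1) ∧ ar a % g = p := by
    intro p
    have b1 := hj.mb (j0 + (r - 1)) (by omega) p
    rw [hch _ (by omega) (by omega)] at b1
    have m2p := m2 p
    have m3p := m3 p
    rw [hmask, Nat.testBit_and, Nat.testBit_xor, Bool.and_eq_true, b1]
    constructor
    · rintro ⟨⟨t', ⟨h1, h2⟩, h3⟩, h4⟩
      have h5 := hj.bij₁.mem t' (by omega)
      have h6 := hj.bij₁.inv t' (by omega)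
      have h7 : slot (u₁ t') / g = c0 / g := by rw [h6, h2]
      by_cases hb : (s3.var .pb).testBit p
      · have h8 : ¬ (s3.var .pe).testBit p := by
          intro h; simp [h, hb] at h4
        obtain ⟨a, ha, ⟨h9, h10⟩, h11⟩ := m2p.1 hb
        exact absurd (m3p.2 ⟨a, ha, ⟨h9, by omega⟩, h11⟩) h8
      · have h8 : (s3.var .pe).testBit p := by
          simpa [Bool.eq_false_iff.2 hb] using h4
        obtain ⟨a, ha, ⟨h9, h10⟩, h11⟩ := m3p.1 h8
        have h12 := uniq a ha _ h5 h9 h7 (by rw [h11, h3])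
        refine ⟨a, ha, ⟨⟨h9, ?_⟩, ?_, h10⟩, h11⟩
        · rw [h12, h6]; omega
        · by_contra h13
          exact hb (m2p.2 ⟨a, ha, ⟨h9, by omega⟩, h11⟩)
    · rintro ⟨a, ha, ⟨⟨h1, h2⟩, h3, h4⟩, h5⟩
      refine ⟨⟨slot a, ⟨by omega, h1⟩, by rw [hj.bij₁.map a ha, h5]⟩, ?_⟩
      have hb : (s3.var .pb).testBit p = false := by
        rw [Bool.eq_false_iff]
        intro h
        obtain ⟨b, hb, ⟨h9, h10⟩, h11⟩ := m2p.1 h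
        rw [uniq b hb a ha h9 h1 (by rw [h11, h5])] at h10
        omega
      have he : (s3.var .pe).testBit p = true := m3p.2 ⟨a, ha, ⟨h1, h4⟩, h5⟩
      simp [hb, he]
  refine Triple.assign_seq (T := 100 * (H + 2) + 50)
    (by simp [hv3, hjb, hj0, hr]; omega) ?_ (by simp; omega)
  set s4 := s3.setVar .mask _ with hs4
  have hm4 : s4.var .mask = mask := by
    simp [hs4, hv3, hjb, hj0, hr, ha3, hmask]
  have hv4 : ∀ y, y ≠ .mask → y ≠ .q → y ≠ .pb → y ≠ .pe → y ≠ .len → y ≠ .res → y ≠ .step →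
      y ≠ .i → y ≠ .p → s4.var y = s.var y := fun y h0 h1 h2 h3 h4 h5 h6 h7 h8 => by
    simp [hs4, h0, hv3, *]
  have ha4 : s4.arr = s.arr := by simp [hs4, ha3]
  refine (Triple.ite (T := 100 * (H + 2)) (by simp) ?_ ?_).mono (by simp; omega) fun _ _ => id
  · intro hm
    rw [Expr.eval_var, hm4] at hm
    obtain ⟨p0, hp0⟩ := Nat.exists_testBit_of_ne_zero hm
    have hp0g : p0 < g := by
      obtain ⟨a, -, -, h⟩ := (hbit p0).1 hp0
      rw [← h]; exact Nat.mod_lt _ hg0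
    refine Triple.seq_le (T₁ := 21 + (H + 1) * 40) (T₂ := 50)
      ((bsearch_spec (fun p => mask % 2 ^ p = 0) (by simp [hv4, hH] : s4.var .H = H) hHW hHW'
      (by simp) (by simp [hv4, hg] : _ = g) hgH ?_ ?_).mono (by simp) fun _ _ => id) ?_ (by omega)
    · intro s' hs h1 h2
      have e1 : s'.var .mask = mask := by rw [hs.var _ rfl, hm4]
      have e2 : 2 ^ s'.var .p < c.W := (Nat.pow_le_pow_right (by norm_num) h2).trans_lt hgW
      simp [e1, e2]; omega
    · intro p q _ h1 _ h2
      rw [testBit_mod_eq_zero_iff] at h2 ⊢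
      exact fun i hi => h2 i (by omega)
    rintro s5 hs5 ⟨hres, hok⟩
    set res := s5.var .res with hres'
    -- A bit `p0 < g` is set, so divisibility fails at `p0 + 1`, which is within the range of the
    -- search; `res` is therefore the number of the lowest set bit.
    have hrp : res ≤ p0 := by
      by_contra hlt
      have := (hok (p0 + 1) (by omega) (by omega)).2 (by omega)
      rw [testBit_mod_eq_zero_iff] at this
      rw [this p0 (by omega)] at hp0
      exact absurd hp0 (by simp)
    have hlow : ∀ i < res, mask.testBit i = false := by
      by_cases h0 : res = 0
      · intro i hi; omega
      · exact (testBit_mod_eq_zero_iff _ _).1 ((hok res (by omega) hres).2 le_rfl)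
    have hset : mask.testBit res := by
      by_contra hb
      have h1 := hok (res + 1) (by omega) (by omega)
      rw [testBit_mod_eq_zero_iff] at h1
      have := h1.1 fun i hi => by
        rcases Nat.lt_succ_iff_lt_or_eq.1 hi with hi | rfl
        · exact hlow i hi
        · simpa using hb
      omega
    obtain ⟨a, ha, h1, h2⟩ := (hbit res).1 hset
    have hara : ar a = c0 + res := by
      have h4 := hj.chunk₂ a ha
      have e1 := Nat.div_add_mod (ar a) g
      have e2 := Nat.div_add_mod c0 g
      rw [← h4, h1.1.1] at e1
      omega
    have hltN := hj.bij₂.lt a ha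
    have hak := hj.ak (c0 + res) (by omega)
    rw [← hara, hj.bij₂.map a ha, hara] at hak
    have v1 : s5.var .jb = jb := by rw [hs5.var _ rfl]; simp [hv4, hjb]
    have v2 : s5.var .c0 = c0 := by rw [hs5.var _ rfl]; simp [hv4, hc0]
    have v3 : s5.var .best = s.var .best := by rw [hs5.var _ rfl]; simp [hv4]
    have v4 : s5.arr = s.arr := by funext a; rw [hs5.arr a rfl, ha4]
    -- No admissible element has a bit below `res`, and inside a chunk the list `u₂` is ordered by
    -- key.
    have hmin : ∀ b ∈ E, ((slot b / g = c0 / g ∧ slot b < j0 + r) ∧ x0 ≤ loc b ∧ loc b < x1) →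
        κ a ≤ κ b := by
      intro b hb hb'
      have h4 := hj.chunk₂ b hb
      have e1 := Nat.div_add_mod (ar b) g
      have e2 := Nat.div_add_mod c0 g
      rw [← h4, hb'.1.1] at e1
      have h5 : ¬ ar b % g < res := by
        intro h
        have := hlow _ h
        rw [(hbit _).2 ⟨b, hb, hb', rfl⟩] at this
        exact absurd this (by simp)
      rcases (show ar a ≤ ar b by omega).lt_or_eq with h6 | h6
      · have := hj.asc₂ (ar a) (ar b) h6 (hj.bij₂.lt b hb)
          (by rw [← hj.chunk₂ a ha, ← h4, h1.1.1, hb'.1.1])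
        rw [hj.bij₂.map a ha, hj.bij₂.map b hb] at this
        exact this.le
      · rw [← hj.bij₂.map a ha, ← hj.bij₂.map b hb, h6]
    refine Triple.flat rfl (by simp [Stmt.cost, improve]) ?_ ?_
    · simp [Stmt.safe, v1, v2, ← hres']; omega
    · simp [run, v1, v2, v3, v4, ← hres', hak]
      refine ⟨(min_le_left _ _).trans hbest.le, fun b hb => ?_, fun h => ?_⟩
      · rcases (hQ b).1 hb with hb | hb
        · exact (min_le_left _ _).trans (hbest.le_key b hb)
        · exact (min_le_right _ _).trans (hmin b hb.1 hb.2)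
      · rcases min_choice (s.var .best) (κ a) with e | e
        · rw [e] at h ⊢
          obtain ⟨b, hb, h'⟩ := hbest.attained h
          exact ⟨b, (hQ b).2 (.inl hb), h'⟩
        · rw [e]
          exact ⟨a, (hQ a).2 (.inr ⟨ha, h1⟩), rfl⟩
  · intro hm
    rw [Expr.eval_var, hm4] at hm
    refine Triple.flat rfl (by simp [Stmt.cost]; omega) (by simp [Stmt.safe]) ?_
    simp only [run]
    have : s4.var .best = s.var .best := by simp [hv4]
    rw [this]
    refine hbest.congr fun a => ?_
    rw [hQ]
    constructor
    · exact .inl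
    · rintro (h | ⟨h1, h2⟩)
      · exact h
      · have := (hbit _).2 ⟨a, h1, h2, rfl⟩
        rw [hm] at this
        simp at this

/-- The first `t` chunks of the node are the rows `j0 / g, …, j0 / g + t - 1`. A group has `S / g`
rows, that is, one node, so the prefix minimum in the last of these rows does not reach into earlier
nodes. As `x0` and `x1` are multiples of `ch`, the positions between them fill an interval of
columns. -/
theorem nodeTable_spec {c : Lim} (hc : 64 * c.D < c.W) {s : St} {x0 x1 j0 t : ℕ}
    {P Q : ℕ → Prop}
    (hT : IsTable (s.arr .T1) jb (N / g + 1) f g (S / g) (Nat.log 2 f + 1) n κ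
      (fun a => slot a / g) (fun a => loc a % S / ch) E)
    (hnode' : ∀ a ∈ E, loc a / S = slot a / S) (hg : s.var .g = g) (hf : s.var .f = f)
    (hch : s.var .ch = ch) (hjb : s.var .jb = jb) (hx0 : s.var .x0 = x0)
    (hx1 : s.var .x1 = x1) (hj : s.var .j0 = j0) (ht : s.var .t = t) (hg0 : 0 < g)
    (hSf : S = ch * f) (hSg : S % g = 0) (hch0 : 0 < ch) (hf0 : 0 < f)
    (hfg : (Nat.log 2 f + 1) * f ≤ g) (hLG : ∀ i, 0 < i → i ≤ f → s.arr .LG i = Nat.log 2 i)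
    (hj0 : j0 = x0 / S * S) (hx01 : x0 < x1) (hx1S : x1 ≤ j0 + S) (hx0c : x0 % ch = 0)
    (hx1c : x1 % ch = 0) (hrow : j0 / g + t < N / g + 1) (ht0 : t ≠ 0) (htS : t * g < S)
    (hD : jb + (N / g + 1) * g < c.D)
    (hbest : MinOver n κ P (s.var .best))
    (hQ : ∀ a, Q a ↔ P a ∨ (a ∈ E ∧ (x0 ≤ loc a ∧ loc a < x1) ∧ slot a < j0 + t * g)) :
    Triple c nodeTable s 170 fun s' => MinOver n κ Q (s'.var .best) := by
  have hS0 : 0 < S := hSf ▸ Nat.mul_pos hch0 hf0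
  have hj0x : j0 ≤ x0 := hj0 ▸ Nat.div_mul_le_self _ _
  have hSgm : S / g * g = S := Nat.div_mul_cancel (Nat.dvd_of_mod_eq_zero hSg)
  have hj0S : j0 % S = 0 := by simp [hj0]
  have hj0g : j0 % g = 0 :=
    Nat.mod_eq_zero_of_dvd ((Nat.dvd_of_mod_eq_zero hSg).trans (Nat.dvd_of_mod_eq_zero hj0S))
  have hj0gm : j0 / g * g = j0 := Nat.div_mul_cancel (Nat.dvd_of_mod_eq_zero hj0g)
  have hnode : ∀ i, i / S = x0 / S ↔ j0 ≤ i ∧ i < j0 + S := by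
    intro i
    rw [Nat.div_eq_iff hS0, hj0]
    constructor <;> intro h <;> omega
  have d0 : ch ∣ j0 := by rw [hj0, hSf]; exact ⟨x0 / (ch * f) * f, by ring⟩
  have d1 : ch ∣ x0 := Nat.dvd_of_mod_eq_zero hx0c
  have d2 : ch ∣ x1 := Nat.dvd_of_mod_eq_zero hx1c
  have f1 : (x0 - j0) / ch * ch = x0 - j0 := Nat.div_mul_cancel (Nat.dvd_sub d1 d0)
  have f2 : (x1 - j0) / ch * ch = x1 - j0 := Nat.div_mul_cancel (Nat.dvd_sub d2 d0)
  have f3 : (x1 - j0) / ch ≤ f := by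
    rw [Nat.div_le_iff_le_mul_add_pred hch0, ← hSf]; omega
  have f4 : (x0 - j0) / ch < (x1 - j0) / ch := by
    by_contra h
    have := Nat.mul_le_mul_right ch (not_lt.1 h)
    omega
  -- The group of the row that is read is the node of `x0`; `t * g < S` keeps the row inside it.
  have h8 : (j0 / g + (t - 1)) / (S / g) = x0 / S := by
    have : (j0 + (t - 1) * g) / S = x0 / S := (hnode _).2 ⟨by omega, by
      have : (t - 1) * g + g = t * g := by
        rw [← Nat.succ_mul]; congr 1; omega
      omega⟩
    rw [← Nat.add_mul_div_right _ _ hg0, Nat.div_div_eq_div_mul, mul_comm g, hSgm, this]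
  have hND : N / g + 1 ≤ (N / g + 1) * g := Nat.le_mul_of_pos_right _ hg0
  have hgD : g ≤ (N / g + 1) * g := Nat.le_mul_of_pos_left _ (Nat.succ_pos _)
  have hrow' : j0 / g + (t - 1) < N / g + 1 := by
    generalize j0 / g = z, N / g = z' at hrow ⊢
    omega
  have hrowW : j0 / g + (t - 1) < c.W := by
    generalize j0 / g + (t - 1) = z, N / g + 1 = z', (N / g + 1) * g = z'' at *
    omega
  refine Triple.assign_seq (T := 160) (by simp) (Triple.assign_seq (T := 150)
    (by simp [hg, ht, hj]; exact ⟨by omega, hrowW⟩) (Triple.assign_seq (T := 140) (by simp)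
    (Triple.assign_seq (T := 130) (by simp) (Triple.assign_seq (T := 115)
    (by simp [hx0, hch, hj]; omega) (Triple.assign_seq (T := 100)
    (by simp [hx1, hch, hj]; omega) ?_ (by simp)) (by simp)) (by simp)) (by simp))
    (by simp)) (by simp)
  refine tableQuery_spec hc (base := jb) (rows := N / g + 1) (C := f) (stride := g) (G := S / g)
    (Hn := Nat.log 2 f + 1) (n := n) (ρ := j0 / g + (t - 1)) (x := (x0 - j0) / ch)
    (y := (x1 - j0) / ch) (κ := κ) (E := E) (P := P) (row := fun a => slot a / g)
    (col := fun a => loc a % S / ch)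
    (by simpa using hT) (by simp [hjb]) (by simp [hj, ht, hg]) (by simp [hg]) (by simp [hf])
    (by simp [hx0, hj, hch]) (by simp [hx1, hj, hch]) f4 f3 hrow'
    (by simpa using hLG _ (Nat.sub_pos_of_lt f4) ((Nat.sub_le _ _).trans f3))
    (Nat.lt_succ_self _) hfg ?_ hD (by simpa using hbest) ?_
  · have : f ≤ (Nat.log 2 f + 1) * f := Nat.le_mul_of_pos_left _ (by omega)
    omega
  · intro a
    rw [hQ]
    refine or_congr_right ⟨?_, ?_⟩
    · rintro ⟨h1, ⟨h2, h3⟩, h4⟩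
      have h6 : slot a / g < j0 / g + t := by
        rw [Nat.div_lt_iff_lt_mul hg0, Nat.add_mul, hj0gm]; exact h4
      have h7 : slot a / S = x0 / S := by
        rw [← hnode' a h1]; exact (hnode _).2 ⟨by omega, by omega⟩
      have h9 : loc a % S = loc a - j0 := by
        have e1 := Nat.div_add_mod (loc a) S
        rw [(hnode (loc a)).2 ⟨by omega, by omega⟩, mul_comm, ← hj0] at e1
        omega
      refine ⟨⟨h1, by omega, ?_⟩, ?_, ?_⟩
      · rw [h8, Nat.div_div_eq_div_mul, mul_comm g, hSgm, h7]
      · rw [h9]; exact Nat.div_le_div_right (by omega)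
      · rw [h9, Nat.div_lt_iff_lt_mul hch0, f2]; omega
    · rintro ⟨⟨h1, h2, h3⟩, h4, h5⟩
      rw [h8, Nat.div_div_eq_div_mul, mul_comm g, hSgm] at h3
      have h6 := hnode' a h1
      rw [h3] at h6
      have h9 : loc a % S = loc a - j0 := by
        have e1 := Nat.div_add_mod (loc a) S
        rw [h6, mul_comm, ← hj0] at e1
        omega
      have h10 := (hnode _).1 h6
      rw [h9] at h4 h5
      rw [Nat.div_lt_iff_lt_mul hch0, f2] at h5
      rw [Nat.le_div_iff_mul_le hch0, f1] at h4
      have h11 : slot a < j0 + t * g := by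
        have : slot a / g < j0 / g + t := by omega
        rwa [Nat.div_lt_iff_lt_mul hg0, Nat.add_mul, hj0gm] at this
      exact ⟨h1, ⟨by omega, by omega⟩, h11⟩

-- In the slots of a node, which are ordered by descending `B`, the condition `v ≤ B` cuts out a
-- prefix of length `r`. Its complete chunks go to the table and its last chunk to the masks.
-- Alignment with the children is required only for `g < S`: a node of `g` elements is a single
-- chunk, and the masks handle arbitrary ends.
set_option maxHeartbeats 1000000 in
theorem nodeQuery_spec {c : Lim} (hc : 64 * c.D < c.W) {s : St} {x0 x1 v H : ℕ}
    {P Q : ℕ → Prop}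
    (hj : IsJob (s.arr .NB) (s.arr .AK) (s.arr .PP) (s.arr .MB) (s.arr .MP) (s.arr .T1) jb g f S ch
      N n E loc κ B u₁ slot u₂ ar u₃ pr)
    (hH : s.var .H = H) (hHW : 4 * 2 ^ H < c.W) (hHW' : H + 1 < c.W) (hgH : g < 2 ^ (H + 1))
    (hSH : S < 2 ^ (H + 1)) (hg : s.var .g = g) (hf : s.var .f = f) (hS : s.var .S = S)
    (hch : s.var .ch = ch) (hN : s.var .N = N) (hjb : s.var .jb = jb) (hx0 : s.var .x0 = x0)
    (hx1 : s.var .x1 = x1) (hv : s.var .v = v) (hg0 : 0 < g) (hgW : 2 ^ g < c.W)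
    (hSf : S = ch * f) (hSg : S % g = 0) (hch0 : 0 < ch) (hf0 : 0 < f) (hfg : (Nat.log 2 f + 1) * f ≤ g)
    (hLG : ∀ i, 0 < i → i ≤ f → s.arr .LG i = Nat.log 2 i)
    (hx01 : x0 < x1) (hx1S : x1 ≤ x0 / S * S + S) (hx1N : x1 ≤ N)
    (hx0c : g < S → x0 % ch = 0) (hx1c : g < S → x1 % ch = 0)
    (hD : jb + (N / g + 1) * g < c.D) (hbest : MinOver n κ P (s.var .best))
    (hQ : ∀ a, Q a ↔ P a ∨ (a ∈ E ∧ (x0 ≤ loc a ∧ loc a < x1) ∧ v ≤ B a)) :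
    Triple c nodeQuery s (900 * (H + 2)) fun s' => MinOver n κ Q (s'.var .best) := by
  have hS0 : 0 < S := hSf ▸ Nat.mul_pos hch0 hf0
  set j0 := x0 / S * S with hj0
  have hj0x : j0 ≤ x0 := Nat.div_mul_le_self _ _
  have hx0j : x0 < j0 + S := by omega
  have hNg : N < (N / g + 1) * g := by
    have := Nat.lt_div_mul_add (a := N) hg0
    rw [Nat.add_mul]; omega
  have hSgm : S / g * g = S := Nat.div_mul_cancel (Nat.dvd_of_mod_eq_zero hSg)
  have hj0S : j0 % S = 0 := by simp [hj0]
  have hj0g : j0 % g = 0 :=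
    Nat.mod_eq_zero_of_dvd ((Nat.dvd_of_mod_eq_zero hSg).trans (Nat.dvd_of_mod_eq_zero hj0S))
  have hj0gm : j0 / g * g = j0 := Nat.div_mul_cancel (Nat.dvd_of_mod_eq_zero hj0g)
  have hnode : ∀ i, i / S = x0 / S ↔ j0 ≤ i ∧ i < j0 + S := by
    intro i
    rw [Nat.div_eq_iff hS0, hj0]
    constructor <;> intro h <;> omega
  refine Triple.assign_seq (T := 850 * (H + 2)) (by simp [hx0, hS]; omega) ?_
    (by simp; omega)
  set s1 := s.setVar .j0 _ with hs1
  have hv1 : ∀ y, y ≠ .j0 → s1.var y = s.var y := fun y hy => by simp [hs1, hy]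
  have hj1 : s1.var .j0 = j0 := by simp [hs1, hx0, hS, hj0]
  have ha1 : s1.arr = s.arr := rfl
  refine minInto_triple (T := 840 * (H + 2)) (by simp) (by simp [hv1, hN, hj1]; omega) (by simp) ?_
    (by simp; omega)
  set s2 := s1.setVar .q _ with hs2
  have hv2 : ∀ y, y ≠ .j0 → y ≠ .q → s2.var y = s.var y := fun y h1 h2 => by
    simp [hs2, h2, hv1 y h1]
  have hj2 : s2.var .j0 = j0 := by simp [hs2, hj1]
  have hq2 : s2.var .q = min S (N - j0) := by simp [hs2, hv1, hS, hN, hj1]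
  have ha2 : s2.arr = s.arr := rfl
  refine Triple.seq_le (T₁ := 21 + (H + 1) * 60) (T₂ := 750 * (H + 2))
    ((bsearch_spec (L := min S (N - j0)) (fun p => v ≤ B (u₁ (j0 + (p - 1))))
    (by simp [hv2, hH] : s2.var .H = H) hHW hHW' (by simp) (by simp [hq2])
    ((min_le_left _ _).trans_lt hSH) ?_ ?_).mono ?_ fun _ _ => id) ?_ (by omega)
  · intro s' hs h1 h2
    have e1 : s'.var .jb = jb := by rw [hs.var _ rfl]; simp [hv2, hjb]
    have e2 : s'.var .j0 = j0 := by rw [hs.var _ rfl, hj2]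
    have e3 : s'.var .v = v := by rw [hs.var _ rfl]; simp [hv2, hv]
    have e4 : s'.arr = s.arr := by funext a; rw [hs.arr a rfl, ha2]
    have e5 := hj.nb (j0 + (s'.var .p - 1)) (by omega)
    simp [e1, e2, e3, e4, e5]
    omega
  · intro p q h1 h2 h3 h4
    rcases h2.lt_or_eq with h2 | rfl
    · refine h4.trans (hj.desc (j0 + (p - 1)) (j0 + (q - 1)) (by omega) (by omega) ?_)
      rw [(hnode _).2 ⟨by omega, by omega⟩, (hnode (j0 + (q - 1))).2 ⟨by omega, by omega⟩]
    · exact h4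
  · simp
  rintro s3 hs3 ⟨hr, hok⟩
  have hv3 : ∀ y, y ≠ .j0 → y ≠ .q → y ≠ .len → y ≠ .res → y ≠ .step → y ≠ .i → y ≠ .p →
      s3.var y = s.var y := fun y h1 h2 h3 h4 h5 h6 h7 => by
    rw [hs3.var y (by simp [bsearch, wr, *]), hv2 y h1 h2]
  have hj3 : s3.var .j0 = j0 := by rw [hs3.var _ rfl, hj2]
  have ha3 : s3.arr = s.arr := by funext a; rw [hs3.arr a rfl, ha2]
  set r := s3.var .res with hrdef
  have hin : ∀ a ∈ E, x0 ≤ loc a → loc a < x1 → j0 ≤ slot a ∧ slot a < j0 + S := by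
    intro a ha h1 h2
    rw [← hnode, ← hj.node a ha]
    exact (hnode _).2 ⟨by omega, by omega⟩
  -- A position and its slot belong to the same node, so the search in the list of the node decides
  -- `v ≤ B a`.
  have hB : ∀ a ∈ E, x0 ≤ loc a → loc a < x1 → (v ≤ B a ↔ slot a < j0 + r) := by
    intro a ha h1 h2
    have h3 := hin a ha h1 h2
    have h4 := hj.bij₁.lt a ha
    have h5 := hok (slot a - j0 + 1) (by omega) (by omega)
    rw [show j0 + (slot a - j0 + 1 - 1) = slot a by omega, hj.bij₁.map a ha] at h5
    rw [h5]; omega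
  refine Triple.assign_seq (T := 740 * (H + 2)) (by simp) ?_ (by simp; omega)
  set s4 := s3.setVar .r _ with hs4
  have hv4 : ∀ y, y ≠ .j0 → y ≠ .q → y ≠ .len → y ≠ .res → y ≠ .step → y ≠ .i → y ≠ .p → y ≠ .r →
      s4.var y = s.var y := fun y h1 h2 h3 h4 h5 h6 h7 h8 => by simp [hs4, h8, hv3, *]
  have hr4 : s4.var .r = r := by simp [hs4, hrdef]
  have hj4 : s4.var .j0 = j0 := by simp [hs4, hj3]
  have ha4 : s4.arr = s.arr := by simp [hs4, ha3]
  refine (Triple.ite (T := 730 * (H + 2)) (by simp) ?_ ?_).mono (by simp; omega) fun _ _ => id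
  swap
  · intro h0
    rw [Expr.eval_var, hr4] at h0
    refine Triple.flat rfl (by simp [Stmt.cost]; omega) (by simp [Stmt.safe]) ?_
    simp only [run]
    have : s4.var .best = s.var .best := by simp [hv4]
    rw [this]
    refine hbest.congr fun a => ?_
    rw [hQ]
    refine ⟨.inl, ?_⟩
    rintro (h | ⟨h1, ⟨h2, h3⟩, h4⟩)
    · exact h
    · have := (hB a h1 h2 h3).1 h4
      have := hin a h1 h2 h3
      omega
  intro h0
  rw [Expr.eval_var, hr4] at h0
  -- With `r - 1` instead of `r` the last chunk always receives between `1` and `g` elements, so the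
  -- mask at `r - 1` exists and belongs to it.
  set t := (r - 1) / g with ht
  set c0 := j0 + t * g with hc0
  have htg : t * g ≤ r - 1 := Nat.div_mul_le_self _ _
  have htg' : r - 1 < t * g + g := Nat.lt_div_mul_add hg0
  have hc0g : c0 % g = 0 := by rw [hc0, Nat.add_mul_mod_self_right, hj0g]
  have hc0m : c0 / g = j0 / g + t := by rw [hc0, Nat.add_mul_div_right _ _ hg0]
  have hc0m' : c0 / g * g = c0 := by rw [hc0m, Nat.add_mul, hj0gm]
  refine Triple.assign_seq (T := 725 * (H + 2)) (by simp [hr4, hv4, hg]; omega) ?_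
    (by simp; omega)
  set s5 := s4.setVar .t _ with hs5
  have ht5 : s5.var .t = t := by simp [hs5, hr4, hv4, hg, ht]
  have hv5 : ∀ y, y ≠ .t → s5.var y = s4.var y := fun y hy => by simp [hs5, hy]
  refine Triple.assign_seq (T := 720 * (H + 2))
    (by simp [hv5, hv4, ht5, hg, hj4]; omega) ?_ (by simp; omega)
  set s6 := s5.setVar .c0 _ with hs6
  have hv6 : ∀ y, y ≠ .j0 → y ≠ .q → y ≠ .len → y ≠ .res → y ≠ .step → y ≠ .i → y ≠ .p → y ≠ .r →
      y ≠ .t → y ≠ .c0 → s6.var y = s.var y := fun y h1 h2 h3 h4 h5 h6 h7 h8 h9 h10 => by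
    simp [hs6, h10, hv5, h9, hv4, *]
  have hc6 : s6.var .c0 = c0 := by simp [hs6, hv5, hv4, hj4, ht5, hg, hc0]
  have ht6 : s6.var .t = t := by simp [hs6, ht5]
  have hr6 : s6.var .r = r := by simp [hs6, hv5, hr4]
  have hj6 : s6.var .j0 = j0 := by simp [hs6, hv5, hj4]
  have ha6 : s6.arr = s.arr := by simp [hs6, hs5, ha4]
  let R : ℕ → Prop := fun a => P a ∨ (a ∈ E ∧ (x0 ≤ loc a ∧ loc a < x1) ∧ slot a < c0)
  have hsplit : ∀ a, Q a ↔ R a ∨ (a ∈ E ∧ (slot a / g = c0 / g ∧ slot a < j0 + r) ∧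
      x0 ≤ loc a ∧ loc a < x1) := by
    intro a
    rw [hQ]
    constructor
    · rintro (h | ⟨h1, h2, h3⟩)
      · exact .inl (.inl h)
      · have h4 := (hB a h1 h2.1 h2.2).1 h3
        by_cases h5 : slot a < c0
        · exact .inl (.inr ⟨h1, h2, h5⟩)
        · refine .inr ⟨h1, ⟨?_, h4⟩, h2⟩
          rw [Nat.div_eq_iff hg0, hc0m']; omega
    · rintro ((h | ⟨h1, h2, h3⟩) | ⟨h1, ⟨h2, h3⟩, h4⟩)
      · exact .inl h
      · exact .inr ⟨h1, h2, (hB a h1 h2.1 h2.2).2 (by omega)⟩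
      · exact .inr ⟨h1, h4, (hB a h1 h4.1 h4.2).2 h3⟩
  refine Triple.seq_le (T₁ := 180) (T₂ := 500 * (H + 2))
    (Q₁ := fun s' => MinOver n κ R (s'.var .best)) ((Triple.ite (T := 170) (by simp) ?_ ?_).mono
      (by simp) fun _ _ => id) ?_ (by omega)
  · intro ht0
    rw [Expr.eval_var, ht6] at ht0
    have hg_le : g ≤ t * g := Nat.le_mul_of_pos_left _ (by omega)
    -- A complete chunk followed by a further element needs more than `g` slots in the node, so this
    -- is not the lowest level and the ends are aligned.
    have hgS : g < S := by omega
    have hrow : j0 / g + t < N / g + 1 := by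
      have h1 : c0 / g ≤ N / g := Nat.div_le_div_right (by omega)
      omega
    exact nodeTable_spec hc (by rw [ha6]; exact hj.tab) hj.node (by simp [hv6, hg])
      (by simp [hv6, hf]) (by simp [hv6, hch]) (by simp [hv6, hjb]) (by simp [hv6, hx0])
      (by simp [hv6, hx1]) hj6 ht6 hg0 hSf hSg
      hch0 hf0 hfg (by rw [ha6]; exact hLG) rfl hx01 hx1S (hx0c hgS) (hx1c hgS) hrow
      ht0 (by omega) hD
      (by rw [hv6 .best] <;> first | exact hbest | decide) fun _ => Iff.rfl
  · intro ht0
    rw [Expr.eval_var, ht6] at ht0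
    refine Triple.flat rfl (by simp [Stmt.cost]) (by simp [Stmt.safe]) ?_
    simp only [run]
    have : s6.var .best = s.var .best := by simp [hv6]
    rw [this]
    refine hbest.congr fun a => ⟨.inl, ?_⟩
    rintro (h | ⟨h1, ⟨h2, h3⟩, h4⟩)
    · exact h
    · have := hin a h1 h2 h3
      rw [hc0, ht0] at h4
      omega
  intro s7 hs7 hb7
  have hv7 : ∀ y, y ≠ .j0 → y ≠ .q → y ≠ .len → y ≠ .res → y ≠ .step → y ≠ .i → y ≠ .p → y ≠ .r →
      y ≠ .t → y ≠ .c0 → y ≠ .base → y ≠ .row → y ≠ .stride → y ≠ .C → y ≠ .x → y ≠ .y → y ≠ .h →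
      y ≠ .acc → y ≠ .best → s7.var y = s.var y :=
    fun y h1 h2 h3 h4 h5 h6 h7 h8 h9 h10 h11 h12 h13 h14 h15 h16 h17 h18 h19 => by
    rw [hs7.var y (by simp [nodeTable, tableQuery, improve, wr, *])]
    exact hv6 y h1 h2 h3 h4 h5 h6 h7 h8 h9 h10
  have ha7 : s7.arr = s.arr := by funext a; rw [hs7.arr a rfl, ha6]
  exact microQuery_spec hc (c0 := c0) (j0 := j0) (r := r) (x0 := x0) (x1 := x1) (H := H)
    (by rw [ha7]; exact hj) (by simp [hv7, hH]) hHW hHW' hgH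
    (by simp [hv7, hg]) (by simp [hv7, hN]) (by simp [hv7, hjb]) (by rw [hs7.var _ rfl, hc6])
    (by rw [hs7.var _ rfl, hj6]) (by rw [hs7.var _ rfl, hr6]) (by simp [hv7, hx0])
    (by simp [hv7, hx1]) hg0 hgW hc0g (by omega) (by omega) (by omega) (by omega) (by omega)
    (by omega) hx01.le hb7 hsplit

end

/-! ### The query program -/

/-! ### Ranks in a set of positions -/

/-- The number of elements of `E` that are less than `x`. -/
def rank (E : Finset ℕ) (x : ℕ) : ℕ := (E.filter (· < x)).card

theorem rank_le_card (E : Finset ℕ) (x : ℕ) : rank E x ≤ E.card := Finset.card_filter_le _ _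

theorem rank_mono (E : Finset ℕ) {x y : ℕ} (h : x ≤ y) : rank E x ≤ rank E y :=
  Finset.card_le_card fun a ha => by
    simp only [Finset.mem_filter] at ha ⊢
    exact ⟨ha.1, ha.2.trans_le h⟩

/-- Ranks grow at most as fast as positions. Hence a sample every `g` positions leaves at most `g`
candidates for the binary search. -/
theorem rank_le_add (E : Finset ℕ) (x y : ℕ) : rank E y ≤ rank E x + (y - x) := by
  have : E.filter (· < y) ⊆ E.filter (· < x) ∪ Finset.Ico x y := fun a ha => by
    simp only [Finset.mem_filter, Finset.mem_union, Finset.mem_Ico] at ha ⊢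
    by_cases h : a < x
    · exact .inl ⟨ha.1, h⟩
    · exact .inr ⟨not_lt.1 h, ha.2⟩
  calc rank E y ≤ _ := Finset.card_le_card this
    _ ≤ _ := Finset.card_union_le _ _
    _ = _ := by rw [Nat.card_Ico]; rfl

theorem rank_lt_rank {E : Finset ℕ} {x y : ℕ} (hx : x ∈ E) (h : x < y) : rank E x < rank E y :=
  Finset.card_lt_card ⟨fun a ha => by
    simp only [Finset.mem_filter] at ha ⊢
    exact ⟨ha.1, ha.2.trans h⟩, fun hs => by
    have := hs (Finset.mem_filter.2 ⟨hx, h⟩)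
    simp at this⟩

/-- Only one of the two numbers has to belong to `E`. So a range with arbitrary ends can be
expressed by ranks, as far as elements of `E` are concerned. -/
theorem rank_le_rank_iff {E : Finset ℕ} {x y : ℕ} (hy : y ∈ E) : rank E x ≤ rank E y ↔ x ≤ y :=
  ⟨fun h => not_lt.1 fun hlt => absurd (rank_lt_rank hy hlt) (not_lt.2 h), rank_mono E⟩

theorem rank_lt_rank_iff {E : Finset ℕ} {x y : ℕ} (hx : x ∈ E) : rank E x < rank E y ↔ x < y := by
  rw [← not_le, ← not_le]
  refine not_congr ⟨fun h => ?_, rank_mono E⟩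
  by_contra hlt
  exact absurd (rank_lt_rank hx (not_le.1 hlt)) (not_lt.2 h)

/-! ### The data stored for a class -/

/-- The elements whose value is at least `θ`. -/
def above (n : ℕ) (B : ℕ → ℕ) (θ : ℕ) : Finset ℕ := (Finset.range n).filter fun x => θ ≤ B x

theorem mem_above {n θ x : ℕ} {B : ℕ → ℕ} : x ∈ above n B θ ↔ x < n ∧ θ ≤ B x := by
  simp [above]

/-- The job of level `l` of the elements of `E`, at the address `jb`. -/
def HasJob (a : Arr → ℕ → ℕ) (n f jb N l : ℕ) (E : Finset ℕ) : Prop :=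
  ∃ u₁ slot u₂ ar u₃ pr, IsJob (a .NB) (a .AK) (a .PP) (a .MB) (a .MP) (a .T1) jb (f * f) f
    (f ^ (l + 2)) (f ^ (l + 1)) N n E (rank E) (a .RK) (a .B0) u₁ slot u₂ ar u₃ pr

/-- The table of the elements of `E` with one row for each value from `θ` to `θ' - 1`. -/
def HasTop (a : Arr → ℕ → ℕ) (n f tb N θ θ' : ℕ) (E : Finset ℕ) : Prop :=
  IsTable (a .T2) tb (θ' - θ) (N / f ^ 6 + 1)
    ((Nat.log 2 (N / f ^ 6 + 1) + 1) * (N / f ^ 6 + 1)) (θ' - θ) (Nat.log 2 (N / f ^ 6 + 1) + 1)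
    n (a .RK) (fun x => θ' - 1 - min (a .B0 x) (θ' - 1)) (fun x => rank E x / f ^ 6) E

/-- The number of cells of the table `HasTop`. -/
def topSize (f N θ θ' : ℕ) : ℕ :=
  (θ' - θ) * ((Nat.log 2 (N / f ^ 6 + 1) + 1) * (N / f ^ 6 + 1))

/-- The data for the queries with a bound `v` from `θ` to `θ' - 1`, which are stored under the
number `k`. The pools are filled up to `cE`, `jE` and `tE`. -/
structure IsClass (a : Arr → ℕ → ℕ) (n f k θ θ' N cE jE tE : ℕ) : Prop where
  card : a .CN k = N
  th : a .CTH k = θ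
  th' : a .CTH (k + 1) = θ'
  cb_le : a .CB k + N ≤ cE
  pl : Enum (fun i => a .PL (a .CB k + i)) N (above n (a .B0) θ) (· < ·)
  rs : ∀ j ≤ n / (f * f), a .RS (k * (n / (f * f) + 1) + j) = rank (above n (a .B0) θ) (j * (f * f))
  jb_le : ∀ l < 5, a .JT (k * 6 + l) + (N / (f * f) + 1) * (f * f) ≤ jE
  job : ∀ l < 5, HasJob a n f (a .JT (k * 6 + l)) N l (above n (a .B0) θ)
  tb_le : f ^ 6 ≤ N → a .JT (k * 6 + 5) + topSize f N θ θ' ≤ tE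
  top : f ^ 6 ≤ N → HasTop a n f (a .JT (k * 6 + 5)) N θ θ' (above n (a .B0) θ)

/-- Bounds for the parameters. -/
structure Params (c : Lim) (n f H : ℕ) : Prop where
  D_lt : 64 * c.D < c.W
  H_lt : 4 * 2 ^ H < c.W
  H_lt' : H + 1 < c.W
  g_lt : 2 ^ (f * f) < c.W
  f_pos : 0 < f
  lt_H : f ^ 6 < 2 ^ (H + 1)
  n_lt : n + 2 < c.D
  f_lt : f ^ 6 < c.D

namespace Params

variable {c : Lim} {n f H : ℕ}

theorem pow_le (h : Params c n f H) {l : ℕ} (hl : l ≤ 6) : f ^ l ≤ f ^ 6 :=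
  Nat.pow_le_pow_right h.f_pos hl

theorem g_le (h : Params c n f H) : f * f ≤ f ^ 6 := by
  rw [← pow_two]; exact h.pow_le (by norm_num)

theorem g_pos (h : Params c n f H) : 0 < f * f := Nat.mul_pos h.f_pos h.f_pos

theorem log_le (h : Params c n f H) : (Nat.log 2 f + 1) * f ≤ f * f :=
  Nat.mul_le_mul_right _ (Nat.log_lt_self 2 h.f_pos.ne')

end Params

/-! ### One level of the tree -/

/-- Take the elements of a node with a position from `x0` to `x1 - 1` into account, if any. -/
def guardedQuery : Stmt := .ite (lt (var .x0) (var .x1)) nodeQuery .skip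

/-- The registers hold the description of a level. -/
structure AtLevel (s : St) (a : Arr → ℕ → ℕ) (f H N l jb v : ℕ) : Prop where
  earr : s.arr = a
  eH : s.var .H = H
  eg : s.var .g = f * f
  ef : s.var .f = f
  eS : s.var .S = f ^ (l + 2)
  ech : s.var .ch = f ^ (l + 1)
  eN : s.var .N = N
  ejb : s.var .jb = jb
  ev : s.var .v = v

theorem AtLevel.congr {s s' : St} {a : Arr → ℕ → ℕ} {f H N l jb v : ℕ}
    (h : AtLevel s a f H N l jb v) (ha : s'.arr = s.arr)
    (hv : ∀ y ∈ [Reg.H, .g, .f, .S, .ch, .N, .jb, .v], s'.var y = s.var y) :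
    AtLevel s' a f H N l jb v := by
  constructor
  · rw [ha, h.earr]
  all_goals rw [hv _ (by simp)]
  exacts [h.eH, h.eg, h.ef, h.eS, h.ech, h.eN, h.ejb, h.ev]

theorem guardedQuery_spec {c : Lim} {n f H N l jb v x0 x1 : ℕ} {s : St} {a : Arr → ℕ → ℕ}
    {E : Finset ℕ} {P Q : ℕ → Prop} (hp : Params c n f H) (hs : AtLevel s a f H N l jb v)
    (hl : l < 5) (hj : HasJob a n f jb N l E) (hD : jb + (N / (f * f) + 1) * (f * f) < c.D)
    (hLG : ∀ i, 0 < i → i ≤ f → a .LG i = Nat.log 2 i)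
    (hx0 : s.var .x0 = x0) (hx1 : s.var .x1 = x1)
    (hx1S : x0 < x1 → x1 ≤ x0 / f ^ (l + 2) * f ^ (l + 2) + f ^ (l + 2)) (hx1N : x1 ≤ N)
    (hx0c : x0 < x1 → 1 ≤ l → f ^ (l + 1) ∣ x0) (hx1c : x0 < x1 → 1 ≤ l → f ^ (l + 1) ∣ x1)
    (hbest : MinOver n (a .RK) P (s.var .best))
    (hQ : ∀ x, Q x ↔ P x ∨ (x ∈ E ∧ (x0 ≤ rank E x ∧ rank E x < x1) ∧ v ≤ a .B0 x)) :
    Triple c guardedQuery s (910 * (H + 2)) fun s' => MinOver n (a .RK) Q (s'.var .best) := by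
  refine (Triple.ite (T := 900 * (H + 2)) (by simp) ?_ ?_).mono (by simp; omega) fun _ _ => id
  · intro h
    simp only [Expr.eval_lt, Expr.eval_var, hx0, hx1] at h
    have hlt : x0 < x1 := by by_contra h'; simp [h'] at h
    obtain ⟨u₁, slot, u₂, ar, u₃, pr, hj⟩ := hj
    have e : f ^ (l + 2) = f ^ (l + 1) * f := pow_succ f (l + 1)
    -- On level `0` a node has `f ^ 2 = f * f` elements, that is, one chunk, and no alignment is
    -- needed.
    have e1 : f * f < f ^ (l + 2) → 1 ≤ l := fun h => by
      by_contra h0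
      rw [show l = 0 by omega] at h
      simp [pow_two] at h
    have h6 := hp.pow_le (show l + 2 ≤ 6 by omega)
    have hg6 := hp.g_le
    have hH := hp.lt_H
    exact nodeQuery_spec hp.D_lt (by rw [hs.earr]; exact hj) hs.eH hp.H_lt hp.H_lt' (by omega)
      (by omega) hs.eg hs.ef hs.eS hs.ech hs.eN hs.ejb hx0 hx1 hs.ev hp.g_pos hp.g_lt e
      (Nat.mod_eq_zero_of_dvd (by rw [← pow_two]; exact pow_dvd_pow f (by omega)))
      (pow_pos hp.f_pos _) hp.f_pos hp.log_le (by rw [hs.earr]; exact hLG) hlt (hx1S hlt) hx1N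
      (fun h => Nat.mod_eq_zero_of_dvd (hx0c hlt (e1 h)))
      (fun h => Nat.mod_eq_zero_of_dvd (hx1c hlt (e1 h))) hD hbest hQ
  · intro h
    simp only [Expr.eval_lt, Expr.eval_var, hx0, hx1] at h
    have hlt : ¬ x0 < x1 := by intro h'; simp [h'] at h
    refine Triple.flat rfl (by simp [Stmt.cost]; omega) (by simp [Stmt.safe]) ?_
    simp only [run]
    refine hbest.congr fun x => ?_
    rw [hQ]
    exact ⟨.inl, fun h => h.elim id fun h => absurd (h.2.1.1.trans_lt h.2.1.2) hlt⟩

/-- Remove the incomplete nodes of a level from both ends of the range. -/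
def levelQuery : Stmt :=
  .S ::= var .ch * var .f ;;
  .jb ::= get .JT (var .k * 6 + var .l) ;;
  .x0 ::= var .b ;;
  minInto .x1 ((var .b + (var .S - 1)) / var .S * var .S) (var .e) ;;
  guardedQuery ;;
  .b ::= var .x1 ;;
  .x0 ::= var .e / var .S * var .S ;;
  .ite (lt (var .x0) (var .b)) (.x0 ::= var .b) .skip ;;
  .x1 ::= var .e ;;
  guardedQuery ;;
  .e ::= var .x0 ;;
  .ch ::= var .S

theorem le_ceil {b S : ℕ} (hS : 0 < S) : b ≤ (b + (S - 1)) / S * S := by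
  have e1 := Nat.div_add_mod (b + (S - 1)) S
  have e2 := Nat.mod_lt (b + (S - 1)) hS
  rw [mul_comm] at e1
  omega

theorem ceil_le {b S : ℕ} (hS : 0 < S) : (b + (S - 1)) / S * S ≤ b / S * S + S := by
  have e1 := Nat.div_add_mod b S
  have e2 := Nat.mod_lt b hS
  have : (b + (S - 1)) / S ≤ b / S + 1 := by
    rw [← Nat.lt_succ_iff, Nat.div_lt_iff_lt_mul hS, Nat.succ_mul, Nat.add_mul, mul_comm (b / S)]
    omega
  calc _ ≤ (b / S + 1) * S := Nat.mul_le_mul_right _ this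
    _ = _ := by ring

/-- `best` covers the part of the original range `[b0, e0)` outside the remaining range `[b, e)`.
The level moves `b` up and `e` down to the next node boundaries. The two pieces removed lie in one
node each, and their ends are multiples of `f ^ (l + 1)` by the previous level, hence borders of
children. -/
theorem levelQuery_spec {c : Lim} {n f H N l k v b e b0 e0 : ℕ} {s : St} {a : Arr → ℕ → ℕ}
    {E : Finset ℕ} (hp : Params c n f H) (hl : l < 5)
    (hj : HasJob a n f (a .JT (k * 6 + l)) N l E)
    (hD : a .JT (k * 6 + l) + (N / (f * f) + 1) * (f * f) < c.D) (hk : k * 6 + 6 < c.D)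
    (hLG : ∀ i, 0 < i → i ≤ f → a .LG i = Nat.log 2 i) (hN : N ≤ n)
    (harr : s.arr = a) (hH : s.var .H = H) (hg : s.var .g = f * f) (hf : s.var .f = f)
    (hch : s.var .ch = f ^ (l + 1)) (hNv : s.var .N = N) (hv : s.var .v = v)
    (hkv : s.var .k = k) (hlv : s.var .l = l) (hb : s.var .b = b) (he : s.var .e = e)
    (hbe : b ≤ e) (heN : e ≤ N) (hb0 : b0 ≤ b) (he0 : e ≤ e0)
    (hdvd : b < e → 1 ≤ l → f ^ (l + 1) ∣ b ∧ f ^ (l + 1) ∣ e)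
    (hbest : MinOver n (a .RK) (fun x => (x ∈ E ∧ v ≤ a .B0 x) ∧ (b0 ≤ rank E x ∧ rank E x < e0) ∧
      ¬ (b ≤ rank E x ∧ rank E x < e)) (s.var .best)) :
    Triple c levelQuery s (2000 * (H + 2)) fun s' => ∃ b' e', s'.var .ch = f ^ (l + 2) ∧
      s'.var .b = b' ∧ s'.var .e = e' ∧ b' ≤ e' ∧ e' ≤ N ∧ b0 ≤ b' ∧ e' ≤ e0 ∧
      (b' < e' → f ^ (l + 2) ∣ b' ∧ f ^ (l + 2) ∣ e') ∧
      MinOver n (a .RK) (fun x => (x ∈ E ∧ v ≤ a .B0 x) ∧ (b0 ≤ rank E x ∧ rank E x < e0) ∧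
        ¬ (b' ≤ rank E x ∧ rank E x < e')) (s'.var .best) := by
  have hS : f ^ (l + 1) * f = f ^ (l + 2) := (pow_succ f (l + 1)).symm
  have h6 := hp.pow_le (show l + 2 ≤ 6 by omega)
  have h6D := hp.f_lt
  have hDW := hp.D_lt
  have hnD := hp.n_lt
  have hSpos : 0 < f ^ (l + 2) := pow_pos hp.f_pos _
  have hdv : f ^ (l + 1) ∣ f ^ (l + 2) := pow_dvd_pow f (by omega)
  set S := f ^ (l + 2) with hSdef
  have c1 := le_ceil (b := b) hSpos
  have c2 := ceil_le (b := b) hSpos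
  have c3 := Nat.div_mul_le_self b S
  have c4 := Nat.div_mul_le_self e S
  have c5 := Nat.lt_div_mul_add (a := e) hSpos
  -- If no node boundary lies in the range, then `b' = e' = e`: the first piece takes everything and
  -- nothing remains.
  set b' := min ((b + (S - 1)) / S * S) e with hb'
  set e' := max (e / S * S) b' with he'
  have d1 : b ≤ b' := by omega
  have d2 : b' ≤ e' := by omega
  have d3 : e' ≤ e := by omega
  refine Triple.assign_seq (T := 1990 * (H + 2)) (by simp [hch, hf, hS]; omega) ?_ (by simp; omega)
  refine Triple.assign_seq (T := 1980 * (H + 2)) (by simp [hkv, hlv]; omega) ?_ (by simp; omega)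
  refine Triple.assign_seq (T := 1970 * (H + 2)) (by simp) ?_ (by simp; omega)
  refine minInto_triple (T := 1940 * (H + 2)) (by simp [hch, hf, hS, hb]; omega) (by simp) (by simp)
    ?_ (by simp; omega)
  set s1 := (((s.setVar .S _).setVar .jb _).setVar .x0 _).setVar .x1 _ with hs1
  have hx0 : s1.var .x0 = b := by simp [hs1, hb]
  have hx1 : s1.var .x1 = b' := by simp [hs1, hb, he, hch, hf, hS, hb']
  have hb1 : s1.var .best = s.var .best := by simp [hs1]
  have he1 : s1.var .e = e := by simp [hs1, he]
  have hl1 : AtLevel s1 a f H N l (a .JT (k * 6 + l)) v := by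
    constructor <;> simp [hs1, harr, hH, hg, hf, hch, hS, hNv, hv, hkv, hlv, hSdef]
  refine Triple.seq_le (T₁ := 910 * (H + 2)) (T₂ := 1000 * (H + 2)) (guardedQuery_spec hp hl1 hl hj
    hD hLG hx0 hx1 (fun _ => by rw [← hSdef]; omega) (by omega) ?_ ?_ (by rw [hb1]; exact hbest)
    (fun x => Iff.rfl)) ?_ (by omega)
  · exact fun h h' => (hdvd (by omega) h').1
  · intro h h'
    rcases min_choice ((b + (S - 1)) / S * S) e with h0 | h0
    · rw [hb', h0]; exact hdv.trans (Dvd.intro_left _ rfl)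
    · rw [hb', h0]; exact (hdvd (by omega) h').2
  intro s2 hs2 hbest2
  have hl2 : AtLevel s2 a f H N l (a .JT (k * 6 + l)) v :=
    hl1.congr (by funext x; rw [hs2.arr x rfl]) (by
      intro y hy
      apply hs2.var
      fin_cases hy <;> rfl)
  have hx12 : s2.var .x1 = b' := by rw [hs2.var _ rfl, hx1]
  have he2 : s2.var .e = e := by rw [hs2.var _ rfl, he1]
  refine Triple.assign_seq (T := 990 * (H + 2)) (by simp) ?_ (by simp; omega)
  refine Triple.assign_seq (T := 980 * (H + 2)) (by simp [he2, hl2.eS, ← hSdef]; omega) ?_ (by simp; omega)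
  set s3 := (s2.setVar .b _).setVar .x0 _ with hs3
  have h3 : s3.var .x0 = e / S * S ∧ s3.var .b = b' ∧ s3.var .e = e ∧ s3.var .best = s2.var .best := by
    simp [hs3, he2, hl2.eS, hx12, hSdef]
  refine Triple.seq_le (T₁ := 20) (T₂ := 960 * (H + 2)) (Q₁ := fun s' => s'.var .x0 = e')
    (Triple.flat rfl (by simp [Stmt.cost]) (by simp [Stmt.safe, run]) ?_) ?_ (by omega)
  · by_cases h : e / S * S < b'
    · simp [run, h3, h, he', h.le]
    · simp [run, h3, h, he', not_lt.1 h]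
  intro s4 hs4 hx04
  refine Triple.assign_seq (T := 950 * (H + 2)) (by simp) ?_ (by simp; omega)
  set s5 := s4.setVar .x1 _ with hs5
  have hx05 : s5.var .x0 = e' := by simp [hs5, hx04]
  have hx15 : s5.var .x1 = e := by simp [hs5, hs4.var, wr, h3]
  have hb5 : s5.var .b = b' := by simp [hs5, hs4.var, wr, h3]
  have hbe5 : s5.var .best = s2.var .best := by simp [hs5, hs4.var, wr, h3]
  have hl5 : AtLevel s5 a f H N l (a .JT (k * 6 + l)) v :=
    hl2.congr (by funext x; simp [hs5, hs4.arr, wa, hs3]) (by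
      intro y hy
      fin_cases hy <;> simp [hs5, hs4.var, wr, hs3])
  refine Triple.seq_le (T₁ := 910 * (H + 2)) (T₂ := 20) (guardedQuery_spec hp hl5 hl hj hD hLG hx05
    hx15 ?_ (by omega) ?_ ?_ (by rw [hbe5]; exact hbest2) (fun x => Iff.rfl)) ?_ (by omega)
  · intro h
    have e1 : e' / S = e / S := by
      rw [Nat.div_eq_iff hSpos]
      omega
    rw [← hSdef, e1]; omega
  · intro h h'
    rcases max_choice (e / S * S) b' with h0 | h0
    · rw [he', h0]; exact hdv.trans (Dvd.intro_left _ rfl)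
    · rcases min_choice ((b + (S - 1)) / S * S) e with h1 | h1
      · rw [he', h0, hb', h1]; exact hdv.trans (Dvd.intro_left _ rfl)
      · omega
  · exact fun h h' => (hdvd (by omega) h').2
  intro s6 hs6 hbest6
  have f1 : s6.var .b = b' := by rw [hs6.var _ rfl, hb5]
  have f2 : s6.var .x0 = e' := by rw [hs6.var _ rfl, hx05]
  have f3 : s6.var .S = S := by rw [hs6.var _ rfl, hl5.eS]
  refine Triple.flat rfl (by simp [Stmt.cost]) (by simp [Stmt.safe, run]) ?_
  refine ⟨b', e', by simp [run, f3], by simp [run, f1], by simp [run, f2], d2, by omega, by omega,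
    by omega, ?_, ?_⟩
  · intro h
    have g1 : b' = (b + (S - 1)) / S * S := by omega
    have g2 : e' = e / S * S := by omega
    exact ⟨g1 ▸ Dvd.intro_left _ rfl, g2 ▸ Dvd.intro_left _ rfl⟩
  · have : (run (.e ::= var .x0 ;; .ch ::= var .S) s6).var .best = s6.var .best := by simp [run]
    rw [this]
    refine hbest6.congr fun x => ?_
    constructor
    · rintro ((⟨g1, g2, g3⟩ | ⟨g1, g2, g3⟩) | ⟨g1, g2, g3⟩)
      · exact ⟨g1, g2, by omega⟩
      · exact ⟨⟨g1, g3⟩, by omega, by omega⟩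
      · exact ⟨⟨g1, g3⟩, by omega, by omega⟩
    · rintro ⟨g1, g2, g3⟩
      by_cases g4 : b ≤ rank E x ∧ rank E x < e
      · by_cases g5 : rank E x < b'
        · exact .inl (.inr ⟨g1.1, ⟨g4.1, g5⟩, g1.2⟩)
        · exact .inr ⟨g1.1, by omega, g1.2⟩
      · exact .inl (.inl ⟨g1, g2, g4⟩)

/-! ### From positions to ranks -/

/-- Replace a position by the number of elements of the class before it. -/
def rankOf (x : Reg) : Stmt :=
  .c0 ::= get .RS (var .k * var .ns + var x / var .g) ;;
  minInto .q (var .g) (var .N - var .c0) ;;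
  bsearch (var .q) (lt (get .PL (var .cb + (var .c0 + (var .p - 1)))) (var x)) ;;
  x ::= var .c0 + var .res

/-- The stored sample `c0` is the rank of the multiple of `g` just below `xx`. The remaining
elements before `xx` are among the next `g` entries of the sorted list of the class. -/
theorem rankOf_spec {c : Lim} {n f H k θ θ' N cE jE tE xx : ℕ} {s : St} {a : Arr → ℕ → ℕ}
    (hp : Params c n f H) (hc : IsClass a n f k θ θ' N cE jE tE) {x : Reg}
    (hx : x = .b ∨ x = .e) (harr : s.arr = a) (hH : s.var .H = H) (hg : s.var .g = f * f)
    (hN : s.var .N = N) (hk : s.var .k = k) (hns : s.var .ns = n / (f * f) + 1)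
    (hcb : s.var .cb = a .CB k) (hxv : s.var x = xx) (hxn : xx ≤ n) (hcE : cE < c.D)
    (hkD : k * (n / (f * f) + 1) + n / (f * f) + 1 < c.D) :
    Triple c (rankOf x) s (100 * (H + 2)) fun s' =>
      s'.var x = rank (above n (a .B0) θ) xx := by
  set E := above n (a .B0) θ with hE
  have hDW := hp.D_lt
  have hxg : xx / (f * f) ≤ n / (f * f) := Nat.div_le_div_right hxn
  have hx1 : xx / (f * f) * (f * f) ≤ xx := Nat.div_mul_le_self _ _
  have hx2 := Nat.lt_div_mul_add (a := xx) hp.g_pos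
  set c0 := rank E (xx / (f * f) * (f * f)) with hc0
  have hcard := hc.pl.card
  have r1 : c0 ≤ rank E xx := rank_mono E hx1
  have r2 : rank E xx ≤ N := hcard ▸ rank_le_card E xx
  have r3 : rank E xx ≤ c0 + f * f := (rank_le_add E (xx / (f * f) * (f * f)) _).trans (by omega)
  have hrs := hc.rs _ hxg
  set d := n / (f * f) with hd
  set q := xx / (f * f) with hq
  clear_value d q
  have hcb' := hc.cb_le
  have hgH := hp.g_le
  have hgH' := hp.lt_H
  have hne : x ≠ .c0 ∧ x ≠ .q ∧ x ≠ .len ∧ x ≠ .res ∧ x ≠ .step ∧ x ≠ .i ∧ x ≠ .p := by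
    rcases hx with rfl | rfl <;> simp
  have hidx : k * (d + 1) + q < c.D := by omega
  refine Triple.assign_seq (T := 93 * (H + 2)) ?_ ?_ (by simp; omega)
  · simp [hg, hk, hns, hxv, ← hq]
    omega
  set s1 := s.setVar .c0 _ with hs1
  have hN1 : s1.var .N = N := by simp [hs1, hN]
  have v1 : s1.var .c0 = c0 := by simp [hs1, hg, hk, hns, hxv, harr, ← hq, hrs, hc0, hE]
  refine minInto_triple (T := 83 * (H + 2)) (by simp) (by simp [v1, hN1]; omega) (by simp) ?_
    (by simp; omega)
  set s2 := s1.setVar .q _ with hs2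
  have v2 : ∀ y, y ≠ .c0 → y ≠ .q → s2.var y = s.var y := fun y h1 h2 => by
    simp [hs2, hs1, h1, h2]
  have hq2 : s2.var .q = min (f * f) (N - c0) := by rw [hs2]; simp [v1]; simp [hs1, hg, hN]
  have hc2 : s2.var .c0 = c0 := by simp [hs2, v1]
  have ha2 : s2.arr = a := harr
  -- In a sorted list the entries less than `xx` are exactly the first `rank E xx`.
  have hiff : ∀ p, 1 ≤ p → p ≤ min (f * f) (N - c0) →
      (a .PL (a .CB k + (c0 + (p - 1))) < xx ↔ p ≤ rank E xx - c0) := by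
    intro p h1 h2
    have := hc.pl.lt_card_filter_iff (fun _ => lt_irrefl _) (P := (· < xx))
      (fun a _ b _ h1 h2 => h1.trans h2) (i := c0 + (p - 1)) (by omega)
    rw [this]
    show _ < rank E xx ↔ _
    omega
  refine Triple.seq_le (T₁ := 21 + (H + 1) * 50) (T₂ := 5)
    ((bsearch_spec (L := min (f * f) (N - c0)) (fun p => p ≤ rank E xx - c0)
    (by simp [v2, hH] : s2.var .H = H) hp.H_lt hp.H_lt' (by simp) (by simp [hq2])
    ((min_le_left _ _).trans_lt (by omega)) ?_ ?_).mono (by simp) fun _ _ => id) ?_ (by omega)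
  · intro s' hs h1 h2
    have e1 : s'.var .cb = a .CB k := by rw [hs.var _ rfl, v2 _ (by simp) (by simp), hcb]
    have e2 : s'.var .c0 = c0 := by rw [hs.var _ rfl, hc2]
    have e3 : s'.var x = xx := by
      rw [hs.var _ (by simp [bsearch, wr, hne]), v2 _ hne.1 hne.2.1, hxv]
    have e4 : s'.arr = a := by funext y; rw [hs.arr y rfl, ha2]
    simp only [← hiff _ h1 h2]
    simp [e1, e2, e3, e4]
    omega
  · exact fun p q _ h1 _ h2 => h1.trans h2
  rintro s3 hs3 ⟨hres, hok⟩
  have e2 : s3.var .c0 = c0 := by rw [hs3.var _ rfl, hc2]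
  have : c0 + s3.var .res = rank E xx := by
    have h1 := hok (s3.var .res)
    have h2 := hok (rank E xx - c0)
    omega
  refine Triple.flat rfl (by simp [Stmt.cost]) ?_ ?_
  · simp [Stmt.safe, e2]; omega
  · simp [run, e2, this]

/-! ### Ranges of complete nodes of the highest level -/

/-- Answer the query for a range that consists of complete nodes of the highest level. -/
def topQuery : Stmt :=
  .C ::= var .N / var .ch + 1 ;;
  .stride ::= (get .LG (var .C) + 1) * var .C ;;
  .base ::= get .JT (var .k * 6 + 5) ;;
  .row ::= get .CTH (var .k + 1) - 1 - var .v ;;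
  .x ::= var .b / var .ch ;;
  .y ::= var .e / var .ch ;;
  tableQuery .T2

/-- Rows are numbered by descending value, so `v ≤ B` becomes a prefix of rows ending at `θ' - 1 -
v`. Values from `θ' - 1` on are clipped into row `0`, which is harmless because `v < θ'`. -/
theorem topQuery_spec {c : Lim} {n f H k θ θ' N cE jE tE v b e : ℕ} {s : St} {a : Arr → ℕ → ℕ}
    {P Q : ℕ → Prop}
    (hp : Params c n f H) (hc : IsClass a n f k θ θ' N cE jE tE)
    (hLG : ∀ i, 0 < i → i ≤ n + 1 → a .LG i = Nat.log 2 i) (hNn : N ≤ n)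
    (harr : s.arr = a) (hch : s.var .ch = f ^ 6) (hN : s.var .N = N) (hk : s.var .k = k)
    (hv : s.var .v = v) (hb : s.var .b = b) (he : s.var .e = e) (hbe : b < e) (heN : e ≤ N)
    (hbd : f ^ 6 ∣ b) (hed : f ^ 6 ∣ e) (hv1 : θ ≤ v) (hv2 : v < θ') (hkD : k * 6 + 6 < c.D)
    (htE : tE < c.D) (hbest : MinOver n (a .RK) P (s.var .best))
    (hQ : ∀ x, Q x ↔ P x ∨ ((x ∈ above n (a .B0) θ ∧ v ≤ a .B0 x) ∧
      b ≤ rank (above n (a .B0) θ) x ∧ rank (above n (a .B0) θ) x < e)) :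
    Triple c topQuery s 200 fun s' => MinOver n (a .RK) Q (s'.var .best) := by
  have hF : 0 < f ^ 6 := pow_pos hp.f_pos 6
  have hDW := hp.D_lt
  have hn := hp.n_lt
  -- A nonempty aligned range contains a complete node, so the class is large enough to have a
  -- table.
  have hfN : f ^ 6 ≤ N := (Nat.le_of_dvd (by omega) hed).trans heN
  have htop := hc.top hfN
  unfold HasTop at htop
  have htb := hc.tb_le hfN
  have hNF : N / f ^ 6 ≤ N := Nat.div_le_self _ _
  set F := f ^ 6 with hFdef
  set NF := N / F with hNFd
  clear_value NF
  set C := NF + 1 with hC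
  have f1 : b / F * F = b := Nat.div_mul_cancel hbd
  have f2 : e / F * F = e := Nat.div_mul_cancel hed
  have f4 : b / F < e / F := by
    by_contra h
    have := Nat.mul_le_mul_right F (not_lt.1 h)
    omega
  have f3 : e / F ≤ NF := hNFd ▸ Nat.div_le_div_right heN
  set bF := b / F with hbF
  set eF := e / F with heF
  clear_value bF eF
  have hlg := hLG C (by omega) (by omega)
  have hts : topSize f N θ θ' = (θ' - θ) * ((Nat.log 2 C + 1) * C) := by
    simp only [topSize, hC, hNFd, hFdef]
  have hst : (Nat.log 2 C + 1) * C ≤ topSize f N θ θ' :=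
    hts ▸ Nat.le_mul_of_pos_left _ (by omega)
  have hC1 : C ≤ (Nat.log 2 C + 1) * C := Nat.le_mul_of_pos_left _ (by omega)
  have hlC : Nat.log 2 C + 1 ≤ (Nat.log 2 C + 1) * C := Nat.le_mul_of_pos_right _ (by omega)
  have hth' := hc.th'
  set L := (Nat.log 2 C + 1) * C with hL
  refine Triple.assign_seq (T := 190) (by simp [hN, hch, ← hNFd]; omega) (Triple.assign_seq (T := 170)
    (by simp [hN, hch, ← hNFd, ← hC, harr, hlg, ← hL]; omega) (Triple.assign_seq (T := 155)
    (by simp [hk]; omega) (Triple.assign_seq (T := 140) (by simp [hk, harr, hth', hv]; omega)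
    (Triple.assign_seq (T := 125) (by simp) (Triple.assign_seq (T := 110) (by simp) ?_
    (by simp)) (by simp)) (by simp)) (by simp)) (by simp)) (by simp)
  refine (tableQuery_spec hp.D_lt (base := a .JT (k * 6 + 5)) (rows := θ' - θ) (C := C)
    (stride := L) (G := θ' - θ) (Hn := Nat.log 2 C + 1) (n := n) (ρ := θ' - 1 - v) (x := bF)
    (y := eF) (κ := a .RK) (E := above n (a .B0) θ) (P := P) (Q := Q)
    (row := fun x => θ' - 1 - min (a .B0 x) (θ' - 1))
    (col := fun x => rank (above n (a .B0) θ) x / F)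
    (by simpa [harr] using htop) (by simp [harr, hk]) (by simp [harr, hk, hth', hv])
    (by simp [harr, hN, hch, ← hNFd, ← hC, hlg, ← hL]) (by simp [hN, hch, ← hNFd, ← hC]) (by simp [hb, hch, hbF])
    (by simp [he, hch, heF]) f4 (by omega) (by omega)
    (by simpa [harr] using hLG (eF - bF) (by omega) (by omega)) (Nat.lt_succ_self _) le_rfl
    (by omega) (by rw [hts] at htb; omega) (by simpa using hbest) ?_).mono (by norm_num)
    fun _ _ => id
  intro x
  rw [hQ]
  refine or_congr_right ?_
  -- There is a single group of rows, so the condition on the group is void for elements of the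
  -- class.
  have e1 : ∀ x, (θ' - 1 - min (a .B0 x) (θ' - 1)) / (θ' - θ) = 0 ∨ a .B0 x < θ := by
    intro x
    by_cases h : a .B0 x < θ
    · exact .inr h
    · exact .inl (Nat.div_eq_of_lt (by omega))
  have e2 : (θ' - 1 - v) / (θ' - θ) = 0 := Nat.div_eq_of_lt (by omega)
  rw [Nat.div_lt_iff_lt_mul hF, f2, Nat.le_div_iff_mul_le hF, f1, e2]
  constructor
  · rintro ⟨⟨h1, h2⟩, h3, h4⟩
    have h5 := (mem_above.1 h1).2
    exact ⟨⟨h1, by omega, (e1 x).resolve_right (by omega)⟩, h3, h4⟩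
  · rintro ⟨⟨h1, h2, -⟩, h3, h4⟩
    exact ⟨⟨h1, by omega⟩, h3, h4⟩

/-! ### The whole query -/

/-- Put the answer of the query with the bounds `b`, `e`, `v` into the register `best`. -/
def query : Stmt :=
  .n ::= get .META 0 ;;
  .f ::= get .META 1 ;;
  .g ::= get .META 2 ;;
  .H ::= get .META 3 ;;
  .NC ::= get .META 4 ;;
  .ns ::= get .META 5 ;;
  bsearch (var .NC - 1) (le (get .CTH (var .p)) (var .v)) ;;
  .k ::= var .res ;;
  .N ::= get .CN (var .k) ;;
  .cb ::= get .CB (var .k) ;;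
  rankOf .b ;;
  rankOf .e ;;
  .best ::= var .n ;;
  .ch ::= var .f ;;
  .loop .l 5 levelQuery ;;
  .ite (lt (var .b) (var .e)) topQuery .skip ;;
  .best ::= get .AO (var .best) + 1

/-- The contents of the arrays from which the queries are answered. -/
structure IsData (c : Lim) (a : Arr → ℕ → ℕ) (n f H NC : ℕ) (θ : ℕ → ℕ) : Prop where
  params : Params c n f H
  meta0 : a .META 0 = n
  meta1 : a .META 1 = f
  meta2 : a .META 2 = f * f
  meta3 : a .META 3 = H
  meta4 : a .META 4 = NC
  meta5 : a .META 5 = n / (f * f) + 1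
  NC_pos : 0 < NC
  NC_lt : NC < 2 ^ (H + 1)
  NC_D : NC * 6 + 6 < c.D
  ns_D : NC * (n / (f * f) + 1) < c.D
  θ_zero : θ 0 = 0
  θ_mono : Monotone θ
  lt_θ : ∀ x < n, a .B0 x < θ NC
  log : ∀ i, 0 < i → i ≤ max (n + 1) f → a .LG i = Nat.log 2 i
  rk_lt : ∀ x < n, a .RK x < n
  ao_rk : ∀ x < n, a .AO (a .RK x) = x
  rk_le : ∀ x < n, ∀ y < n, a .RK x ≤ a .RK y → a .A0 x < a .A0 y ∨ a .A0 x = a .A0 y ∧ x ≤ y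
  cls : ∀ k < NC, ∃ N cE jE tE, cE < c.D ∧ jE < c.D ∧ tE < c.D ∧
    IsClass a n f k (θ k) (θ (k + 1)) N cE jE tE

/-- One search finds the class, two find the ranks of the ends, and then five levels and at most one
table cover the range. Since there is a constant number of searches, each over fewer than `2 ^ (H +
1)` items, the time is linear in `H`. -/
theorem query_spec {c : Lim} {n f H NC b e v : ℕ} {θ : ℕ → ℕ} {s : St} {a : Arr → ℕ → ℕ}
    (hd : IsData c a n f H NC θ) (harr : s.arr = a) (hb : s.var .b = b) (he : s.var .e = e)
    (hv : s.var .v = v) (hbn : b ≤ n) (hen : e ≤ n)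
    (hne : ∃ x, (b ≤ x ∧ x < e) ∧ v ≤ a .B0 x) :
    Triple c query s (12000 * (H + 2)) fun s' => ∃ x, s'.var .best = x + 1 ∧
      ((b ≤ x ∧ x < e) ∧ v ≤ a .B0 x) ∧ ∀ y, (b ≤ y ∧ y < e) ∧ v ≤ a .B0 y →
        a .A0 x < a .A0 y ∨ a .A0 x = a .A0 y ∧ x ≤ y := by
  have hp := hd.params
  have hDW := hp.D_lt
  have hnD := hp.n_lt
  have hNCD := hd.NC_D
  have hNC0 := hd.NC_pos
  refine Triple.assign_seq (T := 11990 * (H + 2)) (by simp; omega) (Triple.assign_seq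
    (T := 11980 * (H + 2)) (by simp; omega) (Triple.assign_seq (T := 11970 * (H + 2))
    (by simp; omega) (Triple.assign_seq (T := 11960 * (H + 2)) (by simp; omega)
    (Triple.assign_seq (T := 11950 * (H + 2)) (by simp; omega) (Triple.assign_seq
    (T := 11940 * (H + 2)) (by simp; omega) ?_ (by simp; omega)) (by simp; omega))
    (by simp; omega)) (by simp; omega)) (by simp; omega)) (by simp; omega)
  set s1 := (((((s.setVar .n _).setVar .f _).setVar .g _).setVar .H _).setVar .NC _).setVar .ns _
    with hs1
  have ha1 : s1.arr = a := harr
  have w1 : s1.var .n = n := by simp [hs1, harr, hd.meta0]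
  have w2 : s1.var .f = f := by simp [hs1, harr, hd.meta1]
  have w3 : s1.var .g = f * f := by simp [hs1, harr, hd.meta2]
  have w4 : s1.var .H = H := by simp [hs1, harr, hd.meta3]
  have w5 : s1.var .NC = NC := by simp [hs1, harr, hd.meta4]
  have w6 : s1.var .ns = n / (f * f) + 1 := by simp [hs1, harr, hd.meta5]
  have w7 : s1.var .b = b ∧ s1.var .e = e ∧ s1.var .v = v := by simp [hs1, hb, he, hv]
  clear_value s1
  have hcth : ∀ k < NC, a .CTH k = θ k := fun k hk => by
    obtain ⟨N, cE, jE, tE, -, -, -, h⟩ := hd.cls k hk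
    exact h.th
  refine Triple.seq_le (T₁ := 30 + (H + 1) * 50) (T₂ := 11000 * (H + 2))
    ((bsearch_spec (L := NC - 1) (fun p => θ p ≤ v) w4 hp.H_lt hp.H_lt' (by simp [w5]; omega)
    (by simp [w5]) (by have := hd.NC_lt; omega) ?_ ?_).mono (by simp; omega) fun _ _ => id) ?_ (by omega)
  · intro s' hs h1 h2
    have e1 : s'.var .v = v := by rw [hs.var _ rfl, w7.2.2]
    have e2 : s'.arr = a := by funext y; rw [hs.arr y rfl, ha1]
    simp [e1, e2, hcth _ (show s'.var .p < NC by omega)]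
    omega
  · exact fun p q _ h1 _ h2 => (hd.θ_mono h1).trans h2
  rintro s2 hs2 ⟨hres, hok⟩
  set k := s2.var .res with hk
  have hkNC : k < NC := by omega
  -- The search does not test class `0`; there `θ 0 = 0` suffices.
  have hθ1 : θ k ≤ v := by
    by_cases h0 : k = 0
    · rw [h0, hd.θ_zero]; exact Nat.zero_le _
    · exact (hok k (by omega) hres).2 le_rfl
  obtain ⟨x0, hx0, hx0v⟩ := hne
  -- For the last class the upper threshold exceeds all values of `B`, and some value is at least
  -- `v`.
  have hθ2 : v < θ (k + 1) := by
    by_cases h : k + 1 = NC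
    · rw [h]; exact hx0v.trans_lt (hd.lt_θ x0 (by omega))
    · by_contra h'
      have := (hok (k + 1) (by omega) (by omega)).1 (not_lt.1 h')
      omega
  obtain ⟨N, cE, jE, tE, hcE, hjE, htE, hc⟩ := hd.cls k hkNC
  set E := above n (a .B0) (θ k) with hE
  have hcard := hc.pl.card
  have hNn : N ≤ n := by
    rw [← hcard]
    exact (Finset.card_filter_le _ _).trans (by simp)
  have hcn := hc.card
  have ha2 : s2.arr = a := by funext y; rw [hs2.arr y rfl, ha1]
  have hks : k * (n / (f * f) + 1) + (n / (f * f) + 1) < c.D := by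
    have h1 := hd.ns_D
    have h2 : k * (n / (f * f) + 1) + (n / (f * f) + 1) ≤ NC * (n / (f * f) + 1) := by
      rw [← Nat.succ_mul]; exact Nat.mul_le_mul_right _ hkNC
    omega
  refine Triple.assign_seq (T := 10990 * (H + 2)) (by simp) (Triple.assign_seq
    (T := 10980 * (H + 2)) (by simp; omega) (Triple.assign_seq (T := 10970 * (H + 2))
    (by simp; omega) ?_ (by simp; omega)) (by simp; omega)) (by simp; omega)
  set s3 := ((s2.setVar .k _).setVar .N _).setVar .cb _ with hs3
  have hv3 : ∀ y, y ≠ .k → y ≠ .N → y ≠ .cb → y ≠ .len → y ≠ .res → y ≠ .step → y ≠ .i → y ≠ .p →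
      s3.var y = s1.var y := fun y h1 h2 h3 h4 h5 h6 h7 h8 => by
    simp [hs3, h1, h2, h3]
    exact hs2.var y (by simp [bsearch, wr, *])
  have u1 : s3.var .k = k := by simp [hs3, hk]
  have u2 : s3.var .N = N := by simp [hs3, ha2, ← hk, hcn]
  have u3 : s3.var .cb = a .CB k := by simp [hs3, ha2, ← hk]
  have u4 : s3.var .n = n := by rw [hv3 _ (by simp)] <;> first | exact w1 | simp
  have u5 : s3.var .f = f := by rw [hv3 _ (by simp)] <;> first | exact w2 | simp
  have u6 : s3.var .g = f * f := by rw [hv3 _ (by simp)] <;> first | exact w3 | simp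
  have u7 : s3.var .H = H := by rw [hv3 _ (by simp)] <;> first | exact w4 | simp
  have u8 : s3.var .ns = n / (f * f) + 1 := by rw [hv3 _ (by simp)] <;> first | exact w6 | simp
  have u9 : s3.var .b = b := by rw [hv3 _ (by simp)] <;> first | exact w7.1 | simp
  have u10 : s3.var .e = e := by rw [hv3 _ (by simp)] <;> first | exact w7.2.1 | simp
  have u11 : s3.var .v = v := by rw [hv3 _ (by simp)] <;> first | exact w7.2.2 | simp
  have ha3 : s3.arr = a := ha2
  clear_value s3
  refine Triple.seq_le (T₁ := 100 * (H + 2)) (T₂ := 10800 * (H + 2)) (rankOf_spec hp hc (.inl rfl)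
    ha3 u7 u6 u2 u1 u8 u3 u9 hbn hcE (by omega)) ?_ (by omega)
  intro s4 hs4 q9
  have q1 : s4.var .k = k := by rw [hs4.var _ rfl, u1]
  have q2 : s4.var .N = N := by rw [hs4.var _ rfl, u2]
  have q3 : s4.var .cb = a .CB k := by rw [hs4.var _ rfl, u3]
  have q4 : s4.var .n = n := by rw [hs4.var _ rfl, u4]
  have q5 : s4.var .f = f := by rw [hs4.var _ rfl, u5]
  have q6 : s4.var .g = f * f := by rw [hs4.var _ rfl, u6]
  have q7 : s4.var .H = H := by rw [hs4.var _ rfl, u7]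
  have q8 : s4.var .ns = n / (f * f) + 1 := by rw [hs4.var _ rfl, u8]
  have q10 : s4.var .e = e := by rw [hs4.var _ rfl, u10]
  have q11 : s4.var .v = v := by rw [hs4.var _ rfl, u11]
  have ha4 : s4.arr = a := by funext y; rw [hs4.arr y rfl, ha3]
  refine Triple.seq_le (T₁ := 100 * (H + 2)) (T₂ := 10700 * (H + 2)) (rankOf_spec hp hc (.inr rfl)
    ha4 q7 q6 q2 q1 q8 q3 q10 hen hcE (by omega)) ?_ (by omega)
  intro s5 hs5 p10
  refine Triple.assign_seq (T := 10690 * (H + 2)) (by simp) (Triple.assign_seq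
    (T := 10680 * (H + 2)) (by simp) ?_ (by simp; omega)) (by simp; omega)
  set s6 := (s5.setVar .best _).setVar .ch _ with hs6
  have r1 : s6.var .k = k := by simp [hs6]; rw [hs5.var _ rfl, q1]
  have r2 : s6.var .N = N := by simp [hs6]; rw [hs5.var _ rfl, q2]
  have r5 : s6.var .f = f := by simp [hs6]; rw [hs5.var _ rfl, q5]
  have r6 : s6.var .g = f * f := by simp [hs6]; rw [hs5.var _ rfl, q6]
  have r7 : s6.var .H = H := by simp [hs6]; rw [hs5.var _ rfl, q7]
  have r9 : s6.var .b = rank E b := by simp [hs6]; rw [hs5.var _ rfl, q9]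
  have r10 : s6.var .e = rank E e := by simp [hs6, p10, hE]
  have r11 : s6.var .v = v := by simp [hs6]; rw [hs5.var _ rfl, q11]
  have r12 : s6.var .best = n := by simp [hs6]; rw [hs5.var _ rfl, q4]
  have r13 : s6.var .ch = f := by simp [hs6]; rw [hs5.var _ rfl, q5]
  have ha6 : s6.arr = a := by funext y; simp [hs6]; rw [hs5.arr y rfl, ha4]
  clear_value s6
  have hbe : rank E b ≤ rank E e := rank_mono E (by omega)
  have heN : rank E e ≤ N := hcard ▸ rank_le_card E e
  -- Before level `l` the ranks in `[b', e')` are still open. They are claimed to be aligned only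
  -- from `l = 1` on, as the original ends are arbitrary.
  refine Triple.seq_le (T₁ := 10 + 5 * (2000 * (H + 2) + 5)) (T₂ := 300)
    (Q₁ := fun s' => ∃ b' e', s'.var .ch = f ^ 6 ∧ s'.var .b = b' ∧ s'.var .e = e' ∧ b' ≤ e' ∧
      e' ≤ N ∧ rank E b ≤ b' ∧ e' ≤ rank E e ∧ (b' < e' → f ^ 6 ∣ b' ∧ f ^ 6 ∣ e') ∧
      MinOver n (a .RK) (fun x => (x ∈ E ∧ v ≤ a .B0 x) ∧
        (rank E b ≤ rank E x ∧ rank E x < rank E e) ∧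
        ¬ (b' ≤ rank E x ∧ rank E x < e')) (s'.var .best))
    ((Triple.loop (fun l s' => ∃ b' e', s'.var .ch = f ^ (l + 1) ∧ s'.var .b = b' ∧
      s'.var .e = e' ∧ b' ≤ e' ∧
      e' ≤ N ∧ rank E b ≤ b' ∧ e' ≤ rank E e ∧
      (b' < e' → 1 ≤ l → f ^ (l + 1) ∣ b' ∧ f ^ (l + 1) ∣ e') ∧
      MinOver n (a .RK) (fun x => (x ∈ E ∧ v ≤ a .B0 x) ∧
        (rank E b ≤ rank E x ∧ rank E x < rank E e) ∧
        ¬ (b' ≤ rank E x ∧ rank E x < e')) (s'.var .best)) 5 (2000 * (H + 2)) (by simp; omega)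
      (by simp) ?_ ?_).mono (by simp) ?_) ?_ (by omega)
  · refine ⟨_, _, by simp [r13], r9, r10, hbe, heN, le_rfl, le_rfl, by simp, ?_⟩
    rw [r12]
    exact MinOver.empty fun x hx => hx.2.2 hx.2.1
  · rintro l hl s' hs ⟨b', e', i1, i2, i3, i4, i5, i6, i7, i8, i9⟩
    have ha' : s'.arr = a := by funext y; rw [hs.arr y rfl, ha6]
    refine (levelQuery_spec hp hl (hc.job l hl) ((hc.jb_le l hl).trans_lt hjE) (by omega)
      (fun i h1 h2 => hd.log i h1 (h2.trans (le_max_right _ _))) hNn (by simpa using ha')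
      (by simp; rw [hs.var _ rfl, r7]) (by simp; rw [hs.var _ rfl, r6])
      (by simp; rw [hs.var _ rfl, r5]) (by simp [i1]) (by simp; rw [hs.var _ rfl, r2])
      (by simp; rw [hs.var _ rfl, r11]) (by simp; rw [hs.var _ rfl, r1]) (by simp) (by simp [i2])
      (by simp [i3]) i4 i5 i6 i7 i8 (by simpa using i9)).mono le_rfl ?_
    rintro s'' - ⟨b'', e'', j1, j2, j3, j4, j5, j6, j7, j8, j9⟩
    exact ⟨b'', e'', j1, j2, j3, j4, j5, j6, j7, fun h _ => j8 h, j9⟩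
  · rintro s' - ⟨b', e', i1, i2, i3, i4, i5, i6, i7, i8, i9⟩
    exact ⟨b', e', i1, i2, i3, i4, i5, i6, i7, fun h => i8 h (by norm_num), i9⟩
  rintro s7 hs7 ⟨b', e', i1, i2, i3, i4, i5, i6, i7, i8, i9⟩
  have ha7 : s7.arr = a := by funext y; rw [hs7.arr y rfl, ha6]
  refine Triple.seq_le (T₁ := 210) (T₂ := 20)
    (Q₁ := fun s' => MinOver n (a .RK) (fun x => (x ∈ E ∧ v ≤ a .B0 x) ∧
        (rank E b ≤ rank E x ∧ rank E x < rank E e)) (s'.var .best))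
    ((Triple.ite (T := 200) (by simp) ?_ ?_).mono (by simp) fun _ _ => id) ?_ (by omega)
  · intro h
    simp only [Expr.eval_lt, Expr.eval_var, i2, i3] at h
    have hlt : b' < e' := by by_contra h'; simp [h'] at h
    refine topQuery_spec hp hc (fun i h1 h2 => hd.log i h1 (h2.trans (le_max_left _ _))) hNn ha7 i1
      (by rw [hs7.var _ rfl, r2]) (by rw [hs7.var _ rfl, r1]) (by rw [hs7.var _ rfl, r11]) i2 i3
      hlt i5 (i8 hlt).1 (i8 hlt).2 hθ1 hθ2 (by omega) htE i9 fun x => ?_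
    constructor
    · rintro ⟨h1, h2⟩
      by_cases h3 : b' ≤ rank E x ∧ rank E x < e'
      · exact .inr ⟨h1, h3⟩
      · exact .inl ⟨h1, h2, h3⟩
    · rintro (⟨h1, h2, -⟩ | ⟨h1, h2⟩)
      · exact ⟨h1, h2⟩
      · have h2 : b' ≤ rank E x ∧ rank E x < e' := h2
        exact ⟨h1, by omega⟩
  · intro h
    simp only [Expr.eval_lt, Expr.eval_var, i2, i3] at h
    have hlt : ¬ b' < e' := by intro h'; simp [h'] at h
    refine Triple.flat rfl (by simp [Stmt.cost]) (by simp [Stmt.safe]) ?_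
    simp only [run]
    refine i9.congr fun x => ⟨fun h => ⟨h.1, h.2.1⟩, fun h => ⟨h.1, h.2, by omega⟩⟩
  intro s8 hs8 hbest
  have ha8 : s8.arr = a := by funext y; rw [hs8.arr y rfl, ha7]
  have hbest : MinOver n (a .RK) (fun x => (b ≤ x ∧ x < e) ∧ v ≤ a .B0 x) (s8.var .best) := by
    refine hbest.congr fun x => ?_
    constructor
    · rintro ⟨⟨h1, h2⟩, h3, h4⟩
      rw [rank_le_rank_iff h1] at h3
      rw [rank_lt_rank_iff h1] at h4
      exact ⟨⟨h3, h4⟩, h2⟩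
    · rintro ⟨⟨h1, h2⟩, h3⟩
      have h4 : x ∈ E := mem_above.2 ⟨by omega, by omega⟩
      exact ⟨⟨h4, h3⟩, (rank_le_rank_iff h4).2 h1, (rank_lt_rank_iff h4).2 h2⟩
  -- The range contains an admissible element, so the minimum is less than the default `n` and
  -- therefore attained.
  have hlt := (hbest.le_key x0 ⟨hx0, hx0v⟩).trans_lt (hd.rk_lt x0 (by omega))
  obtain ⟨x, hx, hxk⟩ := hbest.attained hlt
  have hxn : x < n := by omega
  have hao := hd.ao_rk x hxn
  rw [hxk] at hao
  refine Triple.flat rfl (by simp [Stmt.cost]) ?_ ⟨x, ?_, hx, ?_⟩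
  · simp [Stmt.safe, ha8, hao]; omega
  · simp [run, ha8, hao]
  · intro y hy
    exact hd.rk_le x hxn y (by omega) (by rw [hxk]; exact hbest.le_key y hy)

/-! ### Preprocessing: the structure for one level of a class -/

theorem Stmt.Same.trans {p q : Stmt} {s s' s'' : St} (h : Same p s s') (h' : Same q s' s'') :
    Same (p ;; q) s s'' := by
  refine ⟨fun y hy => ?_, fun a ha => ?_, h'.inp.trans h.inp⟩
  · simp only [wr, Bool.or_eq_false_iff] at hy
    rw [h'.var y hy.2, h.var y hy.1]
  · simp only [wa, Bool.or_eq_false_iff] at ha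
    rw [h'.arr a ha.2, h.arr a ha.1]

theorem Stmt.Same.assign (x : Reg) (e : Expr) (s : St) (z : ℕ) :
    Same (x ::= e) s (s.setVar x z) :=
  ⟨fun y hy => by simp only [wr, decide_eq_false_iff_not] at hy; simp [hy], fun _ _ => rfl, rfl⟩

/-- Write the value of `e` to the cell `a[W[t]]` for each position `t` of the list `W`. -/
def forEach (W a : Arr) (e : Expr) : Stmt := .loop .t (var .N) (.put a (get W (var .t)) e)

/-- Write the value of `e` to the cell `a[p + t]` for each `t < N`. -/
def fillPool (p : Reg) (a : Arr) (e : Expr) : Stmt :=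
  .loop .t (var .N) (.put a (var p + var .t) e)

theorem forEach_spec {c : Lim} {W a : Arr} (hWa : W ≠ a) {ve : Expr} {s : St}
    {N : ℕ} {E : Finset ℕ} {r : ℕ → ℕ → Prop} (val : ℕ → ℕ) (hN : s.var .N = N)
    (hE : Enum (s.arr W) N E r) (hr : ∀ a, ¬ r a a) (hED : ∀ x ∈ E, x < c.D) (hND : N < c.D)
    (hv : ∀ t < N, ∀ u : ℕ → ℕ,
      ve.eval ⟨Function.update s.var .t t, Function.update s.arr a u, s.inp⟩ = val t ∧
      ve.safe c ⟨Function.update s.var .t t, Function.update s.arr a u, s.inp⟩) :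
    Triple c (forEach W a ve) s (4 + N * (ve.cost + 20)) fun s' =>
      ∀ t < N, s'.arr a (s.arr W t) = val t := by
  refine (Triple.loop_put N (s.arr W) val (by simp) (by simp [hN]) ?_
    (fun t ht => hED _ (hE.mem t ht)) ?_).mono ?_ fun _ _ h => h.1
  · intro t ht u
    obtain ⟨h1, h2⟩ := hv t ht u
    refine ⟨⟨by simp [hWa], h1⟩, ?_, h2⟩
    simp; omega
  · intro t ht j hj e
    exact absurd (hE.inj hr (by omega) ht e) hj.ne
  · simp only [Expr.cost_var, Expr.cost_get]
    exact Nat.add_le_add (by norm_num) (Nat.mul_le_mul_left _ (by omega))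

theorem fillPool_spec {c : Lim} (hc : 64 * c.D < c.W) {p : Reg} (hp : p ≠ .t) {a : Arr} {ve : Expr}
    {s : St} {N jb : ℕ} (val : ℕ → ℕ) (hN : s.var .N = N) (hjb : s.var p = jb)
    (hD : jb + N < c.D)
    (hv : ∀ t < N, ∀ u : ℕ → ℕ,
      ve.eval ⟨Function.update s.var .t t, Function.update s.arr a u, s.inp⟩ = val t ∧
      ve.safe c ⟨Function.update s.var .t t, Function.update s.arr a u, s.inp⟩) :
    Triple c (fillPool p a ve) s (4 + N * (ve.cost + 20)) fun s' =>
      (∀ t < N, s'.arr a (jb + t) = val t) ∧ ∀ i < jb, s'.arr a i = s.arr a i := by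
  refine (Triple.loop_put N (fun t => jb + t) val (by simp) (by simp [hN]) ?_
    (fun t ht => by omega) ?_).mono ?_ fun _ _ h => ⟨h.1, fun i hi => h.2 i fun k _ => by omega⟩
  · intro t ht u
    obtain ⟨h1, h2⟩ := hv t ht u
    refine ⟨⟨by simp [hp, hjb], h1⟩, ?_, h2⟩
    simp [hp, hjb]; omega
  · intro t ht j hj e
    omega
  · simp only [Expr.cost_var, Expr.cost_bin, Expr.cost_add]
    exact Nat.add_le_add (by norm_num) (Nat.mul_le_mul_left _ (by omega))

/-- Sort the elements for one level. -/
def jobOrder : Stmt :=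
  forEach .WB .KEY (get .LOC (get .WB (var .t)) / var .S) ;;
  .J ::= var .N / var .S + 1 ;;
  csort .WB .KEY .L1 ;;
  forEach .L1 .SL (var .t) ;;
  forEach .WB .KEY (get .SL (get .WB (var .t)) / var .g) ;;
  .J ::= var .N / var .g + 1 ;;
  csort .WA .KEY .L2 ;;
  forEach .L2 .AR (var .t) ;;
  csort .WP .KEY .L3

theorem KeyLex.congr_enum {u κ κ' : ℕ → ℕ} {N : ℕ} {E : Finset ℕ} {r : ℕ → ℕ → Prop}
    (h : Enum u N E (KeyLex κ r)) (hκ : ∀ a ∈ E, κ a = κ' a) : Enum u N E (KeyLex κ' r) :=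
  h.weaken fun a ha b hb hab => by
    simpa only [KeyLex, hκ a ha, hκ b hb] using hab

theorem Enum.bij {u φ : ℕ → ℕ} {N : ℕ} {E : Finset ℕ} {r : ℕ → ℕ → Prop} (h : Enum u N E r)
    (hr : ∀ a, ¬ r a a) (hφ : ∀ t < N, φ (u t) = t) : Bij u φ N E := by
  refine ⟨h.mem, hφ, fun a ha => ?_, fun a ha => ?_⟩
  · obtain ⟨i, hi, rfl⟩ := h.surj hr ha
    rwa [hφ i hi]
  · obtain ⟨i, hi, rfl⟩ := h.surj hr ha
    rw [hφ i hi]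

theorem Bij.inj {u φ : ℕ → ℕ} {N : ℕ} {E : Finset ℕ} (h : Bij u φ N E) :
    ∀ a ∈ E, ∀ b ∈ E, φ a = φ b → a = b := fun a ha b hb e => by
  rw [← h.map a ha, ← h.map b hb, e]

/-- The input lists are ordered by descending `B`, by key and by position. Stable sorting by node,
respectively by chunk, keeps these orders inside each node or chunk. The first sort fixes the slots,
and the chunks used as keys of the other two are read off from the slots. -/
theorem jobOrder_spec {c : Lim} (hc : 64 * c.D < c.W) {s : St} {N S g : ℕ} {E : Finset ℕ}
    {rP rA rB : ℕ → ℕ → Prop} {loc : ℕ → ℕ}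
    (hP : Enum (s.arr .WP) N E rP) (hA : Enum (s.arr .WA) N E rA) (hB : Enum (s.arr .WB) N E rB)
    (hrA : ∀ a, ¬ rA a a) (hrB : ∀ a, ¬ rB a a)
    (hN : s.var .N = N) (hS : s.var .S = S) (hg : s.var .g = g)
    (hloc : ∀ x ∈ E, s.arr .LOC x = loc x) (hlocN : ∀ x ∈ E, loc x < N)
    (hED : ∀ x ∈ E, x < c.D) (hND : N + 1 < c.D) :
    Triple c jobOrder s (1500 * (N + 1)) fun s' =>
      Enum (s'.arr .L1) N E (KeyLex (fun x => loc x / S) rB) ∧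
      (∀ t < N, s'.arr .SL (s'.arr .L1 t) = t) ∧
      Enum (s'.arr .L2) N E (KeyLex (fun x => s'.arr .SL x / g) rA) ∧
      (∀ t < N, s'.arr .AR (s'.arr .L2 t) = t) ∧
      Enum (s'.arr .L3) N E (KeyLex (fun x => s'.arr .SL x / g) rP) ∧
      ∀ x ∈ E, s'.arr .KEY x = s'.arr .SL x / g := by
  have hNS : N / S ≤ N := Nat.div_le_self _ _
  have hNg : N / g ≤ N := Nat.div_le_self _ _
  refine Triple.seq_le (T₁ := 4 + N * 40) (T₂ := 1450 * (N + 1)) ((forEach_spec (by decide)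
    (fun t => loc (s.arr .WB t) / S) hN hB hrB hED (by omega) ?_).mono (by simp; omega)
    fun _ _ => id) ?_ (by omega)
  · intro t ht u
    have h1 := hB.mem t ht
    have h2 := hED _ h1
    simp [hloc _ h1, hS]
    omega
  intro s1 h1 k1
  have h01 := h1
  have hJ1 : (s1.setVar .J (N / S + 1)).var .J = N / S + 1 := by simp
  have w1 : s1.var .N = N := by rw [h1.var _ rfl, hN]
  have w2 : s1.var .S = S := by rw [h1.var _ rfl, hS]
  refine Triple.assign_seq (T := 1440 * (N + 1)) (by
    simp [w1, w2]
    generalize N / S = z at *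
    omega) ?_ (by simp; omega)
  have h2 := h01.trans (Same.assign .J (var .N / var .S + 1) s1 (eval s1 (var .N / var .S + 1)))
  set s2 := s1.setVar .J _ with hs2
  have j2 : s2.var .J = N / S + 1 := by simp [hs2, w1, w2]
  have b2 : s2.arr .WB = s.arr .WB := h2.arr _ rfl
  have k2 : ∀ t < N, s2.arr .KEY (s.arr .WB t) = loc (s.arr .WB t) / S := fun t ht => by
    simp [hs2, k1 t ht]
  refine Triple.seq_le (T₁ := 200 * (N + (N / S + 1) + 1)) (T₂ := 1030 * (N + 1))
    (csort_spec hc (E := E) (r := rB) (by decide) (by decide) (by decide) (by decide) (by decide)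
    ((h2.var _ rfl).trans hN) j2 (by omega) (by omega) ?_ ?_ (b2 ▸ hB)) ?_ (by omega)
  · exact fun t ht => by rw [b2]; exact hED _ (hB.mem t ht)
  · intro t ht
    rw [b2, k2 t ht, Nat.lt_succ_iff]
    exact Nat.div_le_div_right (hlocN _ (hB.mem t ht)).le
  intro s3 hs3 e3
  have h3 := h2.trans hs3
  replace e3 : Enum (s3.arr .L1) N E (KeyLex (fun x => loc x / S) rB) :=
    KeyLex.congr_enum e3 fun x hx => by
      obtain ⟨t, ht, rfl⟩ := hB.surj hrB hx
      exact k2 t ht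
  have irr1 := KeyLex.irrefl (κ := fun x => loc x / S) hrB
  refine Triple.seq_le (T₁ := 4 + N * 40) (T₂ := 980 * (N + 1)) ((forEach_spec (by decide)
    (fun t => t) ((h3.var _ rfl).trans hN) e3 irr1 hED (by omega) ?_).mono (by simp; omega)
    fun _ _ => id) ?_ (by omega)
  · intro t ht u
    simp
  intro s4 hs4 k4
  have h4 := h3.trans hs4
  have bij : Bij (s3.arr .L1) (s4.arr .SL) N E := e3.bij irr1 k4
  have b4 : s4.arr .WB = s.arr .WB := h4.arr _ rfl
  refine Triple.seq_le (T₁ := 4 + N * 40) (T₂ := 930 * (N + 1)) ((forEach_spec (by decide)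
    (fun t => s4.arr .SL (s.arr .WB t) / g) ((h4.var _ rfl).trans hN) (b4 ▸ hB) hrB hED (by omega)
    ?_).mono (by simp; omega) fun _ _ => id) ?_ (by omega)
  · intro t ht u
    have h1 := hB.mem t ht
    have h2 := hED _ h1
    have h3 : s4.var .g = g := (h4.var _ rfl).trans hg
    simp [h3, b4]
    omega
  intro s5 hs5 k5
  have h5 := h4.trans hs5
  rw [b4] at k5
  have k5' : ∀ x ∈ E, s5.arr .KEY x = s4.arr .SL x / g := by
    intro x hx
    obtain ⟨t, ht, rfl⟩ := hB.surj hrB hx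
    exact k5 t ht
  have v1 : s5.var .N = N := (h5.var _ rfl).trans hN
  have v2 : s5.var .g = g := (h5.var _ rfl).trans hg
  refine Triple.assign_seq (T := 920 * (N + 1)) (by
    simp [v1, v2]
    generalize N / g = z at *
    omega) ?_ (by simp; omega)
  have hs6' := Same.assign .J (var .N / var .g + 1) s5 (eval s5 (var .N / var .g + 1))
  have h6 := h5.trans hs6'
  have i6 := hs5.trans hs6'
  set s6 := s5.setVar .J _ with hs6
  have j6 : s6.var .J = N / g + 1 := by simp [hs6, v1, v2]
  have b6 : s6.arr .WA = s.arr .WA := h6.arr _ rfl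
  have key_lt : ∀ x ∈ E, s4.arr .SL x / g < N / g + 1 := fun x hx =>
    Nat.lt_succ_iff.2 (Nat.div_le_div_right (bij.lt x hx).le)
  refine Triple.seq_le (T₁ := 200 * (N + (N / g + 1) + 1)) (T₂ := 510 * (N + 1))
    (csort_spec hc (E := E) (r := rA) (by decide) (by decide) (by decide) (by decide) (by decide)
    ((h6.var _ rfl).trans hN) j6 (by omega) (by omega) ?_ ?_ (b6 ▸ hA)) ?_ (by omega)
  · exact fun t ht => by rw [b6]; exact hED _ (hA.mem t ht)
  · intro t ht
    rw [b6]
    show s5.arr .KEY _ < _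
    rw [k5' _ (hA.mem t ht)]
    exact key_lt _ (hA.mem t ht)
  intro s7 hs7 e7
  have h7 := h6.trans hs7
  have i7 := i6.trans hs7
  replace e7 : Enum (s7.arr .L2) N E (KeyLex (fun x => s4.arr .SL x / g) rA) :=
    KeyLex.congr_enum e7 k5'
  have irr2 := KeyLex.irrefl (κ := fun x => s4.arr .SL x / g) hrA
  refine Triple.seq_le (T₁ := 4 + N * 40) (T₂ := 460 * (N + 1)) ((forEach_spec (by decide)
    (fun t => t) ((h7.var _ rfl).trans hN) e7 irr2 hED (by omega) ?_).mono (by simp; omega)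
    fun _ _ => id) ?_ (by omega)
  · intro t ht u
    simp
  intro s8 hs8 k8
  have h8 := h7.trans hs8
  have i8 := i7.trans hs8
  have b8 : s8.arr .WP = s.arr .WP := h8.arr _ rfl
  have key8 : s8.arr .KEY = s5.arr .KEY := by
    rw [hs8.arr _ rfl, hs7.arr _ rfl]; rfl
  refine (csort_spec hc (E := E) (r := rP) (N := N) (J := N / g + 1) (by decide) (by decide)
    (by decide) (by decide) (by decide) ((h8.var _ rfl).trans hN) ?_ (by omega) (by omega) ?_ ?_
    (b8 ▸ hP)).mono (by omega) ?_
  · rw [hs8.var _ rfl, hs7.var _ rfl, j6]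
  · exact fun t ht => by rw [b8]; exact hED _ (hP.mem t ht)
  · intro t ht
    rw [b8, key8, k5' _ (hP.mem t ht)]
    exact key_lt _ (hP.mem t ht)
  intro s9 hs9 e9
  have i9 := i8.trans hs9
  have sl9 : s9.arr .SL = s4.arr .SL := i9.arr _ rfl
  have l19 : s9.arr .L1 = s3.arr .L1 := (hs4.trans i9).arr _ rfl
  have l29 : s9.arr .L2 = s7.arr .L2 := (hs8.trans hs9).arr _ rfl
  have ar9 : s9.arr .AR = s8.arr .AR := hs9.arr _ rfl
  have ky9 : s9.arr .KEY = s5.arr .KEY := (hs9.arr _ rfl).trans key8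
  rw [key8] at e9
  refine ⟨l19 ▸ e3, ?_, ?_, ?_, ?_, ?_⟩
  · rw [sl9, l19]; exact k4
  · rw [sl9, l29]; exact e7
  · rw [ar9, l29]; exact k8
  · rw [sl9]; exact KeyLex.congr_enum e9 k5'
  · rw [ky9, sl9]; exact k5'

/-! ### Stability of the structures under later writes -/

theorem IsTable.congr_keys {T κ row col row' col' : ℕ → ℕ} {base rows C stride G Hn n : ℕ}
    {E : Finset ℕ} (h : IsTable T base rows C stride G Hn n κ row col E)
    (hr : ∀ a ∈ E, row a = row' a) (hc : ∀ a ∈ E, col a = col' a) :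
    IsTable T base rows C stride G Hn n κ row' col' E := fun ρ hρ z hz x hx =>
  (h ρ hρ z hz x hx).congr fun a =>
    ⟨fun ⟨⟨h1, h2⟩, h3⟩ => by rw [hr a h1] at h2; rw [hc a h1] at h3; exact ⟨⟨h1, h2⟩, h3⟩,
      fun ⟨⟨h1, h2⟩, h3⟩ => by rw [← hr a h1] at h2; rw [← hc a h1] at h3; exact ⟨⟨h1, h2⟩, h3⟩⟩

theorem IsTable.congr_cells {T T' κ row col : ℕ → ℕ} {base rows C stride G Hn n : ℕ}
    {E : Finset ℕ} (h : IsTable T base rows C stride G Hn n κ row col E) (hst : Hn * C ≤ stride)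
    (hT : ∀ i < base + rows * stride, T' i = T i) :
    IsTable T' base rows C stride G Hn n κ row col E := fun ρ hρ z hz x hx => by
  rw [hT]
  · exact h ρ hρ z hz x hx
  · have h1 := index_lt hx hz
    have h2 := index_lt (h1.trans_le hst) hρ
    omega

/-- All cells of a level lie below `jb + (N / g + 1) * g`. Later levels and classes write only above
this address and cannot spoil it. -/
theorem IsJob.congr_cells {NB AK PP MB MP T NB' AK' PP' MB' MP' T' : ℕ → ℕ}
    {jb g f S ch N n : ℕ} {E : Finset ℕ} {loc κ B u₁ slot u₂ ar u₃ pr : ℕ → ℕ}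
    (h : IsJob NB AK PP MB MP T jb g f S ch N n E loc κ B u₁ slot u₂ ar u₃ pr)
    (hg : 0 < g) (hfg : (Nat.log 2 f + 1) * f ≤ g)
    (h1 : ∀ i < jb + (N / g + 1) * g, NB' i = NB i)
    (h2 : ∀ i < jb + (N / g + 1) * g, AK' i = AK i)
    (h3 : ∀ i < jb + (N / g + 1) * g, PP' i = PP i)
    (h4 : ∀ i < jb + (N / g + 1) * g, MB' i = MB i)
    (h5 : ∀ i < jb + (N / g + 1) * g, MP' i = MP i)
    (h6 : ∀ i < jb + (N / g + 1) * g, T' i = T i) :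
    IsJob NB' AK' PP' MB' MP' T' jb g f S ch N n E loc κ B u₁ slot u₂ ar u₃ pr := by
  have hN : ∀ i < N, jb + i < jb + (N / g + 1) * g := fun i hi => by
    have := Nat.lt_div_mul_add (a := N) hg
    rw [Nat.add_mul]; omega
  refine { h with
    nb := fun i hi => by rw [h1 _ (hN i hi), h.nb i hi]
    ak := fun i hi => by rw [h2 _ (hN i hi), h.ak i hi]
    pp := fun i hi => by rw [h3 _ (hN i hi), h.pp i hi]
    mb := fun i hi => by rw [h4 _ (hN i hi)]; exact h.mb i hi
    mp := fun i hi => by rw [h5 _ (hN i hi)]; exact h.mp i hi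
    tab := h.tab.congr_cells hfg h6 }

/-! ### Storing the structure of a level -/

/-- Store the lists and the masks of a level. -/
def jobPools : Stmt :=
  fillPool .jb .NB (get .B0 (get .L1 (var .t))) ;;
  fillPool .jb .AK (get .RK (get .L2 (var .t))) ;;
  fillPool .jb .PP (get .LOC (get .L3 (var .t))) ;;
  masks .L1 .MB ;;
  masks .L3 .MP

/-- Store the table of a level. -/
def jobTable : Stmt :=
  forEach .WP .ROW (get .KEY (get .WP (var .t))) ;;
  forEach .WP .COL (get .LOC (get .WP (var .t)) % var .S / var .ch) ;;
  .rows ::= var .N / var .g + 1 ;;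
  .C ::= var .f ;;
  .stride ::= var .g ;;
  .G ::= var .S / var .g ;;
  .Hn ::= get .LG (var .f) + 1 ;;
  .base ::= var .jb ;;
  table .T1

/-- Store the structure for a level. -/
def jobBody : Stmt := jobOrder ;; jobPools ;; jobTable

theorem jobPools_spec {c : Lim} (hc : 64 * c.D < c.W) {s : St} {N g jb : ℕ}
    (hN : s.var .N = N) (hg : s.var .g = g) (hjb : s.var .jb = jb) (hg0 : 0 < g)
    (hgW : 2 ^ g < c.W) (hD : jb + N < c.D) (h1 : ∀ t < N, s.arr .L1 t < c.D)
    (h2 : ∀ t < N, s.arr .L2 t < c.D) (h3 : ∀ t < N, s.arr .L3 t < c.D) :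
    Triple c jobPools s (400 * (N + 1)) fun s' =>
      (∀ i < N, s'.arr .NB (jb + i) = s.arr .B0 (s.arr .L1 i)) ∧
      (∀ i < N, s'.arr .AK (jb + i) = s.arr .RK (s.arr .L2 i)) ∧
      (∀ i < N, s'.arr .PP (jb + i) = s.arr .LOC (s.arr .L3 i)) ∧
      (∀ t < N, ∀ p, (s'.arr .MB (jb + t)).testBit p ↔
        ∃ t', (t' ≤ t ∧ t' / g = t / g) ∧ s.arr .AR (s.arr .L1 t') % g = p) ∧
      (∀ t < N, ∀ p, (s'.arr .MP (jb + t)).testBit p ↔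
        ∃ t', (t' ≤ t ∧ t' / g = t / g) ∧ s.arr .AR (s.arr .L3 t') % g = p) ∧
      ∀ a ∈ [Arr.NB, .AK, .PP, .MB, .MP], ∀ i < jb, s'.arr a i = s.arr a i := by
  refine Triple.seq_le (T₁ := 4 + N * 40) (T₂ := 350 * (N + 1)) ((fillPool_spec hc (by decide)
    (fun t => s.arr .B0 (s.arr .L1 t)) hN hjb hD ?_).mono (by simp; omega) fun _ _ => id) ?_
    (by omega)
  · intro t ht u
    have := h1 t ht
    simp; omega
  rintro s1 i1 ⟨k1, m1⟩
  refine Triple.seq_le (T₁ := 4 + N * 40) (T₂ := 300 * (N + 1)) ((fillPool_spec hc (by decide)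
    (fun t => s.arr .RK (s.arr .L2 t)) ((i1.var _ rfl).trans hN) ((i1.var _ rfl).trans hjb) hD
    ?_).mono (by simp; omega) fun _ _ => id) ?_ (by omega)
  · intro t ht u
    have := h2 t ht
    have e1 : s1.arr .L2 = s.arr .L2 := i1.arr _ rfl
    have e2 : s1.arr .RK = s.arr .RK := i1.arr _ rfl
    simp [e1, e2]; omega
  rintro s2 j2 ⟨k2, m2⟩
  have i2 := i1.trans j2
  refine Triple.seq_le (T₁ := 4 + N * 40) (T₂ := 250 * (N + 1)) ((fillPool_spec hc (by decide)
    (fun t => s.arr .LOC (s.arr .L3 t)) ((i2.var _ rfl).trans hN) ((i2.var _ rfl).trans hjb) hD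
    ?_).mono (by simp; omega) fun _ _ => id) ?_ (by omega)
  · intro t ht u
    have := h3 t ht
    have e1 : s2.arr .L3 = s.arr .L3 := i2.arr _ rfl
    have e2 : s2.arr .LOC = s.arr .LOC := i2.arr _ rfl
    simp [e1, e2]; omega
  rintro s3 j3 ⟨k3, m3⟩
  have i3 := i2.trans j3
  have e3 : s3.arr .L1 = s.arr .L1 := i3.arr _ rfl
  refine Triple.seq_le (T₁ := 100 * (N + 1)) (T₂ := 100 * (N + 1)) (masks_spec hc (by decide)
    (by decide) ((i3.var _ rfl).trans hN) ((i3.var _ rfl).trans hg) ((i3.var _ rfl).trans hjb) hg0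
    hgW hD (by rw [e3]; exact h1)) ?_ (by omega)
  rintro s4 j4 ⟨k4, m4⟩
  have i4 := i3.trans j4
  have e4 : s4.arr .L3 = s.arr .L3 := i4.arr _ rfl
  refine (masks_spec hc (by decide)
    (by decide) ((i4.var _ rfl).trans hN) ((i4.var _ rfl).trans hg) ((i4.var _ rfl).trans hjb) hg0
    hgW hD (by rw [e4]; exact h3)).mono le_rfl ?_
  rintro s5 j5 ⟨k5, m5⟩
  have t5 := j4.trans j5
  have t4 := j3.trans t5
  have t3 := j2.trans t4
  have ar3 : s3.arr .AR = s.arr .AR := i3.arr _ rfl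
  have ar4 : s4.arr .AR = s.arr .AR := i4.arr _ rfl
  rw [e3, ar3] at k4
  rw [e4, ar4] at k5
  refine ⟨?_, ?_, ?_, ?_, k5, ?_⟩
  · rw [t3.arr .NB rfl]; exact k1
  · rw [t4.arr .AK rfl]; exact k2
  · rw [t5.arr .PP rfl]; exact k3
  · rw [j5.arr .MB rfl]; exact k4
  · intro a ha i hi
    fin_cases ha
    · show s5.arr .NB i = s.arr .NB i
      rw [t3.arr .NB rfl]; exact m1 i hi
    · show s5.arr .AK i = s.arr .AK i
      rw [t4.arr .AK rfl, m2 i hi, i1.arr .AK rfl]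
    · show s5.arr .PP i = s.arr .PP i
      rw [t5.arr .PP rfl, m3 i hi, i2.arr .PP rfl]
    · show s5.arr .MB i = s.arr .MB i
      rw [j5.arr .MB rfl, m4 i hi, i3.arr .MB rfl]
    · show s5.arr .MP i = s.arr .MP i
      rw [m5 i hi, i4.arr .MP rfl]

/-- A row of the table belongs to `g` elements and takes `(log f + 1) * f ≤ g` cells, so giving the
rows the stride `g` lets the table occupy the same range of addresses as the lists. -/
theorem jobTable_spec {c : Lim} (hc : 64 * c.D < c.W) {s : St} {N S g f ch jb n : ℕ} {E : Finset ℕ}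
    {rP : ℕ → ℕ → Prop} {loc slot : ℕ → ℕ}
    (hP : Enum (s.arr .WP) N E rP) (hrP : ∀ a, ¬ rP a a)
    (hN : s.var .N = N) (hS : s.var .S = S) (hg : s.var .g = g) (hf : s.var .f = f)
    (hch : s.var .ch = ch) (hjb : s.var .jb = jb) (hn : s.var .n = n) (hg0 : 0 < g) (hf0 : 0 < f)
    (hch0 : 0 < ch) (hSf : S = ch * f) (hSg : g ≤ S) (hfg : (Nat.log 2 f + 1) * f ≤ g)
    (hLG : s.arr .LG f = Nat.log 2 f)
    (hloc : ∀ x ∈ E, s.arr .LOC x = loc x) (hkey : ∀ x ∈ E, s.arr .KEY x = slot x / g)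
    (hslot : ∀ x ∈ E, slot x < N) (hκ : ∀ x ∈ E, s.arr .RK x ≤ n)
    (hED : ∀ x ∈ E, x < c.D) (hD : jb + (N / g + 1) * g < c.D) :
    Triple c jobTable s (2000 * (N + g + 1)) fun s' =>
      IsTable (s'.arr .T1) jb (N / g + 1) f g (S / g) (Nat.log 2 f + 1) n (s.arr .RK)
        (fun a => slot a / g) (fun a => loc a % S / ch) E ∧
      ∀ i < jb, s'.arr .T1 i = s.arr .T1 i := by
  have hNlt := Nat.lt_div_mul_add (a := N) hg0
  have hrows : (N / g + 1) * g ≤ N + g := by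
    rw [Nat.add_mul, one_mul]; have := Nat.div_mul_le_self N g; omega
  have hfg' : f ≤ g := (Nat.le_mul_of_pos_left _ (Nat.succ_pos _)).trans hfg
  have hD1 : N / g + 1 ≤ (N / g + 1) * g := Nat.le_mul_of_pos_right _ hg0
  have hD2 : g ≤ (N / g + 1) * g := Nat.le_mul_of_pos_left _ (Nat.succ_pos _)
  have hD3 : (N / g + 1) * f ≤ (N / g + 1) * g := Nat.mul_le_mul_left _ hfg'
  -- The time for the table is linear: `f + 1 ≤ 2 * f`, and the rest is at most `g` per row.
  have hlin : (N / g + 1) * ((Nat.log 2 f + 1) * (f + 1)) ≤ 2 * (N + g) := by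
    calc (N / g + 1) * ((Nat.log 2 f + 1) * (f + 1))
        ≤ (N / g + 1) * ((Nat.log 2 f + 1) * (2 * f)) := by gcongr; omega
      _ = 2 * ((N / g + 1) * ((Nat.log 2 f + 1) * f)) := by ring
      _ ≤ 2 * ((N / g + 1) * g) := by gcongr
      _ ≤ _ := by omega
  have hND : N < c.D := by
    rw [Nat.add_mul] at hD; omega
  refine Triple.seq_le (T₁ := 4 + N * 40) (T₂ := 1950 * (N + g + 1)) ((forEach_spec (by decide)
    (fun t => slot (s.arr .WP t) / g) hN hP hrP hED hND ?_).mono (by simp; omega) fun _ _ => id) ?_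
    (by omega)
  · intro t ht u
    have h1 := hP.mem t ht
    have h2 := hED _ h1
    simp [hkey _ h1]
    omega
  intro s1 i1 k1
  have p1 : s1.arr .WP = s.arr .WP := i1.arr _ rfl
  have lo1 : s1.arr .LOC = s.arr .LOC := i1.arr _ rfl
  refine Triple.seq_le (T₁ := 4 + N * 50) (T₂ := 1890 * (N + g + 1)) ((forEach_spec (by decide)
    (fun t => loc (s.arr .WP t) % S / ch) ((i1.var _ rfl).trans hN) (p1 ▸ hP) hrP hED hND ?_).mono
    (by simp; omega) fun _ _ => id) ?_ (by omega)
  · intro t ht u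
    have h1 := hP.mem t ht
    have h2 := hED _ h1
    have h3 : s1.var .S = S := (i1.var _ rfl).trans hS
    have h4 : s1.var .ch = ch := (i1.var _ rfl).trans hch
    simp [lo1, p1, hloc _ h1, h3, h4]
    omega
  intro s2 j2 k2
  have i2 := i1.trans j2
  rw [p1] at k2
  have rw2 : s2.arr .ROW = s1.arr .ROW := j2.arr _ rfl
  have v1 : s2.var .N = N := (i2.var _ rfl).trans hN
  have v2 : s2.var .S = S := (i2.var _ rfl).trans hS
  have v3 : s2.var .g = g := (i2.var _ rfl).trans hg
  have v4 : s2.var .f = f := (i2.var _ rfl).trans hf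
  have v5 : s2.var .jb = jb := (i2.var _ rfl).trans hjb
  have v6 : s2.var .n = n := (i2.var _ rfl).trans hn
  have a1 : s2.arr .WP = s.arr .WP := i2.arr _ rfl
  have a2 : s2.arr .LG = s.arr .LG := i2.arr _ rfl
  have a3 : s2.arr .RK = s.arr .RK := i2.arr _ rfl
  have a4 : s2.arr .T1 = s.arr .T1 := i2.arr _ rfl
  have krow : ∀ x ∈ E, s2.arr .ROW x = slot x / g := by
    intro x hx
    obtain ⟨t, ht, rfl⟩ := hP.surj hrP hx
    rw [rw2]; exact k1 t ht
  have kcol : ∀ x ∈ E, s2.arr .COL x = loc x % S / ch := by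
    intro x hx
    obtain ⟨t, ht, rfl⟩ := hP.surj hrP hx
    exact k2 t ht
  have hsW : N / g + 1 < c.W := by
    generalize N / g + 1 = z at *
    omega
  have hlf := Nat.log_lt_self 2 hf0.ne'
  refine Triple.assign_seq (T := 1880 * (N + g + 1)) (by simp [v1, v3]; exact ⟨by omega, hsW⟩)
    (Triple.assign_seq (T := 1870 * (N + g + 1)) (by simp) (Triple.assign_seq
    (T := 1860 * (N + g + 1)) (by simp) (Triple.assign_seq (T := 1850 * (N + g + 1)) (by simp)
    (Triple.assign_seq (T := 1830 * (N + g + 1)) (by simp [v4, a2, hLG]; omega) (Triple.assign_seq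
    (T := 1820 * (N + g + 1)) (by simp) ?_ (by simp; omega)) (by simp; omega)) (by simp; omega))
    (by simp; omega)) (by simp; omega)) (by simp; omega)
  set s3 := (((((s2.setVar .rows _).setVar .C _).setVar .stride _).setVar .G _).setVar .Hn _).setVar
    .base _ with hs3
  have a3' : s3.arr = s2.arr := rfl
  refine (table_spec hc (by decide) (s := s3) (N := N) (rows := N / g + 1) (C := f) (n := n)
    (stride := g) (G := S / g) (Hn := Nat.log 2 f + 1) (base := jb) (E := E) (r := rP)
    (by rw [a3', a1]; exact hP) hrP (by simp [hs3, v1]) (by simp [hs3, v1, v3]) (by simp [hs3, v4])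
    (by simp [hs3, v6]) (by simp [hs3, v3]) (by simp [hs3, v2, v3])
    (by simp [hs3, v4, a2, hLG]) (by simp [hs3, v5]) (Nat.div_pos hSg hg0) (Nat.succ_pos _)
    ((Nat.pow_log_le_self 2 hf0.ne').trans_lt (by omega)) hfg hD (by omega) (by omega) hND
    (by omega) hED ?_ ?_ ?_).mono (by omega) ?_
  · intro x hx
    rw [a3', krow x hx, Nat.lt_succ_iff]
    exact Nat.div_le_div_right (hslot x hx).le
  · intro x hx
    rw [a3', kcol x hx, Nat.div_lt_iff_lt_mul hch0, mul_comm, ← hSf]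
    exact Nat.mod_lt _ (by omega)
  · intro x hx
    rw [a3', a3]; exact hκ x hx
  · rintro s4 - ⟨h1, h2⟩
    rw [a3'] at h1 h2
    rw [a3] at h1
    rw [a4] at h2
    exact ⟨h1.congr_keys krow kcol, h2⟩

/-- A list of all elements that is sorted by the quotient of a numbering has, at every position, an
element whose number has the quotient of that position. This turns the three sorted lists into lists
whose blocks are exactly the nodes and the chunks. -/
theorem isJob_of_sorted {NB AK PP MB MP T : ℕ → ℕ} {jb g f S ch N n : ℕ} {E : Finset ℕ}
    {loc κ B u₁ slot u₂ ar u₃ : ℕ → ℕ} {rP rA rB : ℕ → ℕ → Prop}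
    (e₁ : Enum u₁ N E (KeyLex (fun x => loc x / S) rB)) (h₁ : ∀ t < N, slot (u₁ t) = t)
    (e₂ : Enum u₂ N E (KeyLex (fun x => slot x / g) rA)) (h₂ : ∀ t < N, ar (u₂ t) = t)
    (e₃ : Enum u₃ N E (KeyLex (fun x => slot x / g) rP)) (hS : 0 < S) (hg : 0 < g)
    (hrP : ∀ a, ¬ rP a a) (hrA : ∀ a, ¬ rA a a) (hrB : ∀ a, ¬ rB a a)
    (hP : ∀ a ∈ E, ∀ b ∈ E, rP a b → loc a < loc b) (hA : ∀ a ∈ E, ∀ b ∈ E, rA a b → κ a < κ b)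
    (hB : ∀ a ∈ E, ∀ b ∈ E, rB a b → B b ≤ B a) (hloc : ∀ a ∈ E, loc a < N)
    (hinj : ∀ a ∈ E, ∀ b ∈ E, loc a = loc b → a = b)
    (nb : ∀ i < N, NB (jb + i) = B (u₁ i)) (ak : ∀ i < N, AK (jb + i) = κ (u₂ i))
    (pp : ∀ i < N, PP (jb + i) = loc (u₃ i))
    (mb : ∀ t < N, ∀ p, (MB (jb + t)).testBit p ↔
      ∃ t', (t' ≤ t ∧ t' / g = t / g) ∧ ar (u₁ t') % g = p)
    (mp : ∀ t < N, ∀ p, (MP (jb + t)).testBit p ↔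
      ∃ t', (t' ≤ t ∧ t' / g = t / g) ∧ ar (u₃ t') % g = p)
    (tab : IsTable T jb (N / g + 1) f g (S / g) (Nat.log 2 f + 1) n κ (fun a => slot a / g)
      (fun a => loc a % S / ch) E) :
    ∃ pr, IsJob NB AK PP MB MP T jb g f S ch N n E loc κ B u₁ slot u₂ ar u₃ pr := by
  have b₁ := e₁.bij (KeyLex.irrefl hrB) h₁
  have b₂ := e₂.bij (KeyLex.irrefl hrA) h₂
  have hu₃ := fun i (hi : i < N) j (hj : j < N) => e₃.inj (KeyLex.irrefl hrP) (i := i) (j := j) hi hj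
  have hsurj : ∀ a ∈ E, ∃ i < N, u₃ i = a := fun a => e₃.surj (KeyLex.irrefl hrP)
  classical
  -- The inverse of the list by position is never computed by the program; it is needed only to
  -- state the correctness.
  choose! pr hpr using hsurj
  have b₃ : Bij u₃ pr N E := e₃.bij (KeyLex.irrefl hrP) fun t ht => by
    have h := hpr _ (e₃.mem t ht)
    exact hu₃ _ h.1 _ ht h.2
  have d₁ : ∀ i < N, loc (u₁ i) / S = i / S := fun i hi =>
    e₁.div_eq (fun _ _ => rfl) hrB hS hloc hinj hi
  have d₂ : ∀ i < N, slot (u₂ i) / g = i / g := fun i hi =>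
    e₂.div_eq (fun _ _ => rfl) hrA hg b₁.lt b₁.inj hi
  have d₃ : ∀ i < N, slot (u₃ i) / g = i / g := fun i hi =>
    e₃.div_eq (fun _ _ => rfl) hrP hg b₁.lt b₁.inj hi
  refine ⟨pr, b₁, b₂, b₃, ?_, ?_, ?_, ?_, ?_, ?_, nb, ak, pp, mb, mp, tab⟩
  · intro a ha
    rw [← d₁ _ (b₁.lt a ha), b₁.map a ha]
  · intro i j hij hj h
    rcases e₁.sorted i j hij hj with h' | h'
    · have h' : loc (u₁ i) / S < loc (u₁ j) / S := h'
      rw [d₁ i (by omega), d₁ j hj, h] at h'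
      exact absurd h' (lt_irrefl _)
    · exact hB _ (e₁.mem i (by omega)) _ (e₁.mem j hj) h'.2
  · intro a ha
    rw [← d₂ _ (b₂.lt a ha), b₂.map a ha]
  · intro i j hij hj h
    rcases e₂.sorted i j hij hj with h' | h'
    · have h' : slot (u₂ i) / g < slot (u₂ j) / g := h'
      rw [d₂ i (by omega), d₂ j hj, h] at h'
      exact absurd h' (lt_irrefl _)
    · exact hA _ (e₂.mem i (by omega)) _ (e₂.mem j hj) h'.2
  · intro a ha
    rw [← d₃ _ (b₃.lt a ha), b₃.map a ha]
  · intro i j hij hj h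
    rcases e₃.sorted i j hij hj with h' | h'
    · have h' : slot (u₃ i) / g < slot (u₃ j) / g := h'
      rw [d₃ i (by omega), d₃ j hj, h] at h'
      exact absurd h' (lt_irrefl _)
    · exact hP _ (e₃.mem i (by omega)) _ (e₃.mem j hj) h'.2

theorem jobBody_spec {c : Lim} (hc : 64 * c.D < c.W) {s : St} {N S g f ch jb n : ℕ} {E : Finset ℕ}
    {rP rA rB : ℕ → ℕ → Prop} {loc : ℕ → ℕ}
    (hP : Enum (s.arr .WP) N E rP) (hA : Enum (s.arr .WA) N E rA) (hB : Enum (s.arr .WB) N E rB)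
    (hrP : ∀ a, ¬ rP a a) (hrA : ∀ a, ¬ rA a a) (hrB : ∀ a, ¬ rB a a)
    (hP' : ∀ a ∈ E, ∀ b ∈ E, rP a b → loc a < loc b)
    (hA' : ∀ a ∈ E, ∀ b ∈ E, rA a b → s.arr .RK a < s.arr .RK b)
    (hB' : ∀ a ∈ E, ∀ b ∈ E, rB a b → s.arr .B0 b ≤ s.arr .B0 a)
    (hN : s.var .N = N) (hS : s.var .S = S) (hg : s.var .g = g) (hf : s.var .f = f)
    (hch : s.var .ch = ch) (hjb : s.var .jb = jb) (hn : s.var .n = n) (hg0 : 0 < g) (hf0 : 0 < f)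
    (hch0 : 0 < ch) (hSf : S = ch * f) (hSg : g ≤ S) (hfg : (Nat.log 2 f + 1) * f ≤ g)
    (hgW : 2 ^ g < c.W) (hLG : s.arr .LG f = Nat.log 2 f)
    (hloc : ∀ x ∈ E, s.arr .LOC x = loc x) (hlocN : ∀ x ∈ E, loc x < N)
    (hinj : ∀ a ∈ E, ∀ b ∈ E, loc a = loc b → a = b) (hκ : ∀ x ∈ E, s.arr .RK x ≤ n)
    (hED : ∀ x ∈ E, x < c.D) (hD : jb + (N / g + 1) * g < c.D) :
    Triple c jobBody s (4000 * (N + g + 1)) fun s' =>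
      (∃ u₁ slot u₂ ar u₃ pr, IsJob (s'.arr .NB) (s'.arr .AK) (s'.arr .PP) (s'.arr .MB)
        (s'.arr .MP) (s'.arr .T1) jb g f S ch N n E loc (s.arr .RK) (s.arr .B0)
        u₁ slot u₂ ar u₃ pr) ∧
      ∀ a ∈ [Arr.NB, .AK, .PP, .MB, .MP, .T1], ∀ i < jb, s'.arr a i = s.arr a i := by
  have hNlt := Nat.lt_div_mul_add (a := N) hg0
  have hND : jb + N + 1 < c.D := by
    rw [Nat.add_mul] at hD; omega
  refine Triple.seq_le (T₁ := 1500 * (N + 1)) (T₂ := 2500 * (N + g + 1)) (jobOrder_spec hc hP hA hB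
    hrA hrB hN hS hg hloc hlocN hED (by omega)) ?_ (by omega)
  rintro s1 i1 ⟨e₁, h₁, e₂, h₂, e₃, hk⟩
  refine Triple.seq_le (T₁ := 400 * (N + 1)) (T₂ := 2000 * (N + g + 1)) (jobPools_spec hc
    ((i1.var _ rfl).trans hN) ((i1.var _ rfl).trans hg) ((i1.var _ rfl).trans hjb) hg0 hgW
    (by omega) (fun t ht => hED _ (e₁.mem t ht)) (fun t ht => hED _ (e₂.mem t ht))
    (fun t ht => hED _ (e₃.mem t ht))) ?_ (by omega)
  rintro s2 j2 ⟨nb, ak, pp, mb, mp, low⟩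
  have i2 := i1.trans j2
  have q1 : s2.arr .WP = s.arr .WP := i2.arr _ rfl
  have q2 : s2.arr .LG = s.arr .LG := i2.arr _ rfl
  have q3 : s2.arr .LOC = s.arr .LOC := i2.arr _ rfl
  have q4 : s2.arr .KEY = s1.arr .KEY := j2.arr _ rfl
  have q5 : s2.arr .RK = s.arr .RK := i2.arr _ rfl
  have q6 : s1.arr .B0 = s.arr .B0 := i1.arr _ rfl
  have q7 : s1.arr .RK = s.arr .RK := i1.arr _ rfl
  have q8 : s1.arr .LOC = s.arr .LOC := i1.arr _ rfl
  have b₁ := e₁.bij (KeyLex.irrefl hrB) h₁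
  refine (jobTable_spec hc (s := s2) (N := N) (S := S) (g := g) (f := f) (ch := ch) (jb := jb)
    (n := n) (E := E) (rP := rP) (loc := loc) (slot := s1.arr .SL) (by rw [q1]; exact hP) hrP
    ((i2.var _ rfl).trans hN) ((i2.var _ rfl).trans hS) ((i2.var _ rfl).trans hg)
    ((i2.var _ rfl).trans hf) ((i2.var _ rfl).trans hch) ((i2.var _ rfl).trans hjb)
    ((i2.var _ rfl).trans hn) hg0 hf0 hch0 hSf hSg hfg (by rw [q2]; exact hLG)
    (by rw [q3]; exact hloc) (by rw [q4]; exact hk) b₁.lt (by rw [q5]; exact hκ) hED hD).mono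
    le_rfl ?_
  rintro s3 j3 ⟨tab, low'⟩
  rw [q5] at tab
  rw [q6] at nb
  rw [q7] at ak
  rw [q8] at pp
  refine ⟨⟨s1.arr .L1, s1.arr .SL, s1.arr .L2, s1.arr .AR, s1.arr .L3, ?_⟩, ?_⟩
  · have r1 : s3.arr .NB = s2.arr .NB := j3.arr _ rfl
    have r2 : s3.arr .AK = s2.arr .AK := j3.arr _ rfl
    have r3 : s3.arr .PP = s2.arr .PP := j3.arr _ rfl
    have r4 : s3.arr .MB = s2.arr .MB := j3.arr _ rfl
    have r5 : s3.arr .MP = s2.arr .MP := j3.arr _ rfl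
    rw [r1, r2, r3, r4, r5]
    refine isJob_of_sorted e₁ h₁ e₂ h₂ e₃ (by omega) hg0 hrP hrA hrB hP' hA' hB' hlocN hinj nb ak
      (fun i hi => ?_) mb mp tab
    rw [pp i hi, hloc _ (e₃.mem i hi)]
  · intro a ha i hi
    by_cases h : a = .T1
    · subst h
      rw [low' i hi, i2.arr _ rfl]
    · have ha' : a ∈ [Arr.NB, .AK, .PP, .MB, .MP] := by simpa [h] using ha
      have r1 : s3.arr a = s2.arr a := j3.arr _ (by fin_cases ha' <;> rfl)
      have r2 : s1.arr a = s.arr a := i1.arr _ (by fin_cases ha' <;> rfl)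
      rw [r1, low a ha' i hi, r2]

/-! ### Preprocessing: one class -/

/-- The order by descending `B`. -/
def DescLt (B : ℕ → ℕ) (x y : ℕ) : Prop := B y < B x ∨ B x = B y ∧ x < y

theorem DescLt.irrefl {B : ℕ → ℕ} (x : ℕ) : ¬ DescLt B x x := by simp [DescLt]

/-- The three lists of the elements of `E`: by position, by key and by descending `B`. -/
structure Lists (s : St) (N : ℕ) (E : Finset ℕ) : Prop where
  var : s.var .N = N
  wp : Enum (s.arr .WP) N E (· < ·)
  wa : Enum (s.arr .WA) N E fun x y => s.arr .RK x < s.arr .RK y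
  wb : Enum (s.arr .WB) N E (DescLt (s.arr .B0))

theorem Lists.congr {s s' : St} {N : ℕ} {E : Finset ℕ} (h : Lists s N E)
    (hN : s'.var .N = s.var .N)
    (ha : ∀ a ∈ [Arr.WP, .WA, .WB, .RK, .B0], s'.arr a = s.arr a) : Lists s' N E := by
  constructor
  · rw [hN, h.var]
  · rw [ha .WP (by simp)]; exact h.wp
  · rw [ha .WA (by simp), ha .RK (by simp)]; exact h.wa
  · rw [ha .WB (by simp), ha .B0 (by simp)]; exact h.wb

/-- Remove the elements with a value less than `th` from the lists. -/
def classLists : Stmt := filterList .WP ;; filterList .WA ;; filterList .WB ;; .N ::= var .cnt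

/-- The sets of successive classes decrease, so filtering the three lists replaces sorting anew. The
length `N` is updated only at the end because all three filters read the old one. -/
theorem classLists_spec {c : Lim} (hc : 64 * c.D < c.W) {s : St} {N θ : ℕ} {E : Finset ℕ}
    (hL : Lists s N E) (hθ : s.var .th = θ) (hND : N < c.D) (hED : ∀ x ∈ E, x < c.D) :
    Triple c classLists s (400 * (N + 1)) fun s' =>
      Lists s' (E.filter fun a => θ ≤ s.arr .B0 a).card (E.filter fun a => θ ≤ s.arr .B0 a) := by
  refine Triple.seq_le (T₂ := 300 * (N + 1)) (filterList_spec hc (by decide) hL.var hθ hND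
    (fun t ht => hED _ (hL.wp.mem t ht)) hL.wp fun _ => lt_irrefl _) ?_ (by omega)
  rintro s1 i1 ⟨-, e1⟩
  have b1 : s1.arr .B0 = s.arr .B0 := i1.arr _ rfl
  have w1 : s1.arr .WA = s.arr .WA := i1.arr _ rfl
  refine Triple.seq_le (T₂ := 200 * (N + 1)) (filterList_spec (N := N) (θ := θ) (E := E)
    (r := fun x y => s.arr .RK x < s.arr .RK y) hc (by decide)
    ((i1.var _ rfl).trans hL.var) ((i1.var _ rfl).trans hθ) hND
    (fun t ht => by rw [w1]; exact hED _ (hL.wa.mem t ht)) (by rw [w1]; exact hL.wa)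
    fun _ => lt_irrefl _) ?_ (by omega)
  rintro s2 j2 ⟨-, e2⟩
  have i2 := i1.trans j2
  have b2 : s2.arr .B0 = s.arr .B0 := i2.arr _ rfl
  have w2 : s2.arr .WB = s.arr .WB := i2.arr _ rfl
  refine Triple.seq_le (T₂ := 5) (filterList_spec hc (by decide)
    ((i2.var _ rfl).trans hL.var) ((i2.var _ rfl).trans hθ) hND
    (fun t ht => by rw [w2]; exact hED _ (hL.wb.mem t ht)) (by rw [w2]; exact hL.wb)
    DescLt.irrefl) ?_ (by omega)
  rintro s3 j3 ⟨n3, e3⟩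
  have i3 := i2.trans j3
  rw [b1] at e2
  rw [b2] at e3 n3
  refine Triple.flat rfl (by simp [Stmt.cost]) (by simp [Stmt.safe]) ?_
  simp only [run, Expr.eval_var]
  have ha : (s3.setVar .N (s3.var .cnt)).arr = s3.arr := rfl
  refine ⟨by simp [n3], ?_, ?_, ?_⟩
  · rw [ha, (j2.trans j3).arr .WP rfl]; exact e1
  · rw [ha, j3.arr .WA rfl, i3.arr .RK rfl]; exact e2
  · rw [ha, i3.arr .B0 rfl]; exact e3

theorem above_filter {n θ θ' : ℕ} {B : ℕ → ℕ} (h : θ ≤ θ') :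
    (above n B θ).filter (fun a => θ' ≤ B a) = above n B θ' := by
  ext x
  simp only [Finset.mem_filter, mem_above]
  exact ⟨fun h => ⟨h.1.1, h.2⟩, fun h' => ⟨⟨h'.1, h.trans h'.2⟩, h'.2⟩⟩

/-- Therefore `LOC`, which is filled with indices in the sorted list, holds the ranks. -/
theorem Enum.rank_eq {u : ℕ → ℕ} {N : ℕ} {E : Finset ℕ} (h : Enum u N E (· < ·)) {t : ℕ}
    (ht : t < N) : rank E (u t) = t := by
  have key : ∀ i < N, (i < t ↔ i < rank E (u t)) := fun i hi => by
    have := h.lt_card_filter_iff (fun _ => lt_irrefl _) (P := (· < u t))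
      (fun a _ b _ h1 h2 => h1.trans h2) hi
    rw [rank, ← this]
    constructor
    · exact fun hlt => h.sorted i t hlt ht
    · intro hlt
      by_contra h'
      rcases (not_lt.1 h').lt_or_eq with h2 | rfl
      · exact absurd (h.sorted t i h2 hi) (not_lt.2 hlt.le)
      · exact lt_irrefl _ hlt
  have hle : rank E (u t) ≤ N := h.card ▸ rank_le_card E _
  have h1 := key (rank E (u t))
  have h2 := key t ht
  by_contra hne
  rcases Nat.lt_or_gt_of_ne hne with h3 | h3
  · have := (h1 (by omega)).1 h3; omega
  · have := h2.2 h3; omega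

/-! ### Lists and rank samples of a class -/

/-- Store the thresholds, the sorted list of the elements and the samples of their ranks. -/
def classIndex : Stmt :=
  .put .CTH (var .k) (var .th) ;;
  .put .CTH (var .k + 1) (var .th') ;;
  .put .CB (var .k) (var .cb) ;;
  .put .CN (var .k) (var .N) ;;
  fillPool .cb .PL (get .WP (var .t)) ;;
  forEach .WP .LOC (var .t) ;;
  forEach .WP .KEY (get .WP (var .t) / var .g) ;;
  .J ::= var .ns ;;
  countStarts .WP .KEY ;;
  .loop .t (var .ns) (.put .RS (var .k * var .ns + var .t) (get .CNT (var .t))) ;;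
  .cb ::= var .cb + var .N

/-- The samples are a by-product of counting sort: with the keys `x / g`, the start of block `j` is
the number of elements less than `j * g`. -/
theorem classIndex_spec {c : Lim} (hc : 64 * c.D < c.W) {s : St} {N n g k ns θ θ' cb : ℕ}
    {E : Finset ℕ} (hL : Lists s N E) (hk : s.var .k = k) (hg : s.var .g = g)
    (hns : s.var .ns = ns) (hθ : s.var .th = θ) (hθ' : s.var .th' = θ') (hcb : s.var .cb = cb)
    (hg0 : 0 < g) (hnsn : ns = n / g + 1) (hEn : ∀ x ∈ E, x < n) (hnD : n + 2 < c.D)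
    (hkD : k + 1 < c.D) (hcD : cb + N < c.D) (hRD : k * ns + ns < c.D) :
    Triple c classIndex s (500 * (N + ns + 1)) fun s' =>
      s'.var .cb = cb + N ∧ s'.arr .CTH k = θ ∧ s'.arr .CTH (k + 1) = θ' ∧ s'.arr .CB k = cb ∧
      s'.arr .CN k = N ∧ (∀ i < k, s'.arr .CTH i = s.arr .CTH i) ∧
      (∀ i < k, s'.arr .CB i = s.arr .CB i) ∧ (∀ i < k, s'.arr .CN i = s.arr .CN i) ∧
      Enum (fun i => s'.arr .PL (cb + i)) N E (· < ·) ∧ (∀ i < cb, s'.arr .PL i = s.arr .PL i) ∧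
      (∀ x ∈ E, s'.arr .LOC x = rank E x) ∧
      (∀ j < ns, s'.arr .RS (k * ns + j) = rank E (j * g)) ∧
      ∀ i < k * ns, s'.arr .RS i = s.arr .RS i := by
  have hED : ∀ x ∈ E, x < c.D := fun x hx => by have := hEn x hx; omega
  have hnsD : ns ≤ n + 1 := by
    rw [hnsn]; exact Nat.succ_le_succ (Nat.div_le_self _ _)
  refine Triple.put_seq (T := 490 * (N + ns + 1)) (by simp) (by simp) (by simp [hk]; omega) ?_
    (by simp; omega)
  refine Triple.put_seq (T := 480 * (N + ns + 1)) (by simp [hk]; omega) (by simp)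
    (by simp [hk]; omega) ?_ (by simp; omega)
  refine Triple.put_seq (T := 470 * (N + ns + 1)) (by simp) (by simp) (by simp [hk]; omega) ?_
    (by simp; omega)
  refine Triple.put_seq (T := 460 * (N + ns + 1)) (by simp) (by simp) (by simp [hk]; omega) ?_
    (by simp; omega)
  set s1 := (((s.setArr .CTH _ _).setArr .CTH _ _).setArr .CB _ _).setArr .CN _ _ with hs1
  have v1 : s1.var = s.var := rfl
  have a1 : ∀ a, a ≠ .CTH → a ≠ .CB → a ≠ .CN → s1.arr a = s.arr a := fun a h1 h2 h3 => by
    funext i; simp [hs1, h1, h2, h3]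
  have t1 : s1.arr .CTH k = θ ∧ s1.arr .CTH (k + 1) = θ' ∧ ∀ i < k, s1.arr .CTH i = s.arr .CTH i := by
    refine ⟨by simp [hs1, hk, hθ], by simp [hs1, hk, hθ'], fun i hi => ?_⟩
    simp [hs1, hk, hi.ne, (show i ≠ k + 1 by omega)]
  have t2 : s1.arr .CB k = cb ∧ ∀ i < k, s1.arr .CB i = s.arr .CB i := by
    refine ⟨by simp [hs1, hk, hcb], fun i hi => ?_⟩
    simp [hs1, hk, hi.ne]
  have t3 : s1.arr .CN k = N ∧ ∀ i < k, s1.arr .CN i = s.arr .CN i := by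
    refine ⟨by simp [hs1, hk, hL.var], fun i hi => ?_⟩
    simp [hs1, hk, hi.ne]
  have L1 : Lists s1 N E := hL.congr rfl fun a ha => a1 a (by fin_cases ha <;> simp)
    (by fin_cases ha <;> simp) (by fin_cases ha <;> simp)
  have pl1 : s1.arr .PL = s.arr .PL := a1 _ (by simp) (by simp) (by simp)
  have rs1 : s1.arr .RS = s.arr .RS := a1 _ (by simp) (by simp) (by simp)
  clear_value s1
  refine Triple.seq_le (T₁ := 4 + N * 40) (T₂ := 400 * (N + ns + 1)) ((fillPool_spec hc (by decide)
    (fun t => s1.arr .WP t) L1.var (by rw [v1, hcb]) hcD ?_).mono (by simp; omega) fun _ _ => id) ?_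
    (by omega)
  · intro t ht u
    simp; omega
  rintro s2 j2 ⟨k2, m2⟩
  have w2 : s2.arr .WP = s1.arr .WP := j2.arr _ rfl
  refine Triple.seq_le (T₁ := 4 + N * 40) (T₂ := 350 * (N + ns + 1)) ((forEach_spec (by decide)
    (fun t => t) ((j2.var _ rfl).trans L1.var) (w2 ▸ L1.wp) (fun _ => lt_irrefl _) hED (by omega)
    ?_).mono (by simp; omega) fun _ _ => id) ?_ (by omega)
  · intro t ht u
    simp
  rintro s3 j3 k3
  rw [w2] at k3
  have i3 := j2.trans j3
  have w3 : s3.arr .WP = s1.arr .WP := i3.arr _ rfl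
  refine Triple.seq_le (T₁ := 4 + N * 40) (T₂ := 300 * (N + ns + 1)) ((forEach_spec (by decide)
    (fun t => s1.arr .WP t / g) ((i3.var _ rfl).trans L1.var) (w3 ▸ L1.wp) (fun _ => lt_irrefl _)
    hED (by omega) ?_).mono (by simp; omega) fun _ _ => id) ?_ (by omega)
  · intro t ht u
    have h3 : s3.var .g = g := by rw [i3.var _ rfl, v1, hg]
    simp [h3, w3]
    omega
  rintro s4 j4 k4
  rw [w3] at k4
  have i4 := i3.trans j4
  refine Triple.assign_seq (T := 290 * (N + ns + 1)) (by simp) ?_ (by simp; omega)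
  have j5 := Same.assign .J (var .ns) s4 (eval s4 (var .ns))
  have i5 := i4.trans j5
  set s5 := s4.setVar .J _ with hs5
  have w5 : s5.arr .WP = s1.arr .WP := i5.arr _ rfl
  have J5 : s5.var .J = ns := by
    have : s4.var .ns = ns := by rw [i4.var _ rfl, v1, hns]
    simp [hs5, this]
  have k5 : ∀ t < N, s5.arr .KEY (s1.arr .WP t) = s1.arr .WP t / g := k4
  refine Triple.seq_le (T₁ := 100 * (N + ns + 1)) (T₂ := 190 * (N + ns + 1)) (countStarts_spec hc
    (by decide) (by decide) ((i5.var _ rfl).trans L1.var) J5 (by omega) (by omega) ?_ ?_) ?_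
    (by omega)
  · exact fun t ht => by rw [w5]; exact hED _ (L1.wp.mem t ht)
  · intro t ht
    rw [w5, k5 t ht, hnsn, Nat.lt_succ_iff]
    exact Nat.div_le_div_right (hEn _ (L1.wp.mem t ht)).le
  intro s6 j6 k6
  have i6 := i5.trans j6
  have hcnt : ∀ j ≤ ns, s6.arr .CNT j = rank E (j * g) := by
    intro j hj
    rw [k6 j hj, w5]
    have e1 : ∀ t, t < N → (s5.arr .KEY (s1.arr .WP t) < j ↔ s1.arr .WP t < j * g) := fun t ht => by
      rw [k5 t ht, Nat.div_lt_iff_lt_mul hg0]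
    rw [rank, L1.wp.card_filter (fun _ => lt_irrefl _), Nat.count_eq_card_filter_range,
      Nat.count_eq_card_filter_range]
    congr 1
    exact Finset.filter_congr fun t ht => e1 t (Finset.mem_range.1 ht)
  have kv6 : s6.var .k = k := by rw [i6.var _ rfl, v1, hk]
  have nv6 : s6.var .ns = ns := by rw [i6.var _ rfl, v1, hns]
  refine Triple.seq_le (T₁ := 4 + ns * 50) (T₂ := 5) ((Triple.loop_put ns (fun t => k * ns + t)
    (fun t => s6.arr .CNT t) (by simp) (by simp [nv6]) ?_ (fun t ht => by omega)
    (fun t ht j hj e => by omega)).mono (by simp; omega) fun _ _ => id) ?_ (by omega)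
  · intro t ht u
    simp [kv6, nv6]
    omega
  rintro s7 j7 ⟨k7, m7⟩
  have i7 := i6.trans j7
  have cb7 : s7.var .cb = cb := by rw [i7.var _ rfl, v1, hcb]
  have N7 : s7.var .N = N := by rw [i7.var _ rfl, L1.var]
  refine Triple.flat rfl (by simp [Stmt.cost]) (by simp [Stmt.safe, cb7, N7]; omega) ?_
  simp only [run, St.setVar_arr]
  have f2 : s7.arr .PL = s2.arr .PL := (((j3.trans j4).trans (j5.trans j6)).trans j7).arr _ rfl
  have f3 : s7.arr .LOC = s3.arr .LOC := ((j4.trans (j5.trans j6)).trans j7).arr _ rfl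
  refine ⟨by simp [cb7, N7], ?_, ?_, ?_, ?_, ?_, ?_, ?_, ?_, ?_, ?_, ?_, ?_⟩
  · rw [i7.arr .CTH rfl]; exact t1.1
  · rw [i7.arr .CTH rfl]; exact t1.2.1
  · rw [i7.arr .CB rfl]; exact t2.1
  · rw [i7.arr .CN rfl]; exact t3.1
  · rw [i7.arr .CTH rfl]; exact t1.2.2
  · rw [i7.arr .CB rfl]; exact t2.2
  · rw [i7.arr .CN rfl]; exact t3.2
  · exact L1.wp.congr fun i hi => by rw [f2, k2 i hi]
  · intro i hi
    rw [f2, m2 i hi, pl1]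
  · intro x hx
    obtain ⟨t, ht, rfl⟩ := L1.wp.surj (fun _ => lt_irrefl _) hx
    rw [f3, k3 t ht, L1.wp.rank_eq ht]
  · intro j hj
    rw [k7 j hj, hcnt j hj.le]
  · intro i hi
    rw [m7 i fun j hj => by omega, i6.arr .RS rfl, rs1]

theorem HasJob.congr {a a' : Arr → ℕ → ℕ} {n f jb N l : ℕ} {E : Finset ℕ}
    (h : HasJob a n f jb N l E) (hf : 0 < f) (hRK : a' .RK = a .RK) (hB : a' .B0 = a .B0)
    (hp : ∀ x ∈ [Arr.NB, .AK, .PP, .MB, .MP, .T1], ∀ i < jb + (N / (f * f) + 1) * (f * f),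
      a' x i = a x i) : HasJob a' n f jb N l E := by
  obtain ⟨u₁, slot, u₂, ar, u₃, pr, h⟩ := h
  refine ⟨u₁, slot, u₂, ar, u₃, pr, ?_⟩
  rw [hRK, hB]
  exact h.congr_cells (Nat.mul_pos hf hf) (Nat.mul_le_mul_right _ (Nat.log_lt_self 2 hf.ne'))
    (hp _ (by simp)) (hp _ (by simp)) (hp _ (by simp)) (hp _ (by simp)) (hp _ (by simp))
    (hp _ (by simp))

theorem HasTop.congr {a a' : Arr → ℕ → ℕ} {n f tb N θ θ' : ℕ} {E : Finset ℕ}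
    (h : HasTop a n f tb N θ θ' E) (hRK : a' .RK = a .RK) (hB : a' .B0 = a .B0)
    (hp : ∀ i < tb + topSize f N θ θ', a' .T2 i = a .T2 i) : HasTop a' n f tb N θ θ' E := by
  unfold HasTop at h ⊢
  rw [hRK, hB]
  exact h.congr_cells le_rfl hp

/-! ### The five levels of a class -/

/-- Store the structures for the five levels. -/
def classJobs : Stmt :=
  .ch ::= var .f ;;
  .loop .l 5 (
    .S ::= var .ch * var .f ;;
    .put .JT (var .k * 6 + var .l) (var .jb) ;;
    jobBody ;;
    .jb ::= var .jb + (var .N / var .g + 1) * var .g ;;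
    .ch ::= var .S)

/-- Each level takes the next `Z` addresses of the pools, whatever its node size. After the last
level `ch` is `f ^ 6`, the block size of the top table. -/
theorem classJobs_spec {c : Lim} {s : St} {N n f H k jb : ℕ} {E : Finset ℕ} (hp : Params c n f H)
    (hL : Lists s N E) (hk : s.var .k = k) (hg : s.var .g = f * f) (hf : s.var .f = f)
    (hjb : s.var .jb = jb) (hn : s.var .n = n) (hEn : ∀ x ∈ E, x < n)
    (hLG : s.arr .LG f = Nat.log 2 f) (hloc : ∀ x ∈ E, s.arr .LOC x = rank E x)
    (hκ : ∀ x ∈ E, s.arr .RK x ≤ n) (hkD : k * 6 + 6 < c.D)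
    (hD : jb + 5 * ((N / (f * f) + 1) * (f * f)) < c.D) :
    Triple c classJobs s (21000 * (N + f * f + 1)) fun s' =>
      s'.var .jb = jb + 5 * ((N / (f * f) + 1) * (f * f)) ∧ s'.var .ch = f ^ 6 ∧
      (∀ l < 5, s'.arr .JT (k * 6 + l) = jb + l * ((N / (f * f) + 1) * (f * f)) ∧
        HasJob s'.arr n f (jb + l * ((N / (f * f) + 1) * (f * f))) N l E) ∧
      (∀ a ∈ [Arr.NB, .AK, .PP, .MB, .MP, .T1], ∀ i < jb, s'.arr a i = s.arr a i) ∧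
      ∀ i < k * 6, s'.arr .JT i = s.arr .JT i := by
  have hDW := hp.D_lt
  have h6D := hp.f_lt
  have hnD := hp.n_lt
  set Z := (N / (f * f) + 1) * (f * f) with hZ
  have hZ1 : N / (f * f) + 1 ≤ Z := Nat.le_mul_of_pos_right _ hp.g_pos
  refine Triple.assign_seq (T := 20990 * (N + f * f + 1)) (by simp) ?_ (by simp; omega)
  set s0 := s.setVar .ch _ with hs0
  -- The finished levels and all cells below the initial `jb`, which belong to earlier classes, are
  -- carried along.
  refine (Triple.loop (fun l s' => s'.var .jb = jb + l * Z ∧ s'.var .ch = f ^ (l + 1) ∧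
      (∀ l' < l, s'.arr .JT (k * 6 + l') = jb + l' * Z ∧ HasJob s'.arr n f (jb + l' * Z) N l' E) ∧
      (∀ a ∈ [Arr.NB, .AK, .PP, .MB, .MP, .T1], ∀ i < jb, s'.arr a i = s.arr a i) ∧
      ∀ i < k * 6, s'.arr .JT i = s.arr .JT i) 5 (4100 * (N + f * f + 1)) (by simp; omega)
      (by simp) ?_ ?_).mono (by simp; omega) fun _ _ => id
  · exact ⟨by simp [hs0, hjb], by simp [hs0, hf], by simp, fun _ _ _ _ => rfl, fun _ _ => rfl⟩
  rintro l hl s1 i1 ⟨q1, q2, q3, q4, q5⟩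
  have hlZ : (l + 1) * Z ≤ 5 * Z := Nat.mul_le_mul_right _ hl
  have hlZ' : (l + 1) * Z = l * Z + Z := by ring
  have hS : f ^ (l + 1) * f = f ^ (l + 2) := (pow_succ f (l + 1)).symm
  have h6 := hp.pow_le (show l + 2 ≤ 6 by omega)
  have frame : ∀ y, y ≠ .ch → (loop .l 5 (
    .S ::= var .ch * var .f ;;
    .put .JT (var .k * 6 + var .l) (var .jb) ;;
    jobBody ;;
    .jb ::= var .jb + (var .N / var .g + 1) * var .g ;;
    .ch ::= var .S)).wr y = false → s1.var y = s.var y := fun y h1 h2 => by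
    rw [i1.var y h2]; simp [hs0, h1]
  have g1 : s1.var .f = f := by rw [frame _ (by decide) rfl, hf]
  have g2 : s1.var .g = f * f := by rw [frame _ (by decide) rfl, hg]
  have g3 : s1.var .N = N := by rw [frame _ (by decide) rfl, hL.var]
  have g4 : s1.var .n = n := by rw [frame _ (by decide) rfl, hn]
  have g5 : s1.var .k = k := by rw [frame _ (by decide) rfl, hk]
  have a1 : s1.arr .WP = s.arr .WP := i1.arr _ rfl
  have a2 : s1.arr .WA = s.arr .WA := i1.arr _ rfl
  have a3 : s1.arr .WB = s.arr .WB := i1.arr _ rfl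
  have a4 : s1.arr .RK = s.arr .RK := i1.arr _ rfl
  have a5 : s1.arr .B0 = s.arr .B0 := i1.arr _ rfl
  have a6 : s1.arr .LOC = s.arr .LOC := i1.arr _ rfl
  have a7 : s1.arr .LG = s.arr .LG := i1.arr _ rfl
  refine Triple.assign_seq (T := 4090 * (N + f * f + 1)) (by simp [q2, g1, hS]; omega) ?_
    (by simp; omega)
  refine Triple.put_seq (T := 4070 * (N + f * f + 1)) (by simp [g5]; omega) (by simp)
    (by simp [g5]; omega) ?_ (by simp; omega)
  set s2 := ((s1.setVar .l _).setVar .S _).setArr .JT _ _ with hs2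
  have e2 : ∀ a, a ≠ .JT → s2.arr a = s1.arr a := fun a ha => by funext i; simp [hs2, ha]
  have v2 : ∀ y, y ≠ .l → y ≠ .S → s2.var y = s1.var y := fun y h1 h2 => by simp [hs2, h1, h2]
  have S2 : s2.var .S = f ^ (l + 2) := by simp [hs2, q2, g1, hS]
  have jt2 : s2.arr .JT (k * 6 + l) = jb + l * Z := by simp [hs2, g5, q1]
  have jt2' : ∀ i, i ≠ k * 6 + l → s2.arr .JT i = s1.arr .JT i := fun i hi => by
    simp [hs2, g5, hi]
  have hgS : f * f ≤ f ^ (l + 2) := by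
    rw [← pow_two]; exact Nat.pow_le_pow_right hp.f_pos (by omega)
  clear_value s2
  refine Triple.seq_le (T₁ := 4000 * (N + f * f + 1)) (T₂ := 30) (jobBody_spec hp.D_lt
    (s := s2) (N := N) (S := f ^ (l + 2)) (g := f * f) (f := f) (ch := f ^ (l + 1))
    (jb := jb + l * Z) (n := n) (E := E) (rP := (· < ·))
    (rA := fun x y => s.arr .RK x < s.arr .RK y) (rB := DescLt (s.arr .B0)) (loc := rank E)
    (by rw [e2 _ (by decide), a1]; exact hL.wp)
    (by rw [e2 _ (by decide), a2]; exact hL.wa) (by rw [e2 _ (by decide), a3]; exact hL.wb)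
    (fun _ => lt_irrefl _) (fun _ => lt_irrefl _) DescLt.irrefl
    (fun a ha b _ h => rank_lt_rank ha h) (fun a _ b _ h => by rw [e2 _ (by decide), a4]; exact h)
    (fun a _ b _ h => by
      rw [e2 _ (by decide), a5]
      rcases h with h | h
      · exact h.le
      · exact h.1.ge)
    (by rw [v2 _ (by decide) (by decide), g3]) S2 (by rw [v2 _ (by decide) (by decide), g2])
    (by rw [v2 _ (by decide) (by decide), g1]) (by rw [v2 _ (by decide) (by decide), q2])
    (by rw [v2 _ (by decide) (by decide), q1]) (by rw [v2 _ (by decide) (by decide), g4])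
    hp.g_pos hp.f_pos (pow_pos hp.f_pos _) hS.symm hgS hp.log_le hp.g_lt
    (by rw [e2 _ (by decide), a7]; exact hLG) (by rw [e2 _ (by decide), a6]; exact hloc)
    (fun x hx => by
      rw [← hL.wp.card]
      exact Finset.card_lt_card ⟨Finset.filter_subset _ _, fun h => by
        have := h hx; simp at this⟩)
    (fun a ha b hb h => by
      rcases lt_trichotomy a b with h' | h' | h'
      · exact absurd h (rank_lt_rank ha h').ne
      · exact h'
      · exact absurd h (rank_lt_rank hb h').ne')
    (by rw [e2 _ (by decide), a4]; exact hκ) (fun x hx => by have := hEn x hx; omega)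
    (by omega)) ?_ (by omega)
  rintro s3 j3 ⟨hj, low⟩
  have b1 : s3.var .jb = jb + l * Z := by
    rw [j3.var _ rfl, v2 _ (by decide) (by decide), q1]
  have b2 : s3.var .N = N := by rw [j3.var _ rfl, v2 _ (by decide) (by decide), g3]
  have b3 : s3.var .g = f * f := by rw [j3.var _ rfl, v2 _ (by decide) (by decide), g2]
  have b4 : s3.var .S = f ^ (l + 2) := by rw [j3.var _ rfl, S2]
  have b5 : s3.arr .JT = s2.arr .JT := j3.arr _ rfl
  have b6 : s3.arr .RK = s2.arr .RK := j3.arr _ rfl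
  have b7 : s3.arr .B0 = s2.arr .B0 := j3.arr _ rfl
  have hNgW : N / (f * f) + 1 < c.W := by
    generalize N / (f * f) + 1 = z at *
    omega
  refine Triple.flat rfl (by simp [Stmt.cost]) ?_ ?_
  · simp [Stmt.safe, run, b1, b2, b3, ← hZ]
    exact ⟨⟨⟨by omega, hNgW⟩, by omega⟩, by omega⟩
  · simp only [run, St.setVar_arr]
    refine ⟨by simp [b1, b2, b3, ← hZ]; omega, by simp [b4], ?_, ?_, ?_⟩
    · intro l' hl'
      rw [b5]
      rcases Nat.lt_succ_iff_lt_or_eq.1 hl' with h | rfl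
      · rw [jt2' _ (by omega)]
        have hle : (l' + 1) * Z ≤ l * Z := Nat.mul_le_mul_right _ h
        have hle' : (l' + 1) * Z = l' * Z + Z := by ring
        refine ⟨(q3 l' h).1, (q3 l' h).2.congr hp.f_pos (by rw [b6, e2 _ (by decide)])
          (by rw [b7, e2 _ (by decide)]) fun x hx i hi => ?_⟩
        rw [low x hx i (by omega), e2 x (by fin_cases hx <;> decide)]
      · refine ⟨jt2, ?_⟩
        obtain ⟨u₁, slot, u₂, ar, u₃, pr, hj⟩ := hj
        refine ⟨u₁, slot, u₂, ar, u₃, pr, ?_⟩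
        rw [b6, b7]
        exact hj
    · intro x hx i hi
      rw [low x hx i (by omega), e2 x (by fin_cases hx <;> decide), q4 x hx i hi]
    · intro i hi
      rw [b5, jt2' i (by omega), q5 i hi]

/-! ### The top table of a class -/

/-- The number of cells of the table `HasTop` if there is one. -/
def topCells (f N θ θ' : ℕ) : ℕ := if f ^ 6 ≤ N then topSize f N θ θ' else 0

/-- Store the table for the ranges of complete nodes of the highest level. -/
def classTop : Stmt :=
  .put .JT (var .k * 6 + 5) (var .tb) ;;
  .ite (lt (var .N) (var .ch)) .skip (
    .y ::= var .th' - 1 ;;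
    forEach .WP .ROW (var .y - (get .B0 (get .WP (var .t)) *
      lt (get .B0 (get .WP (var .t))) (var .y) +
      var .y * le (var .y) (get .B0 (get .WP (var .t))))) ;;
    forEach .WP .COL (get .LOC (get .WP (var .t)) / var .ch) ;;
    .rows ::= var .th' - var .th ;;
    .C ::= var .N / var .ch + 1 ;;
    .Hn ::= get .LG (var .C) + 1 ;;
    .stride ::= var .Hn * var .C ;;
    .G ::= var .rows ;;
    .base ::= var .tb ;;
    table .T2 ;;
    .tb ::= var .tb + var .rows * var .stride)

/-- Classes with fewer than `f ^ 6` elements get no table: no query leaves a complete node there.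
This is also what makes the number of blocks at most `2 * N / f ^ 6` whenever a table is built. -/
theorem classTop_spec {c : Lim} {s : St} {N n f H k θ θ' tb : ℕ} {E : Finset ℕ}
    (hp : Params c n f H) (hL : Lists s N E) (hk : s.var .k = k) (hθ : s.var .th = θ)
    (hθ' : s.var .th' = θ') (htb : s.var .tb = tb) (hch : s.var .ch = f ^ 6) (hn : s.var .n = n)
    (hEn : ∀ x ∈ E, x < n) (hEθ : ∀ x ∈ E, θ ≤ s.arr .B0 x)
    (hLG : ∀ i, 0 < i → i ≤ n + 1 → s.arr .LG i = Nat.log 2 i)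
    (hloc : ∀ x ∈ E, s.arr .LOC x = rank E x) (hκ : ∀ x ∈ E, s.arr .RK x ≤ n)
    (hlt : 0 < N → θ < θ') (hθW : θ' < c.W) (hkD : k * 6 + 6 < c.D)
    (hD : tb + topCells f N θ θ' < c.D) :
    Triple c classTop s (2000 * (N + topCells f N θ θ' + 1)) fun s' =>
      s'.var .tb = tb + topCells f N θ θ' ∧ s'.arr .JT (k * 6 + 5) = tb ∧
      (f ^ 6 ≤ N → HasTop s'.arr n f tb N θ θ' E) ∧ (∀ i < tb, s'.arr .T2 i = s.arr .T2 i) ∧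
      ∀ i < k * 6 + 5, s'.arr .JT i = s.arr .JT i := by
  have hDW := hp.D_lt
  have hnD := hp.n_lt
  have hED : ∀ x ∈ E, x < c.D := fun x hx => by have := hEn x hx; omega
  have hF : 0 < f ^ 6 := pow_pos hp.f_pos 6
  have hNn : N ≤ n := by
    rw [← hL.wp.card]
    calc E.card ≤ (Finset.range n).card :=
          Finset.card_le_card fun x hx => Finset.mem_range.2 (hEn x hx)
      _ = n := Finset.card_range n
  refine Triple.put_seq (T := 1980 * (N + topCells f N θ θ' + 1)) (by simp [hk]; omega) (by simp)
    (by simp [hk]; omega) ?_ (by simp; omega)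
  set s1 := s.setArr .JT _ _ with hs1
  have e1 : ∀ a, a ≠ .JT → s1.arr a = s.arr a := fun a ha => by funext i; simp [hs1, ha]
  have v1 : s1.var = s.var := rfl
  have jt1 : s1.arr .JT (k * 6 + 5) = tb := by simp [hs1, hk, htb]
  have jt1' : ∀ i < k * 6 + 5, s1.arr .JT i = s.arr .JT i := fun i hi => by
    simp [hs1, hk, hi.ne]
  clear_value s1
  refine (Triple.ite (T := 1970 * (N + topCells f N θ θ' + 1)) (by simp) ?_ ?_).mono
    (by simp; omega) fun _ _ => id
  · intro h
    simp only [Expr.eval_lt, Expr.eval_var, v1, hL.var, hch] at h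
    have hlt : N < f ^ 6 := by by_contra h'; simp [h'] at h
    have hz : topCells f N θ θ' = 0 := if_neg (not_le.2 hlt)
    refine Triple.flat rfl (by simp [Stmt.cost]; omega) (by simp [Stmt.safe]) ?_
    simp only [run]
    refine ⟨by rw [v1, htb, hz]; rfl, jt1, fun h => absurd h (not_le.2 hlt), fun i _ => ?_, jt1'⟩
    rw [e1 _ (by decide)]
  intro h
  simp only [Expr.eval_lt, Expr.eval_var, v1, hL.var, hch] at h
  have hfN : f ^ 6 ≤ N := by by_contra h'; simp [not_le.1 h'] at h
  have hz : topCells f N θ θ' = topSize f N θ θ' := if_pos hfN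
  have hrows : θ < θ' := hlt (by omega)
  rw [hz] at hD ⊢
  have L1 : Lists s1 N E := hL.congr (by rw [v1]) fun a ha => e1 a (by fin_cases ha <;> decide)
  have lo1 : s1.arr .LOC = s.arr .LOC := e1 _ (by decide)
  have b1 : s1.arr .B0 = s.arr .B0 := e1 _ (by decide)
  have lg1 : s1.arr .LG = s.arr .LG := e1 _ (by decide)
  have rk1 : s1.arr .RK = s.arr .RK := e1 _ (by decide)
  have t21 : s1.arr .T2 = s.arr .T2 := e1 _ (by decide)
  set TS := topSize f N θ θ' with hTS
  refine Triple.assign_seq (T := 1960 * (N + TS + 1)) (by simp [v1, hθ']; omega) ?_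
    (by simp; omega)
  have i2 := Same.assign .y (var .th' - 1) s1 (eval s1 (var .th' - 1))
  set s2 := s1.setVar .y _ with hs2
  have y2 : s2.var .y = θ' - 1 := by simp [hs2, v1, hθ']
  have w2 : s2.arr .WP = s1.arr .WP := rfl
  refine Triple.seq_le (T₁ := 4 + N * 80) (T₂ := 1850 * (N + TS + 1)) ((forEach_spec (by decide)
    (fun t => θ' - 1 - min (s.arr .B0 (s1.arr .WP t)) (θ' - 1)) ((i2.var _ rfl).trans L1.var)
    (w2 ▸ L1.wp) (fun _ => lt_irrefl _) hED (by omega) ?_).mono (by simp; omega) fun _ _ => id) ?_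
    (by omega)
  · intro t ht u
    have h1 := L1.wp.mem t ht
    have h2 := hED _ h1
    have e : s2.arr .B0 = s.arr .B0 := b1
    -- The program writes the minimum of a value and `y` as a sum of two products with comparison
    -- bits, exactly one of which is `1`.
    by_cases hb : s.arr .B0 (s1.arr .WP t) < θ' - 1
    · simp [y2, w2, e, hb, not_le.2 hb, hb.le]
      omega
    · simp [y2, w2, e, hb, not_lt.1 hb]
      omega
  intro s3 j3 k3
  have i3 := i2.trans j3
  have w3 : s3.arr .WP = s1.arr .WP := i3.arr _ rfl
  have lo3 : s3.arr .LOC = s.arr .LOC := (i3.arr _ rfl).trans lo1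
  have ch3 : s3.var .ch = f ^ 6 := (i3.var _ rfl).trans (by rw [v1, hch])
  refine Triple.seq_le (T₁ := 4 + N * 40) (T₂ := 1800 * (N + TS + 1)) ((forEach_spec (by decide)
    (fun t => rank E (s1.arr .WP t) / f ^ 6) ((i3.var _ rfl).trans L1.var)
    (w3 ▸ L1.wp) (fun _ => lt_irrefl _) hED (by omega) ?_).mono (by simp; omega) fun _ _ => id) ?_
    (by omega)
  · intro t ht u
    have h1 := L1.wp.mem t ht
    have h2 := hED _ h1
    simp [w3, lo3, ch3, hloc _ h1]
    omega
  intro s4 j4 k4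
  have i4 := i3.trans j4
  rw [w2] at k3
  rw [w3] at k4
  have krow : ∀ x ∈ E, s4.arr .ROW x = θ' - 1 - min (s.arr .B0 x) (θ' - 1) := by
    intro x hx
    obtain ⟨t, ht, rfl⟩ := L1.wp.surj (fun _ => lt_irrefl _) hx
    rw [j4.arr _ rfl]
    exact k3 t ht
  have kcol : ∀ x ∈ E, s4.arr .COL x = rank E x / f ^ 6 := by
    intro x hx
    obtain ⟨t, ht, rfl⟩ := L1.wp.surj (fun _ => lt_irrefl _) hx
    exact k4 t ht
  have c1 : s4.var .th' = θ' := (i4.var _ rfl).trans (by rw [v1, hθ'])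
  have c2 : s4.var .th = θ := (i4.var _ rfl).trans (by rw [v1, hθ])
  have c3 : s4.var .N = N := (i4.var _ rfl).trans (by rw [v1, hL.var])
  have c4 : s4.var .ch = f ^ 6 := (i4.var _ rfl).trans (by rw [v1, hch])
  have c5 : s4.var .tb = tb := (i4.var _ rfl).trans (by rw [v1, htb])
  have c6 : s4.var .n = n := (i4.var _ rfl).trans (by rw [v1, hn])
  have d1 : s4.arr .LG = s.arr .LG := (i4.arr _ rfl).trans lg1
  have d2 : s4.arr .WP = s1.arr .WP := i4.arr _ rfl
  have d3 : s4.arr .RK = s.arr .RK := (i4.arr _ rfl).trans rk1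
  have d4 : s4.arr .T2 = s.arr .T2 := (i4.arr _ rfl).trans t21
  have d5 : s4.arr .JT = s1.arr .JT := i4.arr _ rfl
  have d6 : s4.arr .B0 = s.arr .B0 := (i4.arr _ rfl).trans b1
  obtain ⟨C, hC⟩ : ∃ C, C = N / f ^ 6 + 1 := ⟨_, rfl⟩
  have hCn : C ≤ N + 1 := hC ▸ Nat.succ_le_succ (Nat.div_le_self _ _)
  have hC0 : 0 < C := hC ▸ Nat.succ_pos _
  have hlg := hLG C hC0 (by omega)
  obtain ⟨Hn, hHn⟩ : ∃ Hn, Hn = Nat.log 2 C + 1 := ⟨_, rfl⟩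
  have hTS' : TS = (θ' - θ) * (Hn * C) := by rw [hTS, topSize, hHn, hC]
  have hm1 : Hn * C ≤ TS := hTS' ▸ Nat.le_mul_of_pos_left _ (by omega)
  have hm2 : C ≤ Hn * C := Nat.le_mul_of_pos_left _ (by omega)
  have hm3 : Hn ≤ Hn * C := Nat.le_mul_of_pos_right _ hC0
  have hm4 : θ' - θ ≤ TS := hTS' ▸ Nat.le_mul_of_pos_right _ (Nat.mul_pos (by omega) hC0)
  have hm5 : (θ' - θ) * C ≤ TS := hTS' ▸ Nat.mul_le_mul_left _ hm2
  -- The time bound of `table_spec` is thereby linear in the number of cells, as `C` is positive.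
  have hm6 : (θ' - θ) * (Hn * (C + 1)) ≤ 2 * TS := by
    rw [hTS']
    calc (θ' - θ) * (Hn * (C + 1)) ≤ (θ' - θ) * (Hn * (2 * C)) := by gcongr; omega
      _ = _ := by ring
  refine Triple.assign_seq (T := 1790 * (N + TS + 1)) (by simp [c1, c2]; omega)
    (Triple.assign_seq (T := 1780 * (N + TS + 1)) (by simp [c3, c4, ← hC]; omega)
    (Triple.assign_seq (T := 1770 * (N + TS + 1)) (by simp [c3, c4, ← hC, d1, hlg]; omega)
    (Triple.assign_seq (T := 1760 * (N + TS + 1)) (by simp [c3, c4, ← hC, d1, hlg, ← hHn]; omega)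
    (Triple.assign_seq (T := 1750 * (N + TS + 1)) (by simp) (Triple.assign_seq
    (T := 1740 * (N + TS + 1)) (by simp) ?_ (by simp; omega)) (by simp; omega)) (by simp; omega))
    (by simp; omega)) (by simp; omega)) (by simp; omega)
  set s5 := (((((s4.setVar .rows _).setVar .C _).setVar .Hn _).setVar .stride _).setVar .G
    _).setVar .base _ with hs5
  have a5 : s5.arr = s4.arr := rfl
  refine Triple.seq_le (T₁ := 600 * (N + (θ' - θ) * (Hn * (C + 1)) + 1)) (T₂ := 10)
    (table_spec hp.D_lt (by decide) (s := s5) (N := N) (rows := θ' - θ) (C := C) (n := n)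
    (stride := Hn * C) (G := θ' - θ) (Hn := Hn) (base := tb) (E := E) (r := (· < ·))
    (by rw [a5, d2]; exact L1.wp) (fun _ => lt_irrefl _) (by simp [hs5, c3])
    (by simp [hs5, c1, c2]) (by simp [hs5, c3, c4, hC])
    (by simp [hs5, c6]) (by simp [hs5, c3, c4, ← hC, d1, hlg, hHn]) (by simp [hs5, c1, c2])
    (by simp [hs5, c3, c4, ← hC, d1, hlg, hHn]) (by simp [hs5, c5]) (by omega) (by omega)
    (by
      have h1 := Nat.pow_log_le_self 2 hC0.ne'
      rw [hHn, Nat.add_sub_cancel]; omega) le_rfl (by rw [← hTS']; exact hD) (by omega) (by omega)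
    (by omega) (by omega) hED ?_ ?_ ?_) ?_ (by omega)
  · intro x hx
    have := hEθ x hx
    rw [a5, krow x hx]; omega
  · intro x hx
    rw [a5, kcol x hx, hC, Nat.lt_succ_iff]
    exact Nat.div_le_div_right (hL.wp.card ▸ rank_le_card E x)
  · intro x hx
    rw [a5, d3]; exact hκ x hx
  rintro s6 j6 ⟨tab, low⟩
  have f1 : s6.var .tb = tb := by rw [j6.var _ rfl]; simp [hs5, c5]
  have f2 : s6.var .rows = θ' - θ := by rw [j6.var _ rfl]; simp [hs5, c1, c2]
  have f3 : s6.var .stride = Hn * C := by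
    rw [j6.var _ rfl]; simp [hs5, c3, c4, ← hC, d1, hlg, hHn]
  have g1 : s6.arr .B0 = s.arr .B0 := (j6.arr _ rfl).trans d6
  have g2 : s6.arr .RK = s.arr .RK := (j6.arr _ rfl).trans d3
  have g3 : s6.arr .JT = s1.arr .JT := (j6.arr _ rfl).trans d5
  rw [a5, d3] at tab
  rw [a5, d4] at low
  refine Triple.flat rfl (by simp [Stmt.cost]) ?_ ?_
  · simp [Stmt.safe, f1, f2, f3, ← hTS']
    omega
  · simp only [run, St.setVar_arr]
    refine ⟨by simp [f1, f2, f3, hTS'], by rw [g3]; exact jt1, fun _ => ?_, low, by rw [g3]; exact jt1'⟩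
    unfold HasTop
    rw [g1, g2, ← hC, ← hHn]
    exact tab.congr_keys krow kcol

/-! ### From one class to the next -/

/-- The data of the classes less than `k` are the same in `a` and `a'`. -/
structure Keeps (a a' : Arr → ℕ → ℕ) (n f k cE jE tE : ℕ) : Prop where
  rk : a' .RK = a .RK
  b0 : a' .B0 = a .B0
  cn : ∀ i < k, a' .CN i = a .CN i
  cb : ∀ i < k, a' .CB i = a .CB i
  cth : ∀ i < k + 1, 0 < k → a' .CTH i = a .CTH i
  rs : ∀ i < k * (n / (f * f) + 1), a' .RS i = a .RS i
  jt : ∀ i < k * 6, a' .JT i = a .JT i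
  pl : ∀ i < cE, a' .PL i = a .PL i
  pool : ∀ x ∈ [Arr.NB, .AK, .PP, .MB, .MP, .T1], ∀ i < jE, a' x i = a x i
  t2 : ∀ i < tE, a' .T2 i = a .T2 i

theorem IsClass.keep {a a' : Arr → ℕ → ℕ} {n f k j θ θ' N cE jE tE cE' jE' tE' : ℕ}
    (h : IsClass a n f j θ θ' N cE jE tE) (hk : Keeps a a' n f k cE jE tE) (hj : j < k) (hf : 0 < f)
    (hc : cE ≤ cE') (hjE : jE ≤ jE') (ht : tE ≤ tE') : IsClass a' n f j θ θ' N cE' jE' tE' := by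
  have e1 := hk.cb j hj
  have e2 : ∀ l < 6, a' .JT (j * 6 + l) = a .JT (j * 6 + l) := fun l hl => hk.jt _ (by omega)
  have hcb := h.cb_le
  refine ⟨(hk.cn j hj).trans h.card, (hk.cth j (by omega) (by omega)).trans h.th,
    (hk.cth (j + 1) (by omega) (by omega)).trans h.th', by omega, ?_, ?_, ?_, ?_, ?_, ?_⟩
  · rw [e1, hk.b0]
    exact h.pl.congr fun i hi => hk.pl _ (by omega)
  · intro i hi
    rw [hk.b0, ← h.rs i hi]
    refine hk.rs _ ?_
    calc j * (n / (f * f) + 1) + i < j * (n / (f * f) + 1) + (n / (f * f) + 1) := by omega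
      _ = (j + 1) * (n / (f * f) + 1) := by ring
      _ ≤ _ := Nat.mul_le_mul_right _ hj
  · intro l hl
    rw [e2 l (by omega)]
    exact (h.jb_le l hl).trans hjE
  · intro l hl
    rw [e2 l (by omega), hk.b0]
    exact (h.job l hl).congr hf hk.rk hk.b0 fun x hx i hi =>
      hk.pool x hx i (hi.trans_le (h.jb_le l hl))
  · intro hN
    rw [e2 5 (by omega)]
    exact (h.tb_le hN).trans ht
  · intro hN
    rw [e2 5 (by omega), hk.b0]
    exact (h.top hN).congr hk.rk hk.b0 fun i hi => hk.t2 i (hi.trans_le (h.tb_le hN))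

/-- Store the data of a class and go on to the next one. -/
def classBody : Stmt :=
  classLists ;;
  classIndex ;;
  classJobs ;;
  classTop ;;
  .th ::= var .th' ;;
  .th' ::= var .th' + var .th' ;;
  .ite (lt (var .mx) (var .th')) (.th' ::= var .mx + 1) .skip

/-- The number of cells of the pools for the levels of a class with `N` elements. -/
def jobCells (f N : ℕ) : ℕ := 5 * ((N / (f * f) + 1) * (f * f))

/-- The lists on entry belong to the previous threshold `θ₀`, hence the term `N₀` in the time. The
terms `n / g` and `g` pay for the rank samples and for the incomplete last chunks. -/
theorem classBody_spec {c : Lim} {s : St} {N₀ n f H k θ₀ θ θ' M cb jb tb N : ℕ}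
    (hp : Params c n f H) (hL : Lists s N₀ (above n (s.arr .B0) θ₀)) (hθ₀ : θ₀ ≤ θ)
    (hk : s.var .k = k) (hg : s.var .g = f * f) (hf : s.var .f = f) (hn : s.var .n = n)
    (hns : s.var .ns = n / (f * f) + 1) (hθ : s.var .th = θ) (hθ' : s.var .th' = θ')
    (hM : s.var .mx + 1 = M) (hcb : s.var .cb = cb) (hjb : s.var .jb = jb) (htb : s.var .tb = tb)
    (hLG : ∀ i, 0 < i → i ≤ max (n + 1) f → s.arr .LG i = Nat.log 2 i)
    (hκ : ∀ x < n, s.arr .RK x ≤ n) (hcth : 0 < k → s.arr .CTH k = θ)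
    (hN : N = (above n (s.arr .B0) θ).card)
    (hlt : 0 < N → θ < θ') (hθW : 2 * θ' < c.W) (hMW : M < c.W) (hkD : k * 6 + 6 < c.D)
    (hRD : k * (n / (f * f) + 1) + (n / (f * f) + 1) < c.D) (hcD : cb + N < c.D)
    (hjD : jb + jobCells f N < c.D) (htD : tb + topCells f N θ θ' < c.D) :
    Triple c classBody s (24000 * (N₀ + n / (f * f) + f * f + topCells f N θ θ' + 2)) fun s' =>
      Lists s' N (above n (s.arr .B0) θ) ∧ s'.var .th = θ' ∧ s'.var .th' = min (2 * θ') M ∧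
      s'.var .cb = cb + N ∧ s'.var .jb = jb + jobCells f N ∧
      s'.var .tb = tb + topCells f N θ θ' ∧
      IsClass s'.arr n f k θ θ' N (cb + N) (jb + jobCells f N) (tb + topCells f N θ θ') ∧
      Keeps s.arr s'.arr n f k cb jb tb := by
  have hDW := hp.D_lt
  have hnD := hp.n_lt
  have hN₀n : N₀ ≤ n := by
    rw [← hL.wp.card]
    exact (Finset.card_filter_le _ _).trans (by simp)
  have hlists := above_filter (n := n) (B := s.arr .B0) hθ₀
  have hNN : N ≤ N₀ := by
    rw [hN, ← hlists, ← hL.wp.card]; exact Finset.card_filter_le _ _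
  have hEn : ∀ θ, ∀ x ∈ above n (s.arr .B0) θ, x < n := fun θ x hx => (mem_above.1 hx).1
  set E := above n (s.arr .B0) θ with hE
  set ns := n / (f * f) + 1 with hns'
  set TC := topCells f N θ θ' with hTC
  refine Triple.seq_le (T₁ := 400 * (N₀ + 1)) (T₂ := 23600 * (N₀ + ns + f * f + TC + 1))
    (classLists_spec hp.D_lt hL hθ (by omega) fun x hx => by have := hEn _ x hx; omega) ?_
    (by omega)
  intro s1 i1 L1
  rw [hlists, ← hN] at L1
  refine Triple.seq_le (T₁ := 500 * (N + ns + 1)) (T₂ := 23050 * (N₀ + ns + f * f + TC + 1))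
    (classIndex_spec (k := k) (θ := θ) (θ' := θ') (cb := cb) (n := n) hp.D_lt L1
    ((i1.var _ rfl).trans hk) ((i1.var _ rfl).trans hg)
    ((i1.var _ rfl).trans hns) ((i1.var _ rfl).trans hθ) ((i1.var _ rfl).trans hθ')
    ((i1.var _ rfl).trans hcb) hp.g_pos hns' (hEn _) hnD (by omega) hcD hRD) ?_ (by omega)
  rintro s2 j2 ⟨x1, x2, x3, x4, x5, x6, x7, x8, x9, x10, x11, x12, x13⟩
  have i2 := i1.trans j2
  have L2 : Lists s2 N E := L1.congr (j2.var _ rfl) fun a ha => j2.arr a (by fin_cases ha <;> rfl)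
  have lg2 : s2.arr .LG = s.arr .LG := i2.arr _ rfl
  have rk2 : s2.arr .RK = s.arr .RK := i2.arr _ rfl
  have b02 : s2.arr .B0 = s.arr .B0 := i2.arr _ rfl
  refine Triple.seq_le (T₁ := 21000 * (N + f * f + 1)) (T₂ := 2040 * (N₀ + ns + f * f + TC + 1))
    (classJobs_spec (k := k) (jb := jb) hp L2 ((i2.var _ rfl).trans hk) ((i2.var _ rfl).trans hg)
    ((i2.var _ rfl).trans hf) ((i2.var _ rfl).trans hjb) ((i2.var _ rfl).trans hn) (hEn _)
    (by rw [lg2]; exact hLG f hp.f_pos (le_max_right _ _)) x11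
    (by rw [rk2]; exact fun x hx => hκ x (hEn _ x hx)) hkD hjD) ?_ (by omega)
  rintro s3 j3 ⟨y1, y2, y3, y4, y5⟩
  have i3 := i2.trans j3
  have L3 : Lists s3 N E := L2.congr (j3.var _ rfl) fun a ha => j3.arr a (by fin_cases ha <;> rfl)
  have lg3 : s3.arr .LG = s.arr .LG := i3.arr _ rfl
  have rk3 : s3.arr .RK = s.arr .RK := i3.arr _ rfl
  have b03 : s3.arr .B0 = s.arr .B0 := i3.arr _ rfl
  have lo3 : s3.arr .LOC = s2.arr .LOC := j3.arr _ rfl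
  refine Triple.seq_le (T₁ := 2000 * (N + TC + 1)) (T₂ := 30)
    (classTop_spec (k := k) (θ := θ) (θ' := θ') (tb := tb) hp L3 ((i3.var _ rfl).trans hk)
    ((i3.var _ rfl).trans hθ) ((i3.var _ rfl).trans hθ') ((i3.var _ rfl).trans htb) y2
    ((i3.var _ rfl).trans hn) (hEn _) (by rw [b03]; exact fun x hx => (mem_above.1 hx).2)
    (by rw [lg3]; exact fun i h1 h2 => hLG i h1 (h2.trans (le_max_left _ _)))
    (by rw [lo3]; exact x11) (by rw [rk3]; exact fun x hx => hκ x (hEn _ x hx)) hlt (by omega)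
    hkD htD) ?_ (by omega)
  rintro s4 j4 ⟨z1, z2, z3, z4, z5⟩
  have i4 := i3.trans j4
  have t4 := j3.trans j4
  have L4 : Lists s4 N E := L3.congr (j4.var _ rfl) fun a ha => j4.arr a (by fin_cases ha <;> rfl)
  have w1 : s4.var .th' = θ' := (i4.var _ rfl).trans hθ'
  have w2 : s4.var .mx + 1 = M := by rw [i4.var _ rfl, hM]
  have w3 : s4.var .cb = cb + N := (t4.var _ rfl).trans x1
  have w4 : s4.var .jb = jb + jobCells f N := (j4.var _ rfl).trans y1
  have b04 : s4.arr .B0 = s.arr .B0 := i4.arr _ rfl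
  have rk4 : s4.arr .RK = s.arr .RK := i4.arr _ rfl
  have hcls : IsClass s4.arr n f k θ θ' N (cb + N) (jb + jobCells f N) (tb + TC) := by
    have e1 : s4.arr .CB k = cb := by rw [t4.arr _ rfl, x4]
    have e2 : ∀ l < 5, s4.arr .JT (k * 6 + l) = jb + l * ((N / (f * f) + 1) * (f * f)) :=
      fun l hl => (z5 _ (by omega)).trans (y3 l hl).1
    refine ⟨by rw [t4.arr _ rfl, x5], by rw [t4.arr _ rfl, x2], by rw [t4.arr _ rfl, x3],
      by rw [e1], ?_, ?_, ?_, ?_, ?_, ?_⟩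
    · rw [e1, b04, t4.arr .PL rfl]; exact x9
    · intro j hj
      rw [t4.arr .RS rfl, b04]
      exact x12 j (by omega)
    · intro l hl
      rw [e2 l hl, jobCells]
      generalize (N / (f * f) + 1) * (f * f) = q
      have : (l + 1) * q ≤ 5 * q := Nat.mul_le_mul_right q hl
      have e : (l + 1) * q = l * q + q := by ring
      omega
    · intro l hl
      rw [e2 l hl, b04]
      exact (y3 l hl).2.congr hp.f_pos (by rw [rk4, rk3]) (by rw [b04, b03]) fun x hx i _ => by
        rw [j4.arr x (by fin_cases hx <;> rfl)]
    · intro h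
      rw [z2, hTC, topCells, if_pos h]
    · intro h
      rw [z2, b04]; exact z3 h
  have hkeep : Keeps s.arr s4.arr n f k cb jb tb := by
    refine ⟨rk4, b04, ?_, ?_, ?_, ?_, ?_, ?_, ?_, ?_⟩
    · intro i hi
      rw [t4.arr _ rfl, x8 i hi, i1.arr _ rfl]
    · intro i hi
      rw [t4.arr _ rfl, x7 i hi, i1.arr _ rfl]
    · intro i hi h0
      rw [t4.arr _ rfl]
      rcases Nat.lt_succ_iff_lt_or_eq.1 hi with h | rfl
      · rw [x6 i h, i1.arr _ rfl]
      -- The cell `CTH[k]` is shared: it holds the upper threshold of class `k - 1` and is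
      -- overwritten with the same number.
      · rw [x2, hcth h0]
    · intro i hi
      rw [t4.arr _ rfl, x13 i hi, i1.arr _ rfl]
    · intro i hi
      rw [z5 i (by omega), y5 i hi, i2.arr _ rfl]
    · intro i hi
      rw [t4.arr _ rfl, x10 i hi, i1.arr _ rfl]
    · intro x hx i hi
      rw [j4.arr x (by fin_cases hx <;> rfl), y4 x hx i hi, i2.arr x (by fin_cases hx <;> rfl)]
    · intro i hi
      rw [z4 i hi, i3.arr _ rfl]
  refine Triple.flat rfl (by simp [Stmt.cost]) ?_ ?_
  · simp [Stmt.safe, run, w1]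
    omega
  · have hrun : ∃ u, run (.th ::= var .th' ;; .th' ::= var .th' + var .th' ;;
        .ite (lt (var .mx) (var .th')) (.th' ::= var .mx + 1) .skip) s4 =
        (s4.setVar .th θ').setVar .th' u ∧ u = min (2 * θ') M := by
      refine ⟨_, ?_, rfl⟩
      by_cases h : s4.var .mx < θ' + θ'
      · simp [run, w1, h, w2, St.setVar, show min (2 * θ') M = M by omega]
      · simp [run, w1, h, St.setVar, show min (2 * θ') M = θ' + θ' by omega]
    obtain ⟨u, hu, hu'⟩ := hrun
    rw [hu, St.setVar_arr, St.setVar_arr]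
    refine ⟨L4.congr (by simp) fun _ _ => rfl, by simp, by simp [hu'], by simp [w3], by simp [w4],
      by simp [z1, ← hTC], hcls, hkeep⟩

/-! ### The loop over the classes -/

/-- The thresholds: `0`, `g`, `2 g`, `4 g` and so on, but at most `M`. -/
def thr (g M k : ℕ) : ℕ := if k = 0 then 0 else min (g * 2 ^ (k - 1)) M

theorem thr_zero (g M : ℕ) : thr g M 0 = 0 := rfl

theorem thr_succ (g M k : ℕ) : thr g M (k + 1) = min (g * 2 ^ k) M := rfl

theorem thr_le (g M k : ℕ) : thr g M k ≤ M := by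
  cases k
  · exact Nat.zero_le _
  · exact min_le_right _ _

theorem thr_mono (g M : ℕ) : Monotone (thr g M) := by
  refine monotone_nat_of_le_succ fun k => ?_
  cases k with
  | zero => exact Nat.zero_le _
  | succ k =>
    rw [thr_succ, thr_succ]
    exact min_le_min_right _ (Nat.mul_le_mul_left _ (Nat.pow_le_pow_right (by omega) (by omega)))

/-- The program finds each next threshold by doubling the last one and capping it again, so capping
must commute with later doublings. -/
theorem min_two_mul_thr (g M k : ℕ) : min (2 * thr g M (k + 1)) M = thr g M (k + 2) := by
  rw [thr_succ, thr_succ, pow_succ]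
  have : g * (2 ^ k * 2) = 2 * (g * 2 ^ k) := by ring
  omega

theorem thr_lt_succ {g M k : ℕ} (hg : 0 < g) (h : thr g M k < M) : thr g M k < thr g M (k + 1) := by
  cases k with
  | zero => rw [thr_succ, thr_zero] at *; simp; omega
  | succ k =>
    rw [thr_succ] at h
    have : 0 < g * 2 ^ k := by positivity
    rw [thr_succ, thr_succ, pow_succ, ← mul_assoc]
    omega

/-- Build the structures for all classes. -/
def classes : Stmt :=
  .cb ::= 0 ;;
  .jb ::= 0 ;;
  .tb ::= 0 ;;
  .th ::= 0 ;;
  .th' ::= var .mx + 1 ;;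
  .ite (lt (var .g) (var .th')) (.th' ::= var .g) .skip ;;
  .loop .k (var .NC) classBody

/-- The number of elements of class `k`. -/
def classCard (n : ℕ) (B : ℕ → ℕ) (g M k : ℕ) : ℕ := (above n B (thr g M k)).card

/-- The number of cells of the table for class `k`. -/
def classTopCells (n : ℕ) (B : ℕ → ℕ) (f M k : ℕ) : ℕ :=
  topCells f (classCard n B (f * f) M k) (thr (f * f) M k) (thr (f * f) M (k + 1))

/-- The number of steps for class `k`, up to a constant factor. -/
def classCost (n : ℕ) (B : ℕ → ℕ) (f M k : ℕ) : ℕ :=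
  classCard n B (f * f) M (k - 1) + n / (f * f) + f * f + classTopCells n B f M k + 3

/-- Each class appends to the pools, so their fill levels are partial sums of class sizes. It
suffices that the sums over all classes stay within the bound for indices. -/
theorem classes_spec {c : Lim} {s : St} {n f H NC M : ℕ}
    (hp : Params c n f H) (hL : Lists s n (above n (s.arr .B0) 0))
    (hg : s.var .g = f * f) (hf : s.var .f = f) (hn : s.var .n = n)
    (hns : s.var .ns = n / (f * f) + 1) (hM : s.var .mx + 1 = M) (hNC : s.var .NC = NC)
    (hB : ∀ x < n, s.arr .B0 x < M)
    (hLG : ∀ i, 0 < i → i ≤ max (n + 1) f → s.arr .LG i = Nat.log 2 i)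
    (hκ : ∀ x < n, s.arr .RK x ≤ n)
    (hMW : 2 * M < c.W) (hkD : NC * 6 + 6 < c.D)
    (hRD : NC * (n / (f * f) + 1) < c.D)
    (hcD : ∑ k ∈ Finset.range NC, classCard n (s.arr .B0) (f * f) M k < c.D)
    (hjD : ∑ k ∈ Finset.range NC, jobCells f (classCard n (s.arr .B0) (f * f) M k) < c.D)
    (htD : ∑ k ∈ Finset.range NC, classTopCells n (s.arr .B0) f M k < c.D) :
    Triple c classes s (24000 * (∑ k ∈ Finset.range NC, classCost n (s.arr .B0) f M k + 1))
      fun s' => ∀ k < NC, ∃ N cE jE tE, cE < c.D ∧ jE < c.D ∧ tE < c.D ∧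
        IsClass s'.arr n f k (thr (f * f) M k) (thr (f * f) M (k + 1)) N cE jE tE := by
  have hDW := hp.D_lt
  have hgp : 0 < f * f := hp.g_pos
  set B := s.arr .B0 with hBdef
  set T := ∑ k ∈ Finset.range NC, classCost n B f M k with hT
  set CB : ℕ → ℕ := fun k => ∑ i ∈ Finset.range k, classCard n B (f * f) M i with hCB
  set JB : ℕ → ℕ := fun k => ∑ i ∈ Finset.range k, jobCells f (classCard n B (f * f) M i) with hJB
  set TB : ℕ → ℕ := fun k => ∑ i ∈ Finset.range k, classTopCells n B f M i with hTB
  replace hcD : CB NC < c.D := hcD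
  replace hjD : JB NC < c.D := hjD
  replace htD : TB NC < c.D := htD
  -- The lists before round `k` are those of class `k - 1`. For `k = 0` truncated subtraction gives
  -- class `0`, the set of all positions, which is what the initial lists contain.
  let I : ℕ → St → Prop := fun k s' =>
    Lists s' (classCard n B (f * f) M (k - 1)) (above n B (thr (f * f) M (k - 1))) ∧
    s'.var .th = thr (f * f) M k ∧ s'.var .th' = thr (f * f) M (k + 1) ∧
    s'.var .cb = CB k ∧ s'.var .jb = JB k ∧ s'.var .tb = TB k ∧
    (0 < k → s'.arr .CTH k = thr (f * f) M k) ∧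
    ∀ j < k, IsClass s'.arr n f j (thr (f * f) M j) (thr (f * f) M (j + 1))
      (classCard n B (f * f) M j) (CB k) (JB k) (TB k)
  have hcard : classCard n B (f * f) M 0 = n := by simp [classCard, thr_zero, above]
  refine Triple.assign_seq (T := 24000 * T + 23000) (by simp; omega) (Triple.assign_seq
    (T := 24000 * T + 22000) (by simp; omega) (Triple.assign_seq (T := 24000 * T + 21000)
    (by simp; omega) (Triple.assign_seq (T := 24000 * T + 20000) (by simp; omega)
    (Triple.assign_seq (T := 24000 * T + 19000) (by simp; omega)
    (Triple.seq_le (T₁ := 100) (T₂ := 24000 * T + 1000) (Q₁ := fun s' => I 0 s')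
      (Triple.flat rfl (by simp [Stmt.cost]) ?_ ?_) ?_ (by omega)) (by simp; omega))
      (by simp; omega)) (by simp; omega)) (by simp; omega)) (by simp; omega)
  · simp [Stmt.safe]
  · have hrun : ∀ s : St, s.var .g = f * f → s.var .th' = M →
        run (.ite (lt (var .g) (var .th')) (.th' ::= var .g) .skip) s =
        s.setVar .th' (min (f * f) M) := by
      intro s h1 h2
      by_cases h : f * f < M
      · simp [run, h1, h2, h, min_eq_left h.le]
      · rw [min_eq_right (not_lt.1 h)]
        simp [run, h1, h2, h]
        simp [St.setVar, ← h2]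
    rw [hrun _ (by simp [hg]) (by simp [hM])]
    refine ⟨?_, by simp [thr_zero], by simp [thr_succ], by simp [CB], by simp [JB], by simp [TB],
      by simp, by simp⟩
    simp only [Nat.zero_sub, hcard, thr_zero]
    exact hL.congr (by simp) fun _ _ => rfl
  · intro s₀ i₀ h0
    have e1 : s₀.var .NC = NC := by rw [i₀.var _ rfl]; simp [hNC]
    -- The overhead of `5` steps per round is taken out of the budget of the class, which is large
    -- enough because `classCost` is at least `3`.
    refine (Triple.loop_sum I NC (fun k => 24000 * classCost n B f M k - 5) (by simp) (by simp [e1])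
      h0 ?_).mono ?_ ?_
    · intro k hk s' i' ⟨L', h1, h2, h3, h4, h5, h6, h7⟩
      have v : ∀ y, (Stmt.loop .k (var .NC) classBody).wr y = false →
          (y ≠ .cb ∧ y ≠ .jb ∧ y ≠ .tb ∧ y ≠ .th ∧ y ≠ .th') → s'.var y = s.var y := by
        intro y hy ⟨a1, a2, a3, a4, a5⟩
        rw [i'.var y hy, i₀.var y (by simp [wr, a5])]
        simp [a1, a2, a3, a4, a5]
      have a : ∀ y, (Stmt.loop .k (var .NC) classBody).wa y = false → s'.arr y = s.arr y :=
        fun y hy => (i'.arr y hy).trans (i₀.arr y rfl)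
      have b0 : s'.arr .B0 = B := a _ rfl
      have hCs : CB (k + 1) = CB k + classCard n B (f * f) M k := Finset.sum_range_succ _ _
      have hJs : JB (k + 1) = JB k + jobCells f (classCard n B (f * f) M k) :=
        Finset.sum_range_succ _ _
      have hTs : TB (k + 1) = TB k + classTopCells n B f M k := Finset.sum_range_succ _ _
      have hCl : CB (k + 1) ≤ CB NC := Finset.sum_le_sum_of_subset (by simpa using hk)
      have hJl : JB (k + 1) ≤ JB NC := Finset.sum_le_sum_of_subset (by simpa using hk)
      have hTl : TB (k + 1) ≤ TB NC := Finset.sum_le_sum_of_subset (by simpa using hk)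
      have hθ' := thr_le (f * f) M (k + 1)
      have hR : k * (n / (f * f) + 1) + (n / (f * f) + 1) ≤ NC * (n / (f * f) + 1) := by
        rw [← Nat.succ_mul]; exact Nat.mul_le_mul_right _ hk
      refine (classBody_spec (c := c) (s := s'.setVar .k k) (k := k) (f := f) (n := n) (H := H)
        (θ₀ := thr (f * f) M (k - 1)) (θ := thr (f * f) M k) (θ' := thr (f * f) M (k + 1))
        (M := M) (cb := CB k) (jb := JB k) (tb := TB k)
        (N₀ := classCard n B (f * f) M (k - 1)) (N := classCard n B (f * f) M k) hp
        (by simp only [St.setVar_arr, b0]; exact L'.congr (by simp) fun _ _ => rfl)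
        (thr_mono _ _ (by omega)) (by simp)
        (by simp [v .g rfl (by decide), hg]) (by simp [v .f rfl (by decide), hf])
        (by simp [v .n rfl (by decide), hn]) (by simp [v .ns rfl (by decide), hns])
        (by simp [h1]) (by simp [h2]) (by simp [v .mx rfl (by decide), hM])
        (by simp [h3]) (by simp [h4]) (by simp [h5])
        (by simpa [a .LG rfl] using hLG) (by simpa [a .RK rfl] using hκ) (by simpa using h6)
        (by simp [b0, classCard]) ?_ (by omega) (by omega) (by omega) (by omega)
        (by omega) (by omega) ?_).mono ?_ ?_
      · intro hN
        refine thr_lt_succ hgp ?_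
        obtain ⟨x, hx⟩ := Finset.card_pos.1 hN
        have := mem_above.1 hx
        exact this.2.trans_lt (hB x this.1)
      · change TB k + classTopCells n B f M k < c.D
        omega
      · simp only [classCost, classTopCells]
        omega
      · rintro s'' i'' ⟨L, q1, q2, q3, q4, q5, q6, q7⟩
        simp only [St.setVar_arr, b0] at L q6 q7
        rw [← hCs, ← hJs] at q6
        change IsClass _ _ _ _ _ _ _ _ _ (TB k + classTopCells n B f M k) at q6
        change s''.var .tb = TB k + classTopCells n B f M k at q5
        rw [← hTs] at q6
        refine ⟨L, q1, q2.trans (min_two_mul_thr _ _ _), q3.trans hCs.symm, q4.trans hJs.symm,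
          q5.trans hTs.symm, fun _ => q6.th', fun j hj => ?_⟩
        rcases Nat.lt_succ_iff_lt_or_eq.1 hj with hj | rfl
        · exact (h7 j hj).keep q7 hj hp.f_pos (by omega) (by omega) (by omega)
        · exact q6
    · have : ∑ k ∈ Finset.range NC, (24000 * classCost n B f M k - 5 + 5) = 24000 * T := by
        rw [hT, Finset.mul_sum]
        refine Finset.sum_congr rfl fun k _ => ?_
        have : 3 ≤ classCost n B f M k := by unfold classCost; omega
        omega
      simp only [this, cost_var]
      omega
    · intro s' _ ⟨_, _, _, _, _, _, _, h⟩ k hk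
      exact ⟨_, _, _, _, hcD, hjD, htD, h k hk⟩

/-! ### The initial arrays and parameters -/

/-- Copy the input and list the positions. -/
def initArrays : Stmt :=
  .loop .i (var .n) (.put .A0 (var .i) (.inp (var .i))) ;;
  .loop .i (var .n) (.put .B0 (var .i) (.inp (var .n + var .i))) ;;
  .loop .i (var .n) (.put .WP (var .i) (var .i)) ;;
  .N ::= var .n

theorem initArrays_spec {c : Lim} {s : St} {n : ℕ} (hn : s.var .n = n) (hnD : n < c.D)
    (hI : 2 * n ≤ c.I) (hW : 2 * n < c.W) :
    Triple c initArrays s (100 * (n + 1)) fun s' =>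
      (∀ i < n, s'.arr .A0 i = s.inp i) ∧ (∀ i < n, s'.arr .B0 i = s.inp (n + i)) ∧
      Enum (s'.arr .WP) n (Finset.range n) (· < ·) ∧ s'.var .N = n := by
  refine Triple.seq_le (T₁ := 4 + n * 30) (T₂ := 70 * n + 60) ((Triple.loop_put n (fun i => i)
    s.inp (by simp) (by simp [hn]) ?_ (fun k hk => by omega) (fun k _ j hj => hj.ne)).mono
    (by simp; omega) fun _ _ h => h.1) ?_ (by omega)
  · intro k hk u
    simp; omega
  intro s1 i1 h1
  refine Triple.seq_le (T₁ := 4 + n * 30) (T₂ := 40 * n + 40) ((Triple.loop_put n (fun i => i)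
    (fun i => s.inp (n + i)) (by simp) (by simp [i1.var .n rfl, hn]) ?_ (fun k hk => by omega)
    (fun k _ j hj => hj.ne)).mono (by simp; omega) fun _ _ h => h.1) ?_ (by omega)
  · intro k hk u
    simp [i1.var .n rfl, hn, i1.inp]; omega
  intro s2 i2 h2
  refine Triple.seq_le (T₁ := 4 + n * 30) (T₂ := 10) ((Triple.loop_put n (fun i => i)
    (fun i => i) (by simp) (by simp [i2.var .n rfl, i1.var .n rfl, hn]) ?_ (fun k hk => by omega)
    (fun k _ j hj => hj.ne)).mono (by simp; omega) fun _ _ h => h.1) ?_ (by omega)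
  · intro k hk u
    simp
  intro s3 i3 h3
  refine Triple.flat rfl (by simp [Stmt.cost]) (by simp [Stmt.safe]) ?_
  simp only [run, St.setVar_arr]
  refine ⟨fun i hi => ?_, fun i hi => ?_, ⟨by simp, fun i hi => ?_, fun i j hij hj => ?_⟩, ?_⟩
  · rw [i3.arr _ rfl, i2.arr _ rfl, h1 i hi]
  · rw [i3.arr _ rfl, h2 i hi]
  · rw [h3 i hi]; simpa using hi
  · rw [h3 i (by omega), h3 j hj]; exact hij
  · simp [i3.var .n rfl, i2.var .n rfl, i1.var .n rfl, hn]

/-- Tabulate the logarithms. -/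
def initLogs : Stmt :=
  .put .LG 0 0 ;;
  .put .LG 1 0 ;;
  .loop .i (var .m) (.put .LG (var .i + 2) (get .LG ((var .i + 2) / 2) + 1))

/-- The logarithm of `i + 2` exceeds that of its half by one, and the half has been treated before.
-/
theorem initLogs_spec {c : Lim} {s : St} {m : ℕ} (hm : s.var .m = m) (hD : m + 2 < c.D)
    (hW : c.D < c.W) :
    Triple c initLogs s (40 * (m + 1)) fun s' => ∀ i ≤ m + 1, s'.arr .LG i = Nat.log 2 i := by
  refine Triple.put_seq (T := 40 * m + 20) (by simp; omega) (by simp; omega) (by simp; omega)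
    (Triple.put_seq (T := 40 * m + 5) (by simp; omega) (by simp; omega) (by simp; omega) ?_
      (by simp; omega)) (by simp; omega)
  refine (Triple.loop (fun k s' => ∀ i ≤ k + 1, s'.arr .LG i = Nat.log 2 i) m 35 (by simp)
    (by simp [hm]) ?_ ?_).mono (by simp; omega) fun _ _ => id
  · intro i hi
    interval_cases i <;> simp
  · intro k hk s' i' h'
    have hd : (k + 2) / 2 ≤ k + 1 := by omega
    have e := h' _ hd
    have hl : Nat.log 2 ((k + 2) / 2) ≤ k + 1 := (Nat.log_le_self _ _).trans hd
    refine Triple.flat rfl (by simp [Stmt.cost]) ?_ ?_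
    · have e' : s'.arr .LG (k / 2 + 1) ≤ k + 1 := by
        rw [h' _ (by omega)]
        exact (Nat.log_le_self _ _).trans (by omega)
      simp [Stmt.safe]
      omega
    · intro i hi
      simp only [run, St.setArr_arr]
      simp only [eval_add, eval_var, eval_get, eval_div, eval_lit, St.setVar_var_same,
        St.setVar_arr, true_and]
      split
      · next h =>
        subst h
        rw [e, Nat.log_of_one_lt_of_le (by omega) (by omega : 2 ≤ k + 2)]
      · exact h' i (by omega)

/-- The branching factor of the trees. -/
def branching (m : ℕ) : ℕ := max 1 (Nat.sqrt (Nat.log 2 m))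

/-- Binary searches are over ranges of less than `2 ^ (height + 1)` elements. -/
def height (K m : ℕ) : ℕ := 6 * Nat.log 2 (branching m) + (K + 10)

/-- The number of classes. -/
def numClasses (K m : ℕ) : ℕ := 8 * (branching m * branching m) + (K + 1)

theorem branching_sq_le (m : ℕ) : branching m * branching m ≤ Nat.log 2 m + 1 := by
  have := Nat.sqrt_le (Nat.log 2 m)
  rcases le_total 1 (Nat.sqrt (Nat.log 2 m)) with h | h
  · rw [branching, max_eq_right h]; omega
  · rw [branching, max_eq_left h]; omega

theorem branching_pos (m : ℕ) : 0 < branching m := Nat.lt_of_succ_le (le_max_left _ _)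

theorem branching_le (m : ℕ) : branching m ≤ m + 1 :=
  (Nat.le_mul_self _).trans ((branching_sq_le m).trans (by have := Nat.log_le_self 2 m; omega))

/-- Compute the parameters. -/
def initParams (K : ℕ) : Stmt :=
  .lg ::= get .LG (var .m) ;;
  .f ::= 1 ;;
  .loop .i (var .lg)
    (.ite (le ((var .f + 1) * (var .f + 1)) (var .lg)) (.f ::= var .f + 1) .skip) ;;
  .g ::= var .f * var .f ;;
  .H ::= 6 * get .LG (var .f) + .lit (K + 10) ;;
  .NC ::= 8 * var .g + .lit (K + 1) ;;
  .ns ::= var .n / var .g + 1 ;;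
  .put .META 0 (var .n) ;;
  .put .META 1 (var .f) ;;
  .put .META 2 (var .g) ;;
  .put .META 3 (var .H) ;;
  .put .META 4 (var .NC) ;;
  .put .META 5 (var .ns)

theorem initParams_spec {c : Lim} {s : St} {n m K : ℕ} (hn : s.var .n = n) (hm : s.var .m = m)
    (hnm : n ≤ m) (hLG : ∀ i ≤ m + 1, s.arr .LG i = Nat.log 2 i) (hD : m + K + 10 < c.D)
    (hDW : 64 * c.D < c.W) :
    Triple c (initParams K) s (100 * (m + 2)) fun s' =>
      s'.var .f = branching m ∧ s'.var .g = branching m * branching m ∧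
      s'.var .NC = numClasses K m ∧ s'.var .ns = n / (branching m * branching m) + 1 ∧
      s'.arr .META 0 = n ∧ s'.arr .META 1 = branching m ∧
      s'.arr .META 2 = branching m * branching m ∧ s'.arr .META 3 = height K m ∧
      s'.arr .META 4 = numClasses K m ∧
      s'.arr .META 5 = n / (branching m * branching m) + 1 := by
  set L := Nat.log 2 m with hL
  have hLm : L ≤ m := Nat.log_le_self _ _
  have hsq := branching_sq_le m
  have hb := branching_le m
  rw [← hL] at hsq
  refine Triple.assign_seq (T := 90 * (m + 2)) (by simp [hm]; omega) (Triple.assign_seq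
    (T := 85 * (m + 2)) (by simp; omega) (Triple.seq_le (T₁ := 10 + L * 40)
      -- The square root is found by trying to increase `f` in each of `L = log m` rounds, which is
      -- enough as the root is at most `L`.
      (T₂ := 130) ((Triple.loop (fun k s' =>
        s'.var .f = max 1 (min (k + 1) (Nat.sqrt L))) L 30 (by simp) ?_ ?_ ?_).mono ?_
        fun _ _ => id) ?_ (by omega)) (by simp; omega)) (by simp; omega)
  · simpa [hm] using hLG m (by omega)
  · simp
  · intro k hk s' i' h'
    have e1 : s'.var .lg = L := by
      rw [i'.var _ rfl]; simp [hm]; exact hLG _ (by omega)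
    have hs := Nat.sqrt_le L
    have hf : ∀ r : ℕ, r = max 1 (min (k + 1) (Nat.sqrt L)) → (r + 1) * (r + 1) ≤ 4 * (L + 1) := by
      intro r hr
      have h1 : r * r ≤ L + 1 := by
        rcases le_total 1 (Nat.sqrt L) with h | h
        · have : r ≤ Nat.sqrt L := by omega
          have := Nat.mul_le_mul this this
          omega
        · have : r = 1 := by omega
          subst this; omega
      have h2 : 1 ≤ r := by omega
      nlinarith
    have hf' := hf _ rfl
    refine Triple.flat rfl (by simp [Stmt.cost]) ?_ ?_
    · simp only [Stmt.safe, safe_le, safe_mul, safe_add, safe_var, safe_lit, eval_add, eval_var,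
        eval_lit, St.setVar_var_ne _ _ (show Reg.f ≠ .i by decide), h', true_and]
      refine ⟨⟨⟨⟨?_, ?_⟩, ⟨?_, ?_⟩, ?_⟩, ?_⟩, ?_⟩
      any_goals omega
      split
      · exact ⟨by omega, by omega⟩
      · trivial
    · have hle := Nat.le_sqrt (m := max 1 (min (k + 1) (Nat.sqrt L)) + 1) (n := L)
      by_cases hc : (max 1 (min (k + 1) (Nat.sqrt L)) + 1) * (max 1 (min (k + 1) (Nat.sqrt L)) + 1)
        ≤ L
      · have := hle.2 hc
        simp only [run, eval_le, eval_mul, eval_add, eval_var, eval_lit, h', e1,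
          St.setVar_var_ne _ _ (show Reg.f ≠ .i by decide),
          St.setVar_var_ne _ _ (show Reg.lg ≠ .i by decide), if_pos hc, St.setVar_var_same,
          ne_eq, one_ne_zero, not_false_eq_true, if_true]
        omega
      · have := mt hle.1 hc
        simp only [run, eval_le, eval_mul, eval_add, eval_var, eval_lit, h', e1,
          St.setVar_var_ne _ _ (show Reg.f ≠ .i by decide),
          St.setVar_var_ne _ _ (show Reg.lg ≠ .i by decide), if_neg hc, St.setVar_var_same,
          ne_eq, not_true_eq_false, if_false]
        omega
  · simp; omega
  · intro s1 i1 h1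
    have hf : s1.var .f = branching m := by
      rw [h1, branching, ← hL]
      have := Nat.sqrt_le_self L
      omega
    have e1 : s1.var .n = n := by rw [i1.var _ rfl]; simp [hn]
    have e2 : s1.arr .LG (branching m) = Nat.log 2 (branching m) := by
      rw [i1.arr _ rfl]; exact hLG _ hb
    have hl := Nat.log_le_self 2 (branching m)
    have hdiv := Nat.div_le_self n (branching m * branching m)
    refine Triple.flat rfl (by simp [Stmt.cost]) ?_ ?_
    · simp [Stmt.safe, run, hf, e1, e2, Function.update_apply]
      generalize n / (branching m * branching m) = d at *
      generalize branching m * branching m = q at *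
      omega
    · simp [run, hf, e1, e2, Function.update_apply, height, numClasses]

/-! ### The initial sorting -/

/-- Compute the maximum of `B`. -/
def initMax : Stmt :=
  .mx ::= 0 ;;
  .loop .i (var .n)
    (.ite (lt (var .mx) (get .B0 (var .i))) (.mx ::= get .B0 (var .i)) .skip)

theorem initMax_spec {c : Lim} {s : St} {n : ℕ} (hn : s.var .n = n) (hnD : n < c.D)
    (hW : c.D < c.W) :
    Triple c initMax s (40 * (n + 1)) fun s' =>
      s'.var .mx = (Finset.range n).sup (s.arr .B0) := by
  refine Triple.assign_seq (T := 40 * n + 5) (by simp; omega) ?_ (by simp; omega)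
  refine (Triple.loop (fun k s' => s'.var .mx = (Finset.range k).sup (s.arr .B0)) n 30 (by simp)
    (by simp [hn]) (by simp) ?_).mono (by simp; omega) fun _ _ => id
  intro k hk s' i' h'
  have e : s'.arr .B0 = s.arr .B0 := i'.arr _ rfl
  refine Triple.flat rfl (by simp [Stmt.cost]) ?_ ?_
  · simp [Stmt.safe]
    omega
  · rw [Finset.range_add_one, Finset.sup_insert]
    by_cases h : s'.var .mx < s.arr .B0 k
    · have h1 := h
      rw [h'] at h1
      simpa [run, e, h] using h1.le
    · have h1 := h
      rw [h'] at h1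
      simp only [run, eval_lt, eval_var, eval_get, St.setVar_var_same, St.setVar_arr, e,
        St.setVar_var_ne _ _ (show Reg.mx ≠ .i by decide), h', h1, if_false, ne_eq,
        not_true_eq_false]
      exact (sup_eq_right.2 (not_lt.1 h1)).symm

/-- Sort the positions by the values `z`, which have two digits to the base `m + 1`. -/
def radix (K : ℕ) (z dst : Arr) : Stmt :=
  forEach .WP .KEY (get z (get .WP (var .t)) % (var .m + 1)) ;;
  .J ::= var .m + 1 ;;
  csort .WP .KEY .L1 ;;
  forEach .WP .KEY (get z (get .WP (var .t)) / (var .m + 1)) ;;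
  .J ::= .lit K * (var .m + 1) + 1 ;;
  csort .L1 .KEY dst

/-- Radix sort from the lower digit: stability makes the remainder the tie-break for equal
quotients. Two digits suffice because the values are at most quadratic in `m`, and `K * (m + 1) + 1`
bounds the upper digit. -/
theorem radix_spec {c : Lim} (hc : 64 * c.D < c.W) {K : ℕ} {z dst : Arr} {s : St} {n m : ℕ}
    (hz : z ≠ .KEY) (hz1 : z ≠ .L1) (hz2 : z ≠ .CNT) (hd : dst ≠ .CNT) (hd1 : dst ≠ .L1)
    (hd2 : dst ≠ .KEY) (hN : s.var .N = n) (hm : s.var .m = m) (hnD : n < c.D)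
    (hmD : m + 2 < c.D) (hKD : K * (m + 1) + 1 < c.D)
    (hv : ∀ x < n, s.arr z x < (m + 1) * (K * (m + 1) + 1))
    (hE : Enum (s.arr .WP) n (Finset.range n) (· < ·)) :
    Triple c (radix K z dst) s (500 * (n + (K + 1) * (m + 1) + 1)) fun s' =>
      Enum (s'.arr dst) n (Finset.range n) (KeyLex (s.arr z) (· < ·)) := by
  have hir : ∀ a : ℕ, ¬ a < a := fun a => lt_irrefl a
  have hED : ∀ x ∈ Finset.range n, x < c.D := fun x hx => by
    have := Finset.mem_range.1 hx; omega
  have hKm : K * (m + 1) + 1 + (m + 1) = (K + 1) * (m + 1) + 1 := by ring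
  have hK : K ≤ K * (m + 1) := Nat.le_mul_of_pos_right _ (Nat.succ_pos _)
  generalize hX : (K + 1) * (m + 1) = X at *
  refine Triple.seq_le (T₁ := 4 + n * 40) (T₂ := 450 * (n + X + 1)) ((forEach_spec (by decide)
    (fun t => s.arr z (s.arr .WP t) % (m + 1)) hN hE hir hED hnD ?_).mono (by simp; omega)
    fun _ _ => id) ?_ (by omega)
  · intro t ht u
    have := hED _ (hE.mem t ht)
    simp [hz, hm]; omega
  intro s1 i1 k1
  have w1 : s1.arr .WP = s.arr .WP := i1.arr _ rfl
  have n1 : s1.var .N = n := (i1.var _ rfl).trans hN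
  have m1 : s1.var .m = m := (i1.var _ rfl).trans hm
  refine Triple.assign_seq (T := 440 * (n + X + 1)) (by simp [m1]; omega) ?_ (by simp; omega)
  have key1 : ∀ x ∈ Finset.range n, s1.arr .KEY x = s.arr z x % (m + 1) := by
    intro x hx
    obtain ⟨t, ht, rfl⟩ := hE.surj hir hx
    exact k1 t ht
  refine Triple.seq_le (T₁ := 200 * (n + (m + 1) + 1)) (T₂ := 240 * n + 200 * (K * (m + 1) + 1)
    + 230) (csort_spec hc (E := Finset.range n) (r := fun x y => x < y) (N := n) (J := m + 1)
      (by decide) (by decide) (by decide) (by decide) (by decide) (by simp [n1]) (by simp [m1])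
      hnD (by omega) ?_ ?_ (by simpa [w1] using hE)) ?_ (by omega)
  · intro t ht
    simpa [w1] using hED _ (hE.mem t ht)
  · intro t ht
    have := hE.mem t ht
    simp [w1, key1 _ this]
    exact Nat.lt_succ_iff.1 (Nat.mod_lt _ (Nat.succ_pos m))
  intro s2 i2 k2
  have w2 : s2.arr .WP = s.arr .WP := by rw [i2.arr _ rfl]; exact w1
  have z2 : s2.arr z = s.arr z := by
    rw [i2.arr z (by simp [csort, countStarts, wa, hz1, hz2]), St.setVar_arr,
      i1.arr z (by simp [forEach, wa, hz])]
  have n2 : s2.var .N = n := by rw [i2.var _ rfl]; simp [n1]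
  have m2 : s2.var .m = m := by rw [i2.var _ rfl]; simp [m1]
  rw [St.setVar_arr] at k2
  refine Triple.seq_le (T₁ := 4 + n * 40) (T₂ := 200 * n + 200 * (K * (m + 1) + 1) + 210)
    ((forEach_spec (by decide)
    (fun t => s.arr z (s.arr .WP t) / (m + 1)) n2 (w2 ▸ hE) hir hED hnD ?_).mono (by simp; omega)
    fun _ _ => id) ?_ (by omega)
  · intro t ht u
    have := hED _ (hE.mem t ht)
    simp [hz, m2, z2, w2]; omega
  intro s3 i3 k3
  have l3 : s3.arr .L1 = s2.arr .L1 := i3.arr _ rfl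
  have n3 : s3.var .N = n := (i3.var _ rfl).trans n2
  have m3 : s3.var .m = m := (i3.var _ rfl).trans m2
  have key3 : ∀ x ∈ Finset.range n, s3.arr .KEY x = s.arr z x / (m + 1) := by
    intro x hx
    obtain ⟨t, ht, rfl⟩ := hE.surj hir hx
    rw [← k3 t ht, w2]
  refine Triple.assign_seq (T := 200 * (n + (K * (m + 1) + 1) + 1)) (by simp [m3]; omega) ?_
    (by simp; omega)
  refine (csort_spec hc (E := Finset.range n) (r := KeyLex (s1.arr .KEY) fun x y => x < y)
      (N := n) (J := K * (m + 1) + 1)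
      (by decide) (by decide) hd (Ne.symm hd1) (Ne.symm hd2) (by simp [n3]) (by simp [m3])
      hnD (by omega) ?_ ?_ (by simpa [l3] using k2)).mono le_rfl ?_
  · intro t ht
    simpa [l3] using hED _ (k2.mem t ht)
  · intro t ht
    have h1 := k2.mem t ht
    simp only [St.setVar_arr, l3, key3 _ h1]
    exact Nat.div_lt_of_lt_mul (hv _ (Finset.mem_range.1 h1))
  · intro s4 i4 k4
    rw [St.setVar_arr] at k4
    refine k4.weaken ?_
    intro a ha b hb h
    simp only [KeyLex, key3 a ha, key3 b hb, key1 a ha, key1 b hb] at h ⊢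
    have ea := Nat.div_add_mod (s.arr z a) (m + 1)
    have eb := Nat.div_add_mod (s.arr z b) (m + 1)
    have la : s.arr z a % (m + 1) < m + 1 := Nat.mod_lt _ (Nat.succ_pos m)
    have lb : s.arr z b % (m + 1) < m + 1 := Nat.mod_lt _ (Nat.succ_pos m)
    -- The lexicographic order of quotient and remainder is the order of the values.
    rcases h with h | ⟨h, h' | ⟨h', h''⟩⟩
    · have : (m + 1) * (s.arr z a / (m + 1) + 1) ≤ (m + 1) * (s.arr z b / (m + 1)) :=
        Nat.mul_le_mul_left _ h
      rw [Nat.mul_add, mul_one] at this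
      left; omega
    · rw [h] at ea; left; omega
    · rw [h, h'] at ea; right; exact ⟨by omega, h''⟩

/-- The orders by `A` and by descending `B`. -/
def initOrders (K : ℕ) : Stmt :=
  radix K .A0 .AO ;;
  .loop .i (var .n) (.put .RK (get .AO (var .i)) (var .i)) ;;
  .loop .i (var .n) (.put .WA (var .i) (get .AO (var .i))) ;;
  .loop .i (var .n) (.put .BN (var .i) (var .mx - get .B0 (var .i))) ;;
  radix K .BN .WB

/-- `RK` is the inverse of the list `AO` by value and index, so equal values of `A` get keys in the
order of the indices. Descending order of `B` is ascending order of `mx - B`. -/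
theorem initOrders_spec {c : Lim} (hc : 64 * c.D < c.W) {K : ℕ} {s : St} {n m M : ℕ}
    (hn : s.var .n = n) (hN : s.var .N = n) (hm : s.var .m = m) (hM : s.var .mx = M)
    (hnD : n < c.D)
    (hmD : m + 2 < c.D) (hKD : K * (m + 1) + 1 < c.D)
    (hA : ∀ x < n, s.arr .A0 x < (m + 1) * (K * (m + 1) + 1))
    (hMK : M < (m + 1) * (K * (m + 1) + 1)) (hB : ∀ x < n, s.arr .B0 x ≤ M)
    (hE : Enum (s.arr .WP) n (Finset.range n) (· < ·)) :
    Triple c (initOrders K) s (1200 * (n + (K + 1) * (m + 1) + 1)) fun s' =>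
      Lists s' n (Finset.range n) ∧ (∀ x < n, s'.arr .RK x < n) ∧
      (∀ x < n, s'.arr .AO (s'.arr .RK x) = x) ∧
      ∀ x < n, ∀ y < n, s'.arr .RK x ≤ s'.arr .RK y →
        s.arr .A0 x < s.arr .A0 y ∨ s.arr .A0 x = s.arr .A0 y ∧ x ≤ y := by
  have hED : ∀ x ∈ Finset.range n, x < c.D := fun x hx => by
    have := Finset.mem_range.1 hx; omega
  generalize hX : (K + 1) * (m + 1) = X
  have hir : ∀ a : ℕ, ¬ a < a := fun a => lt_irrefl a
  refine Triple.seq_le (T₁ := 500 * (n + X + 1)) (T₂ := 700 * (n + X + 1))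
    (hX ▸ radix_spec (K := K) (n := n) (m := m) hc (by decide) (by decide) (by decide) (by decide)
      (by decide) (by decide) hN hm hnD hmD hKD hA hE) ?_ (by omega)
  intro s1 i1 k1
  have hir' := KeyLex.irrefl (κ := s.arr .A0) hir
  refine Triple.seq_le (T₁ := 4 + n * 40) (T₂ := 650 * (n + X + 1)) ((Triple.loop_put n (s1.arr .AO)
    (fun i => i) (by simp) (by simp [i1.var .n rfl, hn]) ?_
    (fun k hk => hED _ (k1.mem k hk))
    (fun k hk j hj e => absurd (k1.inj hir' (by omega) hk e) hj.ne)).mono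
    (by simp; omega) fun _ _ h => h.1) ?_ (by omega)
  · intro k hk u
    simp; omega
  intro s2 i2 k2
  have a2 : s2.arr .AO = s1.arr .AO := i2.arr _ rfl
  refine Triple.seq_le (T₁ := 4 + n * 40) (T₂ := 600 * (n + X + 1)) ((Triple.loop_put n (fun i => i)
    (s1.arr .AO) (by simp) (by simp [i2.var .n rfl, i1.var .n rfl, hn]) ?_ (fun k hk => by omega)
    (fun k _ j hj => hj.ne)).mono (by simp; omega) fun _ _ h => h.1) ?_ (by omega)
  · intro k hk u
    simp [a2]; omega
  intro s3 i3 k3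
  have j3 := i2.trans i3
  have b3 : s3.arr .B0 = s.arr .B0 := (j3.arr _ rfl).trans (i1.arr _ rfl)
  have m3 : s3.var .mx = M := (j3.var _ rfl).trans ((i1.var _ rfl).trans hM)
  refine Triple.seq_le (T₁ := 4 + n * 40) (T₂ := 550 * (n + X + 1)) ((Triple.loop_put n (fun i => i)
    (fun i => M - s.arr .B0 i) (by simp) (by simp [i3.var .n rfl, i2.var .n rfl, i1.var .n rfl, hn])
    ?_ (fun k hk => by omega)
    (fun k _ j hj => hj.ne)).mono (by simp; omega) fun _ _ h => h.1) ?_ (by omega)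
  · intro k hk u
    have := hB k hk
    simp [b3, m3]; omega
  intro s4 i4 k4
  have j4 := j3.trans i4
  have t4 := i1.trans j4
  have w4 : s4.arr .WP = s.arr .WP := t4.arr _ rfl
  refine (radix_spec (K := K) (n := n) (m := m) hc (z := .BN) (dst := .WB) (by decide) (by decide)
      (by decide) (by decide) (by decide) (by decide)
      ((t4.var _ rfl).trans hN) ((t4.var _ rfl).trans hm) hnD hmD hKD
      (fun x hx => by rw [k4 x hx]; omega) (w4 ▸ hE)).mono (by rw [hX]; omega) ?_
  intro s5 i5 k5
  have t5 := t4.trans i5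
  have j5 := j4.trans i5
  have q3 := i3.trans (i4.trans i5)
  have q4 := i4.trans i5
  have rk : s5.arr .RK = s2.arr .RK := q3.arr _ rfl
  have ao : s5.arr .AO = s1.arr .AO := j5.arr _ rfl
  have wa : s5.arr .WA = s3.arr .WA := q4.arr _ rfl
  have hrk : ∀ t < n, s5.arr .RK (s1.arr .AO t) = t := fun t ht => by rw [rk]; exact k2 t ht
  refine ⟨⟨(t5.var _ rfl).trans hN, ?_, ?_, ?_⟩, ?_, ?_, ?_⟩
  · rw [t5.arr _ rfl]; exact hE
  · refine ⟨by simp, fun i hi => ?_, fun i j hij hj => ?_⟩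
    · rw [wa, k3 i hi]; exact k1.mem i hi
    · rw [wa, k3 i (by omega), k3 j hj, hrk i (by omega), hrk j hj]; exact hij
  · refine k5.weaken fun a ha b hb h => ?_
    have ha := Finset.mem_range.1 ha
    have hb := Finset.mem_range.1 hb
    have h1 := hB a ha
    have h2 := hB b hb
    rw [KeyLex, k4 a ha, k4 b hb] at h
    rw [DescLt, show s5.arr .B0 = s.arr .B0 from t5.arr _ rfl]
    omega
  · intro x hx
    obtain ⟨t, ht, rfl⟩ := k1.surj hir' (Finset.mem_range.2 hx)
    rw [hrk t ht]; exact ht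
  · intro x hx
    obtain ⟨t, ht, rfl⟩ := k1.surj hir' (Finset.mem_range.2 hx)
    rw [hrk t ht, ao]
  · intro x hx y hy h
    obtain ⟨t, ht, rfl⟩ := k1.surj hir' (Finset.mem_range.2 hx)
    obtain ⟨t', ht', rfl⟩ := k1.surj hir' (Finset.mem_range.2 hy)
    rw [hrk t ht, hrk t' ht'] at h
    rcases h.lt_or_eq with h | rfl
    · rcases k1.sorted t t' h ht' with h | h
      · exact Or.inl h
      · exact Or.inr ⟨h.1, h.2.le⟩
    · exact Or.inr ⟨rfl, le_rfl⟩

/-! ### The preprocessing -/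

/-- The preprocessing program. -/
def prep (K : ℕ) : Stmt :=
  initArrays ;; initLogs ;; initParams K ;; initMax ;; initOrders K ;; classes

theorem above_congr {n θ : ℕ} {B B' : ℕ → ℕ} (h : ∀ x < n, B x = B' x) :
    above n B θ = above n B' θ :=
  Finset.filter_congr fun x hx => by rw [h x (Finset.mem_range.1 hx)]

theorem classCard_congr {n : ℕ} {B B' : ℕ → ℕ} (h : ∀ x < n, B x = B' x) :
    classCard n B = classCard n B' := by
  funext g M k
  rw [classCard, above_congr h, classCard]

theorem classTopCells_congr {n : ℕ} {B B' : ℕ → ℕ} (h : ∀ x < n, B x = B' x) :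
    classTopCells n B = classTopCells n B' := by
  funext g M k
  rw [classTopCells, classCard_congr h, classTopCells]

theorem classCost_congr {n : ℕ} {B B' : ℕ → ℕ} (h : ∀ x < n, B x = B' x) :
    classCost n B = classCost n B' := by
  funext g M k
  rw [classCost, classCard_congr h, classTopCells_congr h, classCost]

/-- The conditions on sizes are kept as hypotheses here; they are derived from the bounds on `A`,
`B` and `w` by the estimates below. -/
theorem prep_spec {c : Lim} {s : St} {n m K M : ℕ} {A B : ℕ → ℕ}
    (hn : s.var .n = n) (hm : s.var .m = m) (hnm : n ≤ m)
    (hA : ∀ i < n, s.inp i = A i) (hB : ∀ i < n, s.inp (n + i) = B i) (hI : 2 * n ≤ c.I)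
    (hp : Params c n (branching m) (height K m)) (hM : M = (Finset.range n).sup B + 1)
    (hAK : ∀ x < n, A x < (m + 1) * (K * (m + 1) + 1)) (hMK : M ≤ (m + 1) * (K * (m + 1) + 1))
    (hD : (K + 1) * (m + 1) + K + 12 < c.D) (hNCH : numClasses K m < 2 ^ (height K m + 1))
    (hθ : M ≤ branching m * branching m * 2 ^ (numClasses K m - 1)) (hMW : 2 * M < c.W)
    (hkD : numClasses K m * 6 + 6 < c.D)
    (hRD : numClasses K m * (n / (branching m * branching m) + 1) < c.D)
    (hcD : ∑ k ∈ Finset.range (numClasses K m),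
      classCard n B (branching m * branching m) M k < c.D)
    (hjD : ∑ k ∈ Finset.range (numClasses K m), jobCells (branching m)
      (classCard n B (branching m * branching m) M k) < c.D)
    (htD : ∑ k ∈ Finset.range (numClasses K m), classTopCells n B (branching m) M k < c.D) :
    Triple c (prep K) s (3000 * ((K + 1) * (m + 1) + 1) + 24000 *
      (∑ k ∈ Finset.range (numClasses K m), classCost n B (branching m) M k + 1)) fun s' =>
      IsData c s'.arr n (branching m) (height K m) (numClasses K m)
        (thr (branching m * branching m) M) ∧
      (∀ x < n, s'.arr .A0 x = A x) ∧ ∀ x < n, s'.arr .B0 x = B x := by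
  have hDW := hp.D_lt
  have hK : K * (m + 1) + 1 + (m + 1) = (K + 1) * (m + 1) + 1 := by ring
  have hbm := branching_le m
  set X := (K + 1) * (m + 1) with hX
  set T := ∑ k ∈ Finset.range (numClasses K m), classCost n B (branching m) M k with hT
  refine Triple.seq_le (T₁ := 100 * (n + 1)) (T₂ := 2900 * (X + 1) + 24000 * (T + 1))
    (initArrays_spec hn (by omega) hI (by omega)) ?_ (by omega)
  rintro s1 i1 ⟨a1, b1, w1, n1⟩
  refine Triple.seq_le (T₁ := 40 * (m + 1)) (T₂ := 2800 * (X + 1) + 24000 * (T + 1))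
    (initLogs_spec ((i1.var _ rfl).trans hm) (by omega) (by omega)) ?_ (by omega)
  intro s2 i2 l2
  have j2 := i1.trans i2
  refine Triple.seq_le (T₁ := 100 * (m + 2)) (T₂ := 2600 * (X + 1) + 24000 * (T + 1))
    (initParams_spec (K := K) ((j2.var _ rfl).trans hn) ((j2.var _ rfl).trans hm) hnm l2 (by omega)
    hDW) ?_ (by omega)
  rintro s3 i3 ⟨p1, p2, p3, p4, q0, q1, q2, q3, q4, q5⟩
  have j3 := j2.trans i3
  have t3 := i2.trans i3
  refine Triple.seq_le (T₁ := 40 * (n + 1)) (T₂ := 2500 * (X + 1) + 24000 * (T + 1))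
    (initMax_spec ((j3.var _ rfl).trans hn) (by omega) (by omega)) ?_ (by omega)
  intro s4 i4 m4
  have j4 := j3.trans i4
  have t4 := t3.trans i4
  have a4 : s4.arr .A0 = s1.arr .A0 := t4.arr _ rfl
  have b4 : s4.arr .B0 = s1.arr .B0 := t4.arr _ rfl
  have hB1 : ∀ x < n, s1.arr .B0 x = B x := fun x hx => (b1 x hx).trans (hB x hx)
  have hA1 : ∀ x < n, s1.arr .A0 x = A x := fun x hx => (a1 x hx).trans (hA x hx)
  have hsup : (Finset.range n).sup (s1.arr .B0) = (Finset.range n).sup B :=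
    Finset.sup_congr rfl fun x hx => hB1 x (Finset.mem_range.1 hx)
  have m4' : s4.var .mx + 1 = M := by
    rw [m4, show s3.arr .B0 = s1.arr .B0 from t3.arr _ rfl, hsup, hM]
  have hBM : ∀ x < n, B x < M := fun x hx => by
    rw [hM, Nat.lt_succ_iff]
    exact Finset.le_sup (f := B) (Finset.mem_range.2 hx)
  refine Triple.seq_le (T₁ := 1200 * (n + X + 1)) (T₂ := 24000 * (T + 1))
    (initOrders_spec (K := K) (n := n) (m := m) (M := s4.var .mx) hDW ((j4.var _ rfl).trans hn)
    ((t4.var _ rfl).trans n1)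
    ((j4.var _ rfl).trans hm) rfl (by omega) (by omega) (by omega)
    (fun x hx => by rw [a4, hA1 x hx]; exact hAK x hx) (by omega)
    (fun x hx => by rw [b4, hB1 x hx]; have := hBM x hx; omega)
    (by rw [show s4.arr .WP = s1.arr .WP from t4.arr _ rfl]; exact w1)) ?_ (by omega)
  rintro s5 i5 ⟨L5, r1, r2, r3⟩
  have j5 := j4.trans i5
  have b5 : s5.arr .B0 = s1.arr .B0 := (i5.arr _ rfl).trans b4
  have hB5 : ∀ x < n, s5.arr .B0 x = B x := fun x hx => by rw [b5, hB1 x hx]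
  have u5 := i4.trans i5
  have lg5 : s5.arr .LG = s2.arr .LG := (i3.trans u5).arr _ rfl
  have hLG : ∀ i, 0 < i → i ≤ max (n + 1) (branching m) → s5.arr .LG i = Nat.log 2 i :=
    fun i _ hi => by rw [lg5]; exact l2 i (by omega)
  have hmeta : s5.arr .META = s3.arr .META := u5.arr _ rfl
  have spec := classes_spec (c := c) (s := s5) (n := n) (f := branching m) (H := height K m)
    (NC := numClasses K m) (M := M) hp
    (by rw [show above n (s5.arr .B0) 0 = Finset.range n by simp [above]]; exact L5)
    ((u5.var _ rfl).trans p2) ((u5.var _ rfl).trans p1) ((j5.var _ rfl).trans hn)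
    ((u5.var _ rfl).trans p4) (by rw [i5.var _ rfl]; exact m4') ((u5.var _ rfl).trans p3)
    (fun x hx => by rw [hB5 x hx]; exact hBM x hx) hLG (fun x hx => (r1 x hx).le) hMW hkD hRD
    (by rw [classCard_congr hB5]; exact hcD) (by rw [classCard_congr hB5]; exact hjD)
    (by rw [classTopCells_congr hB5]; exact htD)
  rw [classCost_congr hB5] at spec
  refine spec.mono le_rfl ?_
  intro s6 i6 h6
  have hNC : 0 < numClasses K m := by unfold numClasses; omega
  have m6 : s6.arr .META = s3.arr .META := (i6.arr _ rfl).trans hmeta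
  have a6 : s6.arr .A0 = s1.arr .A0 := (i6.arr _ rfl).trans ((i5.arr _ rfl).trans a4)
  have b6 : s6.arr .B0 = s1.arr .B0 := (i6.arr _ rfl).trans b5
  have rk6 : s6.arr .RK = s5.arr .RK := i6.arr _ rfl
  have ao6 : s6.arr .AO = s5.arr .AO := i6.arr _ rfl
  have lg6 : s6.arr .LG = s5.arr .LG := i6.arr _ rfl
  refine ⟨⟨hp, by rw [m6, q0], by rw [m6, q1], by rw [m6, q2], by rw [m6, q3], by rw [m6, q4],
    by rw [m6, q5], hNC, hNCH, hkD, hRD, rfl, thr_mono _ _, ?_, ?_, ?_, ?_, ?_, h6⟩, ?_, ?_⟩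
  · intro x hx
    rw [b6, hB1 x hx]
    -- The last threshold is `M` by `hθ`, and all values of `B` are less than `M`.
    obtain ⟨k, hk⟩ : ∃ k, numClasses K m = k + 1 := ⟨_, (Nat.succ_pred_eq_of_pos hNC).symm⟩
    rw [hk, Nat.add_sub_cancel] at hθ
    rw [hk]
    rw [thr_succ, min_eq_right hθ]
    exact hBM x hx
  · rw [lg6]; exact hLG
  · rw [rk6]; exact r1
  · rw [rk6, ao6]; exact r2
  · rw [rk6, a6, ← a4]; exact r3
  · intro x hx
    rw [a6, hA1 x hx]
  · intro x hx
    rw [b6, hB1 x hx]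

/-! ### Bounds for the parameters and for the size of the structures -/

/-- `f` was rounded down from the square root of the logarithm; conversely `Nat.sqrt + 1 ≤ 2 * f`,
which costs the factor `4`. -/
theorem log_add_one_le_branching (m : ℕ) : Nat.log 2 m + 1 ≤ 4 * (branching m * branching m) := by
  have h1 := Nat.lt_succ_sqrt (Nat.log 2 m)
  have h2 : Nat.sqrt (Nat.log 2 m) ≤ branching m := le_max_right _ _
  have h3 := branching_pos m
  have h4 : (Nat.sqrt (Nat.log 2 m) + 1) * (Nat.sqrt (Nat.log 2 m) + 1) ≤
      (branching m + branching m) * (branching m + branching m) :=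
    Nat.mul_le_mul (by omega) (by omega)
  calc Nat.log 2 m + 1 ≤ (Nat.sqrt (Nat.log 2 m) + 1) * (Nat.sqrt (Nat.log 2 m) + 1) := h1
    _ ≤ _ := h4
    _ = _ := by ring

theorem log_succ_le (m : ℕ) : Nat.log 2 (m + 1) ≤ Nat.log 2 m + 1 := by
  rcases Nat.eq_zero_or_pos m with rfl | h
  · simp
  · rw [← Nat.log_mul_base (by omega) h.ne']
    exact Nat.log_mono_right (by omega)

/-- This is why masks of `g` bits are words. -/
theorem two_pow_branching_sq_le (m : ℕ) : 2 ^ (branching m * branching m) ≤ 2 * (m + 1) := by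
  have hs := Nat.sqrt_le (Nat.log 2 m)
  rcases le_total 1 (Nat.sqrt (Nat.log 2 m)) with h | h
  · have hm : m ≠ 0 := by rintro rfl; simp at h
    rw [branching, max_eq_right h]
    calc 2 ^ (Nat.sqrt (Nat.log 2 m) * Nat.sqrt (Nat.log 2 m)) ≤ 2 ^ Nat.log 2 m :=
          Nat.pow_le_pow_right (by omega) hs
      _ ≤ m := Nat.pow_log_le_self 2 hm
      _ ≤ _ := by omega
  · rw [branching, max_eq_left h]; omega

/-- Since `f ^ 6` is the cube of `g`, this and the bound on `2 ^ g` make even the largest nodes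
linear in `m`. -/
theorem cube_le (n : ℕ) : n ^ 3 ≤ 8 * 2 ^ n := by
  rcases lt_or_ge n 4 with h | h
  · interval_cases n <;> norm_num
  · induction n, h using Nat.le_induction with
    | base => norm_num
    | succ n hn ih =>
      have : (n + 1) ^ 3 ≤ 2 * n ^ 3 := by
        obtain ⟨k, rfl⟩ := Nat.exists_eq_add_of_le hn
        ring_nf
        nlinarith [Nat.zero_le (k ^ 3), Nat.zero_le (k ^ 2)]
      rw [pow_succ 2 n]
      omega

theorem branching_pow_le (m : ℕ) : branching m ^ 6 ≤ 16 * (m + 1) := by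
  have h1 := cube_le (branching m * branching m)
  have h2 := two_pow_branching_sq_le m
  calc branching m ^ 6 = (branching m * branching m) ^ 3 := by ring
    _ ≤ _ := by omega

theorem branching_sq_le_pow (m : ℕ) : branching m * branching m ≤ branching m ^ 6 := by
  rw [← sq]
  exact Nat.pow_le_pow_right (branching_pos m) (by omega)

theorem two_pow_height_le (K m : ℕ) : 2 ^ height K m ≤ 2 ^ (K + 14) * (m + 1) := by
  have h1 := Nat.pow_log_le_self 2 (branching_pos m).ne'
  have h2 := branching_pow_le m
  calc 2 ^ height K m = (2 ^ Nat.log 2 (branching m)) ^ 6 * 2 ^ (K + 10) := by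
        rw [height, pow_add, ← pow_mul]; ring_nf
    _ ≤ branching m ^ 6 * 2 ^ (K + 10) := Nat.mul_le_mul_right _ (Nat.pow_le_pow_left h1 6)
    _ ≤ 16 * (m + 1) * 2 ^ (K + 10) := Nat.mul_le_mul_right _ h2
    _ = _ := by rw [pow_add 2 K 14, pow_add 2 K 10]; ring

theorem branching_pow_lt (m : ℕ) : branching m ^ 6 < 2 ^ (6 * Nat.log 2 (branching m) + 6) := by
  have h1 := Nat.lt_pow_succ_log_self (b := 2) (by omega) (branching m)
  calc branching m ^ 6 < (2 ^ (Nat.log 2 (branching m) + 1)) ^ 6 := Nat.pow_lt_pow_left h1 (by omega)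
    _ = _ := by rw [← pow_mul]; ring_nf

theorem branching_pow_lt_height (K m : ℕ) : branching m ^ 6 < 2 ^ (height K m + 1) :=
  (branching_pow_lt m).trans_le (Nat.pow_le_pow_right (by omega) (by unfold height; omega))

theorem numClasses_le (K m : ℕ) : numClasses K m ≤ 9 * (K + 1) * (branching m * branching m) := by
  have h : 0 < branching m * branching m := Nat.mul_pos (branching_pos m) (branching_pos m)
  unfold numClasses
  nlinarith

/-- The class is found by the same kind of search as everything else, so `height` must also cover
the number of classes; its summand `K` is there for this purpose. -/
theorem numClasses_lt (K m : ℕ) : numClasses K m < 2 ^ (height K m + 1) := by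
  have h0 : 0 < branching m * branching m := Nat.mul_pos (branching_pos m) (branching_pos m)
  have h1 := branching_pow_lt m
  have h2 := branching_sq_le_pow m
  have h3 : K < 2 ^ K := Nat.lt_two_pow_self
  calc numClasses K m ≤ (2 ^ K * 9) * (branching m * branching m) := by
        unfold numClasses
        nlinarith
    _ ≤ (2 ^ K * 9) * branching m ^ 6 := Nat.mul_le_mul_left _ h2
    _ < (2 ^ K * 9) * 2 ^ (6 * Nat.log 2 (branching m) + 6) := by gcongr
    _ ≤ (2 ^ K * 2 ^ 5) * 2 ^ (6 * Nat.log 2 (branching m) + 6) := by gcongr; omega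
    _ = 2 ^ (height K m + 1) := by rw [← pow_add, ← pow_add, height]; ring_nf

/-- `8 * g` is at least twice the number of binary digits of `m` and takes care of `(m + 1) ^ 2`;
the summand `K` takes care of the factor `K + 1`. -/
theorem le_thr {K m M : ℕ} (hM : M ≤ K * (m + 1) ^ 2 + 1) :
    M ≤ branching m * branching m * 2 ^ (numClasses K m - 1) := by
  have h0 : 0 < branching m * branching m := Nat.mul_pos (branching_pos m) (branching_pos m)
  have h1 : m + 1 ≤ 2 ^ (Nat.log 2 m + 1) := Nat.lt_pow_succ_log_self (by omega) m
  have h2 := log_add_one_le_branching m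
  have h3 : K + 1 ≤ 2 ^ K := Nat.lt_two_pow_self
  have h4 : 1 ≤ (m + 1) ^ 2 := Nat.one_le_pow _ _ (by omega)
  calc M ≤ (K + 1) * (m + 1) ^ 2 := by rw [Nat.add_mul]; omega
    _ ≤ 2 ^ K * (2 ^ (Nat.log 2 m + 1)) ^ 2 := Nat.mul_le_mul h3 (Nat.pow_le_pow_left h1 2)
    _ = 2 ^ (K + (Nat.log 2 m + 1) * 2) := by rw [← pow_mul, ← pow_add]
    _ ≤ 2 ^ (numClasses K m - 1) := Nat.pow_le_pow_right (by omega) (by unfold numClasses; omega)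
    _ ≤ _ := Nat.le_mul_of_pos_left _ h0

/-- Markov's inequality. -/
theorem card_above_mul_le (n θ : ℕ) (B : ℕ → ℕ) :
    (above n B θ).card * θ ≤ ∑ x ∈ Finset.range n, B x := by
  calc (above n B θ).card * θ = ∑ x ∈ above n B θ, θ := by simp
    _ ≤ ∑ x ∈ above n B θ, B x := Finset.sum_le_sum fun x hx => (mem_above.1 hx).2
    _ ≤ _ := Finset.sum_le_sum_of_subset (Finset.filter_subset _ _)

/-! ### Sizes of the classes -/

section
variable {n g M S : ℕ} {B : ℕ → ℕ}

theorem classCard_le (k : ℕ) : classCard n B g M k ≤ n :=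
  (Finset.card_filter_le _ _).trans (by simp)

theorem classCard_eq_zero (hB : ∀ x < n, B x < M) {k : ℕ} (h : thr g M k = M) :
    classCard n B g M k = 0 := by
  rw [classCard, h, Finset.card_eq_zero, above, Finset.filter_eq_empty_iff]
  exact fun x hx => not_le.2 (hB x (Finset.mem_range.1 hx))

/-- The factor `g` in the sum of `B` is absorbed by the threshold `g * 2 ^ k`. If the threshold is
capped, the class is empty. -/
theorem two_pow_mul_classCard_le (hg : 0 < g) (hB : ∀ x < n, B x < M)
    (hS : ∑ x ∈ Finset.range n, B x ≤ g * S) (k : ℕ) :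
    classCard n B g M (k + 1) * 2 ^ k ≤ S := by
  rcases le_total (g * 2 ^ k) M with h | h
  · have h1 := (card_above_mul_le n (thr g M (k + 1)) B).trans hS
    rw [thr_succ, min_eq_left h] at h1
    refine Nat.le_of_mul_le_mul_left ?_ hg
    rw [classCard, thr_succ, min_eq_left h]
    calc _ = (above n B (g * 2 ^ k)).card * (g * 2 ^ k) := by ring
      _ ≤ _ := h1
  · rw [classCard_eq_zero hB (by rw [thr_succ, min_eq_right h])]
    simp

theorem sum_classCard_le (hg : 0 < g) (hB : ∀ x < n, B x < M)
    (hS : ∑ x ∈ Finset.range n, B x ≤ g * S) (NC : ℕ) :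
    ∑ k ∈ Finset.range NC, classCard n B g M k ≤ n + 2 * S := by
  cases NC with
  | zero => simp
  | succ NC =>
    rw [Finset.sum_range_succ']
    have h1 : ∑ k ∈ Finset.range NC, classCard n B g M (k + 1) ≤ ∑ k ∈ Finset.range NC, S / 2 ^ k :=
      Finset.sum_le_sum fun k _ => (Nat.le_div_iff_mul_le (by positivity)).2
        (two_pow_mul_classCard_le hg hB hS k)
    have h2 := Nat.geom_sum_le (b := 2) le_rfl S NC
    have h3 := classCard_le (n := n) (g := g) (M := M) (B := B) 0
    omega

/-- Filtering reads the lists of the previous class, so this shifted sum, in which class `0` occurs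
twice, enters the time. -/
theorem sum_classCard_pred_le (hg : 0 < g) (hB : ∀ x < n, B x < M)
    (hS : ∑ x ∈ Finset.range n, B x ≤ g * S) (NC : ℕ) :
    ∑ k ∈ Finset.range NC, classCard n B g M (k - 1) ≤ 2 * n + 2 * S := by
  cases NC with
  | zero => simp
  | succ NC =>
    rw [Finset.sum_range_succ']
    have h1 := sum_classCard_le hg hB hS NC
    have h3 := classCard_le (n := n) (g := g) (M := M) (B := B) 0
    simp only [Nat.add_sub_cancel, Nat.zero_sub]
    omega

/-- From the second class on, the upper threshold is at most twice the lower one, so the number of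
rows is at most the lower threshold and Markov's inequality applies. The first class has at most `g`
rows and `n` elements. -/
theorem thr_sub_mul_classCard_le (hS : ∑ x ∈ Finset.range n, B x ≤ g * S) (k : ℕ) :
    (thr g M (k + 1) - thr g M k) * classCard n B g M k ≤ g * (n + S) := by
  cases k with
  | zero =>
    calc _ ≤ g * n := Nat.mul_le_mul (by rw [thr_zero, thr_succ]; simp) (classCard_le _)
      _ ≤ _ := Nat.mul_le_mul_left _ (by omega)
  | succ k =>
    have h1 := (card_above_mul_le n (thr g M (k + 1)) B).trans hS
    have h2 : min (2 * thr g M (k + 1)) M = thr g M (k + 1 + 1) := min_two_mul_thr g M k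
    calc _ ≤ thr g M (k + 1) * classCard n B g M (k + 1) := Nat.mul_le_mul_right _ (by omega)
      _ ≤ g * S := by rw [mul_comm]; exact h1
      _ ≤ _ := Nat.mul_le_mul_left _ (by omega)

end

/-! ### Sizes of the tables and of the pools -/

theorem topCells_mul_le {f N θ θ' L : ℕ} (hL : Nat.log 2 (N + 1) + 1 ≤ L) :
    topCells f N θ θ' * f ^ 6 ≤ 2 * L * ((θ' - θ) * N) := by
  rw [topCells]
  split
  · next h =>
    have h1 : (N / f ^ 6 + 1) * f ^ 6 ≤ 2 * N := by
      have := Nat.div_mul_le_self N (f ^ 6)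
      rw [Nat.add_mul]; omega
    have h2 : Nat.log 2 (N / f ^ 6 + 1) + 1 ≤ L :=
      (Nat.succ_le_succ (Nat.log_mono_right (Nat.succ_le_succ (Nat.div_le_self _ _)))).trans hL
    calc topSize f N θ θ' * f ^ 6
        = (θ' - θ) * ((Nat.log 2 (N / f ^ 6 + 1) + 1) * ((N / f ^ 6 + 1) * f ^ 6)) := by
          rw [topSize]; ring
      _ ≤ (θ' - θ) * (L * (2 * N)) := by gcongr
      _ = _ := by ring
  · simp

/-- The logarithm is at most `5 * g` and the product of rows and elements is at most `g * (n + S)`.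
Two of the three factors `g` in `f ^ 6` cancel; the third one pays for the number of classes. -/
theorem classTopCells_mul_le {n m M S : ℕ} {B : ℕ → ℕ} (hnm : n ≤ m)
    (hS : ∑ x ∈ Finset.range n, B x ≤ branching m * branching m * S) (k : ℕ) :
    classTopCells n B (branching m) M k * (branching m * branching m) ≤ 10 * (n + S) := by
  have hg : 0 < branching m * branching m := Nat.mul_pos (branching_pos m) (branching_pos m)
  have h1 := log_add_one_le_branching m
  have h2 := log_succ_le m
  have h3 : Nat.log 2 (classCard n B (branching m * branching m) M k + 1) ≤ Nat.log 2 (m + 1) :=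
    Nat.log_mono_right (Nat.succ_le_succ ((classCard_le k).trans hnm))
  have h4 := topCells_mul_le (f := branching m) (N := classCard n B (branching m * branching m) M k)
    (θ := thr (branching m * branching m) M k) (θ' := thr (branching m * branching m) M (k + 1))
    (L := 5 * (branching m * branching m)) (by omega)
  have h5 := thr_sub_mul_classCard_le (M := M) hS k
  rw [classTopCells]
  generalize topCells _ _ _ _ = T at *
  refine Nat.le_of_mul_le_mul_left ?_ (Nat.mul_pos hg hg)
  calc _ = T * branching m ^ 6 := by ring
    _ ≤ _ := h4
    _ ≤ 2 * (5 * (branching m * branching m)) * (branching m * branching m * (n + S)) :=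
      Nat.mul_le_mul_left _ h5
    _ = _ := by ring

theorem sum_classTopCells_le {n m M K : ℕ} {B : ℕ → ℕ} (hnm : n ≤ m)
    (hS : ∑ x ∈ Finset.range n, B x ≤ branching m * branching m * (4 * K * (m + 1))) :
    ∑ k ∈ Finset.range (numClasses K m), classTopCells n B (branching m) M k ≤
      360 * (K + 1) ^ 2 * (m + 1) := by
  have hg : 0 < branching m * branching m := Nat.mul_pos (branching_pos m) (branching_pos m)
  refine Nat.le_of_mul_le_mul_right ?_ hg
  rw [Finset.sum_mul]
  calc _ ≤ ∑ k ∈ Finset.range (numClasses K m), 40 * (K + 1) * (m + 1) :=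
        Finset.sum_le_sum fun k _ => (classTopCells_mul_le hnm hS k).trans (by nlinarith)
    _ = numClasses K m * (40 * (K + 1) * (m + 1)) := by simp
    _ ≤ 9 * (K + 1) * (branching m * branching m) * (40 * (K + 1) * (m + 1)) :=
      Nat.mul_le_mul_right _ (numClasses_le K m)
    _ = _ := by ring

/-- There are `O(g)` classes, and `g ^ 2 ≤ f ^ 6`. This covers the overhead of `g` cells or steps
per class. -/
theorem numClasses_mul_le (K m : ℕ) :
    numClasses K m * (branching m * branching m) ≤ 144 * (K + 1) * (m + 1) := by
  have h1 := branching_pow_le m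
  have h2 : (branching m * branching m) * (branching m * branching m) ≤ branching m ^ 6 := by
    calc _ = branching m ^ 4 := by ring
      _ ≤ _ := Nat.pow_le_pow_right (branching_pos m) (by omega)
  calc _ ≤ 9 * (K + 1) * (branching m * branching m) * (branching m * branching m) :=
        Nat.mul_le_mul_right _ (numClasses_le K m)
    _ = 9 * (K + 1) * ((branching m * branching m) * (branching m * branching m)) := by ring
    _ ≤ 9 * (K + 1) * (16 * (m + 1)) := Nat.mul_le_mul_left _ (h2.trans h1)
    _ = _ := by ring

theorem numClasses_le' (K m : ℕ) : numClasses K m ≤ 144 * (K + 1) * (m + 1) :=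
  (Nat.le_mul_of_pos_right _ (Nat.mul_pos (branching_pos m) (branching_pos m))).trans
    (numClasses_mul_le K m)

theorem numClasses_mul_div_le {K m n : ℕ} (hnm : n ≤ m) :
    numClasses K m * (n / (branching m * branching m)) ≤ 9 * (K + 1) * (m + 1) := by
  calc _ ≤ 9 * (K + 1) * (branching m * branching m) * (n / (branching m * branching m)) :=
        Nat.mul_le_mul_right _ (numClasses_le K m)
    _ = 9 * (K + 1) * ((branching m * branching m) * (n / (branching m * branching m))) := by ring
    _ ≤ 9 * (K + 1) * n := Nat.mul_le_mul_left _ (Nat.mul_div_le _ _)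
    _ ≤ _ := Nat.mul_le_mul_left _ (by omega)

theorem sum_jobCells_le {n m M K : ℕ} {B : ℕ → ℕ} (hnm : n ≤ m) (hB : ∀ x < n, B x < M)
    (hS : ∑ x ∈ Finset.range n, B x ≤ branching m * branching m * (4 * K * (m + 1))) :
    ∑ k ∈ Finset.range (numClasses K m), jobCells (branching m)
      (classCard n B (branching m * branching m) M k) ≤ 760 * (K + 1) * (m + 1) := by
  have hg : 0 < branching m * branching m := Nat.mul_pos (branching_pos m) (branching_pos m)
  have h1 := sum_classCard_le hg hB hS (numClasses K m)
  have h2 := numClasses_mul_le K m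
  calc _ ≤ ∑ k ∈ Finset.range (numClasses K m),
          (5 * classCard n B (branching m * branching m) M k + 5 * (branching m * branching m)) :=
        Finset.sum_le_sum fun k _ => by
          have := Nat.div_mul_le_self (classCard n B (branching m * branching m) M k)
            (branching m * branching m)
          rw [jobCells, Nat.add_mul]; omega
    _ = 5 * (∑ k ∈ Finset.range (numClasses K m), classCard n B (branching m * branching m) M k) +
        5 * (numClasses K m * (branching m * branching m)) := by
      rw [Finset.sum_add_distrib, ← Finset.mul_sum]; simp; ring
    _ ≤ 5 * (n + 2 * (4 * K * (m + 1))) + 5 * (144 * (K + 1) * (m + 1)) := by gcongr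
    _ ≤ _ := by nlinarith

/-- Four contributions, each linear in `m`: the lists, the rank samples, the overhead per class and
the top tables. -/
theorem sum_classCost_le {n m M K : ℕ} {B : ℕ → ℕ} (hnm : n ≤ m) (hB : ∀ x < n, B x < M)
    (hS : ∑ x ∈ Finset.range n, B x ≤ branching m * branching m * (4 * K * (m + 1))) :
    ∑ k ∈ Finset.range (numClasses K m), classCost n B (branching m) M k ≤
      1000 * (K + 1) ^ 2 * (m + 1) := by
  have hg : 0 < branching m * branching m := Nat.mul_pos (branching_pos m) (branching_pos m)
  have h1 := sum_classCard_pred_le hg hB hS (numClasses K m)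
  have h2 := numClasses_mul_le K m
  have h3 := numClasses_le' K m
  have h4 := numClasses_mul_div_le (K := K) hnm
  have h5 := sum_classTopCells_le (M := M) hnm hS
  have h6 : (K + 1) * (m + 1) ≤ (K + 1) ^ 2 * (m + 1) :=
    Nat.mul_le_mul_right _ (by nlinarith)
  simp only [classCost, Finset.sum_add_distrib, Finset.sum_const, Finset.card_range, smul_eq_mul]
  nlinarith

/-! ### Bounds in terms of the real logarithm -/

theorem real_log_le (m : ℕ) : Real.log m ≤ Nat.log 2 m + 1 := by
  rcases Nat.eq_zero_or_pos m with rfl | h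
  · simp
  · have h1 : (m : ℝ) ≤ 2 ^ (Nat.log 2 m + 1) := by
      exact_mod_cast (Nat.lt_pow_succ_log_self (b := 2) (by omega) m).le
    have h2 := Real.log_le_log (by exact_mod_cast h) h1
    rw [Real.log_pow] at h2
    have h3 := Real.log_two_lt_d9
    push_cast at h2
    nlinarith [Nat.cast_nonneg (α := ℝ) (Nat.log 2 m)]

/-- Turns the bound on the sum of `B` into the form `g * S` with `S` linear in `m`. -/
theorem mul_log_le_branching (m : ℕ) :
    m * Real.log m + 1 ≤ ((branching m * branching m * (4 * (m + 1)) : ℕ) : ℝ) := by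
  have h1 := real_log_le m
  have h2 : ((Nat.log 2 m + 1 : ℕ) : ℝ) ≤ ((4 * (branching m * branching m) : ℕ) : ℝ) := by
    exact_mod_cast log_add_one_le_branching m
  have h3 : (0 : ℝ) ≤ m := Nat.cast_nonneg m
  have h4 : (0 : ℝ) ≤ Nat.log 2 m := Nat.cast_nonneg _
  push_cast at h2 ⊢
  nlinarith

theorem mul_log_le_sq (m : ℕ) : m * Real.log m + 1 ≤ (((m + 1) ^ 2 : ℕ) : ℝ) := by
  have h1 := Real.log_le_self (Nat.cast_nonneg (α := ℝ) m)
  have h3 : (0 : ℝ) ≤ m := Nat.cast_nonneg m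
  push_cast
  nlinarith

/-- The word size thus gives room for addresses linear in `m`. For `m ≤ 1` the summand `1` does it;
otherwise the logarithm is at least `log 2 > 1 / 2`. -/
theorem le_mul_log (m : ℕ) : ((m : ℝ) + 1) / 2 ≤ m * Real.log m + 1 := by
  rcases Nat.lt_or_ge m 2 with h | h
  · have h0 := mul_nonneg (Nat.cast_nonneg (α := ℝ) m) (Real.log_natCast_nonneg m)
    have : (m : ℝ) ≤ 1 := by exact_mod_cast Nat.lt_succ_iff.1 h
    linarith
  · have h1 : Real.log 2 ≤ Real.log m := Real.log_le_log (by norm_num) (by exact_mod_cast h)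
    have h2 := Real.log_two_gt_d9
    have h3 : (2 : ℝ) ≤ m := by exact_mod_cast h
    nlinarith

/-- With `L` the binary logarithm of `f`, `4 ^ L ≤ f ^ 2 ≤ Nat.log 2 m ≤ 2 * Real.log m`, and taking
logarithms bounds `L` by a multiple of `log log m`. Small `m`, for which `L = 0`, are covered by the
maximum with `1`. -/
theorem height_le (K m : ℕ) :
    ((height K m + 2 : ℕ) : ℝ) ≤ (K + 24) * max 1 (Real.log (Real.log m)) := by
  set R := max 1 (Real.log (Real.log m)) with hR
  have hR1 : 1 ≤ R := le_max_left _ _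
  have hR2 : Real.log (Real.log m) ≤ R := le_max_right _ _
  have hK : (0 : ℝ) ≤ K := Nat.cast_nonneg K
  have h2 := Real.log_two_gt_d9
  have h2' := Real.log_two_lt_d9
  suffices h : (Nat.log 2 (branching m) : ℝ) ≤ 2 * R by
    rw [height]
    push_cast
    nlinarith
  rcases Nat.eq_zero_or_pos (Nat.log 2 (branching m)) with h0 | h0
  · rw [h0]; push_cast; linarith
  have hb : 2 ≤ branching m := by
    by_contra h
    rw [Nat.log_of_lt (by omega)] at h0
    omega
  have hsq : branching m * branching m ≤ Nat.log 2 m := by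
    have hs := Nat.sqrt_le (Nat.log 2 m)
    have : branching m = Nat.sqrt (Nat.log 2 m) := by unfold branching at hb ⊢; omega
    rw [this]; exact hs
  have hm : m ≠ 0 := by rintro rfl; simp at hsq; omega
  set L := Nat.log 2 (branching m) with hL
  have h3 : 2 ^ L ≤ branching m := Nat.pow_log_le_self 2 (by omega)
  have h4 : 4 ^ L ≤ Nat.log 2 m := by
    calc 4 ^ L = 2 ^ L * 2 ^ L := by rw [← mul_pow]; norm_num
      _ ≤ _ := Nat.mul_le_mul h3 h3
      _ ≤ _ := hsq
  have h5 : (Nat.log 2 m : ℝ) * Real.log 2 ≤ Real.log m := by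
    rw [← Real.log_pow]
    exact Real.log_le_log (by positivity) (by exact_mod_cast Nat.pow_log_le_self 2 hm)
  have h6 : (4 : ℝ) ^ L ≤ 2 * Real.log m := by
    have : (4 : ℝ) ^ L ≤ Nat.log 2 m := by exact_mod_cast h4
    nlinarith [Nat.cast_nonneg (α := ℝ) (Nat.log 2 m)]
  have h7 : (0 : ℝ) < Real.log m := by
    have : (0 : ℝ) < 4 ^ L := by positivity
    linarith
  have h8 := Real.log_le_log (by positivity) h6
  rw [Real.log_pow, Real.log_mul (by norm_num) h7.ne',
    show (4 : ℝ) = 2 ^ 2 by norm_num, Real.log_pow] at h8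
  push_cast at h8
  nlinarith [Nat.cast_nonneg (α := ℝ) L]

/-! ### The main theorem -/

/-- The factor in the bounds for time and space. -/
def bigConst (K : ℕ) : ℕ := 100000000 * (K + 1) ^ 2 + 2 ^ (K + 20)

/-- The bound for the indices of the arrays. -/
def arrBound (K m : ℕ) : ℕ := 1000 * (K + 1) ^ 2 * (m + 1)

theorem word_bound {K m w : ℕ} (hw : (bigConst K : ℝ) * (m * Real.log m + 1) ≤ 2 ^ w) :
    bigConst K * (m + 1) ≤ 2 * 2 ^ w := by
  have h1 := le_mul_log m
  have h2 : (0 : ℝ) ≤ bigConst K := Nat.cast_nonneg _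
  have : (bigConst K : ℝ) * (m + 1) ≤ 2 * 2 ^ w := by nlinarith
  exact_mod_cast this

theorem le_bigConst (K : ℕ) : 100000000 * (K + 1) ≤ bigConst K :=
  (Nat.mul_le_mul_left _ (Nat.le_self_pow (by omega) _)).trans (Nat.le_add_right _ _)

theorem bigConst_mul (K m : ℕ) : bigConst K * (m + 1) =
    100000000 * ((K + 1) ^ 2 * (m + 1)) + 2 ^ (K + 20) * (m + 1) := by
  rw [bigConst]; ring

theorem arrBound_eq (K m : ℕ) : arrBound K m = 1000 * ((K + 1) ^ 2 * (m + 1)) := by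
  rw [arrBound]; ring

theorem le_sq_mul (K m : ℕ) : m + 1 ≤ (K + 1) ^ 2 * (m + 1) :=
  Nat.le_mul_of_pos_left _ (pow_pos (Nat.succ_pos K) 2)

theorem arrBound_lt {K m n w : ℕ} (hnm : n ≤ m)
    (hw : (bigConst K : ℝ) * (m * Real.log m + 1) ≤ 2 ^ w) :
    arrBound K m * 64 + 2 * n < 2 ^ w ∧ 0 < w := by
  have h0 := word_bound hw
  have h1 := le_sq_mul K m
  rw [bigConst_mul] at h0
  rw [arrBound_eq]
  generalize (K + 1) ^ 2 * (m + 1) = Y at *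
  generalize 2 ^ (K + 20) * (m + 1) = Z at *
  have h2 : Y * 1000 * 64 + 2 * n < 2 ^ w := by omega
  refine ⟨by omega, Nat.pos_of_ne_zero ?_⟩
  rintro rfl
  omega

/-- The summand `2 ^ (K + 20)` of `bigConst` is there for the powers `2 ^ height K m` that occur in
binary searches. -/
theorem params {K m n w : ℕ} (hnm : n ≤ m) (off : ℕ)
    (hw : (bigConst K : ℝ) * (m * Real.log m + 1) ≤ 2 ^ w) :
    Params ⟨2 ^ w, arrBound K m, off⟩ n (branching m) (height K m) := by
  have h0 := word_bound hw
  have h1 := two_pow_height_le K m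
  have h2 := two_pow_branching_sq_le m
  have h3 := branching_pow_le m
  have h4 : 2 ^ (K + 20) = 64 * 2 ^ (K + 14) := by
    rw [show K + 20 = K + 14 + 6 from rfl, pow_add 2 (K + 14) 6, mul_comm]
    norm_num
  have h5 : m + 1 ≤ (K + 1) ^ 2 * (m + 1) := by
    have : 0 < (K + 1) ^ 2 := pow_pos (Nat.succ_pos K) 2
    exact Nat.le_mul_of_pos_left _ this
  have h6 : 0 < 2 ^ (K + 14) * (m + 1) := Nat.mul_pos (Nat.two_pow_pos _) (Nat.succ_pos m)
  rw [bigConst, h4] at h0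
  have h7 : (100000000 * (K + 1) ^ 2 + 64 * 2 ^ (K + 14)) * (m + 1) =
    100000000 * ((K + 1) ^ 2 * (m + 1)) + 64 * (2 ^ (K + 14) * (m + 1)) := by ring
  rw [h7] at h0
  have h8 : arrBound K m = 1000 * ((K + 1) ^ 2 * (m + 1)) := by rw [arrBound]; ring
  have h9 : height K m < 2 ^ height K m := Nat.lt_two_pow_self
  generalize (K + 1) ^ 2 * (m + 1) = Y at *
  generalize 2 ^ (K + 14) * (m + 1) = Z at *
  constructor <;> try simp only
  case f_pos => exact branching_pos m
  case lt_H => exact branching_pow_lt_height K m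
  all_goals omega

/-- The programs count positions from `0`: position `x` is index `x + 1`, and the half-open range
`[b, e)` of positions is `(b .. e]` of indices. The tie-break by position yields the smallest index.
-/
theorem threeSidedRMQ_eq {A B a₀ b₀ : ℕ → ℕ} {n b e v x : ℕ} (he : e ≤ n)
    (hA : ∀ i < n, a₀ i = A (i + 1)) (hB : ∀ i < n, b₀ i = B (i + 1))
    (hx : (b ≤ x ∧ x < e) ∧ v ≤ b₀ x)
    (hmin : ∀ y, (b ≤ y ∧ y < e) ∧ v ≤ b₀ y → a₀ x < a₀ y ∨ a₀ x = a₀ y ∧ x ≤ y) :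
    threeSidedRMQ A B b e v = x + 1 := by
  have hmem : ∀ i ∈ threeSidedRange B b e v, ∃ y, i = y + 1 ∧ y < n ∧ (b ≤ y ∧ y < e) ∧ v ≤ b₀ y := by
    intro i hi
    simp only [threeSidedRange, Finset.mem_filter, Finset.mem_Ioc] at hi
    obtain ⟨y, rfl⟩ : ∃ y, i = y + 1 := ⟨i - 1, by omega⟩
    exact ⟨y, rfl, by omega, ⟨by omega, by omega⟩, by rw [hB y (by omega)]; exact hi.2⟩
  have hxn : x < n := by omega
  refine IsLeast.csInf_eq ⟨⟨?_, fun j hj => ?_⟩, fun i hi => ?_⟩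
  · simp only [threeSidedRange, Finset.mem_filter, Finset.mem_Ioc]
    exact ⟨⟨by omega, by omega⟩, by rw [← hB x hxn]; exact hx.2⟩
  · obtain ⟨y, rfl, hyn, hy⟩ := hmem j hj
    rw [← hA x hxn, ← hA y hyn]
    rcases hmin y hy with h | h
    · exact h.le
    · exact h.1.le
  · obtain ⟨y, rfl, hyn, hy⟩ := hmem i hi.1
    have h1 := hi.2 (x + 1) (by
      simp only [threeSidedRange, Finset.mem_filter, Finset.mem_Ioc]
      exact ⟨⟨by omega, by omega⟩, by rw [← hB x hxn]; exact hx.2⟩)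
    rw [← hA x hxn, ← hA y hyn] at h1
    rcases hmin y hy with h | h
    · omega
    · exact Nat.succ_le_succ h.2

/-- The machine program for the preprocessing. -/
def prepCmd (K : ℕ) : Cmd :=
  .seq (.seq (.copy Reg.n.idx 1) (.seq (.copy Reg.m.idx 0) (.op .add 0 1 1)))
    ((prep K).compile 100)

/-- The machine program for the queries. -/
def queryCmd : Cmd := .seq (query.compile 100) (.copy 0 Reg.best.idx)

theorem queryCmd_storeFree : storeFree queryCmd = true := by decide

theorem prep_correct {K m n w M : ℕ} {A B : ℕ → ℕ} {s : St} (hnm : n ≤ m) (hn : s.var .n = n)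
    (hm : s.var .m = m) (hAi : ∀ i < n, s.inp i = A i) (hBi : ∀ i < n, s.inp (n + i) = B i)
    (hA : ∀ x < n, (A x : ℝ) ≤ K * (m * Real.log m + 1))
    (hB : ((∑ x ∈ Finset.range n, B x : ℕ) : ℝ) ≤ K * (m * Real.log m + 1))
    (hw : (bigConst K : ℝ) * (m * Real.log m + 1) ≤ 2 ^ w)
    (hM : M = (Finset.range n).sup B + 1) :
    Triple ⟨2 ^ w, arrBound K m, 2 * n⟩ (prep K) s (30000000 * ((K + 1) ^ 2 * (m + 1))) fun s' =>
      IsData ⟨2 ^ w, arrBound K m, 2 * n⟩ s'.arr n (branching m) (height K m) (numClasses K m)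
        (thr (branching m * branching m) M) ∧
      (∀ x < n, s'.arr .A0 x = A x) ∧ ∀ x < n, s'.arr .B0 x = B x := by
  have hK0 : (0 : ℝ) ≤ K := Nat.cast_nonneg K
  have hsup : (Finset.range n).sup B ≤ ∑ x ∈ Finset.range n, B x :=
    Finset.sup_le fun x hx => Finset.single_le_sum (fun _ _ => Nat.zero_le _) hx
  have hBM : ∀ x < n, B x < M := fun x hx => by
    rw [hM, Nat.lt_succ_iff]
    exact Finset.le_sup (f := B) (Finset.mem_range.2 hx)
  -- This is the bound for two digits to the base `m + 1`.
  have hAK : ∀ x < n, A x ≤ K * (m + 1) ^ 2 := fun x hx => by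
    exact_mod_cast (hA x hx).trans (mul_le_mul_of_nonneg_left (mul_log_le_sq m) hK0)
  have hBK : ∑ x ∈ Finset.range n, B x ≤ K * (m + 1) ^ 2 := by
    exact_mod_cast hB.trans (mul_le_mul_of_nonneg_left (mul_log_le_sq m) hK0)
  -- The only place where the sum of `B`, rather than its maximum, is needed: it gives linear space
  -- and time.
  have hS : ∑ x ∈ Finset.range n, B x ≤ branching m * branching m * (4 * K * (m + 1)) := by
    have : ∑ x ∈ Finset.range n, B x ≤ K * (branching m * branching m * (4 * (m + 1))) := by
      exact_mod_cast hB.trans (mul_le_mul_of_nonneg_left (mul_log_le_branching m) hK0)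
    calc _ ≤ _ := this
      _ = _ := by ring
  have hMW : 2 * M < 2 ^ w := by
    have hl := le_mul_log m
    have h1 : (M : ℝ) ≤ K * (m * Real.log m + 1) + 1 := by
      have : (M : ℝ) ≤ ((∑ x ∈ Finset.range n, B x : ℕ) : ℝ) + 1 := by
        rw [hM]; exact_mod_cast Nat.succ_le_succ hsup
      linarith
    have h2 : 2 * (K : ℝ) + 4 < bigConst K := by
      have : 2 * K + 4 < bigConst K := by have := le_bigConst K; omega
      exact_mod_cast this
    have h3 : (1 : ℝ) / 2 ≤ m * Real.log m + 1 := by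
      have : (0 : ℝ) ≤ m := Nat.cast_nonneg m
      linarith
    have : 2 * (M : ℝ) < 2 ^ w := by nlinarith
    exact_mod_cast this
  have hp := params hnm (2 * n) hw
  have c1 := numClasses_le' K m
  have c2 := numClasses_mul_div_le (K := K) hnm
  have hg : 0 < branching m * branching m := Nat.mul_pos (branching_pos m) (branching_pos m)
  have c3 := sum_classCard_le (M := M) hg hBM hS (numClasses K m)
  have c4 := sum_jobCells_le (K := K) hnm hBM hS
  have c5 := sum_classTopCells_le (K := K) (M := M) hnm hS
  have c6 := sum_classCost_le (K := K) hnm hBM hS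
  have hsq : (m + 1) * (K * (m + 1) + 1) = K * (m + 1) ^ 2 + (m + 1) := by ring
  have y1 : arrBound K m = 1000 * ((K + 1) ^ 2 * (m + 1)) := arrBound_eq K m
  have y2 : 1000 * (K + 1) ^ 2 * (m + 1) = 1000 * ((K + 1) ^ 2 * (m + 1)) := by ring
  have y3 : 360 * (K + 1) ^ 2 * (m + 1) = 360 * ((K + 1) ^ 2 * (m + 1)) := by ring
  have y4 : (K + 1) * (m + 1) ≤ (K + 1) ^ 2 * (m + 1) :=
    Nat.mul_le_mul_right _ (Nat.le_self_pow (by omega) _)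
  have y5 : K + 1 ≤ (K + 1) * (m + 1) := Nat.le_mul_of_pos_right _ (Nat.succ_pos m)
  have y6 : m + 1 ≤ (K + 1) * (m + 1) := Nat.le_mul_of_pos_left _ (Nat.succ_pos K)
  have y7 : 2 * (4 * K * (m + 1)) ≤ 8 * ((K + 1) * (m + 1)) :=
    calc _ = 8 * (K * (m + 1)) := by ring
      _ ≤ _ := by gcongr; omega
  rw [y2] at c6
  rw [y3] at c5
  rw [mul_assoc] at c1 c2 c4
  refine (prep_spec (M := M) hn hm hnm hAi hBi le_rfl hp hM ?_ ?_ ?_ (numClasses_lt K m)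
    (le_thr ?_) hMW ?_ ?_ ?_ ?_ ?_).mono ?_ fun _ _ => id
  · intro x hx
    have := hAK x hx
    omega
  · omega
  · simp only [y1]; omega
  · omega
  · simp only [y1]; omega
  · simp only [y1]; rw [Nat.mul_succ]; omega
  · simp only [y1]; omega
  · simp only [y1]; omega
  · simp only [y1]; omega
  · omega

theorem prepCmd_exec {K m n w M : ℕ} {A B : ℕ → ℕ} {s : State} (hnm : n ≤ m)
    (hs : IsPreprocessingInput w m n A B s)
    (hA : ∀ x < n, (A (x + 1) : ℝ) ≤ K * (m * Real.log m + 1))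
    (hB : ((∑ x ∈ Finset.range n, B (x + 1) : ℕ) : ℝ) ≤ K * (m * Real.log m + 1))
    (hw : (bigConst K : ℝ) * (m * Real.log m + 1) ≤ 2 ^ w)
    (hM : M = (Finset.range n).sup (fun x => B (x + 1)) + 1) :
    ∃ s₀ t₀ h, Exec w (prepCmd K) s s₀ t₀ ∧ t₀ ≤ bigConst K * (m + 1) ∧
      Rep w (arrBound K m) (2 * n) s₀ h ∧
      IsData ⟨2 ^ w, arrBound K m, 2 * n⟩ h.arr n (branching m) (height K m) (numClasses K m)
        (thr (branching m * branching m) M) ∧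
      (∀ x < n, h.arr .A0 x = A (x + 1)) ∧ ∀ x < n, h.arr .B0 x = B (x + 1) := by
  obtain ⟨hword, h0, h1, ha, hb⟩ := hs
  have hp := params hnm (2 * n) hw
  have hDW : 64 * arrBound K m < 2 ^ w := hp.D_lt
  have hnD : n + 2 < arrBound K m := hp.n_lt
  obtain ⟨hD, hw0⟩ := arrBound_lt hnm hw
  set s1 := ((s.setReg Reg.n.idx (s.reg 1)).setReg Reg.m.idx
    ((s.setReg Reg.n.idx (s.reg 1)).reg 0)) with hs1
  set s2 := s1.setReg 0 (BinOp.add.eval w (s1.reg 1) (s1.reg 1)) with hs2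
  have x2 : Exec w (.seq (.copy Reg.n.idx 1) (.seq (.copy Reg.m.idx 0) (.op .add 0 1 1))) s s2
      (1 + (1 + 1)) := .seq (.copy _ _ _) (.seq (.copy _ _ _) (.op _ _ _ _ _))
  have r0 : s2.reg 0 = 2 * n := by
    have e : s1.reg 1 = n := by
      rw [← h1]; rfl
    rw [hs2, e, BinOp.eval, ← two_mul, Nat.mod_eq_of_lt (by omega)]
    rfl
  -- The abstract state is read off from the machine as it is. Nothing is assumed about the initial
  -- contents of the arrays, which start behind the `2 * n` cells of the input.
  set h : St := ⟨fun x => s2.reg x.idx, fun a i => s2.mem (i * 64 + a.ctorIdx + 2 * n), s2.mem⟩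
    with hh
  have hrep : Rep w (arrBound K m) (2 * n) s2 h :=
    ⟨Exec.isWord hw0 x2 hword, r0, fun _ => rfl, fun _ _ _ => rfl, fun _ _ => rfl⟩
  have spec := prep_correct (K := K) (w := w) (M := M) (A := fun x => A (x + 1))
    (B := fun x => B (x + 1)) (s := h) hnm h1 h0
    (fun i hi => ha i hi) (fun i hi => hb i hi) hA hB hw hM
  obtain ⟨s3, x3, hr3, -⟩ := (prep K).exec_compile hw0 hD 100 s2 h le_rfl hrep spec.1
  refine ⟨s3, _, _, .seq x2 x3, ?_, hr3, spec.2.2⟩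
  rw [bigConst_mul]
  have y2 := le_sq_mul K m
  have y3 := spec.2.1
  generalize (K + 1) ^ 2 * (m + 1) = Y at *
  generalize 2 ^ (K + 20) * (m + 1) = Z at *
  omega

theorem queryCmd_exec {K m n w b e v : ℕ} {A B θ : ℕ → ℕ} {s₀ s₁ : State} {h : St} (hnm : n ≤ m)
    (hw : (bigConst K : ℝ) * (m * Real.log m + 1) ≤ 2 ^ w)
    (hr : Rep w (arrBound K m) (2 * n) s₀ h)
    (hd : IsData ⟨2 ^ w, arrBound K m, 2 * n⟩ h.arr n (branching m) (height K m) (numClasses K m) θ)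
    (hA : ∀ x < n, h.arr .A0 x = A (x + 1)) (hB : ∀ x < n, h.arr .B0 x = B (x + 1))
    (hb : b ≤ n) (he : e ≤ n) (hne : 0 < threeSidedRangeCount B b e v)
    (hs : IsQueryInput w s₀ b e v s₁) :
    ∃ s₂ t, Exec w queryCmd s₁ s₂ t ∧
      (t : ℝ) ≤ bigConst K * max 1 (Real.log (Real.log m)) ∧
      s₂.reg 0 = threeSidedRMQ A B b e v ∧ s₂.mem = s₀.mem := by
  obtain ⟨hword, hmem, h0, h1, h2, h3⟩ := hs
  have hp := hd.params
  have hDW : 64 * arrBound K m < 2 ^ w := hp.D_lt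
  have hnD : n + 2 < arrBound K m := hp.n_lt
  obtain ⟨hD, hw0⟩ := arrBound_lt hnm hw
  -- The variables `b`, `e`, `v` come first in `Reg` and so are the machine registers 1, 2, 3, in
  -- which the query receives its arguments. All other variables start with arbitrary values.
  set h' : St := ⟨fun x => s₁.reg x.idx, h.arr, h.inp⟩ with hh
  have hrep : Rep w (arrBound K m) (2 * n) s₁ h' :=
    ⟨hword, h0.trans hr.reg_zero, fun _ => rfl, fun a i hi => by rw [hmem, hr.arr a i hi],
      fun i hi => by rw [hmem, hr.inp i hi]⟩
  have hex : ∃ x, (b ≤ x ∧ x < e) ∧ v ≤ h.arr .B0 x := by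
    obtain ⟨i, hi⟩ := Finset.card_pos.1 hne
    simp only [threeSidedRange, Finset.mem_filter, Finset.mem_Ioc] at hi
    obtain ⟨y, rfl⟩ : ∃ y, i = y + 1 := ⟨i - 1, by omega⟩
    exact ⟨y, ⟨by omega, by omega⟩, by rw [hB y (by omega)]; exact hi.2⟩
  have spec := query_spec (s := h') (b := b) (e := e) (v := v) hd rfl h1 h2 h3 hb he hex
  obtain ⟨s3, x3, hr3, -⟩ := query.exec_compile hw0 hD 100 s₁ h' le_rfl hrep spec.1
  obtain ⟨x, hx, hxm, hmin⟩ := spec.2.2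
  have hexec : Exec w queryCmd s₁ (s3.setReg 0 (s3.reg Reg.best.idx)) (query.time h' + 1) :=
    .seq x3 (.copy _ _ _)
  refine ⟨_, _, hexec, ?_, ?_, (Exec.mem_eq hexec queryCmd_storeFree).trans hmem⟩
  · have h4 := height_le K m
    have h5 : query.time h' + 1 ≤ 12001 * (height K m + 2) := by
      have := spec.2.1
      omega
    have h6 : 12001 * (K + 24) ≤ bigConst K := by have := le_bigConst K; omega
    have h7 : ((query.time h' + 1 : ℕ) : ℝ) ≤ 12001 * ((height K m + 2 : ℕ) : ℝ) := by
      exact_mod_cast h5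
    have h8 : 12001 * ((K : ℝ) + 24) ≤ bigConst K := by exact_mod_cast h6
    have h9 : (0 : ℝ) ≤ max 1 (Real.log (Real.log m)) := zero_le_one.trans (le_max_left _ _)
    calc _ ≤ _ := h7
      _ ≤ 12001 * ((K + 24) * max 1 (Real.log (Real.log m))) := by gcongr
      _ = 12001 * ((K : ℝ) + 24) * max 1 (Real.log (Real.log m)) := by ring
      _ ≤ _ := mul_le_mul_of_nonneg_right h8 h9
  · rw [threeSidedRMQ_eq he hA hB hxm hmin, ← hx, ← hr3.var]
    simp [State.setReg]

end RangeMin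

/-- Only the preprocessing program and the constant depend on `K`; the query reads the parameters it
needs from memory. -/
theorem mainTheorem9 :
    ∀ K : ℕ, ∃ (P Q : WordRAM.Cmd) (c : ℕ),
      ∀ (m n : ℕ) (A B : ℕ → ℕ) (w : ℕ),
        n ≤ m →
        (∀ i ∈ Finset.Icc 1 n, (A i : ℝ) ≤ K * (m * Real.log m + 1)) →
        ((∑ i ∈ Finset.Icc 1 n, B i : ℕ) : ℝ) ≤ K * (m * Real.log m + 1) →
        (c : ℝ) * (m * Real.log m + 1) ≤ 2 ^ w →
        ∀ s : WordRAM.State, IsPreprocessingInput w m n A B s →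
          ∃ (s₀ : WordRAM.State) (t₀ : ℕ),
            WordRAM.Exec w P s s₀ t₀ ∧ t₀ ≤ c * (m + 1) ∧
            ∀ b e v : ℕ, b ≤ n → e ≤ n → 0 < threeSidedRangeCount B b e v →
              ∀ s₁ : WordRAM.State, IsQueryInput w s₀ b e v s₁ →
                ∃ (s₂ : WordRAM.State) (t : ℕ),
                  WordRAM.Exec w Q s₁ s₂ t ∧
                  (t : ℝ) ≤ c * max 1 (Real.log (Real.log m)) ∧
                  s₂.reg 0 = threeSidedRMQ A B b e v ∧
                  s₂.mem = s₀.mem := by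
  intro K
  refine ⟨RangeMin.prepCmd K, RangeMin.queryCmd, RangeMin.bigConst K, ?_⟩
  intro m n A B w hnm hA hB hw s hs
  have hsum : ∑ x ∈ Finset.range n, B (x + 1) = ∑ i ∈ Finset.Icc 1 n, B i := by
    rw [Finset.range_eq_Ico, Finset.sum_Ico_add' B 0 n 1]
    rfl
  obtain ⟨s₀, t₀, h, hx, ht, hr, hd, ha, hb⟩ := RangeMin.prepCmd_exec hnm hs
    (fun x hx => hA (x + 1) (Finset.mem_Icc.2 ⟨by omega, by omega⟩)) (hsum ▸ hB) hw rfl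
  exact ⟨s₀, t₀, hx, ht, fun b e v hbn hen hne s₁ hs₁ =>
    RangeMin.queryCmd_exec hnm hw hr hd ha hb hbn hen hne hs₁⟩
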